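/- Let $N\ge 2$, let $\hbar\neq 0$ be real and let $k\in\mathbb C$ (the level). **Bosons.** Consider the Heisenberg algebra with generators $\hat\lambda_\mu(t)$ ($1\le\mu\le N$), $\hat b_{\mu\nu}(t),\hat c_{\mu\nu}(t)$ ($1\le\mu<\nu\le N$), $t\in\mathbb R\setminus\{0\}$, the linear relation $\sum_{\mu=1}^N e^{(1-\mu)\hbar t}\hat\lambda_\mu(t)=0$, and the commutators $$[\hat\lambda_\mu(t),\hat\lambda_\mu(t')]=\frac{\sinh\frac{(k+N)\hbar t}{2}\,\sinh\frac{(N-1)\hbar t}{2}\,\sinh\frac{\hbar t}{2}}{\hbar^2 t\,\sinh\frac{N\hbar t}{2}}\,\delta(t+t'),$$ $$[\hat\lambda_\mu(t),\hat\lambda_\nu(t')]=-\frac{\sinh\frac{(k+N)\hbar t}{2}\,\sinh^2\frac{\hbar t}{2}}{\hbar^2 t\,\sinh\frac{N\hbar t}{2}}\,e^{\mathrm{sign}(\mu-\nu)\frac{N\hbar t}{2}}\,\delta(t+t')\quad(\mu\ne\nu),$$ $$[\hat b_{\mu\nu}(t),\hat b_{\mu\nu}(t')]=-\frac{\sinh^2\frac{\hbar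 t}{2}}{\hbar^2t}\,\delta(t+t'),\qquad[\hat c_{\mu\nu}(t),\hat c_{\mu\nu}(t')]=\frac{\sinh^2\frac{\hbar t}{2}}{\hbar^2t}\,\delta(t+t'),$$ all other commutators being zero. The Fock space $\mathcal F$ consists of the vectors obtained from a vacuum, which is killed by all modes with $t>0$, by polynomials in the modes with $t<0$, smeared with continuous functions of compact support. Matrix elements are taken between $\mathcal F$ and the coherent states of the dual Fock space whose symbols are continuous with compact support in $(0,\infty)$. The completion $\overline{\mathcal F}$ consists of the series, convergent on these coherent states, of homogeneous polynomials of degree $0,1,2,\dots$ in the modes with $t<0$ smeared with arbitrary continuous functions, applied to the vacuum. **Fields.** For $\hat\chi=\hat\lambda_\mu,\hat b_{\mu\nu},\hat c_{\mu\nu}$ put $$\chi^+(u)=e^{2\hbar\int_0^\infty\hat\chi(t)e^{-iut}dt},\quad \chi^-(u)=e^{-2\hbar\int_{-\infty}^0\hat\chi(t)e^{-iut}dt},\quad \chi(u)=e^{-\hbar\int_{-\infty}^0\frac{\hat\chi(t)e^{-iut}}{\sinh(\hbar t/2)}dt}\,e^{-\hbar\int_0^\infty\frac{\hat\chi(t)e^{-iut}}{\sinh(\hbar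 t/2)}dt},$$ and $\beta_{\mu\nu}(u)=\,:\!b_{\mu\nu}(u)c_{\mu\nu}(u)\!:$. Fields $b,c,\beta$ with first index $\ge$ second index are $1$. Write $u[s]=u+is\hbar$. All products of fields in the six definitions below are normal ordered. The $\mathfrak{gl}_N$ currents are $$k^+_\mu(u)=\lambda^+_\mu(u[\tfrac{k-N}4])^{-1}\prod_{\alpha=1}^{\mu-1}b^+_{\alpha\mu}(u[\tfrac{\mu-\alpha}2])\prod_{\beta=\mu+1}^{N}b^+_{\mu\beta}(u[\tfrac{\mu-\beta}2])^{-1},$$ $$k^-_\mu(u)=\lambda^-_\mu(u[-\tfrac{k-N}4])^{-1}\prod_{\rho=1}^{\mu-1}\prod_{\gamma=\mu}^{N}b^-_{\rho\gamma}(u[\tfrac{\rho+\gamma}2])\prod_{\alpha=1}^{\mu}\prod_{\beta=\mu+1}^{N}b^-_{\alpha\beta}(u[\tfrac{\alpha+\beta-2}2])^{-1}$$ for $1\le\mu\le N$, and $X^\pm_\mu(u)$ for $1\le\mu\le N-1$ given by $X^+_\mu(u)=\hbar E_\mu(u[\frac\mu2])$, $X^-_\mu(u)=\hbar F_\mu(u[\frac\mu2])$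 with the explicit expressions below. The $\mathfrak{sl}_N$ currents are, for $1\le\mu\le N-1$, $$H^\pm_\mu(u)=\frac{\lambda^\pm_\mu(u[\pm\frac{k-N}4-\frac\mu2])}{\lambda^\pm_{\mu+1}(u[\pm\frac{k-N}4-\frac\mu2])}\prod_{m=1}^{\mu}\frac{b^\pm_{m,\mu+1}(u[\mp\frac{m-1}2])}{b^\pm_{m\mu}(u[\mp\frac m2])}\prod_{n=\mu+1}^{N}\frac{b^\pm_{\mu n}(u[\mp\frac n2])}{b^\pm_{\mu+1,n}(u[\mp\frac{n-1}2])},$$ $$E_\mu(u)=\frac1\hbar\sum_{m=1}^{\mu}\beta_{m\mu}(u[-\tfrac{m-1}2])\left\{\frac{b^+_{m,\mu+1}(u[-\frac{m-1}2])}{\beta_{m,\mu+1}(u[-\frac m2])}-\frac{b^-_{m,\mu+1}(u[-\frac{m-1}2])}{\beta_{m,\mu+1}(u[-\frac{m-2}2])}\right\}\prod_{n=1}^{m-1}\frac{b^+_{n,\mu+1}(u[-\frac{n-1}2])}{b^+_{n\mu}(u[-\frac n2])},$$ $$F_\mu(u)=\frac1\hbar\Bigg\{\sum_{m=1}^{\mu}\beta_{m,\mu+1}(u[\tfrac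 m2])\frac{\lambda^-_\mu(u[-\frac{k-N}4-\frac\mu2])}{\lambda^-_{\mu+1}(u[-\frac{k-N}4-\frac\mu2])}\left[\frac{1+\delta_{m\mu}}{b^-_{m\mu}(u[\frac m2])\beta_{m\mu}(u[\frac{m-1}2])}-\frac{1}{b^+_{m\mu}(u[\frac m2])\beta_{m\mu}(u[\frac{m+1}2])}\right]\prod_{n=m+1}^{\mu}\frac{b^-_{n,\mu+1}(u[\frac{n-1}2])}{b^-_{n\mu}(u[\frac n2])}\prod_{s=\mu+1}^{N}\frac{b^-_{\mu s}(u[\frac s2])}{b^-_{\mu+1,s}(u[\frac{s-1}2])}$$ $$-\sum_{m=\mu+1}^{N}\beta_{\mu m}(u[-\tfrac{2k+m-1}2])\frac{\lambda^+_\mu(u[-\frac{3k+N}4-\frac\mu2])}{\lambda^+_{\mu+1}(u[-\frac{3k+N}4-\frac\mu2])}\left[(1+\delta_{m,\mu+1})\frac{b^+_{\mu+1,m}(u[-\frac{2k+m-1}2])}{\beta_{\mu+1,m}(u[-\frac{2k+m}2])}-\frac{b^-_{\mu+1,m}(u[-\frac{2k+m-1}2])}{\beta_{\mu+1,m}(u[-\frac{2k+m-2}2])}\right]\prod_{n=m}^{N}\frac{b^+_{\mu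 n}(u[-\frac{2k+n}2])}{b^+_{\mu+1,n}(u[-\frac{2k+n-1}2])}\Bigg\}.$$ **Meaning of the relations.** The matrix elements of a product $X(u)Y(v)$ converge when $\mathrm{Im}(u-v)$ is sufficiently negative; a product of currents at several points stands for the meromorphic continuation of its matrix elements from the region where the imaginary part of each argument is sufficiently smaller than that of the next one. The continuations below are entire functions divided by polynomials in the differences of the arguments. Let $\delta_{\mu\nu}$ be the Kronecker symbol and let $B_{\mu\nu}$ be half the Cartan matrix of $\mathfrak{sl}_N$: $B_{\mu\mu}=1$, $B_{\mu\nu}=-\frac12$ for $|\mu-\nu|=1$, and $B_{\mu\nu}=0$ otherwise. For an operator-valued function $S$, the notation $f\,X(u)Y(v)\simeq g\,Y(v)X(u)\sim S$ means that $f\,X(u)Y(v)-S$ and $g\,Y(v)X(u)-S$ continue to the same entire function of $(u,v)$, for all matrix elements; $\sim reg.$ means $S=0$. **Statement.** The operators $k^\pm_\mu(u)$ are invertible, their inverses being the normal ordered inverses, and the $\mathfrak{sl}_N$ currents are obtained from the $\mathfrak{gl}_N$ currents by $$H^\pm_\mu(u)=k^\pm_{\mu+1}(u-\tfrac{i\mu\hbar}2)\,k^\pm_\mu(u-\tfrac{i\mu\hbar}2)^{-1},\quad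 E_\mu(u)=\tfrac1\hbar X^+_\mu(u-\tfrac{i\mu\hbar}2),\quad F_\mu(u)=\tfrac1\hbar X^-_\mu(u-\tfrac{i\mu\hbar}2).$$ The currents $H^\pm_\mu(u),E_\mu(u),F_\mu(u)$ are well defined on $\mathcal F$: they map $\mathcal F$ to $\overline{\mathcal F}$, with matrix elements entire in $u$. For all $1\le\mu,\nu\le N-1$: 1. $[H^\pm_\mu(u),H^\pm_\nu(v)]=0$; 2. $H^\pm_\mu(u)H^\mp_\nu(v)=\dfrac{u-v\pm ik\hbar+iB_{\mu\nu}\hbar}{u-v\pm ik\hbar-iB_{\mu\nu}\hbar}\cdot\dfrac{u-v-iB_{\mu\nu}\hbar}{u-v+iB_{\mu\nu}\hbar}\,H^\mp_\nu(v)H^\pm_\mu(u)$; 3. $(u-v+iB_{\mu\nu}\hbar)H^\pm_\mu(u)E_\nu(v)=(u-v-iB_{\mu\nu}\hbar)E_\nu(v)H^\pm_\mu(u)$; 4. $(u-v-iB_{\mu\nu}\hbar)H^-_\mu(u)F_\nu(v)=(u-v+iB_{\mu\nu}\hbar)F_\nu(v)H^-_\mu(u)$; 5. $(u-v-iB_{\mu\nu}\hbar+ik\hbar)H^+_\mu(u)F_\nu(v)=(u-v+iB_{\mu\nu}\hbar+ik\hbar)F_\nu(v)H^+_\mu(u)$;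 6. if $B_{\mu\nu}=0$: $E_\mu(u)E_\nu(v)\simeq E_\nu(v)E_\mu(u)\sim reg.$ and $F_\mu(u)F_\nu(v)\simeq F_\nu(v)F_\mu(u)\sim reg.$; 7. if $B_{\mu\nu}\neq0$: $(u-v+iB_{\mu\nu}\hbar)E_\mu(u)E_\nu(v)\simeq(u-v-iB_{\mu\nu}\hbar)E_\nu(v)E_\mu(u)\sim reg.$ and $(u-v-iB_{\mu\nu}\hbar)F_\mu(u)F_\nu(v)\simeq(u-v+iB_{\mu\nu}\hbar)F_\nu(v)F_\mu(u)\sim reg.$; 8. $E_\mu(u)F_\nu(v)\simeq F_\nu(v)E_\mu(u)\sim\dfrac{\delta_{\mu\nu}}{i\hbar}\left(\dfrac{1}{u-v+ik\hbar}H^+_\mu(u)-\dfrac1{u-v}H^-_\mu(v)\right)$; 9. if $|\mu-\nu|=1$, then for $X=E$ and for $X=F$: $X_\mu(u_1)X_\mu(u_2)X_\nu(v)-2X_\mu(u_1)X_\nu(v)X_\mu(u_2)+X_\nu(v)X_\mu(u_1)X_\mu(u_2)+(u_1\leftrightarrow u_2)=0$. -/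

import Mathlib

open MeasureTheory Complex

namespace FreeBoson

/-! ### The Heisenberg algebra -/

/-- The open half line `t > 0`. -/
abbrev HalfLine : Type := Set.Ioi (0 : ℝ)

/-- Lebesgue measure on the half line. -/
noncomputable abbrev dt : Measure HalfLine := Measure.comap Subtype.val volume

/-- Pairs of indices `μ < ν`. -/
abbrev Pair (N : ℕ) : Type := {p : Fin N × Fin N // p.1 < p.2}

/-- The species of bosons: `λ_μ` for all `μ`, and `b_{μν}`, `c_{μν}` for `μ < ν`
(in this order of the summands). The element `j : Fin N` is the index `μ = j + 1`. -/
abbrev Mode (N : ℕ) : Type := Fin N ⊕ (Pair N ⊕ Pair N)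

/-- The coefficient of `δ(t + t')` in the commutator `[a_i(t), a_j(t')]`. -/
noncomputable def comm (N : ℕ) (ħ : ℝ) (k : ℂ) : Mode N → Mode N → ℝ → ℂ
  | .inl μ, .inl ν, t =>
      if μ = ν then
        sinh ((k + N) / 2 * ħ * t) * sinh (((N : ℂ) - 1) / 2 * ħ * t) * sinh ((ħ : ℂ) / 2 * t)
          / ((ħ : ℂ) ^ 2 * t * sinh ((N : ℂ) / 2 * ħ * t))
      else
        - (sinh ((k + N) / 2 * ħ * t) * sinh ((ħ : ℂ) / 2 * t) ^ 2
          / ((ħ : ℂ) ^ 2 * t * sinh ((N : ℂ) / 2 * ħ * t)))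
          * exp ((if ν < μ then 1 else -1) * ((N : ℂ) / 2 * ħ * t))
  | .inr (.inl p), .inr (.inl q), t =>
      if p = q then - (sinh ((ħ : ℂ) / 2 * t) ^ 2 / ((ħ : ℂ) ^ 2 * t)) else 0
  | .inr (.inr p), .inr (.inr q), t =>
      if p = q then sinh ((ħ : ℂ) / 2 * t) ^ 2 / ((ħ : ℂ) ^ 2 * t) else 0
  | _, _, _ => 0

/-- Families `(g_i(t))` of continuous functions on the half line, indexed by the species. -/
abbrev Smearing (N : ℕ) : Type := C(HalfLine, Mode N → ℂ)

/-- The symbols `ζ_i(t)` of the creation modes `a_i(-t)`, `t > 0`. They are subject to the relation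
`∑_μ e^{(1-μ)ħs} λ_μ(s) = 0` at `s = -t`. -/
def Symbols (N : ℕ) (ħ : ℝ) : Submodule ℂ (Smearing N) where
  carrier := {ζ | ∀ t : HalfLine, ∑ j : Fin N, exp ((j : ℕ) * (ħ * (t : ℝ))) * ζ t (.inl j) = 0}
  zero_mem' := by intro t; simp
  add_mem' := by
    intro a b ha hb t
    have h1 := ha t
    have h2 := hb t
    simp only [ContinuousMap.add_apply, Pi.add_apply, mul_add, Finset.sum_add_distrib, h1, h2,
      add_zero]
  smul_mem' := by
    intro c a ha t
    have h1 := ha t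
    simp only [ContinuousMap.smul_apply, Pi.smul_apply, smul_eq_mul, mul_left_comm _ c,
      ← Finset.mul_sum, h1, mul_zero]

theorem sinh_ofReal_ne_zero {x : ℝ} (hx : x ≠ 0) : sinh (x : ℂ) ≠ 0 := by
  rw [← ofReal_sinh]
  exact_mod_cast Real.sinh_ne_zero.mpr hx

theorem continuous_comm (N : ℕ) (ħ : ℝ) (k : ℂ) (i j : Mode N) :
    Continuous fun t : HalfLine => comm N ħ k i j t := by
  have ht : ∀ t : HalfLine, ((t : ℝ) : ℂ) ≠ 0 := fun t => by exact_mod_cast (ne_of_gt t.2)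
  rcases eq_or_ne ħ 0 with rfl | hħ
  · rcases i with i | i | i <;> rcases j with j | j | j <;> simp only [comm] <;>
      first | exact continuous_const | (split_ifs <;> simp [continuous_const])
  have hħ' : (ħ : ℂ) ≠ 0 := by exact_mod_cast hħ
  have hs : ∀ (i : Fin N) (t : HalfLine), sinh ((N : ℂ) / 2 * ħ * (t : ℝ)) ≠ 0 := by
    intro i t
    have hN : (N : ℝ) ≠ 0 := by
      have : N ≠ 0 := fun h => by subst h; exact i.elim0
      exact_mod_cast this
    have h := sinh_ofReal_ne_zero (x := (N : ℝ) / 2 * ħ * t)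
      (mul_ne_zero (mul_ne_zero (div_ne_zero hN two_ne_zero) hħ) (ne_of_gt t.2))
    push_cast at h
    exact h
  have hn : ∀ (i : Fin N) (t : HalfLine),
      (ħ : ℂ) ^ 2 * (t : ℝ) * sinh ((N : ℂ) / 2 * ħ * (t : ℝ)) ≠ 0 := fun i t =>
    mul_ne_zero (mul_ne_zero (pow_ne_zero 2 hħ') (ht t)) (hs i t)
  have hb : ∀ t : HalfLine, (ħ : ℂ) ^ 2 * (t : ℝ) ≠ 0 := fun t =>
    mul_ne_zero (pow_ne_zero 2 hħ') (ht t)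
  rcases i with i | i | i <;> rcases j with j | j | j <;> simp only [comm]
  · split_ifs
    · exact Continuous.div (by fun_prop) (by fun_prop) (hn i)
    · exact (Continuous.div (by fun_prop) (by fun_prop) (hn i)).neg.mul (by fun_prop)
    · exact (Continuous.div (by fun_prop) (by fun_prop) (hn i)).neg.mul (by fun_prop)
  all_goals first
    | exact continuous_const
    | (split_ifs
       · first
         | exact (Continuous.div (by fun_prop) (by fun_prop) hb).neg
         | exact Continuous.div (by fun_prop) (by fun_prop) hb
       · exact continuous_const)

/-- The commutators are compatible with the linear relation between the `λ_μ`. -/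
theorem comm_relation (N : ℕ) (ħ : ℝ) (k : ℂ) (i : Mode N) (t : HalfLine) :
    ∑ j : Fin N, exp ((j : ℕ) * (ħ * (t : ℝ))) * comm N ħ k i (.inl j) t = 0 := by
  rcases i with m | i | i
  · set x : ℂ := (ħ : ℂ) * (t : ℝ) with hx
    set S : ℂ := sinh ((k + N) / 2 * ħ * (t : ℝ)) * sinh ((ħ : ℂ) / 2 * (t : ℝ))
      / ((ħ : ℂ) ^ 2 * (t : ℝ) * sinh ((N : ℂ) / 2 * ħ * (t : ℝ))) with hS
    let T : ℕ → ℂ := fun n => - (exp (- x / 2) * exp (n * x) *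
      (if n ≤ (m : ℕ) then exp (N * x / 2) else exp (- (N * x / 2))))
    have key : ∀ j : Fin N, exp ((j : ℕ) * x) * comm N ħ k (.inl m) (.inl j) t
        = S / 2 * (T ((j : ℕ) + 1) - T (j : ℕ)) := by
      intro j
      have h2 : sinh ((ħ : ℂ) / 2 * (t : ℝ)) = (exp (x / 2) - exp (- x / 2)) / 2 := by
        rw [sinh, hx]; congr 3 <;> ring_nf
      have e1 : exp (((j : ℕ) + 1 : ℕ) * x) = exp ((j : ℕ) * x) * (exp (x / 2) * exp (x / 2)) := by
        rw [← exp_add, ← exp_add]; congr 1; push_cast; ring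
      have e2 : exp (- x / 2) * exp (x / 2) = 1 := by
        rw [← exp_add, ← exp_zero]; congr 1; ring
      rcases lt_trichotomy j m with h | h | h
      · have h1 : ¬ m = j := ne_of_gt h
        have h3 : (j : ℕ) + 1 ≤ (m : ℕ) := h
        have h4 : (j : ℕ) ≤ (m : ℕ) := le_of_lt h
        have e3 : exp (1 * ((N : ℂ) / 2 * ħ * (t : ℝ))) = exp (N * x / 2) := by
          congr 1; rw [hx]; ring
        simp only [comm, h1, h, h3, h4, T, if_true, if_false, e1, e3]
        have hS' : sinh ((k + N) / 2 * ħ * (t : ℝ)) * sinh ((ħ : ℂ) / 2 * (t : ℝ)) ^ 2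
          / ((ħ : ℂ) ^ 2 * (t : ℝ) * sinh ((N : ℂ) / 2 * ħ * (t : ℝ)))
            = S * sinh ((ħ : ℂ) / 2 * (t : ℝ)) := by rw [hS]; ring
        rw [hS', h2]
        linear_combination (S / 2 * exp ((j : ℕ) * x) * exp (N * x / 2) * exp (x / 2)) * e2
      · subst h
        have h3 : ¬ ((j : ℕ) + 1 ≤ (j : ℕ)) := by omega
        have h5 : sinh (((N : ℂ) - 1) / 2 * ħ * (t : ℝ))
            = (exp (N * x / 2) * exp (- x / 2) - exp (- (N * x / 2)) * exp (x / 2)) / 2 := by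
          rw [sinh, ← exp_add, ← exp_add, hx]; congr 3 <;> ring
        simp only [comm, h3, T, if_true, if_false, e1, le_refl]
        have hS' : sinh ((k + N) / 2 * ħ * (t : ℝ)) * sinh (((N : ℂ) - 1) / 2 * ħ * (t : ℝ))
          * sinh ((ħ : ℂ) / 2 * (t : ℝ))
          / ((ħ : ℂ) ^ 2 * (t : ℝ) * sinh ((N : ℂ) / 2 * ħ * (t : ℝ)))
            = S * sinh (((N : ℂ) - 1) / 2 * ħ * (t : ℝ)) := by rw [hS]; ring
        rw [hS', h5]
        linear_combination (S / 2 * exp ((j : ℕ) * x) * exp (- (N * x / 2)) * exp (x / 2)) * e2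
      · have h1 : ¬ m = j := ne_of_lt h
        have h0 : ¬ j < m := not_lt_of_gt h
        have h3 : ¬ (j : ℕ) + 1 ≤ (m : ℕ) := by have : (m : ℕ) < j := h; omega
        have h4 : ¬ (j : ℕ) ≤ (m : ℕ) := by have : (m : ℕ) < j := h; omega
        have e3 : exp (-1 * ((N : ℂ) / 2 * ħ * (t : ℝ))) = exp (- (N * x / 2)) := by
          congr 1; rw [hx]; ring
        simp only [comm, h1, h0, h3, h4, T, if_false, e1, e3]
        have hS' : sinh ((k + N) / 2 * ħ * (t : ℝ)) * sinh ((ħ : ℂ) / 2 * (t : ℝ)) ^ 2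
          / ((ħ : ℂ) ^ 2 * (t : ℝ) * sinh ((N : ℂ) / 2 * ħ * (t : ℝ)))
            = S * sinh ((ħ : ℂ) / 2 * (t : ℝ)) := by rw [hS]; ring
        rw [hS', h2]
        linear_combination (S / 2 * exp ((j : ℕ) * x) * exp (- (N * x / 2)) * exp (x / 2)) * e2
    have hN : 0 < N := m.pos
    have h6 : ¬ N ≤ (m : ℕ) := by have := m.2; omega
    have e4 : exp (N * x) = exp (N * x / 2) * exp (N * x / 2) := by
      rw [← exp_add]; congr 1; ring
    have e5 : exp (- (N * x / 2)) * exp (N * x / 2) = 1 := by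
      rw [← exp_add, ← exp_zero]; congr 1; ring
    rw [Finset.sum_congr rfl fun j _ => key j, ← Finset.mul_sum,
      Fin.sum_univ_eq_sum_range (fun n => T (n + 1) - T n) N, Finset.sum_range_sub]
    simp only [T, h6, if_false, Nat.zero_le, if_true, e4, Nat.cast_zero, zero_mul, exp_zero]
    linear_combination (- S / 2 * exp (- x / 2) * exp (N * x / 2)) * e5
  · simp [comm]
  · simp [comm]

/-- The family `t ↦ ∑_i h_i(t) [a_i(t), a_j(-t)]`, the commutator of `∫ ∑_i h_i(t) a_i(t) dt` with
the creation modes. -/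
noncomputable def commWith (N : ℕ) (ħ : ℝ) (k : ℂ) (h : Smearing N) : Symbols N ħ :=
  ⟨⟨fun t j => ∑ i, h t i * comm N ħ k i j t, by
      have := continuous_comm N ħ k
      fun_prop⟩, by
    intro t
    simp only [ContinuousMap.coe_mk, Finset.mul_sum]
    rw [Finset.sum_comm]
    refine Finset.sum_eq_zero fun i _ => ?_
    have h1 := congrArg (h t i * ·) (comm_relation N ħ k i t)
    simpa only [Finset.mul_sum, mul_left_comm, mul_zero] using h1⟩

/-! ### The Fock space

Vectors are written in the Bargmann-Fock form, as functionals of the symbol `ζ` of the creation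
modes: the vacuum is the constant `1`, the creation mode `a_i(-t)` is multiplication by `ζ_i(t)`, and
the annihilation mode `a_i(t)` is the derivation with `ζ_j(s) ↦ [a_i(t), a_j(-s)]`; it kills the
vacuum. -/

/-- The vector `∫_0^∞ g(t) a_i(-t) dt |0⟩`. -/
noncomputable def creationVector {N : ℕ} {ħ : ℝ} (i : Mode N) (g : C(HalfLine, ℂ)) :
    Symbols N ħ → ℂ :=
  fun ζ => ∫ t : HalfLine, g t * ζ.1 t i ∂dt

/-- The Fock space: all polynomials in the creation modes, smeared with continuous functions of
compact support in `(0, ∞)`, applied to the vacuum. -/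
noncomputable def Fock (N : ℕ) (ħ : ℝ) : Subalgebra ℂ (Symbols N ħ → ℂ) :=
  Algebra.adjoin ℂ {Φ | ∃ (i : Mode N) (g : C(HalfLine, ℂ)), HasCompactSupport g ∧
    Φ = creationVector i g}

/-- The symbols at which vectors are evaluated (that is, paired with coherent states of the dual Fock
space): those with compact support in `(0, ∞)`. -/
def IsTest {N : ℕ} {ħ : ℝ} (ζ : Symbols N ħ) : Prop := HasCompactSupport ζ.1

/-- Homogeneous polynomials of degree `n` in the creation modes, smeared with arbitrary continuous
functions on `(0, ∞)`. -/
noncomputable def generalizedVectors (N : ℕ) (ħ : ℝ) (n : ℕ) : Submodule ℂ (Symbols N ħ → ℂ) :=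
  Submodule.span ℂ (Set.range fun x : Fin n → Mode N × C(HalfLine, ℂ) =>
    ∏ l, creationVector (x l).1 (x l).2)

/-- The completed Fock space: convergent series of generalized vectors of increasing degree. -/
def CompletedFock (N : ℕ) (ħ : ℝ) : Set (Symbols N ħ → ℂ) :=
  {Φ | ∃ Φn : ℕ → Symbols N ħ → ℂ, (∀ n, Φn n ∈ generalizedVectors N ħ n) ∧
    ∀ ζ, IsTest ζ → HasSum (fun n => Φn n ζ) (Φ ζ)}

/-! ### Normal ordered exponentials -/

/-- The pair `(h, g)` stands for the normal ordered exponential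
`:exp{∫_0^∞ ∑_i (h_i(t) a_i(t) + g_i(t) a_i(-t)) dt}:`. The normal ordered product and inverse
correspond to addition and negation. -/
abbrev VertexData (N : ℕ) : Type := Smearing N × Smearing N

/-- The operator `exp{∫ ∑_i g_i(t) a_i(-t) dt} exp{∫ ∑_i h_i(t) a_i(t) dt}`: the exponential of the
annihilation modes is a translation of the symbol, by Taylor's formula. -/
noncomputable def vertexOp {N : ℕ} {ħ : ℝ} (k : ℂ) (D : VertexData N) (Ψ : Symbols N ħ → ℂ) :
    Symbols N ħ → ℂ :=
  fun ζ => exp (∫ t : HalfLine, ∑ i, D.2 t i * ζ.1 t i ∂dt) * Ψ (ζ + commWith N ħ k D.1)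

/-- Finite linear combinations of normal ordered exponentials; the multiplication of this algebra is
the normal ordered product. -/
abbrev NormalOrdered (N : ℕ) : Type := AddMonoidAlgebra ℂ (VertexData N)

/-- A single normal ordered exponential. -/
noncomputable def vx {N : ℕ} (D : VertexData N) : NormalOrdered N := AddMonoidAlgebra.single D 1

/-- The operator given by a linear combination of normal ordered exponentials. -/
noncomputable def op {N : ℕ} {ħ : ℝ} (k : ℂ) (x : NormalOrdered N) (Ψ : Symbols N ħ → ℂ) :
    Symbols N ħ → ℂ :=
  fun ζ => x.coeff.sum fun D a => a * vertexOp k D Ψ ζ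

/-- All integrals that occur in the operator product of `x` and `y` (in this order) converge
absolutely. -/
def ProductConverges {N : ℕ} (ħ : ℝ) (k : ℂ) (x y : NormalOrdered N) : Prop :=
  ∀ D ∈ x.coeff.support, ∀ D' ∈ y.coeff.support,
    Integrable (fun t : HalfLine => ∑ i, D'.2 t i * (commWith N ħ k D.1).1 t i) dt

/-! ### The boson fields -/

/-- The function `f` placed at all species that satisfy `P`. -/
noncomputable def place {N : ℕ} (P : Mode N → Prop) (f : C(HalfLine, ℂ)) : Smearing N :=
  open Classical in
  ⟨fun t i => if P i then f t else 0, by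
    refine continuous_pi fun i => ?_
    split_ifs
    · exact f.continuous
    · exact continuous_const⟩

/-- The species `λ_μ`, `1 ≤ μ ≤ N`. -/
def IsLam {N : ℕ} (μ : ℕ) : Mode N → Prop
  | .inl j => (j : ℕ) + 1 = μ
  | _ => False

/-- The species `b_{μν}`, `1 ≤ μ < ν ≤ N`. No species satisfies this if `μ ≥ ν`, so that the fields
`b_{μν}` with `μ ≥ ν` below are trivial. -/
def IsB {N : ℕ} (μ ν : ℕ) : Mode N → Prop
  | .inr (.inl p) => (p.1.1 : ℕ) + 1 = μ ∧ (p.1.2 : ℕ) + 1 = ν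
  | _ => False

/-- The species `c_{μν}`, `1 ≤ μ < ν ≤ N`. -/
def IsC {N : ℕ} (μ ν : ℕ) : Mode N → Prop
  | .inr (.inr p) => (p.1.1 : ℕ) + 1 = μ ∧ (p.1.2 : ℕ) + 1 = ν
  | _ => False

/-- `χ⁺(u) = exp{2ħ ∫_0^∞ χ(t) e^{-iut} dt}`. -/
noncomputable def chiPlus {N : ℕ} (ħ : ℝ) (P : Mode N → Prop) (u : ℂ) : VertexData N :=
  (place P ⟨fun t => 2 * ħ * exp (- I * u * (t : ℝ)), by fun_prop⟩, 0)

/-- `χ⁻(u) = exp{-2ħ ∫_{-∞}^0 χ(t) e^{-iut} dt}`. -/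
noncomputable def chiMinus {N : ℕ} (ħ : ℝ) (P : Mode N → Prop) (u : ℂ) : VertexData N :=
  (0, place P ⟨fun t => - (2 * ħ * exp (I * u * (t : ℝ))), by fun_prop⟩)

theorem continuous_inv_sinh (ħ : ℝ) :
    Continuous fun t : HalfLine => (sinh ((ħ : ℂ) / 2 * (t : ℝ)))⁻¹ := by
  rcases eq_or_ne ħ 0 with rfl | hħ
  · simp [continuous_const]
  · refine Continuous.inv₀ (by fun_prop) fun t => ?_
    have h := sinh_ofReal_ne_zero (x := ħ / 2 * t)
      (mul_ne_zero (div_ne_zero hħ two_ne_zero) (ne_of_gt t.2))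
    push_cast at h
    exact h

/-- `χ(u) = exp{-ħ ∫_{-∞}^0 χ(t) e^{-iut} dt / sinh(ħt/2)} exp{-ħ ∫_0^∞ (the same integrand)}`. -/
noncomputable def chi {N : ℕ} (ħ : ℝ) (P : Mode N → Prop) (u : ℂ) : VertexData N :=
  (place P ⟨fun t => - ħ * exp (- I * u * (t : ℝ)) * (sinh ((ħ : ℂ) / 2 * (t : ℝ)))⁻¹, by
      have := continuous_inv_sinh ħ
      fun_prop⟩,
   place P ⟨fun t => ħ * exp (I * u * (t : ℝ)) * (sinh ((ħ : ℂ) / 2 * (t : ℝ)))⁻¹, by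
      have := continuous_inv_sinh ħ
      fun_prop⟩)

section Currents

/-! ### The currents

`N`, `ħ`, `k` are the rank parameter, the deformation parameter and the level. Products of fields are
normal ordered. -/

variable (N : ℕ) (ħ : ℝ) (k : ℂ)

/-- `λ_μ^+(u)`. -/
noncomputable def lamP (μ : ℕ) (u : ℂ) : VertexData N := chiPlus ħ (IsLam μ) u

/-- `λ_μ^-(u)`. -/
noncomputable def lamM (μ : ℕ) (u : ℂ) : VertexData N := chiMinus ħ (IsLam μ) u

/-- `b_{μν}^+(u)`. -/
noncomputable def bP (μ ν : ℕ) (u : ℂ) : VertexData N := chiPlus ħ (IsB μ ν) u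

/-- `b_{μν}^-(u)`. -/
noncomputable def bM (μ ν : ℕ) (u : ℂ) : VertexData N := chiMinus ħ (IsB μ ν) u

/-- `(b+c)_{μν}(u) = :b_{μν}(u) c_{μν}(u):`. -/
noncomputable def bc (μ ν : ℕ) (u : ℂ) : VertexData N := chi ħ (IsB μ ν) u + chi ħ (IsC μ ν) u

/-- The shifted argument `u + s iħ`. -/
noncomputable def sh (u s : ℂ) : ℂ := u + s * (I * ħ)

open Finset in
/-- The `gl_N` current `k_μ^+(u)`. -/
noncomputable def kPlus (μ : ℕ) (u : ℂ) : VertexData N :=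
  - lamP N ħ μ (sh ħ u ((k - N) / 4))
    + ∑ α ∈ Icc 1 (μ - 1), bP N ħ α μ (sh ħ u ((μ - α) / 2))
    - ∑ β ∈ Icc (μ + 1) N, bP N ħ μ β (sh ħ u ((μ - β) / 2))

open Finset in
/-- The `gl_N` current `k_μ^-(u)`. -/
noncomputable def kMinus (μ : ℕ) (u : ℂ) : VertexData N :=
  - lamM N ħ μ (sh ħ u (- (k - N) / 4))
    + ∑ ρ ∈ Icc 1 (μ - 1), ∑ γ ∈ Icc μ N, bM N ħ ρ γ (sh ħ u ((ρ + γ) / 2))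
    - ∑ α ∈ Icc 1 μ, ∑ β ∈ Icc (μ + 1) N, bM N ħ α β (sh ħ u ((α + β - 2) / 2))

open Finset in
/-- The `gl_N` current `X_μ^+(u)`. -/
noncomputable def XPlus (μ : ℕ) (u : ℂ) : NormalOrdered N :=
  ∑ m ∈ Icc 1 μ,
    vx (bc N ħ m μ (sh ħ u (- (m - μ - 1) / 2))) *
    (vx (bP N ħ m (μ + 1) (sh ħ u (- (m - μ - 1) / 2))
        - bc N ħ m (μ + 1) (sh ħ u (- (m - μ) / 2)))
      - vx (bM N ħ m (μ + 1) (sh ħ u (- (m - μ - 1) / 2))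
        - bc N ħ m (μ + 1) (sh ħ u (- (m - μ - 2) / 2)))) *
    ∏ n ∈ Icc 1 (m - 1),
      vx (bP N ħ n (μ + 1) (sh ħ u (- (n - μ - 1) / 2)) - bP N ħ n μ (sh ħ u (- (n - μ) / 2)))

open Finset in
/-- The `gl_N` current `X_μ^-(u)`. -/
noncomputable def XMinus (μ : ℕ) (u : ℂ) : NormalOrdered N :=
  (∑ m ∈ Icc 1 μ,
    vx (bc N ħ m (μ + 1) (sh ħ u ((μ + m) / 2))) *
    vx (lamM N ħ μ (sh ħ u (- (k - N) / 4)) - lamM N ħ (μ + 1) (sh ħ u (- (k - N) / 4))) *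
    ((1 + if m = μ then 1 else 0 : ℂ) •
        vx (- bM N ħ m μ (sh ħ u ((μ + m) / 2)) - bc N ħ m μ (sh ħ u ((μ + m - 1) / 2)))
      - vx (- bP N ħ m μ (sh ħ u ((μ + m) / 2)) - bc N ħ m μ (sh ħ u ((μ + m + 1) / 2)))) *
    (∏ n ∈ Icc (m + 1) μ,
      vx (bM N ħ n (μ + 1) (sh ħ u ((μ + n - 1) / 2)) - bM N ħ n μ (sh ħ u ((μ + n) / 2)))) *
    ∏ s ∈ Icc (μ + 1) N,
      vx (bM N ħ μ s (sh ħ u ((μ + s) / 2)) - bM N ħ (μ + 1) s (sh ħ u ((μ + s - 1) / 2))))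
  - ∑ m ∈ Icc (μ + 1) N,
    vx (bc N ħ μ m (sh ħ u (- (2 * k + m - μ - 1) / 2))) *
    vx (lamP N ħ μ (sh ħ u (- (3 * k + N) / 4)) - lamP N ħ (μ + 1) (sh ħ u (- (3 * k + N) / 4))) *
    ((1 + if m = μ + 1 then 1 else 0 : ℂ) •
        vx (bP N ħ (μ + 1) m (sh ħ u (- (2 * k + m - μ - 1) / 2))
          - bc N ħ (μ + 1) m (sh ħ u (- (2 * k + m - μ) / 2)))
      - vx (bM N ħ (μ + 1) m (sh ħ u (- (2 * k + m - μ - 1) / 2))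
          - bc N ħ (μ + 1) m (sh ħ u (- (2 * k + m - μ - 2) / 2)))) *
    ∏ n ∈ Icc m N,
      vx (bP N ħ μ n (sh ħ u (- (2 * k + n - μ) / 2))
        - bP N ħ (μ + 1) n (sh ħ u (- (2 * k + n - μ - 1) / 2)))

open Finset in
/-- The exponent of the `sl_N` current `H_μ^+(u)`. -/
noncomputable def HPlusData (μ : ℕ) (u : ℂ) : VertexData N :=
  lamP N ħ μ (sh ħ u ((k - N) / 4 - μ / 2)) - lamP N ħ (μ + 1) (sh ħ u ((k - N) / 4 - μ / 2))
    + ∑ m ∈ Icc 1 μ, (bP N ħ m (μ + 1) (sh ħ u (- (m - 1) / 2)) - bP N ħ m μ (sh ħ u (- m / 2)))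
    + ∑ n ∈ Icc (μ + 1) N,
        (bP N ħ μ n (sh ħ u (- n / 2)) - bP N ħ (μ + 1) n (sh ħ u (- (n - 1) / 2)))

open Finset in
/-- The exponent of the `sl_N` current `H_μ^-(u)`. -/
noncomputable def HMinusData (μ : ℕ) (u : ℂ) : VertexData N :=
  lamM N ħ μ (sh ħ u (- (k - N) / 4 - μ / 2)) - lamM N ħ (μ + 1) (sh ħ u (- (k - N) / 4 - μ / 2))
    + ∑ m ∈ Icc 1 μ, (bM N ħ m (μ + 1) (sh ħ u ((m - 1) / 2)) - bM N ħ m μ (sh ħ u (m / 2)))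
    + ∑ n ∈ Icc (μ + 1) N,
        (bM N ħ μ n (sh ħ u (n / 2)) - bM N ħ (μ + 1) n (sh ħ u ((n - 1) / 2)))

/-- The `sl_N` currents `H_μ^+(u)` (sign `true`) and `H_μ^-(u)` (sign `false`). -/
noncomputable def HCurrent (ε : Bool) (μ : ℕ) (u : ℂ) : NormalOrdered N :=
  vx (if ε then HPlusData N ħ k μ u else HMinusData N ħ k μ u)

/-- The `gl_N` currents `k_μ^+(u)` (sign `true`) and `k_μ^-(u)` (sign `false`). -/
noncomputable def kCurrent (ε : Bool) (μ : ℕ) (u : ℂ) : NormalOrdered N :=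
  vx (if ε then kPlus N ħ k μ u else kMinus N ħ k μ u)

/-- The inverses `k_μ^±(u)⁻¹`. -/
noncomputable def kCurrentInv (ε : Bool) (μ : ℕ) (u : ℂ) : NormalOrdered N :=
  vx (- if ε then kPlus N ħ k μ u else kMinus N ħ k μ u)

open Finset in
/-- The `sl_N` current `E_μ(u)`. -/
noncomputable def ECurrent (μ : ℕ) (u : ℂ) : NormalOrdered N :=
  (1 / ħ : ℂ) • ∑ m ∈ Icc 1 μ,
    vx (bc N ħ m μ (sh ħ u (- (m - 1) / 2))) *
    (vx (bP N ħ m (μ + 1) (sh ħ u (- (m - 1) / 2)) - bc N ħ m (μ + 1) (sh ħ u (- m / 2)))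
      - vx (bM N ħ m (μ + 1) (sh ħ u (- (m - 1) / 2)) - bc N ħ m (μ + 1) (sh ħ u (- (m - 2) / 2)))) *
    ∏ n ∈ Icc 1 (m - 1),
      vx (bP N ħ n (μ + 1) (sh ħ u (- (n - 1) / 2)) - bP N ħ n μ (sh ħ u (- n / 2)))

open Finset in
/-- The `sl_N` current `F_μ(u)`. -/
noncomputable def FCurrent (μ : ℕ) (u : ℂ) : NormalOrdered N :=
  (1 / ħ : ℂ) • ((∑ m ∈ Icc 1 μ,
    vx (bc N ħ m (μ + 1) (sh ħ u (m / 2))) *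
    vx (lamM N ħ μ (sh ħ u (- (k - N) / 4 - μ / 2))
      - lamM N ħ (μ + 1) (sh ħ u (- (k - N) / 4 - μ / 2))) *
    ((1 + if m = μ then 1 else 0 : ℂ) •
        vx (- bM N ħ m μ (sh ħ u (m / 2)) - bc N ħ m μ (sh ħ u ((m - 1) / 2)))
      - vx (- bP N ħ m μ (sh ħ u (m / 2)) - bc N ħ m μ (sh ħ u ((m + 1) / 2)))) *
    (∏ n ∈ Icc (m + 1) μ,
      vx (bM N ħ n (μ + 1) (sh ħ u ((n - 1) / 2)) - bM N ħ n μ (sh ħ u (n / 2)))) *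
    ∏ s ∈ Icc (μ + 1) N,
      vx (bM N ħ μ s (sh ħ u (s / 2)) - bM N ħ (μ + 1) s (sh ħ u ((s - 1) / 2))))
  - ∑ m ∈ Icc (μ + 1) N,
    vx (bc N ħ μ m (sh ħ u (- (2 * k + m - 1) / 2))) *
    vx (lamP N ħ μ (sh ħ u (- (3 * k + N) / 4 - μ / 2))
      - lamP N ħ (μ + 1) (sh ħ u (- (3 * k + N) / 4 - μ / 2))) *
    ((1 + if m = μ + 1 then 1 else 0 : ℂ) •
        vx (bP N ħ (μ + 1) m (sh ħ u (- (2 * k + m - 1) / 2))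
          - bc N ħ (μ + 1) m (sh ħ u (- (2 * k + m) / 2)))
      - vx (bM N ħ (μ + 1) m (sh ħ u (- (2 * k + m - 1) / 2))
          - bc N ħ (μ + 1) m (sh ħ u (- (2 * k + m - 2) / 2)))) *
    ∏ n ∈ Icc m N,
      vx (bP N ħ μ n (sh ħ u (- (2 * k + n) / 2))
        - bP N ħ (μ + 1) n (sh ħ u (- (2 * k + n - 1) / 2))))

/-- Half of the Cartan matrix of `sl_N`. -/
noncomputable def halfCartan (μ ν : ℕ) : ℂ :=
  if μ = ν then 1 else if μ = ν + 1 ∨ ν = μ + 1 then - 1 / 2 else 0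

/-! ### Operator products

`⟨X(u)Y(v)⟩ := (X(u) Y(v) Ψ)(ζ)` converges for `Im (u - v) ≪ 0` and is continued analytically from
there; `⟨Y(v)X(u)⟩` converges for `Im (u - v) ≫ 0`. -/

/-- A current: a normal ordered expression that depends on the spectral parameter. -/
abbrev Current : Type := ℂ → NormalOrdered N

variable {N}

/-- For every vector of the Fock space, `J(u)` gives a vector of the completed Fock space, with matrix
elements that are entire in `u`. -/
def WellDefinedOnFock (J : Current N) : Prop :=
  ∀ Ψ ∈ Fock N ħ, (∀ u, op k (J u) Ψ ∈ CompletedFock N ħ) ∧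
    ∀ ζ, IsTest ζ → Differentiable ℂ fun u => op k (J u) Ψ ζ

/-- `X(u) Y(v)` converges for `Im (u - v) < -R`. -/
def ConvergesBelow (R : ℝ) (X Y : Current N) : Prop :=
  ∀ u v : ℂ, (u - v).im < -R → ProductConverges ħ k (X u) (Y v)

/-- The exchange relation `f(u-v) X(u) Y(v) = g(u-v) Y(v) X(u)` between the analytic continuations:
both sides continue to the same meromorphic function, an entire function divided by a polynomial
`p(u-v)`. -/
def ExchangeRelation (f : ℂ → ℂ) (X Y : Current N) (g : ℂ → ℂ) : Prop :=
  ∃ (p : Polynomial ℂ) (R : ℝ), p ≠ 0 ∧ ConvergesBelow ħ k R X Y ∧ ConvergesBelow ħ k R Y X ∧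
    ∀ Ψ ∈ Fock N ħ, ∀ ζ, IsTest ζ → ∃ G : ℂ × ℂ → ℂ, Differentiable ℂ G ∧
      (∀ u v, (u - v).im < -R →
        p.eval (u - v) * (f (u - v) * op k (X u) (op k (Y v) Ψ) ζ) = G (u, v)) ∧
      (∀ u v, (v - u).im < -R →
        p.eval (u - v) * (g (u - v) * op k (Y v) (op k (X u) Ψ) ζ) = G (u, v))

/-- The operator product relation `f(u-v) X(u) Y(v) ≃ g(u-v) Y(v) X(u) ∼ S(u,v)`: up to the singular
part `S`, both sides continue to the same entire function. -/
def OPERelation (f : ℂ → ℂ) (X Y : Current N) (g : ℂ → ℂ)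
    (S : ℂ → ℂ → (Symbols N ħ → ℂ) → (Symbols N ħ → ℂ)) : Prop :=
  ∃ R : ℝ, ConvergesBelow ħ k R X Y ∧ ConvergesBelow ħ k R Y X ∧
    ∀ Ψ ∈ Fock N ħ, ∀ ζ, IsTest ζ → ∃ G : ℂ × ℂ → ℂ, Differentiable ℂ G ∧
      (∀ u v, (u - v).im < -R →
        f (u - v) * op k (X u) (op k (Y v) Ψ) ζ - S u v Ψ ζ = G (u, v)) ∧
      (∀ u v, (v - u).im < -R →
        g (u - v) * op k (Y v) (op k (X u) Ψ) ζ - S u v Ψ ζ = G (u, v))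

/-- The Serre relation `X(u₁)X(u₂)Y(v) - 2X(u₁)Y(v)X(u₂) + Y(v)X(u₁)X(u₂) + (u₁ ↔ u₂) = 0` between
the analytic continuations of the triple products. Each continuation is an entire function divided by
the polynomial `p(u₁-u₂) p(u₂-u₁) p(u₁-v) p(u₂-v)`, which is symmetric in `u₁`, `u₂`. -/
def SerreRelation (X Y : Current N) : Prop :=
  ∃ (p : Polynomial ℂ) (R : ℝ), p ≠ 0 ∧ 0 ≤ R ∧ ConvergesBelow ħ k R X X ∧
    ConvergesBelow ħ k R X Y ∧ ConvergesBelow ħ k R Y X ∧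
    ∀ Ψ ∈ Fock N ħ, ∀ ζ, IsTest ζ → ∃ G₁ G₂ G₃ : ℂ × ℂ × ℂ → ℂ,
      Differentiable ℂ G₁ ∧ Differentiable ℂ G₂ ∧ Differentiable ℂ G₃ ∧
      (∀ u₁ u₂ v, (u₁ - u₂).im < -R → (u₂ - v).im < -R →
        p.eval (u₁ - u₂) * p.eval (u₂ - u₁) * p.eval (u₁ - v) * p.eval (u₂ - v) *
          op k (X u₁) (op k (X u₂) (op k (Y v) Ψ)) ζ = G₁ (u₁, u₂, v)) ∧
      (∀ u₁ u₂ v, (u₁ - v).im < -R → (v - u₂).im < -R →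
        p.eval (u₁ - u₂) * p.eval (u₂ - u₁) * p.eval (u₁ - v) * p.eval (u₂ - v) *
          op k (X u₁) (op k (Y v) (op k (X u₂) Ψ)) ζ = G₂ (u₁, u₂, v)) ∧
      (∀ u₁ u₂ v, (v - u₁).im < -R → (u₁ - u₂).im < -R →
        p.eval (u₁ - u₂) * p.eval (u₂ - u₁) * p.eval (u₁ - v) * p.eval (u₂ - v) *
          op k (Y v) (op k (X u₁) (op k (X u₂) Ψ)) ζ = G₃ (u₁, u₂, v)) ∧
      ∀ u₁ u₂ v, (G₁ (u₁, u₂, v) - 2 * G₂ (u₁, u₂, v) + G₃ (u₁, u₂, v))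
        + (G₁ (u₂, u₁, v) - 2 * G₂ (u₂, u₁, v) + G₃ (u₂, u₁, v)) = 0

end Currents

end FreeBoson

open FreeBoson

namespace FreeBoson

/-! ### A complex Frullani integral -/

/-! Every current is a finite linear combination of normal ordered exponentials (`IsExpansion`). In
the Bargmann-Fock picture a product of two exponentials is the normal ordered product times the
exponential of a scalar integral, the contraction (`vertexOp_vertexOp`). For every pair of terms
that is needed, the integrand of the contraction is e^{-i(u-v)t}/t times a finite sum of differences
e^{pħt} - e^{qħt}, recorded as a list of pairs (p, q) (`HasContr`). A complex Frullani integral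
turns the list into a rational function of w = u - v with factors (w + iqħ)/(w + ipħ)
(`laplace_expSum`). Matrix elements of the normal ordered exponentials themselves are entire. Thus
each relation becomes a statement about finite lists and about exponents that coincide at the poles.

The lists are found in the mode picture. Up to a common normalisation each exponent is an array of
exponentials indexed by the species (`HasProfile`), and a contraction is the pairing of the
b-arrays, minus that of the c-arrays, plus the λ part. The tails of E and of the second sum F₂ of F
are annihilation operators, the tail of the first sum F₁ is made of creation operators. Hence only
the products E F₁ and F₂ F₁ pair a tail with a tail; these sums telescope (`pairing_hbE_gbF₁`,
`pairing_hbF₂_gbF₁`). In F₂ F₁ the boundary term of the b-sum at column N is completed by the λ part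
to an expression without N and k (`lamPairing_F`).

The exponent of H^± is the sum of one exponent of E and one of F at the right points
(`HPlusData_eq`, `HMinusData_eq`), so contractions with H are sums of the lists above. They turn out
not to depend on the term of E or F, and the exchange relations with H follow. For E E and F F the
two orders are compared term by term (`ratExchange_EE`, `ratExchange_FF`).

Regularity uses two mechanisms: either the prefactor vanishes at the pole of the term (`Clears`), or
two terms have a pole on the same line with opposite coefficients while their total exponents agree
on that line. In the second case the difference of matrix elements vanishes on the line and is
divisible there (`exists_division`, `regular_cancel`). In E_μ F_μ exactly two poles survive, and the
exponents at them are those of H^- and H^+.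

The Serre relation holds for each triple of terms separately. Once the common matrix element is
removed it is a polynomial identity following from the exchange factors alone (`serre_identity`,
`serreRelation_of`). -/

theorem integrableOn_exp_segment {a b : ℂ} (ha : 0 < a.re) (hb : 0 < b.re) :
    Integrable (Function.uncurry fun (t s : ℝ) => (b - a) * exp (-(a + s * (b - a)) * t))
      ((volume.restrict (Set.Ioi 0)).prod (volume.restrict (Set.Ioc 0 1))) := by
  set c := min a.re b.re with hc
  have hc0 : 0 < c := lt_min ha hb
  have h1 : Integrable (fun t : ℝ => Real.exp (-c * t)) (volume.restrict (Set.Ioi 0)) :=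
    integrableOn_exp_mul_Ioi (by linarith) 0
  have h2 : Integrable (fun _ : ℝ => ‖b - a‖) (volume.restrict (Set.Ioc 0 1)) :=
    integrable_const _
  refine (h1.mul_prod h2).mono' (by
    apply Continuous.aestronglyMeasurable
    unfold Function.uncurry
    fun_prop) ?_
  rw [Measure.prod_restrict, ae_restrict_iff' (measurableSet_Ioi.prod measurableSet_Ioc)]
  refine Filter.Eventually.of_forall ?_
  rintro ⟨t, s⟩ ⟨ht, hs⟩
  simp only [Set.mem_Ioi, Set.mem_Ioc] at ht hs
  simp only [Function.uncurry, norm_mul, norm_exp]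
  rw [mul_comm]
  gcongr
  have h3 : (-(a + s * (b - a)) * t).re = -((1 - s) * a.re + s * b.re) * t := by
    simp only [mul_re, neg_re, add_re, ofReal_re, sub_re, ofReal_im, zero_mul, sub_zero, mul_zero]
    ring
  rw [h3]
  have h4 : c ≤ (1 - s) * a.re + s * b.re := by
    have := min_le_left a.re b.re
    have := min_le_right a.re b.re
    nlinarith
  nlinarith

/-- Frullani's device: the quotient is written as an integral over the segment from `a` to `b`, so
that the singularity at t = 0 disappears and Fubini applies. -/
theorem integral_exp_segment (a b : ℂ) {t : ℝ} (ht : 0 < t) :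
    ∫ s : ℝ in Set.Ioc 0 1, (b - a) * exp (-(a + s * (b - a)) * t)
      = (exp (-a * t) - exp (-b * t)) / t := by
  have htc : (t : ℂ) ≠ 0 := by exact_mod_cast ht.ne'
  rw [← intervalIntegral.integral_of_le zero_le_one]
  have h : ∀ s : ℝ, HasDerivAt (fun s : ℝ => - exp (-(a + s * (b - a)) * t) / t)
      ((b - a) * exp (-(a + s * (b - a)) * t)) s := by
    intro s
    have h1 : HasDerivAt (fun z : ℂ => - exp (-(a + z * (b - a)) * t) / t)
        ((b - a) * exp (-(a + s * (b - a)) * t)) (s : ℂ) := by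
      have h2 : HasDerivAt (fun z : ℂ => -(a + z * (b - a)) * t) (-(1 * (b - a)) * t) (s : ℂ) :=
        ((((hasDerivAt_id (s : ℂ)).mul_const (b - a)).const_add a).neg).mul_const _
      refine (h2.cexp.neg.div_const _).congr_deriv ?_
      field_simp
    exact h1.comp_ofReal
  rw [intervalIntegral.integral_eq_sub_of_hasDerivAt (fun s _ => h s)
    (by apply Continuous.intervalIntegrable; fun_prop)]
  simp only [ofReal_one, one_mul, ofReal_zero, zero_mul, add_zero, add_sub_cancel]
  ring

theorem integrableOn_frullani {a b : ℂ} (ha : 0 < a.re) (hb : 0 < b.re) :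
    IntegrableOn (fun t : ℝ => (exp (-a * t) - exp (-b * t)) / t) (Set.Ioi 0) := by
  refine (integrableOn_exp_segment ha hb).integral_prod_left.congr ?_
  rw [Filter.EventuallyEq, ae_restrict_iff' measurableSet_Ioi]
  exact Filter.Eventually.of_forall fun t ht => integral_exp_segment a b ht

/-- After Fubini the integrand in s is the derivative of the principal logarithm along the segment
from `a` to `b`, which stays in the right half plane. -/
theorem exp_integral_frullani {a b : ℂ} (ha : 0 < a.re) (hb : 0 < b.re) :
    exp (∫ t : ℝ in Set.Ioi 0, (exp (-a * t) - exp (-b * t)) / t) = b / a := by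
  have h0 : ∀ s ∈ Set.Icc (0 : ℝ) 1, 0 < (a + s * (b - a)).re := by
    intro s hs
    have h3 : (a + s * (b - a)).re = (1 - s) * a.re + s * b.re := by
      simp only [mul_re, add_re, ofReal_re, sub_re, ofReal_im, zero_mul, sub_zero]
      ring
    rw [h3]
    rcases hs with ⟨h1, h2⟩
    rcases eq_or_lt_of_le h1 with h | h
    · rw [← h]; simpa using ha
    · have := mul_pos h hb
      nlinarith [mul_nonneg (sub_nonneg.2 h2) ha.le]
  have h1 : ∫ t : ℝ in Set.Ioi 0, (exp (-a * t) - exp (-b * t)) / t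
      = ∫ s : ℝ in Set.Ioc 0 1, ∫ t : ℝ in Set.Ioi 0, (b - a) * exp (-(a + s * (b - a)) * t) := by
    rw [← integral_integral_swap (integrableOn_exp_segment ha hb)]
    exact setIntegral_congr_fun measurableSet_Ioi fun t ht => (integral_exp_segment a b ht).symm
  have h2 : ∀ s ∈ Set.Ioc (0 : ℝ) 1,
      ∫ t : ℝ in Set.Ioi 0, (b - a) * exp (-(a + s * (b - a)) * t) = (b - a) / (a + s * (b - a)) := by
    intro s hs
    have h3 := h0 s ⟨hs.1.le, hs.2⟩
    have h4 : a + s * (b - a) ≠ 0 := fun h => by rw [h] at h3; simp at h3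
    rw [integral_const_mul, integral_exp_mul_complex_Ioi (by rw [neg_re]; linarith)]
    simp only [ofReal_zero, mul_zero, exp_zero]
    field_simp
  rw [h1, setIntegral_congr_fun measurableSet_Ioc h2, ← intervalIntegral.integral_of_le zero_le_one]
  have h5 : ∀ s ∈ Set.uIcc (0 : ℝ) 1, HasDerivAt (fun s : ℝ => log (a + s * (b - a)))
      ((b - a) / (a + s * (b - a))) s := by
    intro s hs
    rw [Set.uIcc_of_le zero_le_one] at hs
    have h6 : HasDerivAt (fun z : ℂ => a + z * (b - a)) (1 * (b - a)) (s : ℂ) :=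
      ((hasDerivAt_id (s : ℂ)).mul_const (b - a)).const_add a
    have := (h6.clog (Or.inl (h0 s hs))).comp_ofReal
    simpa using this
  rw [intervalIntegral.integral_eq_sub_of_hasDerivAt h5]
  · have ha0 : a ≠ 0 := fun h => by rw [h] at ha; simp at ha
    have hb0 : b ≠ 0 := fun h => by rw [h] at hb; simp at hb
    simp [exp_sub, exp_log ha0, exp_log hb0]
  · apply ContinuousOn.intervalIntegrable
    rw [Set.uIcc_of_le zero_le_one]
    refine ContinuousOn.div (by fun_prop) (by fun_prop) fun s hs h => ?_
    have := h0 s hs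
    rw [h] at this
    simp at this

/-! ### Integrals over the half line -/

instance isFiniteMeasureOnCompacts_dt : IsFiniteMeasureOnCompacts dt :=
  IsFiniteMeasureOnCompacts.comap' volume continuous_subtype_val
    (MeasurableEmbedding.subtype_coe measurableSet_Ioi)

theorem integrable_dt_of_integrableOn {f : ℝ → ℂ} (hf : IntegrableOn f (Set.Ioi 0)) :
    Integrable (fun t : HalfLine => f t) dt :=
  (integrableOn_iff_comap_subtypeVal measurableSet_Ioi).1 hf

theorem integral_dt (f : ℝ → ℂ) : ∫ t : HalfLine, f t ∂dt = ∫ t in Set.Ioi 0, f t :=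
  integral_subtype_comap measurableSet_Ioi f

theorem integrable_of_compactSupport {φ g : HalfLine → ℂ} (hφ : Continuous φ)
    (hc : HasCompactSupport φ) (hg : Continuous g) : Integrable (fun t => φ t * g t) dt :=
  (hφ.mul hg).integrable_of_hasCompactSupport hc.mul_right

/-- Finite sums of differences of exponentials, encoded by the list of the pairs of exponents. -/
noncomputable def expSum (L : List (ℂ × ℂ)) (x : ℂ) : ℂ :=
  (L.map fun p => exp (p.1 * x) - exp (p.2 * x)).sum

/-- The rational function whose logarithm is the Laplace transform of `expSum L (ħ t) / t`. -/
noncomputable def ratio (ħ : ℝ) (L : List (ℂ × ℂ)) (w : ℂ) : ℂ :=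
  (L.map fun p => (w + I * p.2 * ħ) / (w + I * p.1 * ħ)).prod

/-- All zeros and poles of `ratio ħ L` lie in the strip `|Im w| ≤ R`. -/
def Bounded (ħ : ℝ) (R : ℝ) (L : List (ℂ × ℂ)) : Prop :=
  ∀ p ∈ L, |(p.1 * ħ).re| ≤ R ∧ |(p.2 * ħ).re| ≤ R

/-- Each pair (p, q) contributes a Frullani integral with a = iw - pħ and b = iw - qħ. `Bounded`
together with Im w < -R is what makes both real parts positive. -/
theorem laplace_expSum {ħ R : ℝ} {L : List (ℂ × ℂ)} (hL : Bounded ħ R L) {w : ℂ} (hw : w.im < -R) :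
    Integrable (fun t : HalfLine => exp (-I * w * (t : ℝ)) / (t : ℝ) * expSum L (ħ * (t : ℝ))) dt ∧
    exp (∫ t : HalfLine, exp (-I * w * (t : ℝ)) / (t : ℝ) * expSum L (ħ * (t : ℝ)) ∂dt)
      = ratio ħ L w := by
  induction L with
  | nil => simp [expSum, ratio]
  | cons p L ih =>
    obtain ⟨h1, h2⟩ := ih fun q hq => hL q (List.mem_cons_of_mem _ hq)
    have hp := hL p List.mem_cons_self
    have ha : 0 < (I * w - p.1 * ħ).re := by
      have := abs_le.1 hp.1
      rw [sub_re]
      simp only [mul_re, I_re, zero_mul, I_im, one_mul, zero_sub] at this ⊢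
      linarith
    have hb : 0 < (I * w - p.2 * ħ).re := by
      have := abs_le.1 hp.2
      rw [sub_re]
      simp only [mul_re, I_re, zero_mul, I_im, one_mul, zero_sub] at this ⊢
      linarith
    have e : (fun t : HalfLine => exp (-I * w * (t : ℝ)) / (t : ℝ) * expSum (p :: L) (ħ * (t : ℝ)))
        = fun t : HalfLine =>
          (exp (-(I * w - p.1 * ħ) * (t : ℝ)) - exp (-(I * w - p.2 * ħ) * (t : ℝ))) / (t : ℝ)
          + exp (-I * w * (t : ℝ)) / (t : ℝ) * expSum L (ħ * (t : ℝ)) := by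
      funext t
      have e1 : ∀ s : ℂ, exp (-(I * w - s * ħ) * (t : ℝ))
          = exp (-I * w * (t : ℝ)) * exp (s * (ħ * (t : ℝ))) := by
        intro s; rw [← exp_add]; congr 1; ring
      simp only [expSum, List.map_cons, List.sum_cons, e1]
      ring
    have h3 := integrable_dt_of_integrableOn (integrableOn_frullani ha hb)
    rw [e]
    refine ⟨h3.add h1, ?_⟩
    rw [integral_add h3 h1, exp_add, h2, integral_dt (fun t : ℝ =>
      (exp (-(I * w - p.1 * ħ) * t) - exp (-(I * w - p.2 * ħ) * t)) / t), exp_integral_frullani ha hb]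
    simp only [ratio, List.map_cons, List.prod_cons]
    congr 1
    -- Multiplying b/a through by -i turns it into a quotient of the linear forms in w that occur in
    -- `ratio`.
    have e2 : ∀ s : ℂ, w + I * s * ħ = -I * (I * w - s * ħ) := by
      intro s
      linear_combination (w) * I_mul_I
    rw [e2, e2, mul_div_mul_left _ _ (neg_ne_zero.2 I_ne_zero)]

theorem ratio_den_ne_zero {ħ R : ℝ} {s w : ℂ} (hs : |(s * ħ).re| ≤ R) (hw : R < |w.im|) :
    w + I * s * ħ ≠ 0 := by
  intro h
  have h1 : w.im = -(s * ħ).re := by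
    have := congrArg Complex.im h
    rw [add_im, mul_assoc] at this
    simp only [mul_im, I_re, zero_mul, I_im, one_mul, zero_add, zero_im] at this
    linarith
  rw [h1, abs_neg] at hw
  linarith

end FreeBoson

namespace FreeBoson

/-! ### Vertex operators -/

variable {N : ℕ} {ħ : ℝ} {k : ℂ}

theorem commWith_add (h h' : Smearing N) :
    commWith N ħ k (h + h') = commWith N ħ k h + commWith N ħ k h' := by
  ext t j
  simp [commWith, add_mul, Finset.sum_add_distrib]

theorem commWith_zero : commWith N ħ k 0 = 0 := by
  ext t j
  simp [commWith]

/-- The integrand of the contraction of two normal ordered exponentials. -/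
noncomputable def contr (N : ℕ) (ħ : ℝ) (k : ℂ) (D D' : VertexData N) (t : HalfLine) : ℂ :=
  ∑ i, D'.2 t i * (commWith N ħ k D.1).1 t i

theorem contr_add_left (D₁ D₂ D' : VertexData N) (t : HalfLine) :
    contr N ħ k (D₁ + D₂) D' t = contr N ħ k D₁ D' t + contr N ħ k D₂ D' t := by
  simp [contr, commWith_add, mul_add, Finset.sum_add_distrib]

theorem contr_add_right (D D₁ D₂ : VertexData N) (t : HalfLine) :
    contr N ħ k D (D₁ + D₂) t = contr N ħ k D D₁ t + contr N ħ k D D₂ t := by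
  simp [contr, add_mul, Finset.sum_add_distrib]

theorem contr_of_fst_eq_zero {D : VertexData N} (h : D.1 = 0) (D' : VertexData N) (t : HalfLine) :
    contr N ħ k D D' t = 0 := by
  simp [contr, h, commWith_zero]

theorem contr_of_snd_eq_zero (D : VertexData N) {D' : VertexData N} (h : D'.2 = 0) (t : HalfLine) :
    contr N ħ k D D' t = 0 := by
  simp [contr, h]

/-- The creation part of the exponent converges at the symbol `ζ`. -/
def Pairs (D : VertexData N) (ζ : Symbols N ħ) : Prop :=
  Integrable (fun t : HalfLine => ∑ i, D.2 t i * ζ.1 t i) dt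

theorem continuous_apply_mode (g : Smearing N) (i : Mode N) : Continuous fun t => g t i :=
  (continuous_apply i).comp g.continuous

theorem HasCompactSupport.apply_mode {g : Smearing N} (h : HasCompactSupport g) (i : Mode N) :
    HasCompactSupport fun t => g t i :=
  h.comp_left (g := fun x : Mode N → ℂ => x i) rfl

theorem pairs_of_isTest (D : VertexData N) {ζ : Symbols N ħ} (hζ : IsTest ζ) : Pairs D ζ :=
  integrable_finsetSum _ fun i _ => by
    simpa only [mul_comm] using integrable_of_compactSupport (continuous_apply_mode ζ.1 i)
      (HasCompactSupport.apply_mode hζ i) (continuous_apply_mode D.2 i)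

theorem Pairs.add_right {D : VertexData N} {ζ ζ' : Symbols N ħ} (h : Pairs D ζ) (h' : Pairs D ζ') :
    Pairs D (ζ + ζ') := by
  refine (h.add h').congr (Filter.Eventually.of_forall fun t => ?_)
  simp [mul_add, Finset.sum_add_distrib]

/-- The annihilation part of `D` translates the symbol before the creation exponential of `D'` reads
it; that exponent is linear, so the translation splits off as a scalar. `Pairs` replaces `IsTest`
because the formula is also needed at translated symbols, which need not have compact support. -/
theorem vertexOp_vertexOp {D D' : VertexData N} {ζ : Symbols N ħ} (hD : Pairs D ζ)
    (hD' : Pairs D' ζ) (h : Integrable (contr N ħ k D D') dt) (Ψ : Symbols N ħ → ℂ) :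
    vertexOp k D (vertexOp k D' Ψ) ζ
      = exp (∫ t, contr N ħ k D D' t ∂dt) * vertexOp k (D + D') Ψ ζ := by
  have e1 : ∫ t : HalfLine, ∑ i, D'.2 t i * (ζ + commWith N ħ k D.1).1 t i ∂dt
      = (∫ t : HalfLine, ∑ i, D'.2 t i * ζ.1 t i ∂dt) + ∫ t, contr N ħ k D D' t ∂dt := by
    rw [← integral_add hD' h]
    simp [contr, mul_add, Finset.sum_add_distrib]
  have e2 : ∫ t : HalfLine, ∑ i, (D + D').2 t i * ζ.1 t i ∂dt
      = (∫ t : HalfLine, ∑ i, D.2 t i * ζ.1 t i ∂dt)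
        + ∫ t : HalfLine, ∑ i, D'.2 t i * ζ.1 t i ∂dt := by
    rw [← integral_add hD hD']
    simp [add_mul, Finset.sum_add_distrib]
  have e3 : ζ + commWith N ħ k (D + D').1 = ζ + commWith N ħ k D.1 + commWith N ħ k D'.1 := by
    rw [Prod.fst_add, commWith_add]
    exact Subtype.ext (add_assoc ζ.1 _ _).symm
  simp only [vertexOp, e1, e2, e3, exp_add]
  ring

theorem vertexOp_vertexOp_vertexOp {D₁ D₂ D₃ : VertexData N} {ζ : Symbols N ħ} (hζ : IsTest ζ)
    (h₁₂ : Integrable (contr N ħ k D₁ D₂) dt) (h₁₃ : Integrable (contr N ħ k D₁ D₃) dt)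
    (h₂₃ : Integrable (contr N ħ k D₂ D₃) dt) (Ψ : Symbols N ħ → ℂ) :
    vertexOp k D₁ (vertexOp k D₂ (vertexOp k D₃ Ψ)) ζ
      = exp (∫ t, contr N ħ k D₁ D₂ t ∂dt) * exp (∫ t, contr N ħ k D₁ D₃ t ∂dt)
        * exp (∫ t, contr N ħ k D₂ D₃ t ∂dt) * vertexOp k (D₁ + D₂ + D₃) Ψ ζ := by
  have hp := fun D : VertexData N => pairs_of_isTest D hζ
  -- The inner product is read at the symbol translated by `D₁`; integrability against the
  -- translation is exactly convergence of the contractions with `D₁`.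
  have e := vertexOp_vertexOp (k := k) (ζ := ζ + commWith N ħ k D₁.1)
    ((hp D₂).add_right h₁₂) ((hp D₃).add_right h₁₃) h₂₃ Ψ
  have h : Integrable (contr N ħ k D₁ (D₂ + D₃)) dt := by
    exact (h₁₂.add h₁₃).congr (Filter.Eventually.of_forall fun t =>
      (contr_add_right D₁ D₂ D₃ t).symm)
  have e1 := vertexOp_vertexOp (hp D₁) (hp (D₂ + D₃)) h Ψ
  have e2 : ∫ t, contr N ħ k D₁ (D₂ + D₃) t ∂dt
      = (∫ t, contr N ħ k D₁ D₂ t ∂dt) + ∫ t, contr N ħ k D₁ D₃ t ∂dt := by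
    rw [← integral_add h₁₂ h₁₃]
    exact integral_congr_ae (Filter.Eventually.of_forall fun t => contr_add_right D₁ D₂ D₃ t)
  rw [e2, exp_add, ← add_assoc] at e1
  have e3 : vertexOp k D₁ (vertexOp k D₂ (vertexOp k D₃ Ψ)) ζ
      = exp (∫ t, contr N ħ k D₂ D₃ t ∂dt) * vertexOp k D₁ (vertexOp k (D₂ + D₃) Ψ) ζ := by
    conv_lhs => rw [vertexOp, e]
    conv_rhs => rw [vertexOp]
    ring
  rw [e3, e1]
  ring

theorem op_add (x y : NormalOrdered N) (Ψ : Symbols N ħ → ℂ) (ζ : Symbols N ħ) :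
    op k (x + y) Ψ ζ = op k x Ψ ζ + op k y Ψ ζ := by
  simp only [op, AddMonoidAlgebra.coeff_add]
  exact Finsupp.sum_add_index' (by simp) fun _ _ _ => add_mul _ _ _

theorem op_smul (a : ℂ) (x : NormalOrdered N) (Ψ : Symbols N ħ → ℂ) (ζ : Symbols N ħ) :
    op k (a • x) Ψ ζ = a * op k x Ψ ζ := by
  simp only [op, AddMonoidAlgebra.coeff_smul]
  rw [Finsupp.sum_smul_index' (by simp), Finsupp.mul_sum]
  simp [mul_assoc]

theorem op_vx (D : VertexData N) (Ψ : Symbols N ħ → ℂ) (ζ : Symbols N ħ) :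
    op k (vx D) Ψ ζ = vertexOp k D Ψ ζ := by
  simp [op, vx, AddMonoidAlgebra.coeff_single]

theorem op_sum {ι : Type*} (s : Finset ι) (x : ι → ℂ) (D : ι → VertexData N)
    (Ψ : Symbols N ħ → ℂ) (ζ : Symbols N ħ) :
    op k (∑ a ∈ s, x a • vx (D a)) Ψ ζ = ∑ a ∈ s, x a * vertexOp k (D a) Ψ ζ := by
  classical
  induction s using Finset.induction_on with
  | empty => simp [op]
  | insert a s ha ih => rw [Finset.sum_insert ha, Finset.sum_insert ha, op_add, op_smul, op_vx, ih]

theorem vertexOp_sum {ι : Type*} (D : VertexData N) (s : Finset ι) (x : ι → ℂ)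
    (Φ : ι → Symbols N ħ → ℂ) (ζ : Symbols N ħ) :
    vertexOp k D (fun ζ => ∑ a ∈ s, x a * Φ a ζ) ζ = ∑ a ∈ s, x a * vertexOp k D (Φ a) ζ := by
  simp only [vertexOp, Finset.mul_sum]
  exact Finset.sum_congr rfl fun _ _ => by ring

/-- Exponents of different indices might coincide and their coefficients cancel, so only this
inclusion is available. It suffices for the convergence of products. -/
theorem mem_support_of_sum {ι : Type*} {s : Finset ι} {x : ι → ℂ} {D : ι → VertexData N}
    {E : VertexData N} (h : E ∈ (∑ a ∈ s, x a • vx (D a)).coeff.support) : ∃ a ∈ s, D a = E := by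
  by_contra hne
  push Not at hne
  rw [Finsupp.mem_support_iff] at h
  apply h
  rw [AddMonoidAlgebra.coeff_sum, Finsupp.finsetSum_apply]
  refine Finset.sum_eq_zero fun a ha => ?_
  rw [AddMonoidAlgebra.coeff_smul, vx, AddMonoidAlgebra.coeff_single, Finsupp.smul_apply,
    Finsupp.single_eq_of_ne (hne a ha).symm, smul_zero]

/-! ### Families of vertex data that depend holomorphically on parameters -/

/-- All smeared components of the vertex data `A z` are entire functions of `z`. -/
def EntireFamily {V : Type*} [NormedAddCommGroup V] [NormedSpace ℂ V] (A : V → VertexData N) :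
    Prop :=
  ∀ φ : C(HalfLine, ℂ), HasCompactSupport φ → ∀ j,
    (Differentiable ℂ fun z => ∫ t, φ t * (A z).1 t j ∂dt) ∧
      Differentiable ℂ fun z => ∫ t, φ t * (A z).2 t j ∂dt

section EntireFamily

variable {V W : Type*} [NormedAddCommGroup V] [NormedSpace ℂ V] [NormedAddCommGroup W]
  [NormedSpace ℂ W]

theorem differentiable_of_eq {f g : V → ℂ} (h : Differentiable ℂ f) (e : ∀ z, g z = f z) :
    Differentiable ℂ g :=
  (funext e : g = f) ▸ h

theorem EntireFamily.comp {A : V → VertexData N} (hA : EntireFamily A) {f : W → V}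
    (hf : Differentiable ℂ f) : EntireFamily fun z => A (f z) :=
  fun φ hφ j => ⟨(hA φ hφ j).1.comp hf, (hA φ hφ j).2.comp hf⟩

theorem integrable_smear {φ : C(HalfLine, ℂ)} (hφ : HasCompactSupport φ) (g : Smearing N)
    (j : Mode N) : Integrable (fun t => φ t * g t j) dt :=
  integrable_of_compactSupport φ.continuous hφ (continuous_apply_mode g j)

theorem EntireFamily.add {A B : V → VertexData N} (hA : EntireFamily A) (hB : EntireFamily B) :
    EntireFamily fun z => A z + B z := by
  intro φ hφ j
  constructor
  · refine differentiable_of_eq ((hA φ hφ j).1.add (hB φ hφ j).1) fun z => ?_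
    rw [Pi.add_apply]
    rw [← integral_add (integrable_smear hφ _ j) (integrable_smear hφ _ j)]
    simp [mul_add]
  · refine differentiable_of_eq ((hA φ hφ j).2.add (hB φ hφ j).2) fun z => ?_
    rw [Pi.add_apply]
    rw [← integral_add (integrable_smear hφ _ j) (integrable_smear hφ _ j)]
    simp [mul_add]

theorem EntireFamily.neg {A : V → VertexData N} (hA : EntireFamily A) :
    EntireFamily fun z => - A z := by
  intro φ hφ j
  simpa [integral_neg] using And.intro (hA φ hφ j).1.neg (hA φ hφ j).2.neg

theorem EntireFamily.sub {A B : V → VertexData N} (hA : EntireFamily A) (hB : EntireFamily B) :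
    EntireFamily fun z => A z - B z := by
  simpa only [sub_eq_add_neg] using hA.add hB.neg

theorem entireFamily_zero : EntireFamily fun _ : V => (0 : VertexData N) :=
  fun φ hφ j => by simp

theorem EntireFamily.sum {ι : Type*} {s : Finset ι} {A : ι → V → VertexData N}
    (hA : ∀ a ∈ s, EntireFamily (A a)) : EntireFamily fun z => ∑ a ∈ s, A a z := by
  classical
  induction s using Finset.induction_on with
  | empty => simpa using entireFamily_zero
  | insert a s ha ih =>
    simp only [Finset.sum_insert ha]
    exact (hA a (Finset.mem_insert_self a s)).add
      (ih fun b hb => hA b (Finset.mem_insert_of_mem hb))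

/-- Differentiation under the integral: on the unit ball around u₀ the derivative of the integrand
is dominated by a continuous function whose support is compact. -/
theorem differentiable_integral_exp {ψ : HalfLine → ℂ} (hψ : Continuous ψ)
    (hc : HasCompactSupport ψ) (α : ℂ) :
    Differentiable ℂ fun u : ℂ => ∫ t : HalfLine, ψ t * exp (α * u * (t : ℝ)) ∂dt := by
  intro u₀
  have hb : Integrable (fun t : HalfLine =>
      ‖ψ t‖ * (‖α * (t : ℝ)‖ * Real.exp (‖α‖ * (‖u₀‖ + 1) * (t : ℝ)))) dt :=
    ((hψ.norm.mul (by fun_prop)).integrable_of_hasCompactSupport hc.norm.mul_right)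
  refine (hasDerivAt_integral_of_dominated_loc_of_deriv_le
    (F' := fun (u : ℂ) (t : HalfLine) => ψ t * (exp (α * u * (t : ℝ)) * (α * (t : ℝ))))
    (bound := fun t : HalfLine => ‖ψ t‖ * (‖α * (t : ℝ)‖ * Real.exp (‖α‖ * (‖u₀‖ + 1) * (t : ℝ))))
    (Metric.ball_mem_nhds u₀ zero_lt_one)
    (Filter.Eventually.of_forall fun u => by
      apply Continuous.aestronglyMeasurable; fun_prop)
    (integrable_of_compactSupport hψ hc (by fun_prop))
    (by apply Continuous.aestronglyMeasurable; fun_prop)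
    (Filter.Eventually.of_forall fun t u hu => ?_) hb
    (Filter.Eventually.of_forall fun t u _ => ?_)).2.differentiableAt
  · have ht : 0 < (t : ℝ) := t.2
    rw [norm_mul, norm_mul, mul_comm ‖exp _‖]
    have h1 : ‖u‖ ≤ ‖u₀‖ + 1 := by
      have h2 : ‖u - u₀‖ < 1 := by simpa [dist_eq_norm] using hu
      have h3 := norm_le_norm_add_norm_sub' u u₀
      linarith
    gcongr
    refine (norm_exp_le_exp_norm _).trans ?_
    rw [norm_mul, norm_mul, norm_real, Real.norm_of_nonneg ht.le]
    gcongr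
  · have h : HasDerivAt (fun u : ℂ => α * u * (t : ℝ)) (α * (t : ℝ)) u := by
      simpa using ((hasDerivAt_id u).const_mul α).mul_const ((t : ℝ) : ℂ)
    exact h.cexp.const_mul _

/-- Smearings of the form `c(t) e^{α u t}`. -/
theorem differentiable_smear_place (P : Mode N → Prop) {c : HalfLine → ℂ} (hc : Continuous c)
    (α : ℂ) (f : ℂ → C(HalfLine, ℂ)) (hf : ∀ u t, f u t = c t * exp (α * u * (t : ℝ)))
    {φ : C(HalfLine, ℂ)} (hφ : HasCompactSupport φ) (j : Mode N) :
    Differentiable ℂ fun u : ℂ => ∫ t : HalfLine, φ t * (place P (f u)) t j ∂dt := by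
  by_cases h : P j
  · have := differentiable_integral_exp (φ.continuous.mul hc) (hφ.mul_right (f' := c)) α
    refine differentiable_of_eq this fun u => ?_
    simp only [place, ContinuousMap.coe_mk, h, if_true, hf, Pi.mul_apply, mul_assoc]
  · simp [place, h]

theorem entireFamily_chiPlus (P : Mode N → Prop) : EntireFamily fun u => chiPlus ħ P u :=
  fun φ hφ j => ⟨differentiable_smear_place P (c := fun _ => 2 * ħ) (by fun_prop) (-I) _
    (fun u t => rfl) hφ j, by simp [chiPlus]⟩

theorem entireFamily_chiMinus (P : Mode N → Prop) : EntireFamily fun u => chiMinus ħ P u :=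
  fun φ hφ j => ⟨by simp [chiMinus], differentiable_smear_place P (c := fun _ => -(2 * ħ))
    (by fun_prop) I _ (fun u t => by simp) hφ j⟩

theorem entireFamily_chi (P : Mode N → Prop) : EntireFamily fun u => chi ħ P u := by
  have h := continuous_inv_sinh ħ
  exact fun φ hφ j => ⟨differentiable_smear_place P
      (c := fun t => -ħ * (sinh ((ħ : ℂ) / 2 * (t : ℝ)))⁻¹) (by fun_prop) (-I) _
      (fun u t => by simp only [ContinuousMap.coe_mk]; ring) hφ j,
    differentiable_smear_place P (c := fun t => ħ * (sinh ((ħ : ℂ) / 2 * (t : ℝ)))⁻¹)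
      (by fun_prop) I _ (fun u t => by simp only [ContinuousMap.coe_mk]; ring) hφ j⟩

theorem differentiable_sh (s : ℂ) : Differentiable ℂ fun u => sh ħ u s := by
  unfold sh; fun_prop

theorem entireFamily_bP (m n : ℕ) (s : ℂ) : EntireFamily fun u => bP N ħ m n (sh ħ u s) :=
  (entireFamily_chiPlus _).comp (differentiable_sh s)

theorem entireFamily_bM (m n : ℕ) (s : ℂ) : EntireFamily fun u => bM N ħ m n (sh ħ u s) :=
  (entireFamily_chiMinus _).comp (differentiable_sh s)

theorem entireFamily_lamP (m : ℕ) (s : ℂ) : EntireFamily fun u => lamP N ħ m (sh ħ u s) :=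
  (entireFamily_chiPlus _).comp (differentiable_sh s)

theorem entireFamily_lamM (m : ℕ) (s : ℂ) : EntireFamily fun u => lamM N ħ m (sh ħ u s) :=
  (entireFamily_chiMinus _).comp (differentiable_sh s)

theorem entireFamily_bc (m n : ℕ) (s : ℂ) : EntireFamily fun u => bc N ħ m n (sh ħ u s) :=
  ((entireFamily_chi _).add (entireFamily_chi _)).comp (differentiable_sh s)

end EntireFamily

end FreeBoson

namespace FreeBoson

variable {N : ℕ} {ħ : ℝ} {k : ℂ}

/-! ### Matrix elements of vertex operators are entire -/

/-- The component `i` of a smearing. -/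
noncomputable def component (g : Smearing N) (i : Mode N) : C(HalfLine, ℂ) :=
  ⟨fun t => g t i, continuous_apply_mode g i⟩

theorem integral_pair_eq (D : VertexData N) {ζ : Symbols N ħ} (hζ : IsTest ζ) :
    ∫ t : HalfLine, ∑ i, D.2 t i * ζ.1 t i ∂dt
      = ∑ i, ∫ t : HalfLine, component ζ.1 i t * D.2 t i ∂dt := by
  rw [← integral_finsetSum]
  · simp only [component, ContinuousMap.coe_mk, mul_comm]
  · exact fun i _ => integrable_smear (φ := component ζ.1 i) (HasCompactSupport.apply_mode hζ i) D.2 i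

/-- The function `t ↦ [a_j(t), a_i(-t)]`, as a coefficient of `δ`. -/
noncomputable def commMap (N : ℕ) (ħ : ℝ) (k : ℂ) (j i : Mode N) : C(HalfLine, ℂ) :=
  ⟨fun t => comm N ħ k j i t, continuous_comm N ħ k j i⟩

/-- The shift is a smearing of `h` against `g` times a commutator, which has compact support. It is
therefore entire in any parameter on which `h` depends through an `EntireFamily`. -/
theorem creationVector_add_commWith {i : Mode N} {g : C(HalfLine, ℂ)} (hg : HasCompactSupport g)
    (ζ : Symbols N ħ) (h : Smearing N) :
    creationVector i g (ζ + commWith N ħ k h) = creationVector i g ζ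
      + ∑ j, ∫ t : HalfLine, (g * commMap N ħ k j i) t * h t j ∂dt := by
  have h1 : ∀ j, Integrable (fun t : HalfLine =>
      (g * commMap N ħ k j i) t * h t j) dt := fun j =>
    integrable_smear (φ := g * commMap N ħ k j i) hg.mul_right h j
  rw [← integral_finsetSum _ fun j _ => h1 j, creationVector, creationVector, ← integral_add]
  · refine integral_congr_ae (Filter.Eventually.of_forall fun t => ?_)
    simp only [commWith, Submodule.coe_add, ContinuousMap.add_apply, Pi.add_apply,
      ContinuousMap.coe_mk, ContinuousMap.mul_apply, mul_add, Finset.mul_sum, commMap]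
    congr 1
    exact Finset.sum_congr rfl fun j _ => by ring
  · exact integrable_smear hg ζ.1 i
  · exact integrable_finsetSum _ fun j _ => h1 j

section Entire

variable {V : Type*} [NormedAddCommGroup V] [NormedSpace ℂ V]

theorem differentiable_pair {A : V → VertexData N} (hA : EntireFamily A) {ζ : Symbols N ħ}
    (hζ : IsTest ζ) : Differentiable ℂ fun z => ∫ t : HalfLine, ∑ i, (A z).2 t i * ζ.1 t i ∂dt := by
  simp only [integral_pair_eq _ hζ]
  exact Differentiable.fun_sum fun i _ =>
    (hA (component ζ.1 i) (HasCompactSupport.apply_mode hζ i) i).2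

theorem differentiable_shift {A : V → VertexData N} (hA : EntireFamily A) {i : Mode N}
    {g : C(HalfLine, ℂ)} (hg : HasCompactSupport g) :
    Differentiable ℂ fun z => ∑ j, ∫ t : HalfLine,
      (g * commMap N ħ k j i) t * (A z).1 t j ∂dt :=
  Differentiable.fun_sum fun j _ => (hA (g * commMap N ħ k j i) hg.mul_right j).1

/-- The matrix element is the exponential of an entire function times a polynomial in shifted
creation vectors. The second factor is treated by induction over the algebra `Fock`. -/
theorem differentiable_vertexOp {A : V → VertexData N} (hA : EntireFamily A)
    {Ψ : Symbols N ħ → ℂ} (hΨ : Ψ ∈ Fock N ħ) {ζ : Symbols N ħ} (hζ : IsTest ζ) :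
    Differentiable ℂ fun z => vertexOp k (A z) Ψ ζ := by
  refine (differentiable_pair hA hζ).cexp.mul ?_
  induction hΨ using Algebra.adjoin_induction with
  | mem Φ h =>
    obtain ⟨i, g, hg, rfl⟩ := h
    simp only [creationVector_add_commWith hg]
    exact (differentiable_shift hA hg).const_add _
  | algebraMap r => exact differentiable_const r
  | add x y _ _ hx hy => exact hx.add hy
  | mul x y _ _ hx hy => exact hx.mul hy

end Entire

/-! ### Division of entire functions of two variables -/

/-- The quotient is K(u, v) = ∫₀¹ A'(v + s(u - v)) ds, which is entire in both variables, the
diagonal included. -/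
theorem exists_divided_difference {A : ℂ → ℂ} (hA : Differentiable ℂ A) :
    ∃ K : ℂ × ℂ → ℂ, Differentiable ℂ K ∧ ∀ u v, A u - A v = (u - v) * K (u, v) := by
  have h1 : Differentiable ℂ (deriv A) := hA.deriv
  have h2 : Continuous (deriv (deriv A)) := h1.deriv.continuous
  refine ⟨fun p => ∫ s : ℝ in (0 : ℝ)..1, deriv A (p.2 + s * (p.1 - p.2)), ?_, ?_⟩
  · intro p₀
    -- `ℓ s` is the linear map (u, v) ↦ v + s(u - v), so that `F'` below is given by the chain rule.
    let ℓ : ℝ → ℂ × ℂ →L[ℂ] ℂ := fun s =>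
      ContinuousLinearMap.snd ℂ ℂ ℂ
        + (s : ℂ) • (ContinuousLinearMap.fst ℂ ℂ ℂ - ContinuousLinearMap.snd ℂ ℂ ℂ)
    have hℓ : Continuous ℓ := by fun_prop
    let F' : ℂ × ℂ → ℝ → ℂ × ℂ →L[ℂ] ℂ := fun p s =>
      (deriv (deriv A) (p.2 + s * (p.1 - p.2))) • ℓ s
    have hF' : Continuous fun q : (ℂ × ℂ) × ℝ => F' q.1 q.2 := by
      refine Continuous.smul (h2.comp (by fun_prop)) (hℓ.comp continuous_snd)
    obtain ⟨C, hC⟩ := ((isCompact_closedBall p₀ 1).prod (isCompact_Icc (a := (0 : ℝ)) (b := 1))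
      ).exists_bound_of_continuousOn hF'.continuousOn
    have hc : ∀ p : ℂ × ℂ, Continuous fun s : ℝ => deriv A (p.2 + s * (p.1 - p.2)) := fun p =>
      h1.continuous.comp (by fun_prop)
    refine (intervalIntegral.hasFDerivAt_integral_of_dominated_of_fderiv_le (F' := F')
      (bound := fun _ => C) (Metric.ball_mem_nhds p₀ zero_lt_one)
      (Filter.Eventually.of_forall fun p => (hc p).aestronglyMeasurable)
      ((hc p₀).intervalIntegrable _ _)
      (Continuous.aestronglyMeasurable (hF'.comp (by fun_prop : Continuous fun s : ℝ => (p₀, s))))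
      (Filter.Eventually.of_forall fun s hs p hp => hC (p, s) ⟨Metric.ball_subset_closedBall hp, ?_⟩)
      (continuous_const.intervalIntegrable _ _)
      (Filter.Eventually.of_forall fun s _ p _ => ?_)).differentiableAt
    · rw [Set.uIoc_of_le zero_le_one] at hs
      exact ⟨hs.1.le, hs.2⟩
    · have h3 : HasFDerivAt (fun p : ℂ × ℂ => p.2 + s * (p.1 - p.2)) (ℓ s) p := (ℓ s).hasFDerivAt
      exact (h1 _).hasDerivAt.comp_hasFDerivAt p h3
  · intro u v
    have h3 : ∀ s : ℝ, HasDerivAt (fun s : ℝ => A (v + s * (u - v)))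
        ((u - v) * deriv A (v + s * (u - v))) s := by
      intro s
      have h4 : HasDerivAt (fun z : ℂ => v + z * (u - v)) (1 * (u - v)) (s : ℂ) :=
        ((hasDerivAt_id (s : ℂ)).mul_const (u - v)).const_add v
      have h5 := ((hA (v + s * (u - v))).hasDerivAt.comp (s : ℂ) h4).comp_ofReal
      exact h5.congr_deriv (by ring)
    have h6 := intervalIntegral.integral_eq_sub_of_hasDerivAt (a := 0) (b := 1) (fun s _ => h3 s)
      ((continuous_const.mul (h1.continuous.comp (by fun_prop))).intervalIntegrable _ _)
    rw [intervalIntegral.integral_const_mul] at h6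
    simp only [ofReal_one, one_mul, ofReal_zero, zero_mul, add_zero, add_sub_cancel] at h6
    exact h6.symm

/-- The algebra generated by the entire functions of one of the two variables. -/
noncomputable def separable : Subalgebra ℂ (ℂ × ℂ → ℂ) :=
  Algebra.adjoin ℂ {F | ∃ A : ℂ → ℂ, Differentiable ℂ A ∧
    (F = (fun p => A p.1) ∨ F = fun p => A p.2)}

theorem fst_mem_separable {A : ℂ → ℂ} (hA : Differentiable ℂ A) :
    (fun p : ℂ × ℂ => A p.1) ∈ separable :=
  Algebra.subset_adjoin ⟨A, hA, Or.inl rfl⟩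

theorem snd_mem_separable {A : ℂ → ℂ} (hA : Differentiable ℂ A) :
    (fun p : ℂ × ℂ => A p.2) ∈ separable :=
  Algebra.subset_adjoin ⟨A, hA, Or.inr rfl⟩

theorem differentiable_of_mem_separable {F : ℂ × ℂ → ℂ} (hF : F ∈ separable) :
    Differentiable ℂ F := by
  induction hF using Algebra.adjoin_induction with
  | mem F h =>
    obtain ⟨A, hA, rfl | rfl⟩ := h
    · exact hA.comp differentiable_fst
    · exact hA.comp differentiable_snd
  | algebraMap r => exact differentiable_const r
  | add x y _ _ hx hy => exact hx.add hy
  | mul x y _ _ hx hy => exact hx.mul hy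

/-- An entire function that vanishes on the line `u - v = w₀` is divisible by `u - v - w₀`. -/
theorem exists_division {F : ℂ × ℂ → ℂ} (hF : F ∈ separable) (w₀ : ℂ)
    (h0 : ∀ v, F (v + w₀, v) = 0) :
    ∃ G : ℂ × ℂ → ℂ, Differentiable ℂ G ∧ ∀ u v, F (u, v) = (u - v - w₀) * G (u, v) := by
  -- Vanishing on a line is not inherited by summands and factors, but divisibility of F(u, v) -
  -- F(u', v) by u - u' with free u' is, by the Leibniz rule. The line enters only at the end,
  -- through u' = v + w₀.
  suffices h : ∃ K : ℂ × ℂ × ℂ → ℂ, Differentiable ℂ K ∧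
      ∀ u u' v, F (u, v) - F (u', v) = (u - u') * K (u, u', v) by
    obtain ⟨K, hK, h⟩ := h
    refine ⟨fun p => K (p.1, p.2 + w₀, p.2), hK.comp (by fun_prop), fun u v => ?_⟩
    have := h u (v + w₀) v
    rw [h0, sub_zero] at this
    rw [this]
    ring
  clear h0
  induction hF using Algebra.adjoin_induction with
  | mem F h =>
    obtain ⟨A, hA, rfl | rfl⟩ := h
    · obtain ⟨K, hK, h⟩ := exists_divided_difference hA
      exact ⟨fun p => K (p.1, p.2.1), hK.comp (by fun_prop), fun u u' v => h u u'⟩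
    · exact ⟨fun _ => 0, differentiable_const _, fun u u' v => by simp⟩
  | algebraMap r =>
    exact ⟨fun _ => 0, differentiable_const _, fun u u' v => by simp [Pi.algebraMap_apply]⟩
  | add x y _ _ hx hy =>
    obtain ⟨K, hK, h⟩ := hx
    obtain ⟨K', hK', h'⟩ := hy
    refine ⟨fun p => K p + K' p, hK.add hK', fun u u' v => ?_⟩
    simp only [Pi.add_apply]
    linear_combination h u u' v + h' u u' v
  | mul x y hx' hy' hx hy =>
    obtain ⟨K, hK, h⟩ := hx
    obtain ⟨K', hK', h'⟩ := hy
    refine ⟨fun p => x (p.1, p.2.2) * K' p + K p * y (p.2.1, p.2.2), ?_, fun u u' v => ?_⟩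
    · have e1 := (differentiable_of_mem_separable hx').comp
        (by fun_prop : Differentiable ℂ fun p : ℂ × ℂ × ℂ => (p.1, p.2.2))
      have e2 := (differentiable_of_mem_separable hy').comp
        (by fun_prop : Differentiable ℂ fun p : ℂ × ℂ × ℂ => (p.2.1, p.2.2))
      exact (e1.mul hK').add (hK.mul e2)
    · simp only [Pi.mul_apply]
      linear_combination (y (u', v)) * h u u' v + (x (u, v)) * h' u u' v

/-- The creation exponent and the shift of the symbol are additive in the data. The exponential
becomes a product of a function of u and a function of v, and a generator of the Fock algebra
becomes a sum of such functions and a constant. -/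
theorem vertexOp_mem_separable {A B : ℂ → VertexData N} (hA : EntireFamily A) (hB : EntireFamily B)
    {Ψ : Symbols N ħ → ℂ} (hΨ : Ψ ∈ Fock N ħ) {ζ : Symbols N ħ} (hζ : IsTest ζ) :
    (fun p : ℂ × ℂ => vertexOp k (A p.1 + B p.2) Ψ ζ) ∈ separable := by
  have h1 : (fun p : ℂ × ℂ => exp (∫ t : HalfLine, ∑ i, (A p.1 + B p.2).2 t i * ζ.1 t i ∂dt))
      ∈ separable := by
    have e : (fun p : ℂ × ℂ => exp (∫ t : HalfLine, ∑ i, (A p.1 + B p.2).2 t i * ζ.1 t i ∂dt))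
        = (fun p : ℂ × ℂ => exp (∫ t : HalfLine, ∑ i, (A p.1).2 t i * ζ.1 t i ∂dt))
          * fun p : ℂ × ℂ => exp (∫ t : HalfLine, ∑ i, (B p.2).2 t i * ζ.1 t i ∂dt) := by
      funext p
      rw [Pi.mul_apply, ← exp_add, ← integral_add (pairs_of_isTest _ hζ) (pairs_of_isTest _ hζ)]
      simp [add_mul, Finset.sum_add_distrib]
    rw [e]
    exact separable.mul_mem (fst_mem_separable (differentiable_pair hA hζ).cexp)
      (snd_mem_separable (differentiable_pair hB hζ).cexp)
  refine separable.mul_mem h1 ?_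
  clear h1
  induction hΨ using Algebra.adjoin_induction with
  | mem Φ h =>
    obtain ⟨i, g, hg, rfl⟩ := h
    have e : (fun p : ℂ × ℂ => creationVector i g (ζ + commWith N ħ k (A p.1 + B p.2).1))
        = ((fun p : ℂ × ℂ => ∑ j, ∫ t : HalfLine,
            (g * commMap N ħ k j i) t * (A p.1).1 t j ∂dt)
          + fun p : ℂ × ℂ => ∑ j, ∫ t : HalfLine,
            (g * commMap N ħ k j i) t * (B p.2).1 t j ∂dt)
          + algebraMap ℂ (ℂ × ℂ → ℂ) (creationVector i g ζ) := by
      funext p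
      simp only [creationVector_add_commWith hg, Pi.add_apply, Pi.algebraMap_apply,
        Algebra.algebraMap_self, RingHom.id_apply, ← Finset.sum_add_distrib]
      rw [add_comm]
      congr 1
      refine Finset.sum_congr rfl fun j _ => ?_
      rw [← integral_add
        (integrable_smear (φ := g * commMap N ħ k j i) hg.mul_right _ j)
        (integrable_smear (φ := g * commMap N ħ k j i) hg.mul_right _ j)]
      simp [mul_add]
    rw [e]
    exact separable.add_mem (separable.add_mem (fst_mem_separable (differentiable_shift hA hg))
      (snd_mem_separable (differentiable_shift hB hg))) (separable.algebraMap_mem _)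
  | algebraMap r => exact separable.algebraMap_mem r
  | add x y _ _ hx hy => exact separable.add_mem hx hy
  | mul x y _ _ hx hy => exact separable.mul_mem hx hy

/-! ### The completed Fock space -/

theorem generalizedVectors_mul {m n : ℕ} {Φ Φ' : Symbols N ħ → ℂ}
    (h : Φ ∈ generalizedVectors N ħ m) (h' : Φ' ∈ generalizedVectors N ħ n) :
    Φ * Φ' ∈ generalizedVectors N ħ (m + n) := by
  induction h using Submodule.span_induction with
  | mem Φ hΦ =>
    obtain ⟨x, rfl⟩ := hΦ
    induction h' using Submodule.span_induction with
    | mem Φ' hΦ' =>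
      obtain ⟨y, rfl⟩ := hΦ'
      refine Submodule.subset_span ⟨Fin.append x y, ?_⟩
      simp [Fin.prod_univ_add]
    | zero => simp
    | add a b _ _ ha hb => rw [mul_add]; exact Submodule.add_mem _ ha hb
    | smul c a _ ha => rw [mul_smul_comm]; exact Submodule.smul_mem _ c ha
  | zero => simp
  | add a b _ _ ha hb => rw [add_mul]; exact Submodule.add_mem _ ha hb
  | smul c a _ ha => rw [smul_mul_assoc]; exact Submodule.smul_mem _ c ha

theorem one_mem_generalizedVectors : (1 : Symbols N ħ → ℂ) ∈ generalizedVectors N ħ 0 :=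
  Submodule.subset_span ⟨Fin.elim0, by simp⟩

theorem creationVector_mem_generalizedVectors (i : Mode N) (g : C(HalfLine, ℂ)) :
    creationVector i g ∈ generalizedVectors N ħ 1 :=
  Submodule.subset_span ⟨fun _ => (i, g), by simp⟩

theorem pow_mem_generalizedVectors {Φ : Symbols N ħ → ℂ} (h : Φ ∈ generalizedVectors N ħ 1)
    (n : ℕ) : Φ ^ n ∈ generalizedVectors N ħ n := by
  induction n with
  | zero => simpa using one_mem_generalizedVectors
  | succ n ih => rw [pow_succ]; exact generalizedVectors_mul ih h

theorem completedFock_congr {Φ Φ' : Symbols N ħ → ℂ} (h : Φ ∈ CompletedFock N ħ)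
    (e : ∀ ζ, IsTest ζ → Φ' ζ = Φ ζ) : Φ' ∈ CompletedFock N ħ := by
  obtain ⟨Φn, h1, h2⟩ := h
  exact ⟨Φn, h1, fun ζ hζ => by rw [e ζ hζ]; exact h2 ζ hζ⟩

theorem completedFock_of_mem {n : ℕ} {Φ : Symbols N ħ → ℂ} (h : Φ ∈ generalizedVectors N ħ n) :
    Φ ∈ CompletedFock N ħ := by
  classical
  refine ⟨fun m => if m = n then Φ else 0, fun m => ?_, fun ζ _ => ?_⟩
  · dsimp only
    split_ifs with hm
    · rw [hm]; exact h
    · exact Submodule.zero_mem _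
  · have := hasSum_ite_eq n (Φ ζ)
    convert this using 2 with m
    dsimp only
    split_ifs <;> rfl

theorem completedFock_add {Φ Φ' : Symbols N ħ → ℂ} (h : Φ ∈ CompletedFock N ħ)
    (h' : Φ' ∈ CompletedFock N ħ) : Φ + Φ' ∈ CompletedFock N ħ := by
  obtain ⟨a, h1, h2⟩ := h
  obtain ⟨b, h3, h4⟩ := h'
  exact ⟨fun n => a n + b n, fun n => Submodule.add_mem _ (h1 n) (h3 n),
    fun ζ hζ => (h2 ζ hζ).add (h4 ζ hζ)⟩

/-- Cauchy product: convergence of series in ℂ is absolute, and the antidiagonal sums are the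
homogeneous components of the product. -/
theorem completedFock_mul {Φ Φ' : Symbols N ħ → ℂ} (h : Φ ∈ CompletedFock N ħ)
    (h' : Φ' ∈ CompletedFock N ħ) : Φ * Φ' ∈ CompletedFock N ħ := by
  obtain ⟨a, h1, h2⟩ := h
  obtain ⟨b, h3, h4⟩ := h'
  refine ⟨fun n => ∑ p ∈ Finset.HasAntidiagonal.antidiagonal n, a p.1 * b p.2, fun n => ?_, fun ζ hζ => ?_⟩
  · refine Submodule.sum_mem _ fun p hp => ?_
    rw [← Finset.HasAntidiagonal.mem_antidiagonal.1 hp]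
    exact generalizedVectors_mul (h1 _) (h3 _)
  · have s1 := (h2 ζ hζ).summable.norm
    have s2 := (h4 ζ hζ).summable.norm
    have e := tsum_mul_tsum_eq_tsum_sum_antidiagonal_of_summable_norm s1 s2
    rw [(h2 ζ hζ).tsum_eq, (h4 ζ hζ).tsum_eq] at e
    rw [Pi.mul_apply, e]
    simp only [Finset.sum_apply, Pi.mul_apply]
    exact (summable_norm_sum_mul_antidiagonal_of_summable_norm s1 s2).of_norm.hasSum

theorem completedFock_const (c : ℂ) : (fun _ : Symbols N ħ => c) ∈ CompletedFock N ħ := by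
  refine completedFock_of_mem (n := 0) ?_
  have e : (fun _ : Symbols N ħ => c) = c • 1 := by funext ζ; simp
  rw [e]
  exact Submodule.smul_mem _ _ one_mem_generalizedVectors

theorem completedFock_exp {Φ : Symbols N ħ → ℂ} (h : Φ ∈ generalizedVectors N ħ 1) :
    (fun ζ => exp (Φ ζ)) ∈ CompletedFock N ħ := by
  refine ⟨fun n => ((n.factorial : ℂ)⁻¹) • Φ ^ n,
    fun n => Submodule.smul_mem _ _ (pow_mem_generalizedVectors h n), fun ζ _ => ?_⟩
  have := NormedSpace.exp_series_hasSum_exp' (𝕂 := ℂ) (Φ ζ)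
  rw [← Complex.exp_eq_exp_ℂ] at this
  simpa using this

/-- The creation factor is the exponential series of a vector of degree one. The translated vector
is a polynomial in creation vectors shifted by constants, so closure under sums and products
suffices. -/
theorem vertexOp_mem_completedFock (D : VertexData N) {Ψ : Symbols N ħ → ℂ} (hΨ : Ψ ∈ Fock N ħ) :
    vertexOp k D Ψ ∈ CompletedFock N ħ := by
  have h1 : (fun ζ : Symbols N ħ => exp (∫ t : HalfLine, ∑ i, D.2 t i * ζ.1 t i ∂dt))
      ∈ CompletedFock N ħ := by
    refine completedFock_congr (completedFock_exp (Φ := ∑ i, creationVector i (component D.2 i))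
      (Submodule.sum_mem _ fun i _ => creationVector_mem_generalizedVectors i _)) fun ζ hζ => ?_
    rw [integral_pair_eq D hζ, Finset.sum_apply]
    congr 1
    refine Finset.sum_congr rfl fun i _ => ?_
    simp only [creationVector, component, ContinuousMap.coe_mk, mul_comm]
  have h2 : (fun ζ : Symbols N ħ => Ψ (ζ + commWith N ħ k D.1)) ∈ CompletedFock N ħ := by
    induction hΨ using Algebra.adjoin_induction with
    | mem Φ h =>
      obtain ⟨i, g, hg, rfl⟩ := h
      simp only [creationVector_add_commWith hg]
      exact completedFock_add
        (completedFock_of_mem (creationVector_mem_generalizedVectors i g)) (completedFock_const _)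
    | algebraMap r => exact completedFock_const r
    | add x y _ _ hx hy => exact completedFock_add hx hy
    | mul x y _ _ hx hy => exact completedFock_mul hx hy
  exact completedFock_mul h1 h2

end FreeBoson

namespace FreeBoson

variable {N : ℕ} {ħ : ℝ} {k : ℂ}

/-! ### Contractions of families of normal ordered exponentials -/

/-- The contraction of `A(u)` and `B(v)` is given by the list `L`. -/
def HasContr (ħ : ℝ) (k : ℂ) (A B : ℂ → VertexData N) (L : List (ℂ × ℂ)) : Prop :=
  ∀ u v, ∀ t : HalfLine, contr N ħ k (A u) (B v) t
    = exp (-I * (u - v) * (t : ℝ)) / (t : ℝ) * expSum L (ħ * (t : ℝ))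

theorem expSum_append (L L' : List (ℂ × ℂ)) (x : ℂ) :
    expSum (L ++ L') x = expSum L x + expSum L' x := by
  simp [expSum]

/-- All exponents are shifted by `s`. -/
def shiftList (s : ℂ) (L : List (ℂ × ℂ)) : List (ℂ × ℂ) := L.map fun p => (p.1 + s, p.2 + s)

theorem expSum_shiftList (s : ℂ) (L : List (ℂ × ℂ)) (x : ℂ) :
    expSum (shiftList s L) x = exp (s * x) * expSum L x := by
  induction L with
  | nil => simp [expSum, shiftList]
  | cons p L ih =>
    simp only [expSum, shiftList, List.map_cons, List.sum_cons] at ih ⊢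
    rw [ih, add_mul, add_mul, exp_add, exp_add]
    ring

theorem HasContr.congr {A B : ℂ → VertexData N} {L L' : List (ℂ × ℂ)} (h : HasContr ħ k A B L)
    (e : ∀ x, expSum L' x = expSum L x) : HasContr ħ k A B L' := by
  intro u v t
  rw [h u v t, e]

theorem HasContr.add_left {A A' B : ℂ → VertexData N} {L L' : List (ℂ × ℂ)}
    (h : HasContr ħ k A B L) (h' : HasContr ħ k A' B L') :
    HasContr ħ k (fun u => A u + A' u) B (L ++ L') := by
  intro u v t
  rw [contr_add_left, h u v t, h' u v t, expSum_append, mul_add]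

theorem HasContr.add_right {A B B' : ℂ → VertexData N} {L L' : List (ℂ × ℂ)}
    (h : HasContr ħ k A B L) (h' : HasContr ħ k A B' L') :
    HasContr ħ k A (fun v => B v + B' v) (L ++ L') := by
  intro u v t
  rw [contr_add_right, h u v t, h' u v t, expSum_append, mul_add]

theorem HasContr.shift_left {A B : ℂ → VertexData N} {L : List (ℂ × ℂ)} (h : HasContr ħ k A B L)
    (s : ℂ) : HasContr ħ k (fun u => A (sh ħ u s)) B (shiftList s L) := by
  intro u v t
  have e : exp (-I * (sh ħ u s - v) * (t : ℝ))
      = exp (-I * (u - v) * (t : ℝ)) * exp (s * (ħ * (t : ℝ))) := by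
    rw [← exp_add, sh]
    congr 1
    linear_combination (-(s * ħ * (t : ℝ))) * I_mul_I
  rw [h, expSum_shiftList, e]
  ring

theorem HasContr.of_fst_eq_zero {A B : ℂ → VertexData N} (h : ∀ u, (A u).1 = 0) :
    HasContr ħ k A B [] := by
  intro u v t
  rw [contr_of_fst_eq_zero (h u)]
  simp [expSum]

theorem HasContr.of_snd_eq_zero {A B : ℂ → VertexData N} (h : ∀ v, (B v).2 = 0) :
    HasContr ħ k A B [] := by
  intro u v t
  rw [contr_of_snd_eq_zero _ (h v)]
  simp [expSum]

theorem HasContr.product {A B : ℂ → VertexData N} {L : List (ℂ × ℂ)} (h : HasContr ħ k A B L)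
    {R : ℝ} (hL : Bounded ħ R L) {u v : ℂ} (hw : (u - v).im < -R) :
    Integrable (contr N ħ k (A u) (B v)) dt ∧
      exp (∫ t, contr N ħ k (A u) (B v) t ∂dt) = ratio ħ L (u - v) := by
  have e : contr N ħ k (A u) (B v) = fun t : HalfLine =>
      exp (-I * (u - v) * (t : ℝ)) / (t : ℝ) * expSum L (ħ * (t : ℝ)) := funext (h u v)
  rw [e]
  exact laplace_expSum hL hw

theorem Bounded.mono {R R' : ℝ} {L : List (ℂ × ℂ)} (h : Bounded ħ R L) (hR : R ≤ R') :
    Bounded ħ R' L :=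
  fun p hp => ⟨(h p hp).1.trans hR, (h p hp).2.trans hR⟩

theorem exists_bounded (ħ : ℝ) (L : List (ℂ × ℂ)) : ∃ R, 0 ≤ R ∧ Bounded ħ R L := by
  induction L with
  | nil => exact ⟨0, le_rfl, fun p hp => by simp at hp⟩
  | cons p L ih =>
    obtain ⟨R, h0, h⟩ := ih
    refine ⟨max R (max |(p.1 * ħ).re| |(p.2 * ħ).re|), le_max_of_le_left h0, fun q hq => ?_⟩
    rcases List.mem_cons.1 hq with rfl | hq
    · exact ⟨le_max_of_le_right (le_max_left _ _), le_max_of_le_right (le_max_right _ _)⟩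
    · exact ⟨le_max_of_le_left (h q hq).1, le_max_of_le_left (h q hq).2⟩

theorem exists_bounded_family {ι κ : Type*} (ħ : ℝ) (I : Finset ι) (J : Finset κ)
    (L : ι → κ → List (ℂ × ℂ)) : ∃ R, 0 ≤ R ∧ ∀ a ∈ I, ∀ b ∈ J, Bounded ħ R (L a b) := by
  choose R h0 h using fun a b => exists_bounded ħ (L a b)
  refine ⟨∑ a ∈ I, ∑ b ∈ J, R a b, Finset.sum_nonneg fun a _ => Finset.sum_nonneg fun b _ => h0 a b,
    fun a ha b hb => (h a b).mono ?_⟩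
  exact (Finset.single_le_sum (f := fun b => R a b) (fun b _ => h0 a b) hb).trans
    (Finset.single_le_sum (f := fun a => ∑ b ∈ J, R a b)
      (fun a _ => Finset.sum_nonneg fun b _ => h0 a b) ha)

/-! ### Rational functions -/

open Polynomial in
/-- The denominator of `ratio ħ L`. -/
noncomputable def denPoly (ħ : ℝ) (L : List (ℂ × ℂ)) : Polynomial ℂ :=
  (L.map fun p => X + C (I * p.1 * ħ)).prod

open Polynomial in
/-- The numerator of `ratio ħ L`. -/
noncomputable def numPoly (ħ : ℝ) (L : List (ℂ × ℂ)) : Polynomial ℂ :=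
  (L.map fun p => X + C (I * p.2 * ħ)).prod

theorem denPoly_ne_zero (ħ : ℝ) (L : List (ℂ × ℂ)) : denPoly ħ L ≠ 0 := by
  refine List.prod_ne_zero fun h => ?_
  obtain ⟨p, _, hp⟩ := List.mem_map.1 h
  exact Polynomial.X_add_C_ne_zero _ hp

theorem ratio_eq_div (ħ : ℝ) (L : List (ℂ × ℂ)) (w : ℂ) :
    ratio ħ L w = (numPoly ħ L).eval w / (denPoly ħ L).eval w := by
  induction L with
  | nil => simp [ratio, numPoly, denPoly]
  | cons p L ih =>
    simp only [ratio, numPoly, denPoly, List.map_cons, List.prod_cons, Polynomial.eval_mul,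
      Polynomial.eval_add, Polynomial.eval_X, Polynomial.eval_C] at ih ⊢
    rw [ih, div_mul_div_comm]

theorem denPoly_eval_ne_zero {R : ℝ} {L : List (ℂ × ℂ)} (hL : Bounded ħ R L) {w : ℂ}
    (hw : R < |w.im|) : (denPoly ħ L).eval w ≠ 0 := by
  induction L with
  | nil => simp [denPoly]
  | cons p L ih =>
    simp only [denPoly, List.map_cons, List.prod_cons, Polynomial.eval_mul,
      Polynomial.eval_add, Polynomial.eval_X, Polynomial.eval_C] at ih ⊢
    exact mul_ne_zero (ratio_den_ne_zero (hL p List.mem_cons_self).1 hw)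
      (ih fun q hq => hL q (List.mem_cons_of_mem _ hq))

/-- `f(w) ratio L (w) = g(w) ratio L' (-w)`. -/
def RatExchange (ħ : ℝ) (f g : ℂ → ℂ) (L L' : List (ℂ × ℂ)) : Prop :=
  ∀ w, (denPoly ħ L).eval w ≠ 0 → (denPoly ħ L').eval (-w) ≠ 0 →
    f w * ratio ħ L w = g w * ratio ħ L' (-w)

/-! ### Products of currents -/

/-- The current `X` is the linear combination of the exponentials `A a` with coefficients `x a`. -/
structure IsExpansion {ι : Type*} (X : Current N) (I : Finset ι) (x : ι → ℂ)
    (A : ι → ℂ → VertexData N) : Prop where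
  eq : ∀ u, X u = ∑ a ∈ I, x a • vx (A a u)
  entire : ∀ a ∈ I, EntireFamily (A a)

variable {ι κ : Type*} {X Y : Current N} {I : Finset ι} {J : Finset κ} {x : ι → ℂ} {y : κ → ℂ}
  {A : ι → ℂ → VertexData N} {B : κ → ℂ → VertexData N}

theorem IsExpansion.op (hX : IsExpansion X I x A) (u : ℂ) (Ψ : Symbols N ħ → ℂ) :
    op k (X u) Ψ = fun ζ => ∑ a ∈ I, x a * vertexOp k (A a u) Ψ ζ := by
  funext ζ
  rw [hX.eq, op_sum]

theorem IsExpansion.wellDefined (hX : IsExpansion X I x A) : WellDefinedOnFock ħ k X := by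
  intro Ψ hΨ
  simp only [hX.op]
  refine ⟨fun u => ?_, fun ζ hζ => Differentiable.fun_sum fun a ha =>
    (differentiable_vertexOp (hX.entire a ha) hΨ hζ).const_mul _⟩
  have e : (fun ζ : Symbols N ħ => ∑ a ∈ I, x a * vertexOp k (A a u) Ψ ζ)
      = ∑ a ∈ I, (fun _ => x a) * vertexOp k (A a u) Ψ := by
    funext ζ; simp
  rw [e]
  exact Finset.sum_induction _ (· ∈ CompletedFock N ħ) (fun _ _ => completedFock_add)
    (completedFock_const 0) fun a _ =>
      completedFock_mul (completedFock_const _) (vertexOp_mem_completedFock _ hΨ)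

theorem IsExpansion.convergesBelow (hX : IsExpansion X I x A) (hY : IsExpansion Y J y B)
    {L : ι → κ → List (ℂ × ℂ)} (h : ∀ a ∈ I, ∀ b ∈ J, HasContr ħ k (A a) (B b) (L a b)) {R : ℝ}
    (hR : ∀ a ∈ I, ∀ b ∈ J, Bounded ħ R (L a b)) : ConvergesBelow ħ k R X Y := by
  intro u v huv D hD D' hD'
  rw [hX.eq] at hD
  rw [hY.eq] at hD'
  obtain ⟨a, ha, rfl⟩ := mem_support_of_sum hD
  obtain ⟨b, hb, rfl⟩ := mem_support_of_sum hD'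
  exact ((h a ha b hb).product (hR a ha b hb) huv).1

theorem IsExpansion.product (hX : IsExpansion X I x A) (hY : IsExpansion Y J y B)
    {L : ι → κ → List (ℂ × ℂ)} (h : ∀ a ∈ I, ∀ b ∈ J, HasContr ħ k (A a) (B b) (L a b)) {R : ℝ}
    (hR : ∀ a ∈ I, ∀ b ∈ J, Bounded ħ R (L a b)) {u v : ℂ} (huv : (u - v).im < -R)
    (Ψ : Symbols N ħ → ℂ) {ζ : Symbols N ħ} (hζ : IsTest ζ) :
    FreeBoson.op k (X u) (FreeBoson.op k (Y v) Ψ) ζ = ∑ a ∈ I, ∑ b ∈ J, x a * y b *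
      (ratio ħ (L a b) (u - v) * vertexOp k (A a u + B b v) Ψ ζ) := by
  rw [hX.op, hY.op]
  dsimp only
  refine Finset.sum_congr rfl fun a ha => ?_
  rw [vertexOp_sum, Finset.mul_sum]
  refine Finset.sum_congr rfl fun b hb => ?_
  obtain ⟨h1, h2⟩ := (h a ha b hb).product (hR a ha b hb) huv
  rw [vertexOp_vertexOp (pairs_of_isTest _ hζ) (pairs_of_isTest _ hζ) h1, h2]
  ring

/-- Both orders have the same normal ordered exponentials, so only the rational factors are
compared. `q a b` is the common entire function obtained from both after multiplication by `p`. -/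
theorem exchangeRelation_of (hX : IsExpansion X I x A) (hY : IsExpansion Y J y B)
    {L : ι → κ → List (ℂ × ℂ)} {L' : κ → ι → List (ℂ × ℂ)}
    (h : ∀ a ∈ I, ∀ b ∈ J, HasContr ħ k (A a) (B b) (L a b))
    (h' : ∀ b ∈ J, ∀ a ∈ I, HasContr ħ k (B b) (A a) (L' b a)) {f g : ℂ → ℂ}
    (p : Polynomial ℂ) (hp : p ≠ 0) (R₀ : ℝ) (q : ι → κ → ℂ → ℂ) (hq : ∀ a b, Differentiable ℂ (q a b))
    (h1 : ∀ a ∈ I, ∀ b ∈ J, ∀ w : ℂ, R₀ < |w.im| → p.eval w * (f w * ratio ħ (L a b) w) = q a b w)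
    (h2 : ∀ a ∈ I, ∀ b ∈ J, ∀ w : ℂ, R₀ < |w.im| →
      p.eval w * (g w * ratio ħ (L' b a) (-w)) = q a b w) :
    ExchangeRelation ħ k f X Y g := by
  obtain ⟨R₁, -, hR₁⟩ := exists_bounded_family ħ I J L
  obtain ⟨R₂, -, hR₂⟩ := exists_bounded_family ħ J I L'
  set R := max R₀ (max R₁ R₂) with hR
  have hr1 : ∀ a ∈ I, ∀ b ∈ J, Bounded ħ R (L a b) := fun a ha b hb =>
    (hR₁ a ha b hb).mono ((le_max_left _ _).trans (le_max_right _ _))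
  have hr2 : ∀ b ∈ J, ∀ a ∈ I, Bounded ħ R (L' b a) := fun b hb a ha =>
    (hR₂ b hb a ha).mono ((le_max_right _ _).trans (le_max_right _ _))
  refine ⟨p, R, hp, hX.convergesBelow hY h hr1, hY.convergesBelow hX h' hr2, fun Ψ hΨ ζ hζ =>
    ⟨fun z => ∑ a ∈ I, ∑ b ∈ J, x a * y b *
      (q a b (z.1 - z.2) * vertexOp k (A a z.1 + B b z.2) Ψ ζ), ?_, fun u v huv => ?_,
      fun u v huv => ?_⟩⟩
  · refine Differentiable.fun_sum fun a ha => Differentiable.fun_sum fun b hb => ?_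
    exact (((hq a b).comp (by fun_prop)).mul (differentiable_of_mem_separable
      (vertexOp_mem_separable (hX.entire a ha) (hY.entire b hb) hΨ hζ))).const_mul _
  · have hw : R₀ < |(u - v).im| :=
      lt_of_le_of_lt (le_max_left _ _) (by rw [lt_abs]; right; linarith)
    rw [hX.product hY h hr1 huv Ψ hζ, Finset.mul_sum, Finset.mul_sum]
    refine Finset.sum_congr rfl fun a ha => ?_
    rw [Finset.mul_sum, Finset.mul_sum]
    refine Finset.sum_congr rfl fun b hb => ?_
    rw [← h1 a ha b hb _ hw]
    ring
  · have hw : R₀ < |(u - v).im| :=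
      lt_of_le_of_lt (le_max_left _ _) (by
        rw [lt_abs]; left; rw [sub_im] at huv ⊢; linarith)
    rw [hY.product hX h' hr2 huv Ψ hζ, Finset.sum_comm, Finset.mul_sum, Finset.mul_sum]
    refine Finset.sum_congr rfl fun a ha => ?_
    rw [Finset.mul_sum, Finset.mul_sum]
    refine Finset.sum_congr rfl fun b hb => ?_
    rw [← h2 a ha b hb _ hw, add_comm (B b v), neg_sub]
    ring

/-- By `hex` the second order has the same terms as the first one in the opposite half plane. It
therefore suffices to continue a single sum, known for large |Im (u - v)|, to an entire function. -/
theorem opeRelation_of (hX : IsExpansion X I x A) (hY : IsExpansion Y J y B)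
    {L : ι → κ → List (ℂ × ℂ)} {L' : κ → ι → List (ℂ × ℂ)}
    (h : ∀ a ∈ I, ∀ b ∈ J, HasContr ħ k (A a) (B b) (L a b))
    (h' : ∀ b ∈ J, ∀ a ∈ I, HasContr ħ k (B b) (A a) (L' b a)) {f g : ℂ → ℂ}
    (hex : ∀ a ∈ I, ∀ b ∈ J, RatExchange ħ f g (L a b) (L' b a)) (R₀ : ℝ)
    (S : ℂ → ℂ → (Symbols N ħ → ℂ) → (Symbols N ħ → ℂ))
    (hS : ∀ Ψ ∈ Fock N ħ, ∀ ζ, IsTest ζ → ∃ G : ℂ × ℂ → ℂ, Differentiable ℂ G ∧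
      ∀ u v : ℂ, R₀ < |(u - v).im| → (∑ a ∈ I, ∑ b ∈ J, x a * y b *
        (f (u - v) * ratio ħ (L a b) (u - v) * vertexOp k (A a u + B b v) Ψ ζ)) - S u v Ψ ζ
          = G (u, v)) :
    OPERelation ħ k f X Y g S := by
  obtain ⟨R₁, -, hR₁⟩ := exists_bounded_family ħ I J L
  obtain ⟨R₂, -, hR₂⟩ := exists_bounded_family ħ J I L'
  set R := max R₀ (max R₁ R₂) with hR
  have hr1 : ∀ a ∈ I, ∀ b ∈ J, Bounded ħ R (L a b) := fun a ha b hb =>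
    (hR₁ a ha b hb).mono ((le_max_left _ _).trans (le_max_right _ _))
  have hr2 : ∀ b ∈ J, ∀ a ∈ I, Bounded ħ R (L' b a) := fun b hb a ha =>
    (hR₂ b hb a ha).mono ((le_max_right _ _).trans (le_max_right _ _))
  refine ⟨R, hX.convergesBelow hY h hr1, hY.convergesBelow hX h' hr2, fun Ψ hΨ ζ hζ => ?_⟩
  obtain ⟨G, hG, hGS⟩ := hS Ψ hΨ ζ hζ
  refine ⟨G, hG, fun u v huv => ?_, fun u v huv => ?_⟩
  · have hw : R₀ < |(u - v).im| :=
      lt_of_le_of_lt (le_max_left _ _) (by rw [lt_abs]; right; linarith)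
    rw [← hGS u v hw, hX.product hY h hr1 huv Ψ hζ, Finset.mul_sum]
    congr 1
    refine Finset.sum_congr rfl fun a ha => ?_
    rw [Finset.mul_sum]
    exact Finset.sum_congr rfl fun b hb => by ring
  · have hw' : R < |(u - v).im| := by
      rw [lt_abs]; left; rw [sub_im] at huv ⊢; linarith
    have hw'' : R < |(-(u - v)).im| := by rwa [neg_im, abs_neg]
    rw [← hGS u v (lt_of_le_of_lt (le_max_left _ _) hw'), hY.product hX h' hr2 huv Ψ hζ,
      Finset.sum_comm, Finset.mul_sum]
    congr 1
    refine Finset.sum_congr rfl fun a ha => ?_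
    rw [Finset.mul_sum]
    refine Finset.sum_congr rfl fun b hb => ?_
    rw [hex a ha b hb _ (denPoly_eval_ne_zero (hr1 a ha b hb) hw')
      (denPoly_eval_ne_zero (hr2 b hb a ha) hw''), add_comm (B b v), neg_sub]
    ring

/-! ### The Serre relations -/

theorem IsExpansion.product₃ {ι₁ ι₂ ι₃ : Type*} {X₁ X₂ X₃ : Current N} {I₁ : Finset ι₁}
    {I₂ : Finset ι₂} {I₃ : Finset ι₃} {x₁ : ι₁ → ℂ} {x₂ : ι₂ → ℂ} {x₃ : ι₃ → ℂ}
    {A₁ : ι₁ → ℂ → VertexData N} {A₂ : ι₂ → ℂ → VertexData N} {A₃ : ι₃ → ℂ → VertexData N}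
    (h₁ : IsExpansion X₁ I₁ x₁ A₁) (h₂ : IsExpansion X₂ I₂ x₂ A₂) (h₃ : IsExpansion X₃ I₃ x₃ A₃)
    {L₁₂ : ι₁ → ι₂ → List (ℂ × ℂ)} {L₁₃ : ι₁ → ι₃ → List (ℂ × ℂ)} {L₂₃ : ι₂ → ι₃ → List (ℂ × ℂ)}
    (h₁₂ : ∀ a ∈ I₁, ∀ b ∈ I₂, HasContr ħ k (A₁ a) (A₂ b) (L₁₂ a b))
    (h₁₃ : ∀ a ∈ I₁, ∀ b ∈ I₃, HasContr ħ k (A₁ a) (A₃ b) (L₁₃ a b))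
    (h₂₃ : ∀ a ∈ I₂, ∀ b ∈ I₃, HasContr ħ k (A₂ a) (A₃ b) (L₂₃ a b)) {R : ℝ} (hR : 0 ≤ R)
    (hR₁₂ : ∀ a ∈ I₁, ∀ b ∈ I₂, Bounded ħ R (L₁₂ a b))
    (hR₁₃ : ∀ a ∈ I₁, ∀ b ∈ I₃, Bounded ħ R (L₁₃ a b))
    (hR₂₃ : ∀ a ∈ I₂, ∀ b ∈ I₃, Bounded ħ R (L₂₃ a b)) {u₁ u₂ u₃ : ℂ}
    (hu₁₂ : (u₁ - u₂).im < -R) (hu₂₃ : (u₂ - u₃).im < -R) (Ψ : Symbols N ħ → ℂ) {ζ : Symbols N ħ}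
    (hζ : IsTest ζ) :
    FreeBoson.op k (X₁ u₁) (FreeBoson.op k (X₂ u₂) (FreeBoson.op k (X₃ u₃) Ψ)) ζ
      = ∑ a ∈ I₁, ∑ b ∈ I₂, ∑ c ∈ I₃, x₁ a * x₂ b * x₃ c *
        (ratio ħ (L₁₂ a b) (u₁ - u₂) * ratio ħ (L₁₃ a c) (u₁ - u₃) * ratio ħ (L₂₃ b c) (u₂ - u₃)
          * vertexOp k (A₁ a u₁ + A₂ b u₂ + A₃ c u₃) Ψ ζ) := by
  have hu₁₃ : (u₁ - u₃).im < -R := by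
    have : (u₁ - u₃).im = (u₁ - u₂).im + (u₂ - u₃).im := by simp only [sub_im]; ring
    rw [this]; linarith
  rw [h₁.op, h₂.op, h₃.op]
  dsimp only
  refine Finset.sum_congr rfl fun a ha => ?_
  rw [vertexOp_sum, Finset.mul_sum]
  refine Finset.sum_congr rfl fun b hb => ?_
  have e : vertexOp k (A₂ b u₂) (fun ζ => ∑ c ∈ I₃, x₃ c * vertexOp k (A₃ c u₃) Ψ ζ)
      = fun ζ => ∑ c ∈ I₃, x₃ c * vertexOp k (A₂ b u₂) (vertexOp k (A₃ c u₃) Ψ) ζ :=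
    funext fun ζ => vertexOp_sum _ _ _ _ _
  rw [e, vertexOp_sum, Finset.mul_sum, Finset.mul_sum]
  refine Finset.sum_congr rfl fun c hc => ?_
  obtain ⟨i₁, e₁⟩ := (h₁₂ a ha b hb).product (hR₁₂ a ha b hb) hu₁₂
  obtain ⟨i₂, e₂⟩ := (h₁₃ a ha c hc).product (hR₁₃ a ha c hc) hu₁₃
  obtain ⟨i₃, e₃⟩ := (h₂₃ b hb c hc).product (hR₂₃ b hb c hc) hu₂₃
  rw [vertexOp_vertexOp_vertexOp hζ i₁ i₂ i₃, e₁, e₂, e₃]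
  ring

/-- A nonconstant affine substitution meets the finitely many roots for finitely many `s` only, so
near 0 at most s = 0 is bad. This permits generic perturbations of points at which an identity is
not known. -/
theorem eventually_eval_ne_zero {p : Polynomial ℂ} (hp : p ≠ 0) (z c : ℂ) (hc : c ≠ 0) :
    ∀ᶠ s in nhdsWithin (0 : ℂ) {0}ᶜ, p.eval (z + c * s) ≠ 0 := by
  have hfin : {s : ℂ | p.eval (z + c * s) = 0}.Finite := by
    have h1 : {s : ℂ | p.eval (z + c * s) = 0} = (fun s => z + c * s) ⁻¹' {s | p.IsRoot s} := rfl
    rw [h1]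
    refine Set.Finite.preimage (fun a _ b _ h => ?_) (Polynomial.finite_setOfPred_isRoot hp)
    exact mul_left_cancel₀ hc (add_left_cancel h)
  have h2 : ({s : ℂ | p.eval (z + c * s) = 0} \ {0})ᶜ ∈ nhds (0 : ℂ) :=
    (hfin.subset Set.sdiff_subset).isClosed.isOpen_compl.mem_nhds (by simp)
  filter_upwards [mem_nhdsWithin_of_mem_nhds h2, self_mem_nhdsWithin] with s h3 h4 h5
  exact h3 ⟨h5, h4⟩

/-- The algebraic identity behind the Serre relation. -/
theorem serre_identity {p : Polynomial ℂ} (hp : p ≠ 0) {a₀ : ℂ} {P P' Q₁ Q₂ M₁ M₂ : ℂ → ℂ}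
    (cP : Continuous P) (cP' : Continuous P') (cQ₁ : Continuous Q₁) (cQ₂ : Continuous Q₂)
    (cM₁ : Continuous M₁) (cM₂ : Continuous M₂)
    (hP : ∀ w, p.eval w ≠ 0 → p.eval (-w) ≠ 0 → (w + 2 * a₀) * P w = (w - 2 * a₀) * P' (-w))
    (h₁ : ∀ w, p.eval w ≠ 0 → (w - a₀) * Q₁ w = (w + a₀) * M₁ w)
    (h₂ : ∀ w, p.eval w ≠ 0 → (w - a₀) * Q₂ w = (w + a₀) * M₂ w) (x y : ℂ) :
    P (x - y) * (Q₁ x * Q₂ y - 2 * (Q₁ x * M₂ y) + M₁ x * M₂ y)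
      + P' (y - x) * (Q₂ y * Q₁ x - 2 * (Q₂ y * M₁ x) + M₂ y * M₁ x) = 0 := by
  let T : ℂ × ℂ → ℂ := fun z =>
    P (z.1 - z.2) * (Q₁ z.1 * Q₂ z.2 - 2 * (Q₁ z.1 * M₂ z.2) + M₁ z.1 * M₂ z.2)
      + P' (z.2 - z.1) * (Q₂ z.2 * Q₁ z.1 - 2 * (Q₂ z.2 * M₁ z.1) + M₂ z.2 * M₁ z.1)
  have cT : Continuous T := by fun_prop
  -- The hypotheses may fail at roots of `p`. Along (x + s, y + 2s) the quantities x, y and x - y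
  -- move by s, 2s and -s, so every exceptional value is avoided for small s ≠ 0, and continuity
  -- gives s = 0.
  have c : Filter.Tendsto (fun s : ℂ => T (x + 1 * s, y + 2 * s)) (nhdsWithin (0 : ℂ) {0}ᶜ)
      (nhds (T (x, y))) := by
    have h : Continuous fun s : ℂ => T (x + 1 * s, y + 2 * s) := by fun_prop
    have := (h.tendsto 0).mono_left (nhdsWithin_le_nhds (s := {0}ᶜ))
    simpa using this
  refine tendsto_nhds_unique c (Filter.Tendsto.congr' ?_ tendsto_const_nhds)
  have hX : ∀ a : ℂ, Polynomial.X - Polynomial.C a ≠ 0 := Polynomial.X_sub_C_ne_zero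
  filter_upwards [eventually_eval_ne_zero hp x 1 one_ne_zero,
    eventually_eval_ne_zero hp y 2 two_ne_zero,
    eventually_eval_ne_zero hp (x - y) (-1) (by norm_num),
    eventually_eval_ne_zero hp (y - x) 1 (by norm_num),
    eventually_eval_ne_zero (hX a₀) x 1 one_ne_zero,
    eventually_eval_ne_zero (hX a₀) y 2 two_ne_zero,
    eventually_eval_ne_zero (hX (-(2 * a₀))) (x - y) (-1) (by norm_num)] with s g1 g2 g3 g4 g5 g6 g7
  simp only [Polynomial.eval_sub, Polynomial.eval_X, Polynomial.eval_C] at g5 g6 g7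
  have e1 := h₁ _ g1
  have e2 := h₂ _ g2
  have ed : x + 1 * s - (y + 2 * s) = x - y + -1 * s := by ring
  have ed' : y + 2 * s - (x + 1 * s) = -(x - y + -1 * s) := by ring
  have e3 := hP _ g3 (by convert g4 using 2; ring)
  simp only [T, ed, ed']
  set X₁ := x + 1 * s with hX₁
  set Y₁ := y + 2 * s with hY₁
  have hD : x - y + -1 * s = X₁ - Y₁ := by rw [hX₁, hY₁]; ring
  rw [hD] at e3 g7 ⊢
  -- With D = X₁ - Y₁ everything is written through `n1`, `n2`, `n3`: Q = (· + a₀)n, M = (· - a₀)n,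
  -- P = (D - 2a₀)n3, P' = (D + 2a₀)n3. The two brackets become 2a₀(2a₀ + D)n1n2 and 2a₀(2a₀ -
  -- D)n1n2, so the weighted sum vanishes.
  have q1 : Q₁ X₁ = (X₁ + a₀) * (M₁ X₁ / (X₁ - a₀)) := by field_simp; linear_combination e1
  have q2 : Q₂ Y₁ = (Y₁ + a₀) * (M₂ Y₁ / (Y₁ - a₀)) := by field_simp; linear_combination e2
  have m1 : M₁ X₁ = (X₁ - a₀) * (M₁ X₁ / (X₁ - a₀)) := by field_simp
  have m2 : M₂ Y₁ = (Y₁ - a₀) * (M₂ Y₁ / (Y₁ - a₀)) := by field_simp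
  have g8 : X₁ - Y₁ + 2 * a₀ ≠ 0 := by rwa [sub_neg_eq_add] at g7
  have q3 : P (X₁ - Y₁) = (X₁ - Y₁ - 2 * a₀) * (P' (-(X₁ - Y₁)) / (X₁ - Y₁ + 2 * a₀)) := by
    field_simp; linear_combination e3
  have m3 : P' (-(X₁ - Y₁)) = (X₁ - Y₁ + 2 * a₀) * (P' (-(X₁ - Y₁)) / (X₁ - Y₁ + 2 * a₀)) := by
    field_simp
  generalize M₁ X₁ / (X₁ - a₀) = n1 at *
  generalize M₂ Y₁ / (Y₁ - a₀) = n2 at *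
  generalize P' (-(X₁ - Y₁)) / (X₁ - Y₁ + 2 * a₀) = n3 at *
  rw [q1, q2, q3, m1, m2, m3]
  ring

theorem exists_clearing {p : Polynomial ℂ} {L : List (ℂ × ℂ)} (h : denPoly ħ L ∣ p) :
    ∃ n : Polynomial ℂ, ∀ w, (denPoly ħ L).eval w ≠ 0 → p.eval w * ratio ħ L w = n.eval w := by
  obtain ⟨r, rfl⟩ := h
  refine ⟨r * numPoly ħ L, fun w hw => ?_⟩
  rw [ratio_eq_div, Polynomial.eval_mul, Polynomial.eval_mul]
  field_simp

theorem exists_clearing_neg {p : Polynomial ℂ} {L : List (ℂ × ℂ)}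
    (h : (denPoly ħ L).comp (-Polynomial.X) ∣ p) :
    ∃ n : Polynomial ℂ, ∀ w, (denPoly ħ L).eval (-w) ≠ 0 →
      p.eval w * ratio ħ L (-w) = n.eval w := by
  obtain ⟨r, rfl⟩ := h
  refine ⟨r * (numPoly ħ L).comp (-Polynomial.X), fun w hw => ?_⟩
  rw [ratio_eq_div]
  simp only [Polynomial.eval_mul, Polynomial.eval_comp, Polynomial.eval_neg, Polynomial.eval_X]
  field_simp

theorem dvd_prod_family {ι κ : Type*} {I : Finset ι} {J : Finset κ} (d : ι → κ → Polynomial ℂ)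
    {a : ι} {b : κ} (ha : a ∈ I) (hb : b ∈ J) : d a b ∣ ∏ a ∈ I, ∏ b ∈ J, d a b :=
  (Finset.dvd_prod_of_mem (fun b => d a b) hb).trans
    (Finset.dvd_prod_of_mem (fun a => ∏ b ∈ J, d a b) ha)

theorem prod_family_ne_zero {ι κ : Type*} {I : Finset ι} {J : Finset κ} {d : ι → κ → Polynomial ℂ}
    (h : ∀ a b, d a b ≠ 0) : ∏ a ∈ I, ∏ b ∈ J, d a b ≠ 0 :=
  Finset.prod_ne_zero_iff.2 fun a _ => Finset.prod_ne_zero_iff.2 fun b _ => h a b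

theorem eval_ne_zero_of_dvd {p d : Polynomial ℂ} (h : d ∣ p) {w : ℂ} (hw : p.eval w ≠ 0) :
    d.eval w ≠ 0 := by
  obtain ⟨r, rfl⟩ := h
  rw [Polynomial.eval_mul] at hw
  exact left_ne_zero_of_mul hw

theorem sum_swap_add {ι κ : Type*} {I : Finset ι} {J : Finset κ} (F G : ι → ι → κ → ℂ)
    (h : ∀ a ∈ I, ∀ b ∈ I, ∀ c ∈ J, F a b c + G b a c = 0) :
    ∑ a ∈ I, ∑ b ∈ I, ∑ c ∈ J, F a b c + ∑ a ∈ I, ∑ b ∈ I, ∑ c ∈ J, G a b c = 0 := by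
  rw [Finset.sum_comm (s := I) (t := I) (f := fun a b => ∑ c ∈ J, G a b c),
    ← Finset.sum_add_distrib]
  refine Finset.sum_eq_zero fun a ha => ?_
  rw [← Finset.sum_add_distrib]
  refine Finset.sum_eq_zero fun b hb => ?_
  rw [← Finset.sum_add_distrib]
  exact Finset.sum_eq_zero fun c hc => h a ha b hb c hc

/-- Terms are matched by exchanging the roles of (a, u₁) and (b, u₂). All six products of a triple
then share one normal ordered exponential, and `serre_identity` disposes of the polynomial factors.
-/
theorem serreRelation_of (hX : IsExpansion X I x A) (hY : IsExpansion Y J y B)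
    {L : ι → ι → List (ℂ × ℂ)} {L₁ : ι → κ → List (ℂ × ℂ)} {L₂ : κ → ι → List (ℂ × ℂ)}
    (h : ∀ a ∈ I, ∀ b ∈ I, HasContr ħ k (A a) (A b) (L a b))
    (h₁ : ∀ a ∈ I, ∀ b ∈ J, HasContr ħ k (A a) (B b) (L₁ a b))
    (h₂ : ∀ b ∈ J, ∀ a ∈ I, HasContr ħ k (B b) (A a) (L₂ b a)) (a₀ : ℂ)
    (hex : ∀ a ∈ I, ∀ b ∈ I,
      RatExchange ħ (fun w => w + 2 * a₀) (fun w => w - 2 * a₀) (L a b) (L b a))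
    (hex₁ : ∀ a ∈ I, ∀ b ∈ J,
      RatExchange ħ (fun w => w - a₀) (fun w => w + a₀) (L₁ a b) (L₂ b a)) :
    SerreRelation ħ k X Y := by
  obtain ⟨R₀, h0, hR₀⟩ := exists_bounded_family ħ I I L
  obtain ⟨R₁, h1, hR₁⟩ := exists_bounded_family ħ I J L₁
  obtain ⟨R₂, h2, hR₂⟩ := exists_bounded_family ħ J I L₂
  set R := R₀ + R₁ + R₂ with hR
  have hR0 : 0 ≤ R := by positivity
  have r0 : ∀ a ∈ I, ∀ b ∈ I, Bounded ħ R (L a b) := fun a ha b hb =>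
    (hR₀ a ha b hb).mono (by linarith)
  have r1 : ∀ a ∈ I, ∀ b ∈ J, Bounded ħ R (L₁ a b) := fun a ha b hb =>
    (hR₁ a ha b hb).mono (by linarith)
  have r2 : ∀ b ∈ J, ∀ a ∈ I, Bounded ħ R (L₂ b a) := fun b hb a ha =>
    (hR₂ b hb a ha).mono (by linarith)
  set p₀ := ∏ a ∈ I, ∏ b ∈ I, denPoly ħ (L a b) with hp₀
  set p₁ := ∏ a ∈ I, ∏ b ∈ J, denPoly ħ (L₁ a b) with hp₁
  -- The contraction of `Y` and `X` is a function of v - u; the reflection lets one polynomial,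
  -- evaluated at u - v, clear both orders.
  set p₂ := ∏ b ∈ J, ∏ a ∈ I, (denPoly ħ (L₂ b a)).comp (-Polynomial.X) with hp₂
  set p := p₀ * p₁ * p₂ with hp
  have hpne : p ≠ 0 := by
    refine mul_ne_zero (mul_ne_zero (prod_family_ne_zero fun _ _ => denPoly_ne_zero ħ _)
      (prod_family_ne_zero fun _ _ => denPoly_ne_zero ħ _)) (prod_family_ne_zero fun b a h => ?_)
    rw [Polynomial.comp_neg_X_eq_zero_iff] at h
    exact denPoly_ne_zero ħ _ h
  have d0 : ∀ a ∈ I, ∀ b ∈ I, denPoly ħ (L a b) ∣ p := fun a ha b hb =>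
    ((dvd_prod_family (fun a b => denPoly ħ (L a b)) ha hb).mul_right _).mul_right _
  have d1 : ∀ a ∈ I, ∀ b ∈ J, denPoly ħ (L₁ a b) ∣ p := fun a ha b hb =>
    ((dvd_prod_family (fun a b => denPoly ħ (L₁ a b)) ha hb).mul_left _).mul_right _
  have d2 : ∀ b ∈ J, ∀ a ∈ I, (denPoly ħ (L₂ b a)).comp (-Polynomial.X) ∣ p := fun b hb a ha =>
    (dvd_prod_family (fun b a => (denPoly ħ (L₂ b a)).comp (-Polynomial.X)) hb ha).mul_left _
  have n0 : ∀ a b, ∃ n : Polynomial ℂ, a ∈ I → b ∈ I → ∀ w, (denPoly ħ (L a b)).eval w ≠ 0 →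
      p.eval w * ratio ħ (L a b) w = n.eval w := fun a b => by
    by_cases hab : a ∈ I ∧ b ∈ I
    · obtain ⟨n, hn⟩ := exists_clearing (d0 a hab.1 b hab.2)
      exact ⟨n, fun _ _ => hn⟩
    · exact ⟨0, fun ha hb => absurd ⟨ha, hb⟩ hab⟩
  have n1 : ∀ a b, ∃ n : Polynomial ℂ, a ∈ I → b ∈ J → ∀ w, (denPoly ħ (L₁ a b)).eval w ≠ 0 →
      p.eval w * ratio ħ (L₁ a b) w = n.eval w := fun a b => by
    by_cases hab : a ∈ I ∧ b ∈ J
    · obtain ⟨n, hn⟩ := exists_clearing (d1 a hab.1 b hab.2)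
      exact ⟨n, fun _ _ => hn⟩
    · exact ⟨0, fun ha hb => absurd ⟨ha, hb⟩ hab⟩
  have n2 : ∀ b a, ∃ n : Polynomial ℂ, b ∈ J → a ∈ I → ∀ w, (denPoly ħ (L₂ b a)).eval (-w) ≠ 0 →
      p.eval w * ratio ħ (L₂ b a) (-w) = n.eval w := fun b a => by
    by_cases hab : b ∈ J ∧ a ∈ I
    · obtain ⟨n, hn⟩ := exists_clearing_neg (d2 b hab.1 a hab.2)
      exact ⟨n, fun _ _ => hn⟩
    · exact ⟨0, fun ha hb => absurd ⟨ha, hb⟩ hab⟩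
  choose n₀ hn₀ using n0
  choose n₁ hn₁ using n1
  choose n₂ hn₂ using n2
  have im_lt : ∀ w : ℂ, w.im < -R → R < |w.im| := fun w hw => by rw [lt_abs]; right; linarith
  have im_lt' : ∀ w w' : ℂ, (w' - w).im < -R → R < |(w - w').im| := fun w w' hw => by
    rw [lt_abs]; left; rw [sub_im] at hw ⊢; linarith
  have trans : ∀ a b c : ℂ, (a - b).im < -R → (b - c).im < -R → (a - c).im < -R :=
    fun a b c e1 e2 => by
      have : (a - c).im = (a - b).im + (b - c).im := by simp only [sub_im]; ring
      rw [this]; linarith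
  have v0 : ∀ a ∈ I, ∀ b ∈ I, ∀ w : ℂ, R < |w.im| →
      p.eval w * ratio ħ (L a b) w = (n₀ a b).eval w := fun a ha b hb w hw =>
    hn₀ a b ha hb w (denPoly_eval_ne_zero (r0 a ha b hb) hw)
  have v1 : ∀ a ∈ I, ∀ b ∈ J, ∀ w : ℂ, R < |w.im| →
      p.eval w * ratio ħ (L₁ a b) w = (n₁ a b).eval w := fun a ha b hb w hw =>
    hn₁ a b ha hb w (denPoly_eval_ne_zero (r1 a ha b hb) hw)
  have v2 : ∀ b ∈ J, ∀ a ∈ I, ∀ w : ℂ, R < |w.im| →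
      p.eval w * ratio ħ (L₂ b a) (-w) = (n₂ b a).eval w := fun b hb a ha w hw =>
    hn₂ b a hb ha w (denPoly_eval_ne_zero (r2 b hb a ha) (by rwa [neg_im, abs_neg]))
  refine ⟨p, R, hpne, hR0, hX.convergesBelow hX h r0, hX.convergesBelow hY h₁ r1,
    hY.convergesBelow hX h₂ r2, fun Ψ hΨ ζ hζ => ?_⟩
  let Vop : ι → ι → κ → ℂ × ℂ × ℂ → ℂ := fun a b c z =>
    vertexOp k (A a z.1 + A b z.2.1 + B c z.2.2) Ψ ζ
  have dV : ∀ a ∈ I, ∀ b ∈ I, ∀ c ∈ J, Differentiable ℂ (Vop a b c) := fun a ha b hb c hc =>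
    differentiable_vertexOp ((((hX.entire a ha).comp (by fun_prop :
      Differentiable ℂ fun z : ℂ × ℂ × ℂ => z.1)).add ((hX.entire b hb).comp (by fun_prop :
      Differentiable ℂ fun z : ℂ × ℂ × ℂ => z.2.1))).add ((hY.entire c hc).comp (by fun_prop :
      Differentiable ℂ fun z : ℂ × ℂ × ℂ => z.2.2))) hΨ hζ
  -- The factor p(-w) accounts for p(u₂ - u₁), since clearing the product of the two `X` only uses
  -- p(u₁ - u₂).
  let P : ι → ι → ℂ → ℂ := fun a b w => p.eval (-w) * (n₀ a b).eval w
  have dpoly : ∀ n : Polynomial ℂ, Differentiable ℂ fun w => n.eval w := fun n => n.differentiable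
  have dP : ∀ a b, Differentiable ℂ (P a b) := fun a b =>
    ((dpoly p).comp (by fun_prop : Differentiable ℂ fun w : ℂ => -w)).mul (dpoly _)
  have dc : ∀ {F : ℂ → ℂ} {ℓ : ℂ × ℂ × ℂ → ℂ}, Differentiable ℂ F → Differentiable ℂ ℓ →
      Differentiable ℂ fun z => F (ℓ z) := fun hF hℓ => hF.comp hℓ
  refine ⟨fun z => ∑ a ∈ I, ∑ b ∈ I, ∑ c ∈ J, x a * x b * y c * (P a b (z.1 - z.2.1)
      * ((n₁ a c).eval (z.1 - z.2.2) * (n₁ b c).eval (z.2.1 - z.2.2)) * Vop a b c z),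
    fun z => ∑ a ∈ I, ∑ b ∈ I, ∑ c ∈ J, x a * x b * y c * (P a b (z.1 - z.2.1)
      * ((n₁ a c).eval (z.1 - z.2.2) * (n₂ c b).eval (z.2.1 - z.2.2)) * Vop a b c z),
    fun z => ∑ a ∈ I, ∑ b ∈ I, ∑ c ∈ J, x a * x b * y c * (P a b (z.1 - z.2.1)
      * ((n₂ c a).eval (z.1 - z.2.2) * (n₂ c b).eval (z.2.1 - z.2.2)) * Vop a b c z),
    ?_, ?_, ?_, fun u₁ u₂ v e1 e2 => ?_, fun u₁ u₂ v e1 e2 => ?_, fun u₁ u₂ v e1 e2 => ?_,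
    fun u₁ u₂ v => ?_⟩
  iterate 3
    exact Differentiable.fun_sum fun a ha => Differentiable.fun_sum fun b hb =>
      Differentiable.fun_sum fun c hc => (((dc (dP a b) (by fun_prop)).mul
        ((dc (dpoly _) (by fun_prop)).mul (dc (dpoly _) (by fun_prop)))).mul
          (dV a ha b hb c hc)).const_mul _
  · rw [hX.product₃ hX hY h h₁ h₁ hR0 r0 r1 r1 e1 e2 Ψ hζ, Finset.mul_sum]
    refine Finset.sum_congr rfl fun a ha => ?_
    rw [Finset.mul_sum]
    refine Finset.sum_congr rfl fun b hb => ?_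
    rw [Finset.mul_sum]
    refine Finset.sum_congr rfl fun c hc => ?_
    simp only [P, Vop]
    rw [← v0 a ha b hb _ (im_lt _ e1), ← v1 a ha c hc _ (im_lt _ (trans _ _ _ e1 e2)),
      ← v1 b hb c hc _ (im_lt _ e2), neg_sub]
    ring
  · rw [hX.product₃ hY hX h₁ h h₂ hR0 r1 r0 r2 e1 e2 Ψ hζ, Finset.mul_sum]
    refine Finset.sum_congr rfl fun a ha => ?_
    rw [Finset.sum_comm, Finset.mul_sum]
    refine Finset.sum_congr rfl fun b hb => ?_
    rw [Finset.mul_sum]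
    refine Finset.sum_congr rfl fun c hc => ?_
    simp only [P, Vop]
    rw [← v0 a ha b hb _ (im_lt _ (trans _ _ _ e1 e2)), ← v1 a ha c hc _ (im_lt _ e1),
      ← v2 c hc b hb _ (im_lt' _ _ e2), neg_sub, neg_sub, add_right_comm]
    ring
  · rw [hY.product₃ hX hX h₂ h₂ h hR0 r2 r2 r0 e1 e2 Ψ hζ, Finset.sum_comm, Finset.mul_sum]
    refine Finset.sum_congr rfl fun a ha => ?_
    rw [Finset.sum_comm, Finset.mul_sum]
    refine Finset.sum_congr rfl fun b hb => ?_
    rw [Finset.mul_sum]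
    refine Finset.sum_congr rfl fun c hc => ?_
    simp only [P, Vop]
    rw [← v0 a ha b hb _ (im_lt _ e2), ← v2 c hc a ha _ (im_lt' _ _ e1),
      ← v2 c hc b hb _ (im_lt' _ _ (trans _ _ _ e1 e2)), neg_sub, neg_sub, neg_sub,
      add_comm (B c v), add_right_comm, add_comm (A a u₁ + A b u₂)]
    ring
  · dsimp only
    have key : ∀ (T₁ T₂ T₃ T₁' T₂' T₃' : ι → ι → κ → ℂ), (∀ a ∈ I, ∀ b ∈ I, ∀ c ∈ J,
        (T₁ a b c - 2 * T₂ a b c + T₃ a b c) + (T₁' b a c - 2 * T₂' b a c + T₃' b a c) = 0) →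
        (∑ a ∈ I, ∑ b ∈ I, ∑ c ∈ J, T₁ a b c - 2 * ∑ a ∈ I, ∑ b ∈ I, ∑ c ∈ J, T₂ a b c
          + ∑ a ∈ I, ∑ b ∈ I, ∑ c ∈ J, T₃ a b c)
        + (∑ a ∈ I, ∑ b ∈ I, ∑ c ∈ J, T₁' a b c - 2 * ∑ a ∈ I, ∑ b ∈ I, ∑ c ∈ J, T₂' a b c
          + ∑ a ∈ I, ∑ b ∈ I, ∑ c ∈ J, T₃' a b c) = 0 := by
      intro T₁ T₂ T₃ T₁' T₂' T₃' hT
      rw [← sum_swap_add _ _ hT]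
      simp only [Finset.mul_sum, ← Finset.sum_sub_distrib, ← Finset.sum_add_distrib]
    refine key _ _ _ _ _ _ fun a ha b hb c hc => ?_
    have hV : Vop b a c (u₂, u₁, v) = Vop a b c (u₁, u₂, v) := by
      simp only [Vop]
      rw [add_comm (A b u₂)]
    have hs := serre_identity hpne (a₀ := a₀) (dP a b).continuous (dP b a).continuous
      (dpoly (n₁ a c)).continuous (dpoly (n₁ b c)).continuous (dpoly (n₂ c a)).continuous
      (dpoly (n₂ c b)).continuous (fun w hw hw' => ?_) (fun w hw => ?_) (fun w hw => ?_)
      (u₁ - v) (u₂ - v)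
    · rw [sub_sub_sub_cancel_right, sub_sub_sub_cancel_right] at hs
      rw [hV]
      linear_combination (x a * x b * y c * Vop a b c (u₁, u₂, v)) * hs
    · have e1 := hn₀ a b ha hb w (eval_ne_zero_of_dvd (d0 a ha b hb) hw)
      have e2 := hn₀ b a hb ha (-w) (eval_ne_zero_of_dvd (d0 b hb a ha) hw')
      have e3 := hex a ha b hb w (eval_ne_zero_of_dvd (d0 a ha b hb) hw)
        (eval_ne_zero_of_dvd (d0 b hb a ha) hw')
      simp only [P]
      rw [← e1, ← e2, neg_neg]
      linear_combination (p.eval w * p.eval (-w)) * e3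
    all_goals
      first
      | have e1 := hn₁ a c ha hc w (eval_ne_zero_of_dvd (d1 a ha c hc) hw)
        have hd := eval_ne_zero_of_dvd (d2 c hc a ha) hw
        rw [Polynomial.eval_comp, Polynomial.eval_neg, Polynomial.eval_X] at hd
        have e2 := hn₂ c a hc ha w hd
        have e3 := hex₁ a ha c hc w (eval_ne_zero_of_dvd (d1 a ha c hc) hw) hd
        rw [← e1, ← e2]
        linear_combination (p.eval w) * e3
      | have e1 := hn₁ b c hb hc w (eval_ne_zero_of_dvd (d1 b hb c hc) hw)
        have hd := eval_ne_zero_of_dvd (d2 c hc b hb) hw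
        rw [Polynomial.eval_comp, Polynomial.eval_neg, Polynomial.eval_X] at hd
        have e2 := hn₂ c b hc hb w hd
        have e3 := hex₁ b hb c hc w (eval_ne_zero_of_dvd (d1 b hb c hc) hw) hd
        rw [← e1, ← e2]
        linear_combination (p.eval w) * e3

end FreeBoson

namespace FreeBoson

variable {N : ℕ} {ħ : ℝ} {k : ℂ}

/-! ### Profiles of families of normal ordered exponentials -/

/-- `q^{1/2} - q^{-1/2}` for `q = e^x`. -/
noncomputable def sg (x : ℂ) : ℂ := exp (1 / 2 * x) - exp (-(1 / 2) * x)

theorem sg_eq (x : ℂ) : sg x = 2 * sinh (x / 2) := by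
  rw [sinh, sg]
  ring_nf

theorem sg_ne_zero (hħ : ħ ≠ 0) (t : HalfLine) : sg (ħ * (t : ℝ)) ≠ 0 := by
  have h := sinh_ofReal_ne_zero (x := ħ * t / 2)
    (div_ne_zero (mul_ne_zero hħ (ne_of_gt t.2)) two_ne_zero)
  rw [sg_eq]
  push_cast at h
  exact mul_ne_zero two_ne_zero h

/-- The functions on the species with given values at `λ_μ`, `b_{μν}`, `c_{μν}`. -/
def onModes (l : ℕ → ℂ) (b c : ℕ → ℕ → ℂ) : Mode N → ℂ
  | .inl j => l (j + 1)
  | .inr (.inl p) => b (p.1.1 + 1) (p.1.2 + 1)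
  | .inr (.inr p) => c (p.1.1 + 1) (p.1.2 + 1)

/-- The annihilation and the creation part of `A(u)` are `h` and `g`, up to normalisation. -/
def HasProfile (ħ : ℝ) (A : ℂ → VertexData N) (h g : ℂ → Mode N → ℂ) : Prop :=
  ∀ u, ∀ t : HalfLine, ∀ i,
    (A u).1 t i = 2 * ħ * exp (-I * u * (t : ℝ)) / sg (ħ * (t : ℝ)) * h (ħ * (t : ℝ)) i ∧
    (A u).2 t i = -(2 * ħ) * exp (I * u * (t : ℝ)) / sg (ħ * (t : ℝ)) * g (ħ * (t : ℝ)) i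

theorem HasProfile.add {A B : ℂ → VertexData N} {h g h' g' : ℂ → Mode N → ℂ}
    (hA : HasProfile ħ A h g) (hB : HasProfile ħ B h' g') :
    HasProfile ħ (fun u => A u + B u) (h + h') (g + g') := by
  intro u t i
  have h1 := hA u t i
  have h2 := hB u t i
  constructor
  · simp [h1.1, h2.1, mul_add]
  · simp only [Prod.snd_add, ContinuousMap.add_apply, Pi.add_apply, h1.2, h2.2, mul_add]

theorem HasProfile.neg {A : ℂ → VertexData N} {h g : ℂ → Mode N → ℂ} (hA : HasProfile ħ A h g) :
    HasProfile ħ (fun u => -A u) (-h) (-g) := by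
  intro u t i
  have h1 := hA u t i
  constructor
  · simp [h1.1]
  · simp only [Prod.snd_neg, ContinuousMap.neg_apply, Pi.neg_apply, h1.2, mul_neg]

theorem HasProfile.sub {A B : ℂ → VertexData N} {h g h' g' : ℂ → Mode N → ℂ}
    (hA : HasProfile ħ A h g) (hB : HasProfile ħ B h' g') :
    HasProfile ħ (fun u => A u - B u) (h - h') (g - g') := by
  simpa only [sub_eq_add_neg] using hA.add hB.neg

theorem hasProfile_zero : HasProfile ħ (fun _ => (0 : VertexData N)) 0 0 := by
  intro u t i
  simp

theorem HasProfile.sum {ι : Type*} (s : Finset ι) {A : ι → ℂ → VertexData N}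
    {h g : ι → ℂ → Mode N → ℂ} (hA : ∀ a ∈ s, HasProfile ħ (A a) (h a) (g a)) :
    HasProfile ħ (fun u => ∑ a ∈ s, A a u) (∑ a ∈ s, h a) (∑ a ∈ s, g a) := by
  classical
  induction s using Finset.induction_on with
  | empty => simpa using hasProfile_zero
  | insert a s ha ih =>
    simp only [Finset.sum_insert ha]
    exact (hA a (Finset.mem_insert_self a s)).add
      (ih fun b hb => hA b (Finset.mem_insert_of_mem hb))

theorem exp_sh (u s : ℂ) (t : HalfLine) : exp (-I * sh ħ u s * (t : ℝ))
    = exp (-I * u * (t : ℝ)) * exp (s * (ħ * (t : ℝ))) := by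
  rw [← exp_add, sh]
  congr 1
  linear_combination (-(s * ħ * (t : ℝ))) * I_mul_I

theorem exp_sh_neg (u s : ℂ) (t : HalfLine) : exp (I * sh ħ u s * (t : ℝ))
    = exp (I * u * (t : ℝ)) * exp (-s * (ħ * (t : ℝ))) := by
  rw [← exp_add, sh]
  congr 1
  linear_combination (s * ħ * (t : ℝ)) * I_mul_I

open Classical in
theorem hasProfile_chiPlus (hħ : ħ ≠ 0) (P : Mode N → Prop) (s : ℂ) :
    HasProfile ħ (fun u => chiPlus ħ P (sh ħ u s))
      (fun x i => if P i then sg x * exp (s * x) else 0) 0 := by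
  intro u t i
  have h := sg_ne_zero hħ t
  refine ⟨?_, by simp [chiPlus]⟩
  simp only [chiPlus, place, ContinuousMap.coe_mk]
  split_ifs
  · rw [exp_sh]
    field_simp
  · simp

open Classical in
theorem hasProfile_chiMinus (hħ : ħ ≠ 0) (P : Mode N → Prop) (s : ℂ) :
    HasProfile ħ (fun u => chiMinus ħ P (sh ħ u s)) 0
      (fun x i => if P i then sg x * exp (-s * x) else 0) := by
  intro u t i
  have h := sg_ne_zero hħ t
  refine ⟨by simp [chiMinus], ?_⟩
  simp only [chiMinus, place, ContinuousMap.coe_mk]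
  split_ifs
  · rw [exp_sh_neg]
    field_simp
  · simp

open Classical in
theorem hasProfile_chi (hħ : ħ ≠ 0) (P : Mode N → Prop) (s : ℂ) :
    HasProfile ħ (fun u => chi ħ P (sh ħ u s)) (fun x i => if P i then -exp (s * x) else 0)
      (fun x i => if P i then -exp (-s * x) else 0) := by
  intro u t i
  have h := sg_ne_zero hħ t
  have e : sinh ((ħ : ℂ) / 2 * (t : ℝ)) = sg (ħ * (t : ℝ)) / 2 := by
    rw [sg_eq]; ring_nf
  constructor
  · simp only [chi, place, ContinuousMap.coe_mk]
    split_ifs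
    · rw [exp_sh, e]
      field_simp
    · simp
  · simp only [chi, place, ContinuousMap.coe_mk]
    split_ifs
    · rw [exp_sh_neg, e]
      field_simp
    · simp

/-- The function on pairs of numbers with the only value `a` at `(m, n)`. -/
def single₂ (m n : ℕ) (a : ℂ) (r c : ℕ) : ℂ := if r = m ∧ c = n then a else 0

/-- The function on numbers with the only value `a` at `m`. -/
def single₁ (m : ℕ) (a : ℂ) (r : ℕ) : ℂ := if r = m then a else 0

theorem HasProfile.congr {A : ℂ → VertexData N} {h g h' g' : ℂ → Mode N → ℂ}
    (hA : HasProfile ħ A h g) (e : ∀ x i, h x i = h' x i) (e' : ∀ x i, g x i = g' x i) :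
    HasProfile ħ A h' g' := by
  intro u t i
  rw [← e, ← e']
  exact hA u t i

theorem hasProfile_bP (hħ : ħ ≠ 0) (m n : ℕ) (s : ℂ) :
    HasProfile (N := N) ħ (fun u => bP N ħ m n (sh ħ u s))
      (fun x => onModes 0 (single₂ m n (sg x * exp (s * x))) 0) 0 :=
  (hasProfile_chiPlus hħ (IsB m n) s).congr
    (fun x i => by rcases i with j | p | p <;> simp [IsB, onModes, single₂]; congr) fun _ _ => rfl

theorem hasProfile_bM (hħ : ħ ≠ 0) (m n : ℕ) (s : ℂ) :
    HasProfile (N := N) ħ (fun u => bM N ħ m n (sh ħ u s)) 0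
      (fun x => onModes 0 (single₂ m n (sg x * exp (-s * x))) 0) :=
  (hasProfile_chiMinus hħ (IsB m n) s).congr (fun _ _ => rfl)
    (fun x i => by rcases i with j | p | p <;> simp [IsB, onModes, single₂])

theorem hasProfile_lamP (hħ : ħ ≠ 0) (m : ℕ) (s : ℂ) :
    HasProfile (N := N) ħ (fun u => lamP N ħ m (sh ħ u s))
      (fun x => onModes (single₁ m (sg x * exp (s * x))) 0 0) 0 :=
  (hasProfile_chiPlus hħ (IsLam m) s).congr
    (fun x i => by rcases i with j | p | p <;> simp [IsLam, onModes, single₁]; congr) fun _ _ => rfl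

theorem hasProfile_lamM (hħ : ħ ≠ 0) (m : ℕ) (s : ℂ) :
    HasProfile (N := N) ħ (fun u => lamM N ħ m (sh ħ u s)) 0
      (fun x => onModes (single₁ m (sg x * exp (-s * x))) 0 0) :=
  (hasProfile_chiMinus hħ (IsLam m) s).congr (fun _ _ => rfl)
    (fun x i => by rcases i with j | p | p <;> simp [IsLam, onModes, single₁])

theorem hasProfile_bc (hħ : ħ ≠ 0) (m n : ℕ) (s : ℂ) :
    HasProfile (N := N) ħ (fun u => bc N ħ m n (sh ħ u s))
      (fun x => onModes 0 (single₂ m n (-exp (s * x))) (single₂ m n (-exp (s * x))))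
      (fun x => onModes 0 (single₂ m n (-exp (-s * x))) (single₂ m n (-exp (-s * x)))) :=
  ((hasProfile_chi hħ (IsB m n) s).add (hasProfile_chi hħ (IsC m n) s)).congr
    (fun x i => by rcases i with j | p | p <;> simp [IsB, IsC, onModes, single₂] <;> congr)
    (fun x i => by rcases i with j | p | p <;> simp [IsB, IsC, onModes, single₂] <;> congr)

open Finset in
/-- The sum of `h g` over the pairs `r < c`. -/
noncomputable def pairing (N : ℕ) (h g : ℕ → ℕ → ℂ) : ℂ :=
  ∑ r ∈ Icc 1 N, ∑ c ∈ Icc 1 N, if r < c then h r c * g r c else 0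

theorem sum_pair (f : ℕ → ℕ → ℂ) : ∑ p : Pair N, f (p.1.1 + 1) (p.1.2 + 1)
    = ∑ r ∈ Finset.Icc 1 N, ∑ c ∈ Finset.Icc 1 N, if r < c then f r c else 0 := by
  have h1 : ∀ F : ℕ → ℂ, ∑ r ∈ Finset.Icc 1 N, F r = ∑ j : Fin N, F (j + 1) := fun F => by
    rw [Fin.sum_univ_eq_sum_range (fun j => F (j + 1)) N, Finset.range_eq_Ico,
      Finset.sum_Ico_add' F 0 N 1]
    rfl
  simp only [h1]
  rw [← Fintype.sum_prod_type' (f := fun i j : Fin N =>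
    if (i : ℕ) + 1 < j + 1 then f (i + 1) (j + 1) else 0), ← Finset.sum_filter]
  exact (Finset.sum_subtype (p := fun p : Fin N × Fin N => p.1 < p.2) _ (fun p => by
    simp only [Finset.mem_filter, Finset.mem_univ, true_and, add_lt_add_iff_right, Fin.lt_def])
    (fun p => f (p.1 + 1) (p.2 + 1))).symm

/-- The contribution of the `λ_μ`. -/
noncomputable def lamPairing (N : ℕ) (k : ℂ) (h g : ℕ → ℂ) (x : ℂ) : ℂ :=
  - ∑ j : Fin N, ∑ i : Fin N, h (i + 1) * g (j + 1) *
    (if i = j then sinh ((k + N) / 2 * x) * sinh (((N : ℂ) - 1) / 2 * x) / sinh ((N : ℂ) / 2 * x) /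
        sinh (x / 2)
      else - (sinh ((k + N) / 2 * x) / sinh ((N : ℂ) / 2 * x)
        * exp ((if j < i then 1 else -1) * ((N : ℂ) / 2 * x))))

/-- The normalisation in `HasProfile` is made for this formula: -4ħ²/sg² times the commutator of b
is 1/t, and that of c gives -1/t. What is left of the contraction is a polynomial in exponentials,
apart from the λ part. -/
theorem HasProfile.contr_eq (hħ : ħ ≠ 0) {A B : ℂ → VertexData N} {l l' : ℂ → ℕ → ℂ}
    {b c b' c' : ℂ → ℕ → ℕ → ℂ} {h g : ℂ → Mode N → ℂ}
    (hA : HasProfile ħ A (fun x => onModes (l x) (b x) (c x)) g)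
    (hB : HasProfile ħ B h (fun x => onModes (l' x) (b' x) (c' x))) (u v : ℂ) (t : HalfLine) :
    contr N ħ k (A u) (B v) t = exp (-I * (u - v) * (t : ℝ)) / (t : ℝ) *
      (pairing N (b (ħ * (t : ℝ))) (b' (ħ * (t : ℝ)))
        - pairing N (c (ħ * (t : ℝ))) (c' (ħ * (t : ℝ)))
        + lamPairing N k (l (ħ * (t : ℝ))) (l' (ħ * (t : ℝ))) (ħ * (t : ℝ))) := by
  have ht : ((t : ℝ) : ℂ) ≠ 0 := by exact_mod_cast ne_of_gt t.2
  have hħ' : (ħ : ℂ) ≠ 0 := by exact_mod_cast hħ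
  have hs := sg_ne_zero hħ t
  have e : exp (-I * (u - v) * (t : ℝ)) = exp (-I * u * (t : ℝ)) * exp (I * v * (t : ℝ)) := by
    rw [← exp_add]; ring_nf
  have es : sinh ((ħ : ℂ) / 2 * (t : ℝ)) = sg (ħ * (t : ℝ)) / 2 := by
    rw [sg_eq]; ring_nf
  set x : ℂ := ħ * (t : ℝ) with hx
  have hs2 : sinh (x / 2) = sg x / 2 := by rw [sg_eq]; ring
  have a1 : ∀ a : ℂ, a * ħ * (t : ℝ) = a * x := fun a => by rw [hx]; ring
  simp only [contr, commWith, ContinuousMap.coe_mk, Fintype.sum_sum_type, (hA u t _).1,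
    (hB v t _).2]
  simp only [comm, onModes, mul_zero, mul_ite, Finset.sum_const_zero, add_zero, zero_add,
    Finset.sum_ite_eq', Finset.mem_univ, if_true, es, a1, ← hx]
  rw [e, pairing, pairing, ← sum_pair (fun r c => b x r c * b' x r c),
    ← sum_pair (fun r s => c x r s * c' x r s), lamPairing, mul_add, mul_sub, add_comm, add_assoc,
    sub_eq_add_neg]
  have hsum : ∀ a a' b b' c c' : ℂ, a = a' → b = b' → c = c' →
      a + (b + c) = a' + b' + c' := by
    rintro a _ b _ c _ rfl rfl rfl; ring
  rw [sub_eq_add_neg _ (exp _ * exp _ / _ * _)]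
  refine hsum _ _ _ _ _ _ ?_ ?_ ?_
  · rw [Finset.mul_sum]
    refine Finset.sum_congr rfl fun p _ => ?_
    field_simp
  · rw [Finset.mul_sum, ← Finset.sum_neg_distrib]
    refine Finset.sum_congr rfl fun p _ => ?_
    field_simp
  · rw [mul_neg, Finset.mul_sum, ← Finset.sum_neg_distrib]
    refine Finset.sum_congr rfl fun j _ => ?_
    rw [Finset.mul_sum, Finset.mul_sum, ← Finset.sum_neg_distrib]
    refine Finset.sum_congr rfl fun i _ => ?_
    rw [hs2]
    split_ifs <;>
    · simp only [div_eq_mul_inv, mul_inv]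
      generalize (sinh ((N : ℂ) * 2⁻¹ * x))⁻¹ = Z
      field_simp

end FreeBoson

namespace FreeBoson

set_option linter.unusedSimpArgs false

variable {N : ℕ} {ħ : ℝ} {k : ℂ}

/-! ### The terms of the currents -/

/-- The field `b^±_{mn}`. -/
noncomputable def bS (N : ℕ) (ħ : ℝ) (ε : Bool) (m n : ℕ) (u : ℂ) : VertexData N :=
  if ε then bP N ħ m n u else bM N ħ m n u

open Finset in
/-- The exponents of the terms of `E_μ(u)`. -/
noncomputable def ETerm (N : ℕ) (ħ : ℝ) (μ m : ℕ) (ε : Bool) (u : ℂ) : VertexData N :=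
  bc N ħ m μ (sh ħ u (- (m - 1) / 2)) + (bS N ħ ε m (μ + 1) (sh ħ u (- (m - 1) / 2))
    - bc N ħ m (μ + 1) (sh ħ u (if ε then - m / 2 else - (m - 2) / 2)))
  + ∑ n ∈ Icc 1 (m - 1),
      (bP N ħ n (μ + 1) (sh ħ u (- (n - 1) / 2)) - bP N ħ n μ (sh ħ u (- n / 2)))

open Finset in
/-- The exponents of the terms of the first sum in `F_μ(u)`. -/
noncomputable def FTerm₁ (N : ℕ) (ħ : ℝ) (k : ℂ) (μ m : ℕ) (ε : Bool) (u : ℂ) : VertexData N :=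
  bc N ħ m (μ + 1) (sh ħ u (m / 2)) + (lamM N ħ μ (sh ħ u (- (k - N) / 4 - μ / 2))
      - lamM N ħ (μ + 1) (sh ħ u (- (k - N) / 4 - μ / 2)))
    + (- bS N ħ ε m μ (sh ħ u (m / 2))
        - bc N ħ m μ (sh ħ u (if ε then (m + 1) / 2 else (m - 1) / 2)))
    + (∑ n ∈ Icc (m + 1) μ,
        (bM N ħ n (μ + 1) (sh ħ u ((n - 1) / 2)) - bM N ħ n μ (sh ħ u (n / 2))))
    + ∑ s ∈ Icc (μ + 1) N,
        (bM N ħ μ s (sh ħ u (s / 2)) - bM N ħ (μ + 1) s (sh ħ u ((s - 1) / 2)))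

open Finset in
/-- The exponents of the terms of the second sum in `F_μ(u)`. -/
noncomputable def FTerm₂ (N : ℕ) (ħ : ℝ) (k : ℂ) (μ m : ℕ) (ε : Bool) (u : ℂ) : VertexData N :=
  bc N ħ μ m (sh ħ u (- (2 * k + m - 1) / 2)) + (lamP N ħ μ (sh ħ u (- (3 * k + N) / 4 - μ / 2))
      - lamP N ħ (μ + 1) (sh ħ u (- (3 * k + N) / 4 - μ / 2)))
    + (bS N ħ ε (μ + 1) m (sh ħ u (- (2 * k + m - 1) / 2))
        - bc N ħ (μ + 1) m (sh ħ u (if ε then - (2 * k + m) / 2 else - (2 * k + m - 2) / 2)))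
    + ∑ n ∈ Icc m N,
      (bP N ħ μ n (sh ħ u (- (2 * k + n) / 2)) - bP N ħ (μ + 1) n (sh ħ u (- (2 * k + n - 1) / 2)))

theorem sum_ite_left (a b C : ℕ) (f : ℕ → ℂ) (r c : ℕ) :
    (∑ n ∈ Finset.Icc a b, if r = n ∧ c = C then f n else 0)
      = if a ≤ r ∧ r ≤ b ∧ c = C then f r else 0 := by
  simp only [ite_and, Finset.sum_ite_eq, Finset.mem_Icc]

theorem sum_ite_right (a b R : ℕ) (f : ℕ → ℂ) (r c : ℕ) :
    (∑ n ∈ Finset.Icc a b, if r = R ∧ c = n then f n else 0)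
      = if a ≤ c ∧ c ≤ b ∧ r = R then f c else 0 := by
  by_cases h : r = R <;>
  simp [h, ite_and, Finset.sum_ite_eq, Finset.mem_Icc]

theorem HasProfile.congr_onModes {A : ℂ → VertexData N} {h g : ℂ → Mode N → ℂ}
    (hA : HasProfile ħ A h g) {l l' : ℂ → ℕ → ℂ} {b c b' c' : ℂ → ℕ → ℕ → ℂ}
    (e₁ : ∀ x (j : Fin N) r, j.1 + 1 = r → 1 ≤ r → h x (.inl j) = l x r)
    (e₂ : ∀ x (p : Pair N) r s, p.1.1.1 + 1 = r → p.1.2.1 + 1 = s → 1 ≤ r → r < s → s ≤ N →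
      h x (.inr (.inl p)) = b x r s)
    (e₃ : ∀ x (p : Pair N) r s, p.1.1.1 + 1 = r → p.1.2.1 + 1 = s → 1 ≤ r → r < s → s ≤ N →
      h x (.inr (.inr p)) = c x r s)
    (e₄ : ∀ x (j : Fin N) r, j.1 + 1 = r → 1 ≤ r → g x (.inl j) = l' x r)
    (e₅ : ∀ x (p : Pair N) r s, p.1.1.1 + 1 = r → p.1.2.1 + 1 = s → 1 ≤ r → r < s → s ≤ N →
      g x (.inr (.inl p)) = b' x r s)
    (e₆ : ∀ x (p : Pair N) r s, p.1.1.1 + 1 = r → p.1.2.1 + 1 = s → 1 ≤ r → r < s → s ≤ N →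
      g x (.inr (.inr p)) = c' x r s) :
    HasProfile ħ A (fun x => onModes (l x) (b x) (c x)) (fun x => onModes (l' x) (b' x) (c' x)) := by
  have hp : ∀ p : Pair N, p.1.1.1 + 1 < p.1.2.1 + 1 := fun p => by
    have := Fin.lt_def.1 p.2
    omega
  refine hA.congr (fun x i => ?_) (fun x i => ?_) <;> rcases i with j | p | p
  · exact e₁ x j _ rfl (by omega)
  · exact e₂ x p _ _ rfl rfl (by omega) (hp p) p.1.2.2
  · exact e₃ x p _ _ rfl rfl (by omega) (hp p) p.1.2.2
  · exact e₄ x j _ rfl (by omega)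
  · exact e₅ x p _ _ rfl rfl (by omega) (hp p) p.1.2.2
  · exact e₆ x p _ _ rfl rfl (by omega) (hp p) p.1.2.2

/-- The annihilation part of `b` in the terms of `E_μ`. -/
noncomputable def hbE (μ m : ℕ) (x : ℂ) (r c : ℕ) : ℂ :=
  (if c = μ then if r = m then -exp (-((m : ℂ) - 1) / 2 * x) else
      if r < m then -(sg x * exp (-(r : ℂ) / 2 * x)) else 0
    else 0)
  + (if c = μ + 1 then if r = m then exp ((1 - (m : ℂ) / 2) * x) else
      if r < m then sg x * exp (-((r : ℂ) - 1) / 2 * x) else 0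
    else 0)

theorem hasProfile_bS (hħ : ħ ≠ 0) (ε : Bool) (m n : ℕ) (s : ℂ) :
    HasProfile (N := N) ħ (fun u => bS N ħ ε m n (sh ħ u s))
      (fun x => onModes 0 (single₂ m n (if ε then sg x * exp (s * x) else 0)) 0)
      (fun x => onModes 0 (single₂ m n (if ε then 0 else sg x * exp (-s * x))) 0) := by
  cases ε
  · exact (hasProfile_bM hħ m n s).congr
      (fun x i => by rcases i with j | p | p <;> simp [onModes, single₂]) fun _ _ => rfl
  · exact (hasProfile_bP hħ m n s).congr (fun _ _ => rfl)
      (fun x i => by rcases i with j | p | p <;> simp [onModes, single₂])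

/-- The factor sg of b^± is a difference of two exponentials, one of which cancels against the
neighbouring β field. As a result the b-arrays do not depend on the sign `ε`; only the c-arrays do.
-/
theorem hasProfile_ETerm (hħ : ħ ≠ 0) (μ m : ℕ) (ε : Bool) :
    HasProfile ħ (ETerm N ħ μ m ε)
      (fun x => onModes 0 (hbE μ m x) (single₂ m μ (-exp (-((m : ℂ) - 1) / 2 * x))
        + single₂ m (μ + 1) (exp ((if ε then - (m : ℂ) / 2 else - ((m : ℂ) - 2) / 2) * x))))
      (fun x => onModes 0 (single₂ m μ (-exp (((m : ℂ) - 1) / 2 * x))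
          + single₂ m (μ + 1) (exp ((m : ℂ) / 2 * x)))
        (single₂ m μ (-exp (((m : ℂ) - 1) / 2 * x))
        + single₂ m (μ + 1) (exp ((if ε then (m : ℂ) / 2 else ((m : ℂ) - 2) / 2) * x)))) := by
  have tail := HasProfile.sum (N := N) (ħ := ħ) (Finset.Icc 1 (m - 1)) fun n _ =>
    (hasProfile_bP hħ n (μ + 1) (- (n - 1) / 2)).sub (hasProfile_bP (N := N) hħ n μ (- n / 2))
  have ends := (hasProfile_bc (N := N) hħ m μ (- (m - 1) / 2)).add
      ((hasProfile_bS hħ ε m (μ + 1) (- (m - 1) / 2)).sub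
        (hasProfile_bc hħ m (μ + 1) (if ε then - m / 2 else - (m - 2) / 2)))
  refine (ends.add tail).congr_onModes (fun x j r _ _ => by simp [onModes]) ?_ ?_
    (fun x j r _ _ => by simp [onModes]) ?_ ?_ <;> intro x p r c e1 e2 hr hc _ <;>
  simp only [onModes, e1, e2, Pi.add_apply, Pi.sub_apply, Finset.sum_apply, Pi.zero_apply, hbE,
    single₂, Finset.sum_sub_distrib, sum_ite_left, Finset.sum_const_zero, add_zero, sub_zero] <;>
  cases ε <;> rcases lt_trichotomy r m with h | rfl | h <;> rcases eq_or_ne c μ with h1 | h1 <;>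
    rcases eq_or_ne c (μ + 1) with h2 | h2 <;> first
    | omega
    | simp (disch := omega) only [if_pos, if_neg, sg, sub_mul, ← exp_add, if_true, if_false, true_and,
        Bool.false_eq_true]
      try ring_nf

/-- The creation part of `b` in the terms of the first sum in `F_μ`. -/
noncomputable def gbF₁ (μ m : ℕ) (x : ℂ) (r c : ℕ) : ℂ :=
  (if c = μ + 1 then if r = m then -exp (-(m : ℂ) / 2 * x) else
      if m < r ∧ r ≤ μ then sg x * exp (-((r : ℂ) - 1) / 2 * x) else 0
    else 0)
  + (if c = μ then if r = m then exp (-((m : ℂ) + 1) / 2 * x) else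
      if m < r ∧ r ≤ μ then -(sg x * exp (-(r : ℂ) / 2 * x)) else 0
    else 0)
  + (if r = μ ∧ μ + 1 ≤ c then sg x * exp (-(c : ℂ) / 2 * x) else 0)
  + (if r = μ + 1 ∧ μ + 1 ≤ c then -(sg x * exp (-((c : ℂ) - 1) / 2 * x)) else 0)

/-- As for E the sign is visible only in c. The tails consist of b^- and belong to the creation
part; the annihilation part lives on two entries. -/
theorem hasProfile_FTerm₁ (hħ : ħ ≠ 0) (μ m : ℕ) (ε : Bool) :
    HasProfile ħ (FTerm₁ N ħ k μ m ε)
      (fun x => onModes 0 (single₂ m (μ + 1) (-exp ((m : ℂ) / 2 * x))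
          + single₂ m μ (exp (((m : ℂ) - 1) / 2 * x)))
        (single₂ m (μ + 1) (-exp ((m : ℂ) / 2 * x))
          + single₂ m μ (exp ((if ε then ((m : ℂ) + 1) / 2 else ((m : ℂ) - 1) / 2) * x))))
      (fun x => onModes (single₁ μ (sg x * exp (((k - N) / 4 + μ / 2) * x))
          - single₁ (μ + 1) (sg x * exp (((k - N) / 4 + μ / 2) * x))) (gbF₁ μ m x)
        (single₂ m (μ + 1) (-exp (-(m : ℂ) / 2 * x))
          + single₂ m μ (exp ((if ε then -((m : ℂ) + 1) / 2 else -((m : ℂ) - 1) / 2) * x)))) := by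
  have tail := (HasProfile.sum (N := N) (ħ := ħ) (Finset.Icc (m + 1) μ) fun n _ =>
    (hasProfile_bM hħ n (μ + 1) ((n - 1) / 2)).sub (hasProfile_bM (N := N) hħ n μ (n / 2)))
  have tail' := (HasProfile.sum (N := N) (ħ := ħ) (Finset.Icc (μ + 1) N) fun n _ =>
    (hasProfile_bM hħ μ n (n / 2)).sub (hasProfile_bM (N := N) hħ (μ + 1) n ((n - 1) / 2)))
  have ends := ((hasProfile_bc (N := N) hħ m (μ + 1) (m / 2)).add
    ((hasProfile_lamM hħ μ (- (k - N) / 4 - μ / 2)).sub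
      (hasProfile_lamM hħ (μ + 1) (- (k - N) / 4 - μ / 2)))).add
      ((hasProfile_bS hħ ε m μ (m / 2)).neg.sub
        (hasProfile_bc hħ m μ (if ε then (m + 1) / 2 else (m - 1) / 2)))
  refine ((ends.add tail).add tail').congr_onModes (fun x j r _ _ => by simp [onModes]) ?_ ?_
    (fun x j r e _ => ?_) ?_ ?_
  case refine_3 =>
    simp only [onModes, e, Pi.add_apply, Pi.sub_apply, Pi.neg_apply, Finset.sum_apply,
      Pi.zero_apply, Finset.sum_sub_distrib, Finset.sum_const_zero]
    ring_nf
  all_goals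
    intro x p r c e1 e2 hr hc hN
    simp only [onModes, e1, e2, Pi.add_apply, Pi.sub_apply, Pi.neg_apply, Finset.sum_apply,
      Pi.zero_apply, gbF₁, single₂, Finset.sum_sub_distrib, sum_ite_left, sum_ite_right,
      Finset.sum_const_zero, add_zero, sub_zero]
    clear tail tail' ends
  · cases ε <;> rcases eq_or_ne r m with h | h <;> rcases eq_or_ne c μ with h1 | h1 <;>
      rcases eq_or_ne c (μ + 1) with h2 | h2 <;> first
      | omega
      | simp (disch := omega) only [if_pos, if_neg, sg, sub_mul, ← exp_add, if_true, if_false,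
          true_and, Bool.false_eq_true]
        try ring_nf
  · cases ε <;> rcases eq_or_ne r m with h | h <;> rcases eq_or_ne c μ with h1 | h1 <;>
      rcases eq_or_ne c (μ + 1) with h2 | h2 <;> first
      | omega
      | simp (disch := omega) only [if_pos, if_neg, sg, sub_mul, ← exp_add, if_true, if_false,
          true_and, Bool.false_eq_true]
        try ring_nf
  · cases ε <;> rcases lt_trichotomy r m with h | h | h <;>
      rcases (by omega : c < μ ∨ c = μ ∨ c = μ + 1 ∨ μ + 1 < c) with h1 | h1 | h1 | h1 <;>
      rcases (by omega : r < μ ∨ r = μ ∨ r = μ + 1 ∨ μ + 1 < r) with h2 | h2 | h2 | h2 <;> first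
      | omega
      | simp (disch := omega) only [if_pos, if_neg, sg, sub_mul, ← exp_add, if_true, if_false,
          true_and, Bool.false_eq_true]
        try subst h
        try subst h1
        try ring_nf
  · cases ε <;> rcases eq_or_ne r m with h | h <;> rcases eq_or_ne c μ with h1 | h1 <;>
      rcases eq_or_ne c (μ + 1) with h2 | h2 <;> first
      | omega
      | simp (disch := omega) only [if_pos, if_neg, sg, sub_mul, ← exp_add, if_true, if_false,
          true_and, Bool.false_eq_true]
        try ring_nf

/-- The annihilation part of `b` in the terms of the second sum in `F_μ`. -/
noncomputable def hbF₂ (k : ℂ) (μ m : ℕ) (x : ℂ) (r c : ℕ) : ℂ :=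
  (if r = μ then if c = m then -exp ((-k - ((m : ℂ) + 1) / 2) * x) else
      if m < c then sg x * exp ((-k - (c : ℂ) / 2) * x) else 0
    else 0)
  + (if r = μ + 1 then if c = m then exp ((-k - (m : ℂ) / 2) * x) else
      if m < c then -(sg x * exp ((-k - ((c : ℂ) - 1) / 2) * x)) else 0
    else 0)

/-- The tail consists of b^+ and belongs to the annihilation part together with λ^+; the creation
part lives on two entries, and again only c sees the sign. -/
theorem hasProfile_FTerm₂ (hħ : ħ ≠ 0) (μ m : ℕ) (ε : Bool) :
    HasProfile ħ (FTerm₂ N ħ k μ m ε)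
      (fun x => onModes (single₁ μ (sg x * exp ((-(3 * k + N) / 4 - μ / 2) * x))
          - single₁ (μ + 1) (sg x * exp ((-(3 * k + N) / 4 - μ / 2) * x))) (hbF₂ k μ m x)
        (single₂ μ m (-exp ((-k - ((m : ℂ) - 1) / 2) * x))
          + single₂ (μ + 1) m
            (exp ((if ε then -k - (m : ℂ) / 2 else -k - ((m : ℂ) - 2) / 2) * x))))
      (fun x => onModes 0 (single₂ μ m (-exp ((k + ((m : ℂ) - 1) / 2) * x))
          + single₂ (μ + 1) m (exp ((k + (m : ℂ) / 2) * x)))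
        (single₂ μ m (-exp ((k + ((m : ℂ) - 1) / 2) * x))
          + single₂ (μ + 1) m
            (exp ((if ε then k + (m : ℂ) / 2 else k + ((m : ℂ) - 2) / 2) * x)))) := by
  have tail := (HasProfile.sum (N := N) (ħ := ħ) (Finset.Icc m N) fun n _ =>
    (hasProfile_bP hħ μ n (- (2 * k + n) / 2)).sub
      (hasProfile_bP (N := N) hħ (μ + 1) n (- (2 * k + n - 1) / 2)))
  have ends := ((hasProfile_bc (N := N) hħ μ m (- (2 * k + m - 1) / 2)).add
    ((hasProfile_lamP hħ μ (- (3 * k + N) / 4 - μ / 2)).sub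
      (hasProfile_lamP hħ (μ + 1) (- (3 * k + N) / 4 - μ / 2)))).add
      ((hasProfile_bS hħ ε (μ + 1) m (- (2 * k + m - 1) / 2)).sub
        (hasProfile_bc hħ (μ + 1) m (if ε then - (2 * k + m) / 2 else - (2 * k + m - 2) / 2)))
  refine (ends.add tail).congr_onModes (fun x j r e _ => ?_) ?_ ?_
    (fun x j r _ _ => by simp [onModes]) ?_ ?_
  case refine_1 =>
    simp only [onModes, e, Pi.add_apply, Pi.sub_apply, Pi.neg_apply, Finset.sum_apply,
      Pi.zero_apply, Finset.sum_sub_distrib, Finset.sum_const_zero]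
    ring_nf
  all_goals
    intro x p r c e1 e2 hr hc hN
    simp only [onModes, e1, e2, Pi.add_apply, Pi.sub_apply, Pi.neg_apply, Finset.sum_apply,
      Pi.zero_apply, hbF₂, single₂, Finset.sum_sub_distrib, sum_ite_left, sum_ite_right,
      Finset.sum_const_zero, add_zero, sub_zero]
    clear tail ends
    cases ε <;> rcases lt_trichotomy c m with h | h | h <;> rcases eq_or_ne r μ with h1 | h1 <;>
      rcases eq_or_ne r (μ + 1) with h2 | h2 <;> first
      | omega
      | simp (disch := omega) only [if_pos, if_neg, sg, sub_mul, ← exp_add, if_true, if_false,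
          true_and, Bool.false_eq_true]
        try subst h
        try ring_nf

end FreeBoson

namespace FreeBoson

set_option linter.unusedSimpArgs false

variable {N : ℕ} {ħ : ℝ} {k : ℂ}

/-! ### Contractions of the terms of the currents -/

theorem pairing_add_left (h h' g : ℕ → ℕ → ℂ) :
    pairing N (h + h') g = pairing N h g + pairing N h' g := by
  simp only [pairing, Pi.add_apply, add_mul, ← Finset.sum_add_distrib, ite_add_zero]

theorem pairing_add_right (h g g' : ℕ → ℕ → ℂ) :
    pairing N h (g + g') = pairing N h g + pairing N h g' := by
  simp only [pairing, Pi.add_apply, mul_add, ← Finset.sum_add_distrib, ite_add_zero]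

theorem pairing_comm (h g : ℕ → ℕ → ℂ) : pairing N h g = pairing N g h := by
  simp only [pairing, mul_comm]

theorem pairing_single_right (h : ℕ → ℕ → ℂ) (R C : ℕ) (a : ℂ) :
    pairing N h (single₂ R C a) = if 1 ≤ R ∧ R < C ∧ C ≤ N then h R C * a else 0 := by
  have e : ∀ r c, (if r < c then h r c * single₂ R C a r c else 0)
      = if r = R ∧ c = C then (if R < C then h R C * a else 0) else 0 := fun r c => by
    by_cases hr : r = R ∧ c = C
    · obtain ⟨rfl, rfl⟩ := hr
      simp [single₂]
    · simp [single₂, hr]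
  simp only [pairing, e, ite_and, Finset.sum_ite_eq', Finset.mem_Icc, Finset.sum_ite_irrel,
    Finset.sum_const_zero]
  split_ifs <;> first | rfl | omega

theorem pairing_single_left (g : ℕ → ℕ → ℂ) (R C : ℕ) (a : ℂ) :
    pairing N (single₂ R C a) g = if 1 ≤ R ∧ R < C ∧ C ≤ N then a * g R C else 0 := by
  rw [pairing_comm, pairing_single_right]
  simp only [mul_comm]

theorem lamPairing_zero_left (g : ℕ → ℂ) (x : ℂ) : lamPairing N k 0 g x = 0 := by
  simp [lamPairing]

theorem lamPairing_zero_right (h : ℕ → ℂ) (x : ℂ) : lamPairing N k h 0 x = 0 := by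
  simp [lamPairing]

theorem HasProfile.hasContr (hħ : ħ ≠ 0) {A B : ℂ → VertexData N} {l l' : ℂ → ℕ → ℂ}
    {b c b' c' : ℂ → ℕ → ℕ → ℂ} {h g : ℂ → Mode N → ℂ}
    (hA : HasProfile ħ A (fun x => onModes (l x) (b x) (c x)) g)
    (hB : HasProfile ħ B h (fun x => onModes (l' x) (b' x) (c' x))) {L : List (ℂ × ℂ)}
    (e : ∀ t : HalfLine, pairing N (b (ħ * (t : ℝ))) (b' (ħ * (t : ℝ)))
        - pairing N (c (ħ * (t : ℝ))) (c' (ħ * (t : ℝ)))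
        + lamPairing N k (l (ħ * (t : ℝ))) (l' (ħ * (t : ℝ))) (ħ * (t : ℝ))
          = expSum L (ħ * (t : ℝ))) : HasContr ħ k A B L := by
  intro u v t
  rw [hA.contr_eq hħ hB, e]

theorem expSum_nil (x : ℂ) : expSum [] x = 0 := by simp [expSum]

theorem expSum_cons (p : ℂ × ℂ) (L : List (ℂ × ℂ)) (x : ℂ) :
    expSum (p :: L) x = exp (p.1 * x) - exp (p.2 * x) + expSum L x := by
  simp [expSum]

/-- The contractions of the terms of `E_μ(u)` and `E_ν(v)`. -/
noncomputable def listEE (μ m : ℕ) (ε : Bool) (ν n : ℕ) (δ : Bool) : List (ℂ × ℂ) :=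
  if μ = ν then
    if n < m ∨ n = m ∧ ε = true ∧ δ = false then [(1, -1)]
    else if n = m ∧ ε = δ then [(1, 0)] else []
  else if μ = ν + 1 then if n < m ∨ n = m ∧ δ = false then [(-1 / 2, 1 / 2)] else []
  else if ν = μ + 1 then if n < m ∨ n = m ∧ ε = true then [(-1 / 2, 1 / 2)] else []
  else []

/-- The creation part of the right factor lives on the entries (n, ν) and (n, ν + 1), so the pairing
with the tail of the left factor is a pair of evaluations. The tail is met for n < m, the ends for n
= m, nothing for n > m. -/
theorem hasContr_E_E (hħ : ħ ≠ 0) {μ m ν n : ℕ} (hm : m ∈ Finset.Icc 1 μ) (hn : n ∈ Finset.Icc 1 ν)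
    (hμ : μ < N) (hν : ν < N) (ε δ : Bool) :
    HasContr ħ k (ETerm N ħ μ m ε) (ETerm N ħ ν n δ) (listEE μ m ε ν n δ) := by
  rw [Finset.mem_Icc] at hm hn
  refine (hasProfile_ETerm hħ μ m ε).hasContr hħ (hasProfile_ETerm hħ ν n δ) fun t => ?_
  generalize (ħ * (t : ℝ) : ℂ) = x
  simp only [pairing_add_left, pairing_add_right, pairing_single_right, Pi.add_apply, lamPairing_zero_left,
    hbE,
    single₂, listEE]
  rcases lt_trichotomy n m with h1 | h1 | h1
  · rcases (by omega : μ = ν ∨ μ = ν + 1 ∨ ν = μ + 1 ∨ (μ ≠ ν ∧ μ ≠ ν + 1 ∧ ν ≠ μ + 1))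
      with h | h | h | h <;>
    rcases (by omega : n < ν ∨ n = ν) with h2 | h2 <;> first
    | omega
    | simp (disch := omega) only [if_pos, if_neg, sg, sub_mul, add_mul, neg_mul, mul_neg, ← exp_add, zero_mul,
        expSum_nil, expSum_cons]
      try ring_nf
  · subst h1
    rcases (by omega : μ = ν ∨ μ = ν + 1 ∨ ν = μ + 1 ∨ (μ ≠ ν ∧ μ ≠ ν + 1 ∧ ν ≠ μ + 1))
      with h | h | h | h <;>
    rcases (by omega : n < ν ∨ n = ν) with h2 | h2 <;> first
    | omega
    | simp (disch := omega) only [if_pos, if_neg, sg, sub_mul, add_mul, neg_mul, mul_neg, ← exp_add,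
        zero_mul, true_and, lt_irrefl, false_or]
      cases ε <;> cases δ <;>
      simp only [if_true, if_false, reduceCtorEq, and_true, and_false, expSum_nil, expSum_cons,
          neg_mul, mul_neg, ← exp_add] <;>
      (try ring_nf)
  · rcases (by omega : μ = ν ∨ μ = ν + 1 ∨ ν = μ + 1 ∨ (μ ≠ ν ∧ μ ≠ ν + 1 ∧ ν ≠ μ + 1))
      with h | h | h | h <;>
    rcases (by omega : n < ν ∨ n = ν) with h2 | h2 <;> first
    | omega
    | simp (disch := omega) only [if_pos, if_neg, zero_mul, expSum_nil]
      try ring_nf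

end FreeBoson

/-! ### Contractions of E with the second sum of F -/

namespace FreeBoson

set_option linter.unusedSimpArgs false

variable {N : ℕ} {ħ : ℝ} {k : ℂ}

/-- The list of the opposite exponents. -/
def barList (L : List (ℂ × ℂ)) : List (ℂ × ℂ) := L.map fun p => (-p.1, -p.2)

theorem barList_nil : barList [] = [] := rfl

theorem barList_cons (p : ℂ × ℂ) (L : List (ℂ × ℂ)) :
    barList (p :: L) = (-p.1, -p.2) :: barList L := rfl

/-- The contractions of the terms of `E_μ(u)` and of the second sum in `F_ν(v)`. -/
noncomputable def listEF₂ (k : ℂ) (μ m : ℕ) (ε : Bool) (ν n : ℕ) (δ : Bool) : List (ℂ × ℂ) :=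
  if μ = ν then if m = μ ∧ n = μ + 1 ∧ ε = true ∧ δ = true then [(k, k + 1)] else []
  else if m = ν ∧ n = μ + 1 ∧ ε = true then [(k + (μ - ν) / 2, k + (μ - ν) / 2 + 1)]
  else if m = ν + 1 ∧ n = μ ∧ δ = true then [(k + (μ - ν) / 2, k + (μ - ν) / 2 - 1)]
  else if m = ν + 1 ∧ n = μ + 1 ∧ ε = true ∧ δ = false then
    [(k + (μ - ν) / 2, k + (μ - ν) / 2 - 1)]
  else if m = ν + 1 ∧ n = μ + 1 ∧ ε = false ∧ δ = true then
    [(k + (μ - ν) / 2, k + (μ - ν) / 2 + 1)]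
  else []

/-- Only the entries (ν, n) and (ν + 1, n) of the right factor matter. `hδ` leaves out the term that
is absent from F because b_{ν+1,ν+1} is trivial. -/
theorem hasContr_E_F₂ (hħ : ħ ≠ 0) {μ m ν n : ℕ} (hm : m ∈ Finset.Icc 1 μ)
    (hn : n ∈ Finset.Icc (ν + 1) N) (hμ : μ < N) (hν : 1 ≤ ν) (ε : Bool) {δ : Bool}
    (hδ : δ = false → ν + 1 < n) :
    HasContr ħ k (ETerm N ħ μ m ε) (FTerm₂ N ħ k ν n δ) (listEF₂ k μ m ε ν n δ) := by
  rw [Finset.mem_Icc] at hm hn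
  refine (hasProfile_ETerm hħ μ m ε).hasContr hħ (hasProfile_FTerm₂ hħ ν n δ) fun t => ?_
  generalize (ħ * (t : ℝ) : ℂ) = x
  simp only [pairing_add_left, pairing_add_right, pairing_single_right, Pi.add_apply,
    lamPairing_zero_left, hbE, single₂, listEF₂]
  rcases (by omega : n = μ ∨ n = μ + 1 ∨ (n ≠ μ ∧ n ≠ μ + 1)) with h1 | h1 | h1
  · rcases (by omega : ν + 1 < m ∨ m = ν + 1 ∨ m = ν ∨ m < ν) with h2 | h2 | h2 | h2 <;>
    rcases (by omega : n = ν + 1 ∨ ν + 1 < n) with h | h <;> first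
    | omega
    | simp (disch := omega) only [if_pos, if_neg, sg, sub_mul, add_mul, neg_mul, mul_neg, ← exp_add,
        zero_mul, true_and, and_true, expSum_nil, expSum_cons]
      try subst h1
      try subst h2
      try subst h
      cases ε <;> cases δ <;> first
      | exact absurd (hδ rfl) (by omega)
      | try simp only [if_true, if_false, reduceCtorEq, and_true, and_false, expSum_nil, expSum_cons,
          neg_mul, mul_neg, ← exp_add, Nat.cast_add, Nat.cast_one]
        try ring_nf
        try simp only [← exp_add]
        try ring_nf
  · rcases (by omega : ν + 1 < m ∨ m = ν + 1 ∨ m = ν ∨ m < ν) with h2 | h2 | h2 | h2 <;>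
    rcases (by omega : μ = ν ∨ ν < μ) with h | h <;> first
    | omega
    | simp (disch := omega) only [if_pos, if_neg, sg, sub_mul, add_mul, neg_mul, mul_neg, ← exp_add,
        zero_mul, true_and, and_true, expSum_nil, expSum_cons]
      try subst h1
      try subst h2
      try subst h
      cases ε <;> cases δ <;> first
      | exact absurd (hδ rfl) (by omega)
      | try simp only [if_true, if_false, reduceCtorEq, and_true, and_false, expSum_nil, expSum_cons,
          neg_mul, mul_neg, ← exp_add, Nat.cast_add, Nat.cast_one]
        try ring_nf
        try simp only [← exp_add]
        try ring_nf
  · rcases eq_or_ne μ ν with h | h <;>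
    simp (disch := omega) only [if_pos, if_neg, expSum_nil, zero_mul] <;> simp

end FreeBoson

/-! ### Further contractions in which at most one factor has a tail -/

namespace FreeBoson

set_option linter.unusedSimpArgs false

variable {N : ℕ} {ħ : ℝ} {k : ℂ}

/-- The exponents are opposite to those of the reversed order, so both orders have the same rational
function. For this reason E and F commute up to continuation. -/
theorem hasContr_F₂_E (hħ : ħ ≠ 0) {μ m ν n : ℕ} (hm : m ∈ Finset.Icc (μ + 1) N)
    (hn : n ∈ Finset.Icc 1 ν) (hν : ν < N) (hμ : 1 ≤ μ) {ε : Bool}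
    (hε : ε = false → μ + 1 < m) (δ : Bool) :
    HasContr ħ k (FTerm₂ N ħ k μ m ε) (ETerm N ħ ν n δ) (barList (listEF₂ k ν n δ μ m ε)) := by
  rw [Finset.mem_Icc] at hm hn
  refine (hasProfile_FTerm₂ hħ μ m ε).hasContr hħ (hasProfile_ETerm hħ ν n δ) fun t => ?_
  generalize (ħ * (t : ℝ) : ℂ) = x
  simp only [pairing_add_left, pairing_add_right, pairing_single_right, pairing_single_left,
    Pi.add_apply, lamPairing_zero_right, hbF₂, single₂, listEF₂]
  rcases (by omega : n = μ ∨ n = μ + 1 ∨ (n ≠ μ ∧ n ≠ μ + 1)) with h1 | h1 | h1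
  · rcases (by omega : ν + 1 < m ∨ m = ν + 1 ∨ m = ν ∨ m < ν) with h2 | h2 | h2 | h2 <;>
    rcases (by omega : ν = μ ∨ μ < ν) with h | h <;> first
    | omega
    | simp (disch := omega) only [if_pos, if_neg, sg, sub_mul, add_mul, neg_mul, mul_neg, ← exp_add,
        zero_mul, mul_zero, add_zero, neg_zero, ite_self, true_and, and_true, barList_nil, barList_cons, expSum_nil, expSum_cons]
      try subst h1
      try subst h2
      try subst h
      cases ε <;> cases δ <;> first
      | exact absurd (hε rfl) (by omega)
      | try simp only [if_true, if_false, reduceCtorEq, and_true, and_false, barList_nil, barList_cons,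
          expSum_nil, expSum_cons, neg_mul, mul_neg, ← exp_add, Nat.cast_add, Nat.cast_one,
          lt_irrefl, false_or, or_false, or_true, add_zero, zero_add, neg_zero, zero_mul, mul_zero, ite_self]
        try ring_nf
        try simp only [← exp_add]
        try ring_nf
  · rcases (by omega : ν + 1 < m ∨ m = ν + 1 ∨ m = ν ∨ m < ν) with h2 | h2 | h2 | h2 <;>
    rcases (by omega : n = ν ∨ n < ν) with h | h <;> first
    | omega
    | simp (disch := omega) only [if_pos, if_neg, sg, sub_mul, add_mul, neg_mul, mul_neg, ← exp_add,
        zero_mul, mul_zero, add_zero, neg_zero, ite_self, true_and, and_true, barList_nil, barList_cons, expSum_nil, expSum_cons]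
      try subst h1
      try subst h2
      try subst h
      cases ε <;> cases δ <;> first
      | exact absurd (hε rfl) (by omega)
      | try simp only [if_true, if_false, reduceCtorEq, and_true, and_false, barList_nil, barList_cons,
          expSum_nil, expSum_cons, neg_mul, mul_neg, ← exp_add, Nat.cast_add, Nat.cast_one,
          lt_irrefl, false_or, or_false, or_true, add_zero, zero_add, neg_zero, zero_mul, mul_zero, ite_self]
        try ring_nf
        try simp only [← exp_add]
        try ring_nf
  · rcases eq_or_ne ν μ with h | h <;>
    simp (disch := omega) only [if_pos, if_neg, expSum_nil, zero_mul, barList_nil] <;> simp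

/-- The contractions of the terms of `E_μ(u)` and of the first sum in `F_ν(v)`. -/
noncomputable def listEF₁ (μ m : ℕ) (ε : Bool) (ν n : ℕ) (δ : Bool) : List (ℂ × ℂ) :=
  if μ = ν then
    if n = m ∧ ε = true ∧ δ = true then [(-m, 1 - m)]
    else if n = m ∧ ε = false ∧ δ = false then [(1 - m, -m)] else []
  else if ν = μ + 1 then
    if n = m ∧ ε = true ∧ δ = true then [(1 / 2 - m, -1 / 2 - m)]
    else if n = m ∧ ε = false ∧ δ = false then [(1 / 2 - m, 3 / 2 - m)] else []
  else []

theorem hasContr_F₁_E (hħ : ħ ≠ 0) {μ m ν n : ℕ} (hm : m ∈ Finset.Icc 1 μ)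
    (hn : n ∈ Finset.Icc 1 ν) (hμ : μ < N) (hν : ν < N) {ε : Bool}
    (hε : ε = true → m < μ) (δ : Bool) :
    HasContr ħ k (FTerm₁ N ħ k μ m ε) (ETerm N ħ ν n δ) (barList (listEF₁ ν n δ μ m ε)) := by
  rw [Finset.mem_Icc] at hm hn
  refine (hasProfile_FTerm₁ hħ μ m ε).hasContr hħ (hasProfile_ETerm hħ ν n δ) fun t => ?_
  generalize (ħ * (t : ℝ) : ℂ) = x
  simp only [pairing_add_left, pairing_add_right, pairing_single_right, pairing_single_left,
    Pi.add_apply, lamPairing_zero_left, single₂, listEF₁]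
  rcases eq_or_ne n m with h1 | h1
  · rcases (by omega : μ = ν ∨ μ = ν + 1 ∨ ν = μ + 1 ∨ (μ ≠ ν ∧ μ ≠ ν + 1 ∧ ν ≠ μ + 1))
      with h | h | h | h <;>
    rcases (by omega : n = ν ∨ n < ν) with h2 | h2 <;>
    rcases (by omega : m = μ ∨ m < μ) with h3 | h3 <;> first
    | omega
    | simp (disch := omega) only [if_pos, if_neg, sg, sub_mul, add_mul, neg_mul, mul_neg, ← exp_add,
        zero_mul, mul_zero, add_zero, neg_zero, ite_self, true_and, and_true, barList_nil, barList_cons, expSum_nil, expSum_cons]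
      try subst h1
      try subst h
      cases ε <;> cases δ <;> first
      | exact absurd (hε rfl) (by omega)
      | try simp only [if_true, if_false, reduceCtorEq, and_true, and_false, barList_nil, barList_cons,
          expSum_nil, expSum_cons, neg_mul, mul_neg, ← exp_add, Nat.cast_add, Nat.cast_one,
          lt_irrefl, false_or, or_false, or_true, add_zero, zero_add, neg_zero, zero_mul, mul_zero, ite_self]
        try ring_nf
        try simp only [← exp_add]
        try ring_nf
  · simp (disch := omega) only [if_neg, expSum_nil, zero_mul, barList_nil, ite_self]
    simp

/-- The contractions of the terms of the first sum in `F_μ(u)` and of the second sum in `F_ν(v)`. -/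
noncomputable def listF₁F₂ (k : ℂ) (μ m : ℕ) (ε : Bool) (ν n : ℕ) (δ : Bool) : List (ℂ × ℂ) :=
  if μ ≤ ν then []
  else if m = ν ∧ n = μ ∧ ε = true then [((μ + ν) / 2 + k, (μ + ν) / 2 + k - 1)]
  else if m = ν + 1 ∧ n = μ ∧ ε = false ∧ δ = false then
    [((μ + ν) / 2 + k, (μ + ν) / 2 + k - 1)]
  else if m = ν + 1 ∧ n = μ ∧ ε = true ∧ δ = true then [((μ + ν) / 2 + k, (μ + ν) / 2 + k + 1)]
  else if m = ν + 1 ∧ n = μ + 1 ∧ δ = false then [((μ + ν) / 2 + k, (μ + ν) / 2 + k + 1)]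
  else []

/-- In this order λ does not contribute, since F₁ contains λ^- only and λ^- has no annihilation
part. -/
theorem hasContr_F₁_F₂ (hħ : ħ ≠ 0) {μ m ν n : ℕ} (hm : m ∈ Finset.Icc 1 μ)
    (hn : n ∈ Finset.Icc (ν + 1) N) (hμ : μ < N) (hν : 1 ≤ ν) {ε δ : Bool}
    (hε : ε = true → m < μ) (hδ : δ = false → ν + 1 < n) :
    HasContr ħ k (FTerm₁ N ħ k μ m ε) (FTerm₂ N ħ k ν n δ) (listF₁F₂ k μ m ε ν n δ) := by
  rw [Finset.mem_Icc] at hm hn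
  refine (hasProfile_FTerm₁ hħ μ m ε).hasContr hħ (hasProfile_FTerm₂ hħ ν n δ) fun t => ?_
  generalize (ħ * (t : ℝ) : ℂ) = x
  simp only [pairing_add_left, pairing_add_right, pairing_single_right, pairing_single_left,
    Pi.add_apply, lamPairing_zero_left, single₂, listF₁F₂]
  rcases (by omega : m = ν ∨ m = ν + 1 ∨ (m ≠ ν ∧ m ≠ ν + 1)) with h1 | h1 | h1
  · rcases (by omega : n = μ ∨ n = μ + 1 ∨ (n ≠ μ ∧ n ≠ μ + 1)) with h2 | h2 | h2 <;>
    rcases (by omega : m = μ ∨ m < μ) with h3 | h3 <;>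
    rcases (by omega : n = ν + 1 ∨ ν + 1 < n) with h | h <;> first
    | omega
    | simp (disch := omega) only [if_pos, if_neg, sg, sub_mul, add_mul, neg_mul, mul_neg, ← exp_add,
        zero_mul, mul_zero, add_zero, neg_zero, ite_self, true_and, and_true, barList_nil, barList_cons, expSum_nil, expSum_cons]
      try subst h1
      try subst h2
      try subst h
      cases ε <;> cases δ <;> first
      | exact absurd (hε rfl) (by omega)
      | exact absurd (hδ rfl) (by omega)
      | try simp only [if_true, if_false, reduceCtorEq, and_true, and_false, barList_nil, barList_cons,
          expSum_nil, expSum_cons, neg_mul, mul_neg, ← exp_add, Nat.cast_add, Nat.cast_one,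
          lt_irrefl, false_or, or_false, or_true, add_zero, zero_add, neg_zero, zero_mul, mul_zero, ite_self]
        try ring_nf
        try simp only [← exp_add]
        try ring_nf
  · rcases (by omega : n = μ ∨ n = μ + 1 ∨ (n ≠ μ ∧ n ≠ μ + 1)) with h2 | h2 | h2 <;>
    rcases (by omega : m = μ ∨ m < μ) with h3 | h3 <;>
    rcases (by omega : n = ν + 1 ∨ ν + 1 < n) with h | h <;> first
    | omega
    | simp (disch := omega) only [if_pos, if_neg, sg, sub_mul, add_mul, neg_mul, mul_neg, ← exp_add,
        zero_mul, mul_zero, add_zero, neg_zero, ite_self, true_and, and_true, barList_nil, barList_cons, expSum_nil, expSum_cons]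
      try subst h1
      try subst h2
      try subst h
      cases ε <;> cases δ <;> first
      | exact absurd (hε rfl) (by omega)
      | exact absurd (hδ rfl) (by omega)
      | try simp only [if_true, if_false, reduceCtorEq, and_true, and_false, barList_nil, barList_cons,
          expSum_nil, expSum_cons, neg_mul, mul_neg, ← exp_add, Nat.cast_add, Nat.cast_one,
          lt_irrefl, false_or, or_false, or_true, add_zero, zero_add, neg_zero, zero_mul, mul_zero, ite_self]
        try ring_nf
        try simp only [← exp_add]
        try ring_nf
  · rcases le_or_gt μ ν with h | h <;>
    simp (disch := omega) only [if_pos, if_neg, expSum_nil, zero_mul, mul_zero, ite_self] <;> simp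

/-- The contractions of the terms of the second sums in `F_μ(u)` and `F_ν(v)`. -/
noncomputable def listF₂F₂ (μ m : ℕ) (ε : Bool) (ν n : ℕ) (δ : Bool) : List (ℂ × ℂ) :=
  if μ = ν then
    if m < n ∨ n = m ∧ ε = false ∧ δ = true then [(-1, 1)]
    else if n = m ∧ ε = δ then [(-1, 0)] else []
  else if μ = ν + 1 then if m < n ∨ n = m ∧ δ = true then [(1 / 2, -1 / 2)] else []
  else if ν = μ + 1 then if m < n ∨ n = m ∧ ε = false then [(1 / 2, -1 / 2)] else []
  else []

theorem hasContr_F₂_F₂ (hħ : ħ ≠ 0) {μ m ν n : ℕ} (hm : m ∈ Finset.Icc (μ + 1) N)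
    (hn : n ∈ Finset.Icc (ν + 1) N) (hμ : 1 ≤ μ) (hν : 1 ≤ ν) {ε δ : Bool}
    (hε : ε = false → μ + 1 < m) (hδ : δ = false → ν + 1 < n) :
    HasContr ħ k (FTerm₂ N ħ k μ m ε) (FTerm₂ N ħ k ν n δ) (listF₂F₂ μ m ε ν n δ) := by
  rw [Finset.mem_Icc] at hm hn
  refine (hasProfile_FTerm₂ hħ μ m ε).hasContr hħ (hasProfile_FTerm₂ hħ ν n δ) fun t => ?_
  generalize (ħ * (t : ℝ) : ℂ) = x
  simp only [pairing_add_left, pairing_add_right, pairing_single_right, pairing_single_left,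
    Pi.add_apply, lamPairing_zero_right, hbF₂, single₂, listF₂F₂]
  rcases lt_trichotomy n m with h1 | h1 | h1 <;>
  rcases (by omega : μ = ν ∨ μ = ν + 1 ∨ ν = μ + 1 ∨ (μ ≠ ν ∧ μ ≠ ν + 1 ∧ ν ≠ μ + 1))
    with h | h | h | h <;>
  rcases (by omega : n = ν + 1 ∨ ν + 1 < n) with h2 | h2 <;> first
  | omega
  | simp (disch := omega) only [if_pos, if_neg, sg, sub_mul, add_mul, neg_mul, mul_neg, ← exp_add,
      zero_mul, mul_zero, add_zero, neg_zero, ite_self, true_and, and_true, barList_nil, barList_cons, expSum_nil, expSum_cons]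
    try subst h1
    try subst h
    try subst h2
    try subst h3
    cases ε <;> cases δ <;> first
    | exact absurd (hε rfl) (by omega)
    | exact absurd (hδ rfl) (by omega)
    | try simp only [if_true, if_false, reduceCtorEq, and_true, and_false, barList_nil, barList_cons,
        expSum_nil, expSum_cons, neg_mul, mul_neg, ← exp_add, Nat.cast_add, Nat.cast_one,
        lt_irrefl, false_or, or_false, or_true, add_zero, zero_add, neg_zero, zero_mul, mul_zero, ite_self]
      try ring_nf
      try simp only [← exp_add]
      try ring_nf

/-- The contractions of the terms of the first sums in `F_μ(u)` and `F_ν(v)`. -/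
noncomputable def listF₁F₁ (μ m : ℕ) (ε : Bool) (ν n : ℕ) (δ : Bool) : List (ℂ × ℂ) :=
  if μ = ν then
    if n < m ∨ n = m ∧ ε = true ∧ δ = false then [(-1, 1)]
    else if n = m ∧ ε = δ then [(-1, 0)] else []
  else if μ = ν + 1 then if n < m ∨ n = m ∧ ε = true then [(1 / 2, -1 / 2)] else []
  else if ν = μ + 1 then if n < m ∨ n = m ∧ δ = false then [(1 / 2, -1 / 2)] else []
  else []

theorem hasContr_F₁_F₁ (hħ : ħ ≠ 0) {μ m ν n : ℕ} (hm : m ∈ Finset.Icc 1 μ)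
    (hn : n ∈ Finset.Icc 1 ν) (hμ : μ < N) (hν : ν < N) {ε δ : Bool}
    (hε : ε = true → m < μ) (hδ : δ = true → n < ν) :
    HasContr ħ k (FTerm₁ N ħ k μ m ε) (FTerm₁ N ħ k ν n δ) (listF₁F₁ μ m ε ν n δ) := by
  rw [Finset.mem_Icc] at hm hn
  refine (hasProfile_FTerm₁ hħ μ m ε).hasContr hħ (hasProfile_FTerm₁ hħ ν n δ) fun t => ?_
  generalize (ħ * (t : ℝ) : ℂ) = x
  simp only [pairing_add_left, pairing_add_right, pairing_single_right, pairing_single_left,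
    Pi.add_apply, lamPairing_zero_left, gbF₁, single₂, listF₁F₁]
  rcases lt_trichotomy n m with h1 | h1 | h1 <;>
  rcases (by omega : μ = ν ∨ μ = ν + 1 ∨ ν = μ + 1 ∨ (μ < ν ∧ ν ≠ μ + 1) ∨ (ν < μ ∧ μ ≠ ν + 1))
    with h | h | h | h | h <;>
  rcases (by omega : m = μ ∨ m < μ) with h2 | h2 <;>
  rcases (by omega : m < ν ∨ m = ν ∨ m = ν + 1 ∨ ν + 1 < m) with h3 | h3 | h3 | h3 <;> first
  | omega
  | simp (disch := omega) only [if_pos, if_neg, sg, sub_mul, add_mul, neg_mul, mul_neg, ← exp_add,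
      zero_mul, mul_zero, add_zero, neg_zero, ite_self, true_and, and_true, barList_nil, barList_cons, expSum_nil, expSum_cons]
    try subst h1
    try subst h
    try subst h2
    try subst h3
    cases ε <;> cases δ <;> first
    | exact absurd (hε rfl) (by omega)
    | exact absurd (hδ rfl) (by omega)
    | try simp only [if_true, if_false, reduceCtorEq, and_true, and_false, barList_nil, barList_cons,
        expSum_nil, expSum_cons, neg_mul, mul_neg, ← exp_add, Nat.cast_add, Nat.cast_one,
        lt_irrefl, false_or, or_false, or_true, add_zero, zero_add, neg_zero, zero_mul, mul_zero, ite_self]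
      try ring_nf
      try simp only [← exp_add]
      try ring_nf

end FreeBoson

/-! ### Contractions of E with the first sum of F, and the contribution of λ -/

namespace FreeBoson

set_option linter.unusedSimpArgs false

variable {N : ℕ} {ħ : ℝ} {k : ℂ}

theorem pairing_congr_left {h h' : ℕ → ℕ → ℂ} (g : ℕ → ℕ → ℂ)
    (e : ∀ r c, 1 ≤ r → r < c → c ≤ N → h r c = h' r c) : pairing N h g = pairing N h' g := by
  refine Finset.sum_congr rfl fun r hr => Finset.sum_congr rfl fun c hc => ?_
  split_ifs with hrc
  · rw [e r c (Finset.mem_Icc.1 hr).1 hrc (Finset.mem_Icc.1 hc).2]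
  · rfl

theorem hbE_one (μ : ℕ) (x : ℂ) {r c : ℕ} (hr : 1 ≤ r) :
    hbE μ 1 x r c = (single₂ 1 μ (-1) + single₂ 1 (μ + 1) (exp (1 / 2 * x))) r c := by
  simp only [hbE, single₂, Pi.add_apply]
  rcases eq_or_ne r 1 with h | h <;> rcases eq_or_ne c μ with h1 | h1 <;>
    rcases eq_or_ne c (μ + 1) with h2 | h2 <;> first
  | omega
  | simp (disch := omega) only [if_pos, if_neg, true_and]
    try norm_num

/-- The difference is supported on four entries: the new end in row m + 1, and the replacement of
the old end in row m by a piece of tail. This is what an induction on `m` needs. -/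
theorem hbE_succ (μ m : ℕ) (x : ℂ) :
    hbE μ (m + 1) x = hbE μ m x + (single₂ (m + 1) μ (-exp (-(m : ℂ) / 2 * x))
      + single₂ (m + 1) (μ + 1) (exp ((1 - (m : ℂ)) / 2 * x))
      + single₂ m μ (exp (-((m : ℂ) + 1) / 2 * x)) + single₂ m (μ + 1) (-exp (-(m : ℂ) / 2 * x))) := by
  funext r c
  simp only [hbE, single₂, Pi.add_apply]
  rcases (by omega : r < m ∨ r = m ∨ r = m + 1 ∨ m + 1 < r) with h | h | h | h <;>
  rcases eq_or_ne c μ with h1 | h1 <;> rcases eq_or_ne c (μ + 1) with h2 | h2 <;> first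
  | omega
  | simp (disch := omega) only [if_pos, if_neg, true_and, sg, sub_mul, ← exp_add]
    try subst h
    try push_cast
    try ring_nf

/-- The contribution of `b` to the contractions of the terms of `E_μ` and of the first sum
in `F_ν`. -/
noncomputable def valueEF₁ (μ m ν n : ℕ) (x : ℂ) : ℂ :=
  if n = m then
    if μ = ν then -exp (-(m : ℂ) * x) - if m < μ then exp ((1 - (m : ℂ)) * x) else 0
    else if ν = μ + 1 ∨ μ = ν + 1 then exp ((1 / 2 - (m : ℂ)) * x) else 0
  else 0

set_option maxHeartbeats 1000000 in
-- Tail meets tail, so single evaluations are not enough. Enlarging `m` by one adds four evaluations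
-- of `gbF₁`, and the sums of these telescope.
theorem pairing_hbE_gbF₁ {μ m ν n : ℕ} (hm : 1 ≤ m) (hmμ : m ≤ μ) (hn : 1 ≤ n) (hnν : n ≤ ν)
    (hμ : μ < N) (hν : ν < N) (x : ℂ) :
    pairing N (hbE μ m x) (gbF₁ ν n x) = valueEF₁ μ m ν n x := by
  induction m, hm using Nat.le_induction with
  | base =>
    rw [pairing_congr_left _ fun r c hr _ _ => hbE_one μ x hr]
    simp only [pairing_add_left, pairing_single_left, gbF₁, valueEF₁]
    rcases (by omega : 1 < n ∨ n = 1) with h1 | h1 <;>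
    rcases (by omega : μ = ν ∨ μ = ν + 1 ∨ ν = μ + 1 ∨ (μ < ν ∧ ν ≠ μ + 1) ∨ (ν < μ ∧ μ ≠ ν + 1))
      with h | h | h | h | h <;>
    rcases (by omega : μ = 1 ∨ 1 < μ) with h2 | h2 <;>
    rcases (by omega : ν = 1 ∨ 1 < ν) with h3 | h3 <;> first
    | omega
    | simp (disch := omega) only [if_pos, if_neg, sg, sub_mul, add_mul, neg_mul, mul_neg, ← exp_add,
        zero_mul, mul_zero, add_zero, neg_zero, ite_self, true_and, and_true]
      try subst h1
      try subst h
      try subst h3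
      try subst h2
      try push_cast
      try ring_nf
      try simp only [pow_two, ← exp_add]
      try ring_nf
  | succ m hm ih =>
    rw [hbE_succ, pairing_add_left, ih (by omega)]
    simp only [pairing_add_left, pairing_single_left, gbF₁, valueEF₁]
    rcases (by omega : n < m ∨ n = m ∨ n = m + 1 ∨ m + 1 < n) with h1 | h1 | h1 | h1 <;>
    rcases (by omega : μ = ν ∨ μ = ν + 1 ∨ ν = μ + 1 ∨ (μ < ν ∧ ν ≠ μ + 1) ∨ (ν < μ ∧ μ ≠ ν + 1))
      with h | h | h | h | h <;>
    rcases (by omega : m + 1 < μ ∨ m + 1 = μ) with h2 | h2 <;>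
    rcases (by omega : m + 1 < ν ∨ m + 1 = ν ∨ m = ν ∨ m = ν + 1 ∨ ν + 1 < m)
      with h3 | h3 | h3 | h3 | h3 <;> first
    | omega
    | simp (disch := omega) only [if_pos, if_neg, sg, sub_mul, add_mul, neg_mul, mul_neg, ← exp_add,
        zero_mul, mul_zero, add_zero, neg_zero, ite_self, true_and, and_true]
      try subst h1
      try subst h
      try subst h3
      try subst h2
      try push_cast
      try ring_nf
      try simp only [pow_two, ← exp_add]
      try ring_nf

theorem hasContr_E_F₁ (hħ : ħ ≠ 0) {μ m ν n : ℕ} (hm : m ∈ Finset.Icc 1 μ)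
    (hn : n ∈ Finset.Icc 1 ν) (hμ : μ < N) (hν : ν < N) (ε : Bool) {δ : Bool}
    (hδ : δ = true → n < ν) :
    HasContr ħ k (ETerm N ħ μ m ε) (FTerm₁ N ħ k ν n δ) (listEF₁ μ m ε ν n δ) := by
  rw [Finset.mem_Icc] at hm hn
  refine (hasProfile_ETerm hħ μ m ε).hasContr hħ (hasProfile_FTerm₁ hħ ν n δ) fun t => ?_
  generalize (ħ * (t : ℝ) : ℂ) = x
  rw [pairing_hbE_gbF₁ hm.1 hm.2 hn.1 hn.2 hμ hν]
  simp only [pairing_add_left, pairing_add_right, pairing_single_right, lamPairing_zero_left,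
    Pi.add_apply, single₂, listEF₁, valueEF₁]
  rcases eq_or_ne n m with h1 | h1
  · rcases (by omega : μ = ν ∨ μ = ν + 1 ∨ ν = μ + 1 ∨ (μ ≠ ν ∧ μ ≠ ν + 1 ∧ ν ≠ μ + 1))
      with h | h | h | h <;>
    rcases (by omega : m < μ ∨ m = μ) with h2 | h2 <;>
    rcases (by omega : m < ν ∨ m = ν) with h3 | h3 <;> first
    | omega
    | simp (disch := omega) only [if_pos, if_neg, sub_mul, add_mul, neg_mul, mul_neg, ← exp_add,
        zero_mul, mul_zero, add_zero, neg_zero, ite_self, true_and, and_true]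
      try subst h1
      cases ε <;> cases δ <;> first
      | exact absurd (hδ rfl) (by omega)
      | simp only [if_true, if_false, reduceCtorEq, and_true, and_false, expSum_nil, expSum_cons,
          ← exp_add]
        try ring_nf
  · have h2 : m ≠ n := fun h => h1 h.symm
    simp only [h1, h2, false_and, if_false, expSum_nil, zero_mul, add_zero, neg_zero, ite_self]
    try simp

/-- Source of the factor 1 - e^{-(k+N)x}, the only place where the level enters the λ part. -/
theorem sinh_level (x : ℂ) : exp (-(k + N) / 2 * x) * (2 * sinh ((k + N) / 2 * x))
    = 1 - exp (-(k + N) * x) := by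
  rw [sinh, mul_div_cancel₀ _ two_ne_zero, mul_sub, ← exp_add, ← exp_add]
  ring_nf
  rw [exp_zero]

/-- The contribution of the `λ_μ` to the contractions of the terms of the currents `F`. -/
noncomputable def valueLam (N : ℕ) (k : ℂ) (μ ν : ℕ) (x : ℂ) : ℂ :=
  if μ = ν then -((exp x - exp (-x)) * (1 - exp (-(k + N) * x)))
  else if μ = ν + 1 ∨ ν = μ + 1 then sg x * (1 - exp (-(k + N) * x)) else 0

theorem sum_fin_single₁ {m : ℕ} (h1 : 1 ≤ m) (hm : m ≤ N) (a : ℂ) (F : Fin N → ℂ) :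
    ∑ j : Fin N, single₁ m a (j + 1) * F j = a * F ⟨m - 1, by omega⟩ := by
  rw [Finset.sum_eq_single (⟨m - 1, by omega⟩ : Fin N)]
  · simp only [single₁]
    rw [if_pos (by omega)]
  · intro j _ hj
    simp only [single₁]
    rw [if_neg, zero_mul]
    intro h
    exact hj (Fin.ext (by simp only; omega))
  · simp

theorem lamPairing_single {μ ν : ℕ} (h1 : 1 ≤ μ) (hμ : μ ≤ N) (h2 : 1 ≤ ν) (hν : ν ≤ N) (a b x : ℂ) :
    lamPairing N k (single₁ μ a) (single₁ ν b) x = - (a * b *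
      (if μ = ν then sinh ((k + N) / 2 * x) * sinh (((N : ℂ) - 1) / 2 * x) / sinh ((N : ℂ) / 2 * x) /
        sinh (x / 2)
      else - (sinh ((k + N) / 2 * x) / sinh ((N : ℂ) / 2 * x)
        * exp ((if ν < μ then 1 else -1) * ((N : ℂ) / 2 * x))))) := by
  simp only [lamPairing, mul_assoc, sum_fin_single₁ h1 hμ, ← Finset.mul_sum, sum_fin_single₁ h2 hν,
    Fin.mk.injEq, Fin.mk_lt_mk]
  have e : μ - 1 = ν - 1 ↔ μ = ν := by omega
  have e' : ν - 1 < μ - 1 ↔ ν < μ := by omega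
  simp only [e, e']

theorem lamPairing_sub_left (h h' g : ℕ → ℂ) (x : ℂ) :
    lamPairing N k (h - h') g x = lamPairing N k h g x - lamPairing N k h' g x := by
  simp only [lamPairing, Pi.sub_apply, sub_mul, Finset.sum_sub_distrib]
  ring

theorem lamPairing_sub_right (h g g' : ℕ → ℂ) (x : ℂ) :
    lamPairing N k h (g - g') x = lamPairing N k h g x - lamPairing N k h g' x := by
  simp only [lamPairing, Pi.sub_apply, sub_mul, mul_sub, Finset.sum_sub_distrib]
  ring

/-- Both arguments are differences over neighbouring indices, so a mixed second difference of the λ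
commutator is computed. It vanishes for distant indices because the commutator depends there on the
order of the indices only; otherwise sinh(Nx/2) cancels. -/
theorem lamPairing_F (hħ : ħ ≠ 0) {μ ν : ℕ} (h1 : 1 ≤ μ) (hμ : μ < N) (h2 : 1 ≤ ν) (hν : ν < N)
    (t : HalfLine) {x : ℂ} (hx : x = ħ * (t : ℝ)) :
    lamPairing N k
      (single₁ μ (sg x * exp ((-(3 * k + N) / 4 - μ / 2) * x))
        - single₁ (μ + 1) (sg x * exp ((-(3 * k + N) / 4 - μ / 2) * x)))
      (single₁ ν (sg x * exp (((k - N) / 4 + ν / 2) * x))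
        - single₁ (ν + 1) (sg x * exp (((k - N) / 4 + ν / 2) * x))) x = valueLam N k μ ν x := by
  have hs : sinh (x / 2) ≠ 0 := by
    have := sg_ne_zero hħ t
    rw [← hx, sg_eq] at this
    exact right_ne_zero_of_mul this
  have hN : sinh ((N : ℂ) / 2 * x) ≠ 0 := by
    have hN : (N : ℝ) ≠ 0 := by
      have : N ≠ 0 := by omega
      exact_mod_cast this
    have h := sinh_ofReal_ne_zero (x := (N : ℝ) / 2 * (ħ * t))
      (mul_ne_zero (div_ne_zero hN two_ne_zero) (mul_ne_zero hħ (ne_of_gt t.2)))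
    rw [hx]
    push_cast at h
    exact h
  have eN : sinh (((N : ℂ) - 1) / 2 * x) = sinh ((N : ℂ) / 2 * x) * cosh (x / 2)
      - cosh ((N : ℂ) / 2 * x) * sinh (x / 2) := by
    rw [← sinh_sub]
    ring_nf
  have e1 : exp (1 * ((N : ℂ) / 2 * x)) = cosh ((N : ℂ) / 2 * x) + sinh ((N : ℂ) / 2 * x) := by
    rw [cosh_add_sinh, one_mul]
  have e2 : exp (-1 * ((N : ℂ) / 2 * x)) = cosh ((N : ℂ) / 2 * x) - sinh ((N : ℂ) / 2 * x) := by
    rw [cosh_sub_sinh, neg_one_mul]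
  simp only [lamPairing_sub_left, lamPairing_sub_right, lamPairing_single h1 hμ.le h2 hν.le,
    lamPairing_single h1 hμ.le (Nat.succ_pos ν) hν, lamPairing_single (Nat.succ_pos μ) hμ h2 hν.le,
    lamPairing_single (Nat.succ_pos μ) hμ (Nat.succ_pos ν) hν, valueLam]
  have ex : ∀ s : ℂ, exp (s * x + x / 2) = exp (s * x) * (cosh (x / 2) + sinh (x / 2)) := fun s => by
    rw [cosh_add_sinh, exp_add]
  have level := sinh_level (N := N) (k := k) x
  rcases (by omega : μ = ν ∨ μ = ν + 1 ∨ ν = μ + 1 ∨ (μ < ν ∧ ν ≠ μ + 1) ∨ (ν < μ ∧ μ ≠ ν + 1))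
    with h | h | h | h | h
  · have eq : exp ((-(3 * k + N) / 4 - μ / 2) * x) * exp (((k - N) / 4 + ν / 2) * x)
        = exp (-(k + N) / 2 * x) := by
      rw [← exp_add, h]; ring_nf
    have ed : exp x - exp (-x) = 4 * (sinh (x / 2) * cosh (x / 2)) := by
      have := sinh_two_mul (x / 2)
      rw [mul_div_cancel₀ _ two_ne_zero] at this
      rw [show exp x - exp (-x) = 2 * sinh x by rw [sinh]; ring, this]
      ring
    simp (disch := omega) only [if_pos, if_neg, e1, e2, eN]
    rw [ed, ← level, ← eq, sg_eq]
    generalize sinh ((N : ℂ) / 2 * x) = a at hN ⊢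
    generalize sinh (x / 2) = b at hs ⊢
    field_simp
    ring
  · have eq : exp ((-(3 * k + N) / 4 - μ / 2) * x) * exp (((k - N) / 4 + ν / 2) * x)
        * (cosh (x / 2) + sinh (x / 2)) = exp (-(k + N) / 2 * x) := by
      rw [cosh_add_sinh, ← exp_add, ← exp_add, h]
      push_cast
      ring_nf
    have ec := cosh_sq (x / 2)
    simp (disch := omega) only [if_pos, if_neg, e1, e2, eN]
    rw [← level, ← eq, sg_eq]
    generalize sinh ((N : ℂ) / 2 * x) = a at hN ⊢
    generalize sinh (x / 2) = b at hs ⊢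
    field_simp
    ring
  · have eq : exp ((-(3 * k + N) / 4 - μ / 2) * x) * exp (((k - N) / 4 + ν / 2) * x)
        * (cosh (x / 2) - sinh (x / 2)) = exp (-(k + N) / 2 * x) := by
      rw [cosh_sub_sinh, ← exp_add, ← exp_add, h]
      push_cast
      ring_nf
    simp (disch := omega) only [if_pos, if_neg, e1, e2, eN]
    rw [← level, ← eq, sg_eq]
    generalize sinh ((N : ℂ) / 2 * x) = a at hN ⊢
    generalize sinh (x / 2) = b at hs ⊢
    field_simp
    ring
  · simp (disch := omega) only [if_neg]
    ring
  · simp (disch := omega) only [if_pos, if_neg]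
    ring

theorem hbF₂_top (μ : ℕ) (x : ℂ) {r c : ℕ} (hc : c ≤ N) :
    hbF₂ k μ N x r c = (single₂ μ N (-exp ((-k - ((N : ℂ) + 1) / 2) * x))
      + single₂ (μ + 1) N (exp ((-k - (N : ℂ) / 2) * x))) r c := by
  simp only [hbF₂, single₂, Pi.add_apply]
  rcases eq_or_ne c N with h | h <;> rcases eq_or_ne r μ with h1 | h1 <;>
    rcases eq_or_ne r (μ + 1) with h2 | h2 <;> first
  | omega
  | simp (disch := omega) only [if_pos, if_neg, true_and, sg, sub_mul, add_mul, neg_mul, ← exp_add]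
    try subst h
    try push_cast
    try ring_nf

theorem hbF₂_succ (μ m : ℕ) (x : ℂ) :
    hbF₂ k μ m x = hbF₂ k μ (m + 1) x + (single₂ μ m (-exp ((-k - ((m : ℂ) + 1) / 2) * x))
      + single₂ μ (m + 1) (exp ((-k - (m : ℂ) / 2) * x))
      + single₂ (μ + 1) m (exp ((-k - (m : ℂ) / 2) * x))
      + single₂ (μ + 1) (m + 1) (-exp ((-k - ((m : ℂ) - 1) / 2) * x))) := by
  funext r c
  simp only [hbF₂, single₂, Pi.add_apply]
  rcases (by omega : c < m ∨ c = m ∨ c = m + 1 ∨ m + 1 < c) with h | h | h | h <;>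
  rcases eq_or_ne r μ with h1 | h1 <;> rcases eq_or_ne r (μ + 1) with h2 | h2 <;> first
  | omega
  | simp (disch := omega) only [if_pos, if_neg, true_and, sg, sub_mul, add_mul, neg_mul, ← exp_add]
    try subst h
    try push_cast
    try ring_nf

end FreeBoson

/-! ### Contractions of the second with the first sum of F -/

namespace FreeBoson

set_option linter.unusedSimpArgs false

variable {N : ℕ} {ħ : ℝ} {k : ℂ}

/-- The contribution of `b` to the contractions of the terms of the second sum in `F_μ` and of the
first sum in `F_ν`. -/
noncomputable def valueF₂F₁ (N : ℕ) (k : ℂ) (μ m ν n : ℕ) (x : ℂ) : ℂ :=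
  (if μ = ν then -((exp x - exp (-x)) * exp (-(k + N) * x))
    else if μ = ν + 1 ∨ ν = μ + 1 then sg x * exp (-(k + N) * x) else 0)
  + (if μ < ν then
      if n = μ ∧ m = ν then -exp ((1 - ((μ + ν) / 2 + k)) * x)
      else if n = μ + 1 ∧ m = ν ∧ μ + 1 < ν then exp (-((μ + ν) / 2 + k) * x)
      else if n = μ ∧ m = ν + 1 then exp (-((μ + ν) / 2 + k) * x)
      else if n = μ + 1 ∧ m = ν + 1 then -exp ((-1 - ((μ + ν) / 2 + k)) * x) else 0
    else if μ = ν ∧ n = μ ∧ m = μ + 1 then exp (-((μ + ν) / 2 + k) * x) else 0)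

set_option maxHeartbeats 4000000 in
-- The tail of F₂ runs from m to N, so the induction descends from m = N, where the tail is empty;
-- `j` is N - m. Each step adds the four entries of `hbF₂_succ`.
theorem pairing_hbF₂_gbF₁ {μ ν n : ℕ} (hμ : 1 ≤ μ) (hn : 1 ≤ n) (hnν : n ≤ ν) (hν : ν < N) (x : ℂ)
    (j : ℕ) : ∀ m : ℕ, m + j = N → μ < m →
      pairing N (hbF₂ k μ m x) (gbF₁ ν n x) = valueF₂F₁ N k μ m ν n x := by
  induction j with
  | zero =>
    intro m hj hm
    obtain rfl : m = N := hj
    rw [pairing_congr_left _ fun r c _ _ hc => hbF₂_top μ x hc]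
    simp only [pairing_add_left, pairing_single_left, gbF₁, valueF₂F₁]
    rcases (by omega : n < μ ∨ n = μ ∨ n = μ + 1 ∨ μ + 1 < n) with h1 | h1 | h1 | h1 <;>
    rcases (by omega : μ = ν ∨ μ = ν + 1 ∨ ν = μ + 1 ∨ (μ < ν ∧ ν ≠ μ + 1) ∨ (ν < μ ∧ μ ≠ ν + 1))
      with h | h | h | h | h <;>
    rcases (by omega : m = μ + 1 ∨ μ + 1 < m) with h2 | h2 <;>
    rcases (by omega : m = ν + 1 ∨ ν + 1 < m) with h3 | h3 <;> first
    | omega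
    | simp (disch := omega) only [if_pos, if_neg, sg, sub_mul, add_mul, neg_mul, mul_neg, ← exp_add,
        zero_mul, mul_zero, add_zero, zero_add, neg_zero, ite_self, true_and, and_true]
      try subst h1
      try subst h
      try subst h3
      try subst h2
      try push_cast
      try ring_nf
      try simp only [pow_two, ← exp_add]
      try ring_nf
  | succ j ih =>
    intro m hj hm
    rw [hbF₂_succ, pairing_add_left, ih (m + 1) (by omega) (by omega)]
    simp only [pairing_add_left, pairing_single_left, gbF₁, valueF₂F₁]
    rcases (by omega : n < μ ∨ n = μ ∨ n = μ + 1 ∨ μ + 1 < n) with h1 | h1 | h1 | h1 <;>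
    rcases (by omega : μ = ν ∨ μ = ν + 1 ∨ ν = μ + 1 ∨ (μ < ν ∧ ν ≠ μ + 1) ∨ (ν < μ ∧ μ ≠ ν + 1))
      with h | h | h | h | h <;>
    rcases (by omega : m = μ + 1 ∨ μ + 1 < m) with h2 | h2 <;>
    rcases (by omega : m + 1 < ν ∨ m + 1 = ν ∨ m = ν ∨ m = ν + 1 ∨ ν + 1 < m)
      with h3 | h3 | h3 | h3 | h3 <;> first
    | omega
    | simp (disch := omega) only [if_pos, if_neg, sg, sub_mul, add_mul, neg_mul, mul_neg, ← exp_add,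
        zero_mul, mul_zero, add_zero, zero_add, neg_zero, ite_self, true_and, and_true]
      try subst h1
      try subst h2
      try subst h
      try subst h3
      try push_cast
      try ring_nf
      try simp only [pow_two, ← exp_add]
      try ring_nf

/-- The contractions of the terms of the second sum in `F_μ(u)` and of the first sum in `F_ν(v)`. -/
noncomputable def listF₂F₁ (k : ℂ) (μ m : ℕ) (ε : Bool) (ν n : ℕ) (δ : Bool) : List (ℂ × ℂ) :=
  (if μ = ν then [(-1, 1)] else if μ = ν + 1 ∨ ν = μ + 1 then [(1 / 2, -1 / 2)] else [])
    ++ barList (listF₁F₂ k ν n δ μ m ε)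

set_option maxHeartbeats 2000000 in
-- The b-sum leaves a boundary term with factor e^{-(k+N)x} coming from column N, and λ supplies the
-- complementary 1 - e^{-(k+N)x}. Their sum is the constant part of the list; what remains is the
-- reversed list of F₁ F₂.
theorem hasContr_F₂_F₁ (hħ : ħ ≠ 0) {μ m ν n : ℕ} (hm : m ∈ Finset.Icc (μ + 1) N)
    (hn : n ∈ Finset.Icc 1 ν) (hμ : 1 ≤ μ) (hν : ν < N) {ε δ : Bool}
    (hε : ε = false → μ + 1 < m) (hδ : δ = true → n < ν) :
    HasContr ħ k (FTerm₂ N ħ k μ m ε) (FTerm₁ N ħ k ν n δ) (listF₂F₁ k μ m ε ν n δ) := by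
  rw [Finset.mem_Icc] at hm hn
  refine (hasProfile_FTerm₂ hħ μ m ε).hasContr hħ (hasProfile_FTerm₁ hħ ν n δ) fun t => ?_
  rw [lamPairing_F hħ hμ (by omega) (by omega) hν t rfl]
  generalize (ħ * (t : ℝ) : ℂ) = x
  rw [pairing_hbF₂_gbF₁ hμ hn.1 hn.2 hν x (N - m) m (by omega) (by omega)]
  simp only [pairing_add_left, pairing_add_right, pairing_single_right, expSum_append,
    Pi.add_apply, single₂, listF₂F₁, valueF₂F₁, valueLam, listF₁F₂]
  rcases (by omega : μ = ν ∨ μ = ν + 1 ∨ ν = μ + 1 ∨ (μ < ν ∧ ν ≠ μ + 1) ∨ (ν < μ ∧ μ ≠ ν + 1))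
    with h | h | h | h | h <;>
  rcases (by omega : n = μ ∨ n = μ + 1 ∨ (n ≠ μ ∧ n ≠ μ + 1)) with h1 | h1 | h1 <;>
  rcases (by omega : m = ν ∨ m = ν + 1 ∨ (m ≠ ν ∧ m ≠ ν + 1)) with h2 | h2 | h2 <;>
  rcases (by omega : m = μ + 1 ∨ μ + 1 < m) with h3 | h3 <;>
  rcases (by omega : n = ν ∨ n < ν) with h4 | h4 <;> first
  | omega
  | simp (disch := omega) only [if_pos, if_neg, sg, sub_mul, add_mul, neg_mul, mul_neg, ← exp_add,
      zero_mul, mul_zero, add_zero, zero_add, neg_zero, ite_self, true_and, and_true, barList_nil,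
      barList_cons, expSum_nil, expSum_cons]
    try subst h1
    try subst h2
    try subst h
    try subst h3
    try subst h4
    cases ε <;> cases δ <;> first
    | exact absurd (hε rfl) (by omega)
    | exact absurd (hδ rfl) (by omega)
    | try simp only [if_true, if_false, reduceCtorEq, and_true, and_false, barList_nil, barList_cons,
        expSum_nil, expSum_cons, neg_mul, mul_neg, ← exp_add, Nat.cast_add, Nat.cast_one,
        lt_irrefl, false_or, or_false, or_true, add_zero, zero_add, neg_zero, zero_mul, mul_zero, ite_self]
      try ring_nf
      try simp only [← exp_add]
      try ring_nf

end FreeBoson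

/-! ### Expansion of the currents into terms, and the decomposition of H -/

namespace FreeBoson

set_option linter.unusedSimpArgs false

variable {N : ℕ} {ħ : ℝ} {k : ℂ}

theorem sh_sh (u s t : ℂ) : sh ħ (sh ħ u s) t = sh ħ u (s + t) := by
  simp only [sh]
  ring

theorem place_eq_zero {P : Mode N → Prop} (h : ∀ i, ¬ P i) (f : C(HalfLine, ℂ)) : place P f = 0 := by
  ext t i
  simp [place, h i]

theorem not_isB {m n : ℕ} (h : n ≤ m) (i : Mode N) : ¬ IsB m n i := by
  rcases i with i | p | p
  · exact id
  · intro hp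
    have h1 := Fin.lt_def.1 p.2
    have h2 := hp.1
    have h3 := hp.2
    omega
  · exact id

theorem not_isC {m n : ℕ} (h : n ≤ m) (i : Mode N) : ¬ IsC m n i := by
  rcases i with i | p | p
  · exact id
  · exact id
  · intro hp
    have h1 := Fin.lt_def.1 p.2
    have h2 := hp.1
    have h3 := hp.2
    omega

theorem bP_self (m : ℕ) (u : ℂ) : bP N ħ m m u = 0 := by
  simp only [bP, chiPlus, place_eq_zero (not_isB le_rfl), Prod.mk_zero_zero]

theorem bM_self (m : ℕ) (u : ℂ) : bM N ħ m m u = 0 := by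
  simp only [bM, chiMinus, place_eq_zero (not_isB le_rfl), Prod.mk_zero_zero]

theorem bc_self (m : ℕ) (u : ℂ) : bc N ħ m m u = 0 := by
  simp only [bc, chi, place_eq_zero (not_isB le_rfl), place_eq_zero (not_isC le_rfl),
    Prod.mk_zero_zero, add_zero]

theorem vx_mul (A B : VertexData N) : vx A * vx B = vx (A + B) := by
  rw [vx, vx, vx, AddMonoidAlgebra.single_mul_single, one_mul]

theorem vx_prod {ι : Type*} (s : Finset ι) (A : ι → VertexData N) :
    ∏ i ∈ s, vx (A i) = vx (∑ i ∈ s, A i) := by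
  classical
  induction s using Finset.induction_on with
  | empty => rfl
  | insert a s ha ih => rw [Finset.prod_insert ha, Finset.sum_insert ha, ih, vx_mul]

theorem entireFamily_bS (ε : Bool) (m n : ℕ) (s : ℂ) :
    EntireFamily fun u => bS N ħ ε m n (sh ħ u s) := by
  cases ε
  · exact entireFamily_bM m n s
  · exact entireFamily_bP m n s

theorem entireFamily_ETerm (μ m : ℕ) (ε : Bool) : EntireFamily (ETerm N ħ μ m ε) :=
  ((entireFamily_bc _ _ _).add ((entireFamily_bS _ _ _ _).sub (entireFamily_bc _ _ _))).add
    (EntireFamily.sum fun _ _ => (entireFamily_bP _ _ _).sub (entireFamily_bP _ _ _))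

theorem entireFamily_FTerm₁ (μ m : ℕ) (ε : Bool) : EntireFamily (FTerm₁ N ħ k μ m ε) :=
  ((((entireFamily_bc _ _ _).add ((entireFamily_lamM _ _).sub (entireFamily_lamM _ _))).add
    ((entireFamily_bS _ _ _ _).neg.sub (entireFamily_bc _ _ _))).add
    (EntireFamily.sum fun _ _ => (entireFamily_bM _ _ _).sub (entireFamily_bM _ _ _))).add
    (EntireFamily.sum fun _ _ => (entireFamily_bM _ _ _).sub (entireFamily_bM _ _ _))

theorem entireFamily_FTerm₂ (μ m : ℕ) (ε : Bool) : EntireFamily (FTerm₂ N ħ k μ m ε) :=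
  (((entireFamily_bc _ _ _).add ((entireFamily_lamP _ _).sub (entireFamily_lamP _ _))).add
    ((entireFamily_bS _ _ _ _).sub (entireFamily_bc _ _ _))).add
    (EntireFamily.sum fun _ _ => (entireFamily_bP _ _ _).sub (entireFamily_bP _ _ _))

/-- The indices of the terms of `E_μ`. -/
def indexE (μ : ℕ) : Finset (ℕ × Bool) := Finset.Icc 1 μ ×ˢ Finset.univ

/-- The coefficients of the terms of `E_μ`. -/
noncomputable def coefE (ħ : ℝ) (a : ℕ × Bool) : ℂ := 1 / ħ * if a.2 then 1 else -1

/-- The indices of the terms of the first sum in `F_μ`. -/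
def indexF₁ (μ : ℕ) : Finset (ℕ × Bool) :=
  (Finset.Icc 1 μ ×ˢ Finset.univ).filter fun a => a.2 = true → a.1 < μ

/-- The indices of the terms of the second sum in `F_μ`. -/
def indexF₂ (N μ : ℕ) : Finset (ℕ × Bool) :=
  (Finset.Icc (μ + 1) N ×ˢ Finset.univ).filter fun a => a.2 = false → μ + 1 < a.1

/-- The coefficients of the terms of `F_μ`. -/
noncomputable def coefF (ħ : ℝ) (a : ℕ × Bool) : ℂ := 1 / ħ * if a.2 then -1 else 1

theorem mem_indexE {μ : ℕ} {a : ℕ × Bool} : a ∈ indexE μ ↔ a.1 ∈ Finset.Icc 1 μ := by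
  simp [indexE]

theorem mem_indexF₁ {μ : ℕ} {a : ℕ × Bool} :
    a ∈ indexF₁ μ ↔ a.1 ∈ Finset.Icc 1 μ ∧ (a.2 = true → a.1 < μ) := by
  simp [indexF₁]

theorem mem_indexF₂ {μ : ℕ} {a : ℕ × Bool} :
    a ∈ indexF₂ N μ ↔ a.1 ∈ Finset.Icc (μ + 1) N ∧ (a.2 = false → μ + 1 < a.1) := by
  simp [indexF₂]

theorem isExpansion_E (μ : ℕ) : IsExpansion (ECurrent N ħ μ) (indexE μ) (coefE ħ)
    fun a => ETerm N ħ μ a.1 a.2 := by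
  refine ⟨fun u => ?_, fun a _ => entireFamily_ETerm μ a.1 a.2⟩
  rw [ECurrent, Finset.smul_sum, indexE, Finset.sum_product]
  refine Finset.sum_congr rfl fun m _ => ?_
  simp only [Fintype.sum_bool, coefE, if_true, Bool.false_eq_true, if_false, mul_one, vx_prod,
    mul_sub, sub_mul, vx_mul, ETerm, bS, smul_sub, mul_neg, neg_smul, sub_eq_add_neg (_ • _)]

/-- For m = μ in the first sum and m = μ + 1 in the second, the fields in the bracket have equal
indices and are trivial. The bracket is 2 - 1 = 1, so a single term survives; the filters in
`indexF₁` and `indexF₂` remove the other one. -/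
theorem isExpansion_F (μ : ℕ) : IsExpansion (FCurrent N ħ k μ)
    ((indexF₁ μ).disjSum (indexF₂ N μ)) (Sum.elim (coefF ħ) (coefF ħ))
    (Sum.elim (fun a => FTerm₁ N ħ k μ a.1 a.2) fun a => FTerm₂ N ħ k μ a.1 a.2) := by
  refine ⟨fun u => ?_, ?_⟩
  swap
  · rintro (a | a) _
    · exact entireFamily_FTerm₁ μ a.1 a.2
    · exact entireFamily_FTerm₂ μ a.1 a.2
  have two_vx : ((1 : ℂ) + 1) • vx 0 - vx 0 = (vx 0 : NormalOrdered N) := by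
    rw [add_smul, one_smul, add_sub_cancel_right]
  rw [FCurrent, Finset.sum_disjSum, smul_sub, Finset.smul_sum, Finset.smul_sum, sub_eq_add_neg,
    ← Finset.sum_neg_distrib, indexF₁, indexF₂, Finset.sum_filter, Finset.sum_filter,
    Finset.sum_product, Finset.sum_product]
  congr 1
  · refine Finset.sum_congr rfl fun m hm => ?_
    rw [Finset.mem_Icc] at hm
    rcases hm.2.lt_or_eq with h | rfl
    · simp only [Fintype.sum_bool, coefF, Sum.elim_inl, h, h.ne, if_true, Bool.false_eq_true,
        false_imp_iff, if_false, mul_one, vx_prod, mul_sub, sub_mul, vx_mul, FTerm₁, bS, smul_sub,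
        mul_neg, neg_smul, sub_eq_add_neg (_ • _), add_zero, one_smul, true_imp_iff]
      rw [add_comm]
    · simp only [Fintype.sum_bool, coefF, Sum.elim_inl, lt_irrefl, if_true, Bool.false_eq_true,
        false_imp_iff, if_false, mul_one, vx_prod, vx_mul, FTerm₁, bS, add_zero, zero_add,
        true_imp_iff, bM_self, bP_self, bc_self, neg_zero, sub_zero, two_vx]
  · refine Finset.sum_congr rfl fun m hm => ?_
    rw [Finset.mem_Icc] at hm
    rcases hm.1.lt_or_eq with h | rfl
    · simp only [Fintype.sum_bool, coefF, Sum.elim_inr, h, h.ne', if_true, Bool.false_eq_true,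
        false_imp_iff, if_false, mul_one, vx_prod, mul_sub, sub_mul, vx_mul, FTerm₂, bS, smul_sub,
        mul_neg, neg_smul, sub_eq_add_neg (_ • _), add_zero, one_smul, true_imp_iff, neg_add, neg_neg,
        reduceCtorEq]
    · simp only [Fintype.sum_bool, coefF, Sum.elim_inr, lt_irrefl, if_true, Bool.false_eq_true,
        false_imp_iff, if_false, mul_one, vx_prod, vx_mul, FTerm₂, bS, add_zero, zero_add,
        true_imp_iff, bM_self, bP_self, bc_self, neg_zero, sub_zero, two_vx, mul_neg, neg_smul,
        reduceCtorEq]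

/-- The β fields cancel at these points. This is the exponent of E F at its pole v = u + ikħ, and it
allows contractions with H^+ to be read off from those of E and F₂. -/
theorem HPlusData_eq (μ : ℕ) (hμ : 1 ≤ μ) (u : ℂ) : HPlusData N ħ k μ u
    = ETerm N ħ μ μ true u + FTerm₂ N ħ k μ (μ + 1) true (sh ħ u k) := by
  have e1 : sh ħ u (k + -(2 * k + (μ + 1 : ℕ) - 1) / 2) = sh ħ u (-μ / 2) := by
    congr 1; push_cast; ring
  have e2 : sh ħ u (k + (-(3 * k + N) / 4 - μ / 2)) = sh ħ u ((k - N) / 4 - μ / 2) := by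
    congr 1; ring
  have e3 : ∀ n : ℕ, sh ħ u (k + -(2 * k + n) / 2) = sh ħ u (-n / 2) := fun n => by
    congr 1; ring
  have e4 : ∀ n : ℕ, sh ħ u (k + -(2 * k + n - 1) / 2) = sh ħ u (-(n - 1) / 2) := fun n => by
    congr 1; ring
  obtain ⟨m, rfl⟩ : ∃ m, μ = m + 1 := ⟨μ - 1, by omega⟩
  simp only [HPlusData, ETerm, FTerm₂, bS, if_true, sh_sh, e1, e2, e3, e4, bc_self, bP_self,
    add_tsub_cancel_right, Finset.sum_Icc_succ_top (Nat.le_add_left 1 m)]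
  abel

/-- The β fields cancel at equal arguments. This is the exponent of E F at its pole u = v, and it
reduces contractions with H^- to those with E and F₁. -/
theorem HMinusData_eq (μ : ℕ) (hμ : 1 ≤ μ) (u : ℂ) : HMinusData N ħ k μ u
    = ETerm N ħ μ 1 false u + FTerm₁ N ħ k μ 1 false u := by
  have e1 : sh ħ u (-(((1 : ℕ) : ℂ) - 2) / 2) = sh ħ u (((1 : ℕ) : ℂ) / 2) := by
    congr 1; norm_num
  have e2 : sh ħ u (-(((1 : ℕ) : ℂ) - 1) / 2) = sh ħ u ((((1 : ℕ) : ℂ) - 1) / 2) := by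
    congr 1; norm_num
  simp only [HMinusData, ETerm, FTerm₁, bS, if_false, Bool.false_eq_true, e1, e2,
    ← Finset.add_sum_Ioc_eq_sum_Icc hμ]
  rw [← Finset.Icc_add_one_left_eq_Ioc, tsub_self]
  simp only [Finset.Icc_eq_empty_of_lt zero_lt_one, Finset.sum_empty]
  abel

theorem entireFamily_HPlusData (μ : ℕ) : EntireFamily (HPlusData N ħ k μ) :=
  (((entireFamily_lamP _ _).sub (entireFamily_lamP _ _)).add
    (EntireFamily.sum fun _ _ => (entireFamily_bP _ _ _).sub (entireFamily_bP _ _ _))).add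
    (EntireFamily.sum fun _ _ => (entireFamily_bP _ _ _).sub (entireFamily_bP _ _ _))

theorem entireFamily_HMinusData (μ : ℕ) : EntireFamily (HMinusData N ħ k μ) :=
  (((entireFamily_lamM _ _).sub (entireFamily_lamM _ _)).add
    (EntireFamily.sum fun _ _ => (entireFamily_bM _ _ _).sub (entireFamily_bM _ _ _))).add
    (EntireFamily.sum fun _ _ => (entireFamily_bM _ _ _).sub (entireFamily_bM _ _ _))

/-- The exponents of `H_μ^±`. -/
noncomputable def HData (N : ℕ) (ħ : ℝ) (k : ℂ) (ε : Bool) (μ : ℕ) (u : ℂ) : VertexData N :=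
  if ε then HPlusData N ħ k μ u else HMinusData N ħ k μ u

theorem isExpansion_H (ε : Bool) (μ : ℕ) : IsExpansion (HCurrent N ħ k ε μ) {()} (fun _ => 1)
    fun _ => HData N ħ k ε μ := by
  refine ⟨fun u => ?_, fun _ _ => ?_⟩
  · rw [Finset.sum_singleton, one_smul]
    rfl
  · cases ε
    · exact entireFamily_HMinusData μ
    · exact entireFamily_HPlusData μ

theorem HPlusData_snd (μ : ℕ) (u : ℂ) : (HPlusData N ħ k μ u).2 = 0 := by
  simp [HPlusData, lamP, bP, chiPlus, Prod.snd_sum]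

theorem HMinusData_fst (μ : ℕ) (u : ℂ) : (HMinusData N ħ k μ u).1 = 0 := by
  simp [HMinusData, lamM, bM, chiMinus, Prod.fst_sum]

theorem kPlus_snd (μ : ℕ) (u : ℂ) : (kPlus N ħ k μ u).2 = 0 := by
  simp [kPlus, lamP, bP, chiPlus, Prod.snd_sum]

theorem kMinus_fst (μ : ℕ) (u : ℂ) : (kMinus N ħ k μ u).1 = 0 := by
  simp [kMinus, lamM, bM, chiMinus, Prod.fst_sum]

/-- For the minus sign the double sums belonging to μ and μ + 1 differ by one row and one column of
the index set, and these are the two products in H^-. -/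
theorem kCurrent_sub (ε : Bool) (μ : ℕ) (hμ : 1 ≤ μ) (hN : μ < N) (u : ℂ) :
    HData N ħ k ε μ u = (if ε then kPlus N ħ k (μ + 1) (sh ħ u (-μ / 2))
        else kMinus N ħ k (μ + 1) (sh ħ u (-μ / 2)))
      + -(if ε then kPlus N ħ k μ (sh ħ u (-μ / 2)) else kMinus N ħ k μ (sh ħ u (-μ / 2))) := by
  cases ε
  · simp only [HData, Bool.false_eq_true, if_false, HMinusData, kMinus, sh_sh]
    have e1 : ∀ s : ℂ, -(μ : ℂ) / 2 + s = s - μ / 2 := fun s => by ring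
    have e2 : ∀ s : ℂ, (s + μ) / 2 - (μ : ℂ) / 2 = s / 2 := fun s => by ring
    have e3 : ∀ s : ℂ, ((μ : ℂ) + s) / 2 - μ / 2 = s / 2 := fun s => by ring
    have e4 : ∀ s : ℂ, (s + (μ + 1 : ℕ) - 2) / 2 - (μ : ℂ) / 2 = (s - 1) / 2 := fun s => by
      push_cast; ring
    have e5 : ∀ s : ℂ, ((μ + 1 : ℕ) + s - 2) / 2 - (μ : ℂ) / 2 = (s - 1) / 2 := fun s => by
      push_cast; ring
    obtain ⟨m, rfl⟩ : ∃ m, μ = m + 1 := ⟨μ - 1, by omega⟩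
    simp only [add_tsub_cancel_right, Finset.sum_Icc_succ_top (Nat.le_add_left 1 _),
      ← Finset.add_sum_Ioc_eq_sum_Icc (show m + 1 + 1 ≤ N from hN), ← Finset.add_sum_Ioc_eq_sum_Icc hN.le,
      ← Finset.Icc_add_one_left_eq_Ioc, Finset.sum_add_distrib, Finset.sum_sub_distrib, e1, e2, e3,
      e4, e5, bM_self]
    abel
  · simp only [HData, if_true, HPlusData, kPlus, sh_sh]
    have e1 : sh ħ u (-(μ : ℂ) / 2 + (k - N) / 4) = sh ħ u ((k - N) / 4 - μ / 2) := by
      congr 1; ring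
    have e2 : ∀ s : ℂ, sh ħ u (-(μ : ℂ) / 2 + ((μ + 1 : ℕ) - s) / 2) = sh ħ u (-(s - 1) / 2) :=
      fun s => by congr 1; push_cast; ring
    have e3 : ∀ s : ℂ, sh ħ u (-(μ : ℂ) / 2 + (μ - s) / 2) = sh ħ u (-s / 2) :=
      fun s => by congr 1; ring
    simp only [e1, e2, e3]
    obtain ⟨m, rfl⟩ : ∃ m, μ = m + 1 := ⟨μ - 1, by omega⟩
    simp only [add_tsub_cancel_right, Finset.sum_Icc_succ_top (Nat.le_add_left 1 m),
      ← Finset.add_sum_Ioc_eq_sum_Icc (show m + 1 + 1 ≤ N from hN), ← Finset.Icc_add_one_left_eq_Ioc,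
      Finset.sum_sub_distrib, bP_self]
    abel

theorem vertexOp_vertexOp_of_contr_eq_zero {D D' : VertexData N}
    (h : ∀ t, contr N ħ k D D' t = 0) {ζ : Symbols N ħ} (hζ : IsTest ζ) (Ψ : Symbols N ħ → ℂ) :
    vertexOp k D (vertexOp k D' Ψ) ζ = vertexOp k (D + D') Ψ ζ := by
  have e : contr N ħ k D D' = fun _ => 0 := funext h
  rw [vertexOp_vertexOp (pairs_of_isTest D hζ) (pairs_of_isTest D' hζ) (by rw [e]; exact integrable_zero _ _ _), e,
    integral_zero, exp_zero, one_mul]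

theorem ECurrent_eq_XPlus (μ : ℕ) (u : ℂ) :
    ECurrent N ħ μ u = (1 / ħ : ℂ) • XPlus N ħ μ (sh ħ u (-μ / 2)) := by
  have e1 : ∀ s : ℂ, sh ħ u (-(μ : ℂ) / 2 + -(s - μ - 1) / 2) = sh ħ u (-(s - 1) / 2) :=
    fun s => by congr 1; ring
  have e2 : ∀ s : ℂ, sh ħ u (-(μ : ℂ) / 2 + -(s - μ) / 2) = sh ħ u (-s / 2) :=
    fun s => by congr 1; ring
  have e3 : ∀ s : ℂ, sh ħ u (-(μ : ℂ) / 2 + -(s - μ - 2) / 2) = sh ħ u (-(s - 2) / 2) :=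
    fun s => by congr 1; ring
  simp only [ECurrent, XPlus, sh_sh, e1, e2, e3]

theorem FCurrent_eq_XMinus (μ : ℕ) (u : ℂ) :
    FCurrent N ħ k μ u = (1 / ħ : ℂ) • XMinus N ħ k μ (sh ħ u (-μ / 2)) := by
  have e1 : ∀ s : ℂ, sh ħ u (-(μ : ℂ) / 2 + (μ + s) / 2) = sh ħ u (s / 2) :=
    fun s => by congr 1; ring
  have e2 : ∀ s : ℂ, sh ħ u (-(μ : ℂ) / 2 + (μ + s - 1) / 2) = sh ħ u ((s - 1) / 2) :=
    fun s => by congr 1; ring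
  have e3 : ∀ s : ℂ, sh ħ u (-(μ : ℂ) / 2 + (μ + s + 1) / 2) = sh ħ u ((s + 1) / 2) :=
    fun s => by congr 1; ring
  have e4 : sh ħ u (-(μ : ℂ) / 2 + -(k - N) / 4) = sh ħ u (-(k - N) / 4 - μ / 2) := by
    congr 1; ring
  have e5 : sh ħ u (-(μ : ℂ) / 2 + -(3 * k + N) / 4) = sh ħ u (-(3 * k + N) / 4 - μ / 2) := by
    congr 1; ring
  have e6 : ∀ s : ℂ, sh ħ u (-(μ : ℂ) / 2 + -(2 * k + s - μ - 1) / 2)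
      = sh ħ u (-(2 * k + s - 1) / 2) := fun s => by congr 1; ring
  have e7 : ∀ s : ℂ, sh ħ u (-(μ : ℂ) / 2 + -(2 * k + s - μ) / 2) = sh ħ u (-(2 * k + s) / 2) :=
    fun s => by congr 1; ring
  have e8 : ∀ s : ℂ, sh ħ u (-(μ : ℂ) / 2 + -(2 * k + s - μ - 2) / 2)
      = sh ħ u (-(2 * k + s - 2) / 2) := fun s => by congr 1; ring
  simp only [FCurrent, XMinus, sh_sh, e1, e2, e3, e4, e5, e6, e7, e8]

end FreeBoson

/-! ### Contractions with H -/

namespace FreeBoson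

set_option linter.unusedSimpArgs false

variable {N : ℕ} {ħ : ℝ} {k : ℂ}

theorem HasContr.HPlus {μ : ℕ} (hμ : 1 ≤ μ) {B : ℂ → VertexData N} {L L' : List (ℂ × ℂ)}
    (h : HasContr ħ k (ETerm N ħ μ μ true) B L)
    (h' : HasContr ħ k (FTerm₂ N ħ k μ (μ + 1) true) B L') :
    HasContr ħ k (HData N ħ k true μ) B (L ++ shiftList k L') := by
  have e : HData N ħ k true μ
      = fun u => ETerm N ħ μ μ true u + FTerm₂ N ħ k μ (μ + 1) true (sh ħ u k) :=
    funext fun u => HPlusData_eq μ hμ u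
  rw [e]
  exact h.add_left (h'.shift_left k)

theorem HasContr.HMinus {μ : ℕ} (hμ : 1 ≤ μ) {A : ℂ → VertexData N} {L L' : List (ℂ × ℂ)}
    (h : HasContr ħ k A (ETerm N ħ μ 1 false) L)
    (h' : HasContr ħ k A (FTerm₁ N ħ k μ 1 false) L') :
    HasContr ħ k A (HData N ħ k false μ) (L ++ L') := by
  have e : HData N ħ k false μ
      = fun u => ETerm N ħ μ 1 false u + FTerm₁ N ħ k μ 1 false u :=
    funext fun u => HMinusData_eq μ hμ u
  rw [e]
  exact h.add_right h'

theorem hasContr_any_HPlus (A : ℂ → VertexData N) (μ : ℕ) :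
    HasContr ħ k A (HData N ħ k true μ) [] :=
  .of_snd_eq_zero (HPlusData_snd μ)

theorem hasContr_HMinus_any (B : ℂ → VertexData N) (μ : ℕ) :
    HasContr ħ k (HData N ħ k false μ) B [] :=
  .of_fst_eq_zero (HMinusData_fst μ)

theorem halfCartan_comm (μ ν : ℕ) : halfCartan μ ν = halfCartan ν μ := by
  simp only [halfCartan, eq_comm (a := μ) (b := ν), or_comm]

set_option maxHeartbeats 1000000 in
-- Each of the two lists depends on the term (n, δ), but their sum does not. This uniformity makes H
-- exchange with the whole current E by a single factor; the same happens for F and for H^-.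
theorem hasContr_HPlus_E (hħ : ħ ≠ 0) {μ ν n : ℕ} (hμ : 1 ≤ μ) (hμN : μ < N) (hν : 1 ≤ ν) (hνN : ν < N)
    (hn : n ∈ Finset.Icc 1 ν) {δ : Bool} :
    HasContr ħ k (HData N ħ k true μ) (ETerm N ħ ν n δ) [(halfCartan μ ν, -halfCartan μ ν)] := by
  have hμ' : μ ∈ Finset.Icc 1 μ := Finset.mem_Icc.2 ⟨hμ, le_rfl⟩
  have hμ'' : μ + 1 ∈ Finset.Icc (μ + 1) N := Finset.mem_Icc.2 ⟨le_rfl, hμN⟩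
  have h1' : 1 ∈ Finset.Icc 1 μ := Finset.mem_Icc.2 ⟨le_rfl, hμ⟩
  refine (HasContr.HPlus hμ (hasContr_E_E hħ hμ' hn hμN hνN true δ) (hasContr_F₂_E hħ hμ'' hn hνN hμ (by simp) δ)).congr fun x => ?_
  rw [Finset.mem_Icc] at hn
  simp only [halfCartan, listEE, listEF₂, expSum_append, expSum_shiftList]
  rcases (by omega : μ = ν ∨ μ = ν + 1 ∨ ν = μ + 1 ∨ (μ < ν ∧ ν ≠ μ + 1) ∨ (ν < μ ∧ μ ≠ ν + 1))
    with h | h | h | h | h <;>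
  rcases (by omega : n < μ ∨ n = μ ∨ n = μ + 1 ∨ n = μ + 2 ∨ μ + 2 < n) with h1 | h1 | h1 | h1 | h1 <;> first
  | omega
  | simp (disch := omega) only [if_pos, if_neg, true_and, and_true, expSum_nil, expSum_cons,
      barList_nil, barList_cons, sub_mul, add_mul, mul_sub, mul_zero, add_zero, zero_add, ← exp_add]
    all_goals cases δ <;> first
    | try subst h1
      try subst h
      try simp (disch := omega) only [if_pos, if_neg, if_true, if_false, reduceCtorEq, and_true, and_false, true_and,
        expSum_nil, expSum_cons, barList_nil, barList_cons, Nat.cast_add, Nat.cast_one, mul_sub, ← exp_add, add_zero,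
        zero_add, mul_zero, neg_zero, lt_irrefl, false_or, or_false]
      try ring_nf
      try simp only [← exp_add]
      try ring_nf

set_option maxHeartbeats 1000000 in
theorem hasContr_HPlus_F₁ (hħ : ħ ≠ 0) {μ ν n : ℕ} (hμ : 1 ≤ μ) (hμN : μ < N) (hν : 1 ≤ ν) (hνN : ν < N)
    (hn : n ∈ Finset.Icc 1 ν) {δ : Bool} (hδ : δ = true → n < ν) :
    HasContr ħ k (HData N ħ k true μ) (FTerm₁ N ħ k ν n δ) [(k - halfCartan μ ν, k + halfCartan μ ν)] := by
  have hμ' : μ ∈ Finset.Icc 1 μ := Finset.mem_Icc.2 ⟨hμ, le_rfl⟩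
  have hμ'' : μ + 1 ∈ Finset.Icc (μ + 1) N := Finset.mem_Icc.2 ⟨le_rfl, hμN⟩
  have h1' : 1 ∈ Finset.Icc 1 μ := Finset.mem_Icc.2 ⟨le_rfl, hμ⟩
  refine (HasContr.HPlus hμ (hasContr_E_F₁ hħ hμ' hn hμN hνN true hδ) (hasContr_F₂_F₁ hħ hμ'' hn hμ hνN (by simp) hδ)).congr fun x => ?_
  rw [Finset.mem_Icc] at hn
  simp only [halfCartan, listEF₁, listF₂F₁, listF₁F₂, expSum_append, expSum_shiftList]
  rcases (by omega : μ = ν ∨ μ = ν + 1 ∨ ν = μ + 1 ∨ (μ < ν ∧ ν ≠ μ + 1) ∨ (ν < μ ∧ μ ≠ ν + 1))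
    with h | h | h | h | h <;>
  rcases (by omega : n < μ ∨ n = μ ∨ n = μ + 1 ∨ n = μ + 2 ∨ μ + 2 < n) with h1 | h1 | h1 | h1 | h1 <;> first
  | omega
  | simp (disch := omega) only [if_pos, if_neg, true_and, and_true, expSum_nil, expSum_cons,
      barList_nil, barList_cons, sub_mul, add_mul, mul_sub, mul_zero, add_zero, zero_add, ← exp_add]
    all_goals cases δ <;> first
    | exact absurd (hδ rfl) (by omega)
    | try subst h1
      try subst h
      try simp (disch := omega) only [if_pos, if_neg, if_true, if_false, reduceCtorEq, and_true, and_false, true_and,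
        expSum_nil, expSum_cons, barList_nil, barList_cons, Nat.cast_add, Nat.cast_one, mul_sub, ← exp_add, add_zero,
        zero_add, mul_zero, neg_zero, lt_irrefl, false_or, or_false]
      try ring_nf
      try simp only [← exp_add]
      try ring_nf

set_option maxHeartbeats 1000000 in
theorem hasContr_HPlus_F₂ (hħ : ħ ≠ 0) {μ ν n : ℕ} (hμ : 1 ≤ μ) (hμN : μ < N) (hν : 1 ≤ ν) (hνN : ν < N)
    (hn : n ∈ Finset.Icc (ν + 1) N) {δ : Bool} (hδ : δ = false → ν + 1 < n) :
    HasContr ħ k (HData N ħ k true μ) (FTerm₂ N ħ k ν n δ) [(k - halfCartan μ ν, k + halfCartan μ ν)] := by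
  have hμ' : μ ∈ Finset.Icc 1 μ := Finset.mem_Icc.2 ⟨hμ, le_rfl⟩
  have hμ'' : μ + 1 ∈ Finset.Icc (μ + 1) N := Finset.mem_Icc.2 ⟨le_rfl, hμN⟩
  have h1' : 1 ∈ Finset.Icc 1 μ := Finset.mem_Icc.2 ⟨le_rfl, hμ⟩
  refine (HasContr.HPlus hμ (hasContr_E_F₂ hħ hμ' hn hμN hν true hδ) (hasContr_F₂_F₂ hħ hμ'' hn hμ hν (by simp) hδ)).congr fun x => ?_
  rw [Finset.mem_Icc] at hn
  simp only [halfCartan, listEF₂, listF₂F₂, expSum_append, expSum_shiftList]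
  rcases (by omega : μ = ν ∨ μ = ν + 1 ∨ ν = μ + 1 ∨ (μ < ν ∧ ν ≠ μ + 1) ∨ (ν < μ ∧ μ ≠ ν + 1))
    with h | h | h | h | h <;>
  rcases (by omega : n < μ ∨ n = μ ∨ n = μ + 1 ∨ n = μ + 2 ∨ μ + 2 < n) with h1 | h1 | h1 | h1 | h1 <;> first
  | omega
  | simp (disch := omega) only [if_pos, if_neg, true_and, and_true, expSum_nil, expSum_cons,
      barList_nil, barList_cons, sub_mul, add_mul, mul_sub, mul_zero, add_zero, zero_add, ← exp_add]
    all_goals cases δ <;> first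
    | exact absurd (hδ rfl) (by omega)
    | try subst h1
      try subst h
      try simp (disch := omega) only [if_pos, if_neg, if_true, if_false, reduceCtorEq, and_true, and_false, true_and,
        expSum_nil, expSum_cons, barList_nil, barList_cons, Nat.cast_add, Nat.cast_one, mul_sub, ← exp_add, add_zero,
        zero_add, mul_zero, neg_zero, lt_irrefl, false_or, or_false]
      try ring_nf
      try simp only [← exp_add]
      try ring_nf

set_option maxHeartbeats 1000000 in
theorem hasContr_E_HMinus (hħ : ħ ≠ 0) {μ ν n : ℕ} (hμ : 1 ≤ μ) (hμN : μ < N) (hν : 1 ≤ ν) (hνN : ν < N)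
    (hn : n ∈ Finset.Icc 1 ν) {δ : Bool} :
    HasContr ħ k (ETerm N ħ ν n δ) (HData N ħ k false μ) [(halfCartan μ ν, -halfCartan μ ν)] := by
  have hμ' : μ ∈ Finset.Icc 1 μ := Finset.mem_Icc.2 ⟨hμ, le_rfl⟩
  have hμ'' : μ + 1 ∈ Finset.Icc (μ + 1) N := Finset.mem_Icc.2 ⟨le_rfl, hμN⟩
  have h1' : 1 ∈ Finset.Icc 1 μ := Finset.mem_Icc.2 ⟨le_rfl, hμ⟩
  refine (HasContr.HMinus hμ (hasContr_E_E hħ hn h1' hνN hμN δ false) (hasContr_E_F₁ hħ hn h1' hνN hμN δ (by simp))).congr fun x => ?_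
  rw [Finset.mem_Icc] at hn
  simp only [halfCartan, listEE, listEF₁, expSum_append, expSum_shiftList]
  rcases (by omega : μ = ν ∨ μ = ν + 1 ∨ ν = μ + 1 ∨ (μ < ν ∧ ν ≠ μ + 1) ∨ (ν < μ ∧ μ ≠ ν + 1))
    with h | h | h | h | h <;>
  rcases (by omega : n < 1 ∨ n = 1 ∨ n = 2 ∨ n = 3 ∨ 3 < n) with h1 | h1 | h1 | h1 | h1 <;> first
  | omega
  | simp (disch := omega) only [if_pos, if_neg, true_and, and_true, expSum_nil, expSum_cons,
      barList_nil, barList_cons, sub_mul, add_mul, mul_sub, mul_zero, add_zero, zero_add, ← exp_add]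
    all_goals cases δ <;> first
    | try subst h1
      try subst h
      try simp (disch := omega) only [if_pos, if_neg, if_true, if_false, reduceCtorEq, and_true, and_false, true_and,
        expSum_nil, expSum_cons, barList_nil, barList_cons, Nat.cast_add, Nat.cast_one, mul_sub, ← exp_add, add_zero,
        zero_add, mul_zero, neg_zero, lt_irrefl, false_or, or_false]
      try ring_nf
      try simp only [← exp_add]
      try ring_nf

set_option maxHeartbeats 1000000 in
theorem hasContr_F₁_HMinus (hħ : ħ ≠ 0) {μ ν n : ℕ} (hμ : 1 ≤ μ) (hμN : μ < N) (hν : 1 ≤ ν) (hνN : ν < N)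
    (hn : n ∈ Finset.Icc 1 ν) {δ : Bool} (hδ : δ = true → n < ν) :
    HasContr ħ k (FTerm₁ N ħ k ν n δ) (HData N ħ k false μ) [(-halfCartan μ ν, halfCartan μ ν)] := by
  have hμ' : μ ∈ Finset.Icc 1 μ := Finset.mem_Icc.2 ⟨hμ, le_rfl⟩
  have hμ'' : μ + 1 ∈ Finset.Icc (μ + 1) N := Finset.mem_Icc.2 ⟨le_rfl, hμN⟩
  have h1' : 1 ∈ Finset.Icc 1 μ := Finset.mem_Icc.2 ⟨le_rfl, hμ⟩
  refine (HasContr.HMinus hμ (hasContr_F₁_E hħ hn h1' hνN hμN hδ false) (hasContr_F₁_F₁ hħ hn h1' hνN hμN hδ (by simp))).congr fun x => ?_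
  rw [Finset.mem_Icc] at hn
  simp only [halfCartan, listF₁F₁, listEF₁, expSum_append, expSum_shiftList]
  rcases (by omega : μ = ν ∨ μ = ν + 1 ∨ ν = μ + 1 ∨ (μ < ν ∧ ν ≠ μ + 1) ∨ (ν < μ ∧ μ ≠ ν + 1))
    with h | h | h | h | h <;>
  rcases (by omega : n < 1 ∨ n = 1 ∨ n = 2 ∨ n = 3 ∨ 3 < n) with h1 | h1 | h1 | h1 | h1 <;> first
  | omega
  | simp (disch := omega) only [if_pos, if_neg, true_and, and_true, expSum_nil, expSum_cons,
      barList_nil, barList_cons, sub_mul, add_mul, mul_sub, mul_zero, add_zero, zero_add, ← exp_add]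
    all_goals cases δ <;> first
    | exact absurd (hδ rfl) (by omega)
    | try subst h1
      try subst h
      try simp (disch := omega) only [if_pos, if_neg, if_true, if_false, reduceCtorEq, and_true, and_false, true_and,
        expSum_nil, expSum_cons, barList_nil, barList_cons, Nat.cast_add, Nat.cast_one, mul_sub, ← exp_add, add_zero,
        zero_add, mul_zero, neg_zero, lt_irrefl, false_or, or_false]
      try ring_nf
      try simp only [← exp_add]
      try ring_nf

set_option maxHeartbeats 1000000 in
theorem hasContr_F₂_HMinus (hħ : ħ ≠ 0) {μ ν n : ℕ} (hμ : 1 ≤ μ) (hμN : μ < N) (hν : 1 ≤ ν) (hνN : ν < N)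
    (hn : n ∈ Finset.Icc (ν + 1) N) {δ : Bool} (hδ : δ = false → ν + 1 < n) :
    HasContr ħ k (FTerm₂ N ħ k ν n δ) (HData N ħ k false μ) [(-halfCartan μ ν, halfCartan μ ν)] := by
  have hμ' : μ ∈ Finset.Icc 1 μ := Finset.mem_Icc.2 ⟨hμ, le_rfl⟩
  have hμ'' : μ + 1 ∈ Finset.Icc (μ + 1) N := Finset.mem_Icc.2 ⟨le_rfl, hμN⟩
  have h1' : 1 ∈ Finset.Icc 1 μ := Finset.mem_Icc.2 ⟨le_rfl, hμ⟩
  refine (HasContr.HMinus hμ (hasContr_F₂_E hħ hn h1' hμN hν hδ false) (hasContr_F₂_F₁ hħ hn h1' hν hμN hδ (by simp))).congr fun x => ?_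
  rw [Finset.mem_Icc] at hn
  simp only [halfCartan, listEF₂, listF₂F₁, listF₁F₂, expSum_append, expSum_shiftList]
  rcases (by omega : μ = ν ∨ μ = ν + 1 ∨ ν = μ + 1 ∨ (μ < ν ∧ ν ≠ μ + 1) ∨ (ν < μ ∧ μ ≠ ν + 1))
    with h | h | h | h | h <;>
  rcases (by omega : n < 1 ∨ n = 1 ∨ n = 2 ∨ n = 3 ∨ 3 < n) with h1 | h1 | h1 | h1 | h1 <;> first
  | omega
  | simp (disch := omega) only [if_pos, if_neg, true_and, and_true, expSum_nil, expSum_cons,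
      barList_nil, barList_cons, sub_mul, add_mul, mul_sub, mul_zero, add_zero, zero_add, ← exp_add]
    all_goals cases δ <;> first
    | exact absurd (hδ rfl) (by omega)
    | try subst h1
      try subst h
      try simp (disch := omega) only [if_pos, if_neg, if_true, if_false, reduceCtorEq, and_true, and_false, true_and,
        expSum_nil, expSum_cons, barList_nil, barList_cons, Nat.cast_add, Nat.cast_one, mul_sub, ← exp_add, add_zero,
        zero_add, mul_zero, neg_zero, lt_irrefl, false_or, or_false]
      try ring_nf
      try simp only [← exp_add]
      try ring_nf

end FreeBoson

/-! ### Exchange relations that involve H -/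

namespace FreeBoson

variable {N : ℕ} {ħ : ℝ} {k : ℂ} {ι κ : Type*} {X Y : Current N} {I : Finset ι} {J : Finset κ}
  {x : ι → ℂ} {y : κ → ℂ} {A : ι → ℂ → VertexData N} {B : κ → ℂ → VertexData N}

theorem ratio_nil (w : ℂ) : ratio ħ [] w = 1 := rfl

theorem ratio_cons (p : ℂ × ℂ) (L : List (ℂ × ℂ)) (w : ℂ) : ratio ħ (p :: L) w
    = (w + Complex.I * p.2 * ħ) / (w + Complex.I * p.1 * ħ) * ratio ħ L w := rfl

/-- The reversed product has no contraction, because H^+ has no creation part; `f` cancels the only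
pole of the direct product and leaves `g`. -/
theorem exchangeRelation_of_left (hX : IsExpansion X I x A) (hY : IsExpansion Y J y B) {α β : ℂ}
    (h : ∀ a ∈ I, ∀ b ∈ J, HasContr ħ k (A a) (B b) [(α, β)])
    (h' : ∀ b ∈ J, ∀ a ∈ I, HasContr ħ k (B b) (A a) []) {f g : ℂ → ℂ}
    (hf : ∀ w, f w = w + Complex.I * α * ħ) (hg : ∀ w, g w = w + Complex.I * β * ħ) :
    ExchangeRelation ħ k f X Y g := by
  obtain ⟨R, -, hR⟩ := exists_bounded ħ [(α, β)]
  refine exchangeRelation_of hX hY h h' 1 one_ne_zero R (fun _ _ w => g w)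
    (fun _ _ => by rw [funext hg]; fun_prop) (fun a _ b _ w hw => ?_) (fun a _ b _ w hw => ?_)
  · have h0 := ratio_den_ne_zero (hR (α, β) (by simp)).1 hw
    rw [Polynomial.eval_one, one_mul, ratio_cons, ratio_nil, hf, hg, mul_one, mul_div_cancel₀ _ h0]
  · rw [Polynomial.eval_one, one_mul, ratio_nil, mul_one]

/-- Mirror image of the preceding case: H^- on the left has no annihilation part, so only the
reversed product is contracted, with argument -w. -/
theorem exchangeRelation_of_right (hX : IsExpansion X I x A) (hY : IsExpansion Y J y B) {α β : ℂ}
    (h : ∀ a ∈ I, ∀ b ∈ J, HasContr ħ k (A a) (B b) [])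
    (h' : ∀ b ∈ J, ∀ a ∈ I, HasContr ħ k (B b) (A a) [(α, β)]) {f g : ℂ → ℂ}
    (hf : ∀ w, f w = w - Complex.I * β * ħ) (hg : ∀ w, g w = w - Complex.I * α * ħ) :
    ExchangeRelation ħ k f X Y g := by
  obtain ⟨R, -, hR⟩ := exists_bounded ħ [(α, β)]
  refine exchangeRelation_of hX hY h h' 1 one_ne_zero R (fun _ _ w => f w)
    (fun _ _ => by rw [funext hf]; fun_prop) (fun a _ b _ w hw => ?_) (fun a _ b _ w hw => ?_)
  · rw [Polynomial.eval_one, one_mul, ratio_nil, mul_one]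
  · have h0 := ratio_den_ne_zero (w := -w) (hR (α, β) (by simp)).1 (by rwa [neg_im, abs_neg])
    rw [Polynomial.eval_one, one_mul, ratio_cons, ratio_nil, hf, hg, mul_one]
    simp only
    rw [mul_div_assoc', div_eq_iff h0]
    ring

theorem exchangeRelation_H_E {μ ν : ℕ} (hħ : ħ ≠ 0) (hμ : 1 ≤ μ) (hμN : μ < N)
    (hν : 1 ≤ ν) (hνN : ν < N) (ε : Bool) :
    ExchangeRelation ħ k (fun w => w + Complex.I * halfCartan μ ν * ħ) (HCurrent N ħ k ε μ)
      (ECurrent N ħ ν) (fun w => w - Complex.I * halfCartan μ ν * ħ) := by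
  cases ε
  · refine exchangeRelation_of_right (isExpansion_H false μ) (isExpansion_E ν)
      (fun _ _ _ _ => hasContr_HMinus_any _ _) (fun b hb _ _ => hasContr_E_HMinus hħ hμ hμN hν hνN
        (mem_indexE.1 hb)) (fun w => ?_) fun w => rfl
    ring
  · refine exchangeRelation_of_left (isExpansion_H true μ) (isExpansion_E ν)
      (fun _ _ b hb => hasContr_HPlus_E hħ hμ hμN hν hνN (mem_indexE.1 hb))
      (fun _ _ _ _ => hasContr_any_HPlus _ _) (fun w => rfl) fun w => ?_
    ring

theorem hasContr_HPlus_F {μ ν : ℕ} (hħ : ħ ≠ 0) (hμ : 1 ≤ μ) (hμN : μ < N)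
    (hν : 1 ≤ ν) (hνN : ν < N) {b : (ℕ × Bool) ⊕ (ℕ × Bool)}
    (hb : b ∈ (indexF₁ ν).disjSum (indexF₂ N ν)) :
    HasContr ħ k (HData N ħ k true μ) (Sum.elim (fun a => FTerm₁ N ħ k ν a.1 a.2)
      (fun a => FTerm₂ N ħ k ν a.1 a.2) b) [(k - halfCartan μ ν, k + halfCartan μ ν)] := by
  rcases b with b | b
  · have hb := mem_indexF₁.1 (Finset.inl_mem_disjSum.1 hb)
    exact hasContr_HPlus_F₁ hħ hμ hμN hν hνN hb.1 hb.2
  · have hb := mem_indexF₂.1 (Finset.inr_mem_disjSum.1 hb)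
    exact hasContr_HPlus_F₂ hħ hμ hμN hν hνN hb.1 hb.2

theorem hasContr_F_HMinus {μ ν : ℕ} (hħ : ħ ≠ 0) (hμ : 1 ≤ μ) (hμN : μ < N)
    (hν : 1 ≤ ν) (hνN : ν < N) {b : (ℕ × Bool) ⊕ (ℕ × Bool)}
    (hb : b ∈ (indexF₁ ν).disjSum (indexF₂ N ν)) :
    HasContr ħ k (Sum.elim (fun a => FTerm₁ N ħ k ν a.1 a.2)
      (fun a => FTerm₂ N ħ k ν a.1 a.2) b) (HData N ħ k false μ)
      [(-halfCartan μ ν, halfCartan μ ν)] := by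
  rcases b with b | b
  · have hb := mem_indexF₁.1 (Finset.inl_mem_disjSum.1 hb)
    exact hasContr_F₁_HMinus hħ hμ hμN hν hνN hb.1 hb.2
  · have hb := mem_indexF₂.1 (Finset.inr_mem_disjSum.1 hb)
    exact hasContr_F₂_HMinus hħ hμ hμN hν hνN hb.1 hb.2

theorem exchangeRelation_HMinus_F {μ ν : ℕ} (hħ : ħ ≠ 0) (hμ : 1 ≤ μ) (hμN : μ < N)
    (hν : 1 ≤ ν) (hνN : ν < N) :
    ExchangeRelation ħ k (fun w => w - Complex.I * halfCartan μ ν * ħ) (HCurrent N ħ k false μ)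
      (FCurrent N ħ k ν) (fun w => w + Complex.I * halfCartan μ ν * ħ) := by
  refine exchangeRelation_of_right (isExpansion_H false μ) (isExpansion_F ν)
    (fun _ _ _ _ => hasContr_HMinus_any _ _)
    (fun b hb _ _ => hasContr_F_HMinus hħ hμ hμN hν hνN hb) (fun w => rfl) fun w => ?_
  ring

theorem exchangeRelation_HPlus_F {μ ν : ℕ} (hħ : ħ ≠ 0) (hμ : 1 ≤ μ) (hμN : μ < N)
    (hν : 1 ≤ ν) (hνN : ν < N) :
    ExchangeRelation ħ k (fun w => w - Complex.I * halfCartan μ ν * ħ + Complex.I * k * ħ)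
      (HCurrent N ħ k true μ) (FCurrent N ħ k ν)
      (fun w => w + Complex.I * halfCartan μ ν * ħ + Complex.I * k * ħ) := by
  refine exchangeRelation_of_left (isExpansion_H true μ) (isExpansion_F ν)
    (fun _ _ b hb => hasContr_HPlus_F hħ hμ hμN hν hνN hb)
    (fun _ _ _ _ => hasContr_any_HPlus _ _) (fun w => ?_) fun w => ?_ <;> ring

/-- H^- on the right splits into a term of E and a term of F₁ at the same point, and the uniform
contractions of H^+ with them add up. -/
theorem hasContr_HPlus_HMinus {μ ν : ℕ} (hħ : ħ ≠ 0) (hμ : 1 ≤ μ) (hμN : μ < N)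
    (hν : 1 ≤ ν) (hνN : ν < N) : HasContr ħ k (HData N ħ k true μ) (HData N ħ k false ν)
    [(halfCartan μ ν, -halfCartan μ ν), (k - halfCartan μ ν, k + halfCartan μ ν)] := by
  have hν' : 1 ∈ Finset.Icc 1 ν := Finset.mem_Icc.2 ⟨le_rfl, hν⟩
  exact HasContr.HMinus hν (hasContr_HPlus_E hħ hμ hμN hν hνN hν')
    (hasContr_HPlus_F₁ hħ hμ hμN hν hνN hν' (by simp))

theorem exchangeRelation_HPlus_HMinus {μ ν : ℕ} (hħ : ħ ≠ 0) (hμ : 1 ≤ μ) (hμN : μ < N)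
    (hν : 1 ≤ ν) (hνN : ν < N) :
    ExchangeRelation ħ k (fun _ => 1) (HCurrent N ħ k true μ) (HCurrent N ħ k false ν)
      (fun w => (w + Complex.I * k * ħ + Complex.I * halfCartan μ ν * ħ)
          / (w + Complex.I * k * ħ - Complex.I * halfCartan μ ν * ħ)
        * ((w - Complex.I * halfCartan μ ν * ħ) / (w + Complex.I * halfCartan μ ν * ħ))) := by
  have hc := hasContr_HPlus_HMinus (k := k) hħ hμ hμN hν hνN
  generalize hB : halfCartan μ ν = b at hc ⊢
  obtain ⟨R, -, hR⟩ := exists_bounded ħ [(b, -b), (k - b, k + b)]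
  refine exchangeRelation_of (isExpansion_H true μ) (isExpansion_H false ν) (fun _ _ _ _ => hc)
    (fun _ _ _ _ => hasContr_any_HPlus _ _) (denPoly ħ [(b, -b), (k - b, k + b)])
    (denPoly_ne_zero _ _) R
    (fun _ _ w => (w + Complex.I * (-b) * ħ) * (w + Complex.I * (k + b) * ħ))
    (fun _ _ => by fun_prop) (fun _ _ _ _ w hw => ?_) (fun _ _ _ _ w hw => ?_)
  · have h1 := ratio_den_ne_zero (hR (b, -b) (by simp)).1 hw
    have h2 := ratio_den_ne_zero (hR (k - b, k + b) (by simp)).1 hw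
    simp only at h1 h2
    simp only [ratio_cons, ratio_nil, denPoly, List.map_cons, List.map_nil, List.prod_cons,
      List.prod_nil, Polynomial.eval_mul, Polynomial.eval_add, Polynomial.eval_X, Polynomial.eval_C,
      mul_one, one_mul]
    generalize w + Complex.I * b * ħ = a₁ at h1 ⊢
    generalize w + Complex.I * (k - b) * ħ = a₂ at h2 ⊢
    field_simp
  · have h1 := ratio_den_ne_zero (hR (b, -b) (by simp)).1 hw
    have h2 := ratio_den_ne_zero (hR (k - b, k + b) (by simp)).1 hw
    have h3 : w + Complex.I * k * ħ - Complex.I * b * ħ = w + Complex.I * (k - b) * ħ := by ring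
    simp only at h1 h2
    simp only [ratio_nil, denPoly, List.map_cons, List.map_nil, List.prod_cons,
      List.prod_nil, Polynomial.eval_mul, Polynomial.eval_add, Polynomial.eval_X, Polynomial.eval_C,
      mul_one, h3]
    have h4 : w + Complex.I * k * ħ + Complex.I * b * ħ = w + Complex.I * (k + b) * ħ := by ring
    have h5 : w - Complex.I * b * ħ = w + Complex.I * -b * ħ := by ring
    rw [h4, h5]
    generalize w + Complex.I * b * ħ = a₁ at h1 ⊢
    generalize w + Complex.I * (k - b) * ħ = a₂ at h2 ⊢
    field_simp

theorem exchangeRelation_HMinus_HPlus {μ ν : ℕ} (hħ : ħ ≠ 0) (hμ : 1 ≤ μ) (hμN : μ < N)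
    (hν : 1 ≤ ν) (hνN : ν < N) :
    ExchangeRelation ħ k (fun _ => 1) (HCurrent N ħ k false μ) (HCurrent N ħ k true ν)
      (fun w => (w - Complex.I * k * ħ + Complex.I * halfCartan μ ν * ħ)
          / (w - Complex.I * k * ħ - Complex.I * halfCartan μ ν * ħ)
        * ((w - Complex.I * halfCartan μ ν * ħ) / (w + Complex.I * halfCartan μ ν * ħ))) := by
  have hc := hasContr_HPlus_HMinus (k := k) hħ hν hνN hμ hμN
  rw [halfCartan_comm ν μ] at hc
  generalize hB : halfCartan μ ν = b at hc ⊢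
  obtain ⟨R, -, hR⟩ := exists_bounded ħ [(b, -b), (k - b, k + b)]
  refine exchangeRelation_of (isExpansion_H false μ) (isExpansion_H true ν)
    (fun _ _ _ _ => hasContr_HMinus_any _ _) (fun _ _ _ _ => hc) 1 one_ne_zero R (fun _ _ _ => 1)
    (fun _ _ => by fun_prop) (fun _ _ _ _ w hw => ?_) (fun _ _ _ _ w hw => ?_)
  · simp [ratio_nil]
  · have hw' : R < |(-w).im| := by rwa [neg_im, abs_neg]
    have h1 := ratio_den_ne_zero (hR (b, -b) (by simp)).1 hw'
    have h2 := ratio_den_ne_zero (hR (k - b, k + b) (by simp)).1 hw'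
    have h3 := ratio_den_ne_zero (hR (b, -b) (by simp)).2 hw'
    have h4 := ratio_den_ne_zero (hR (k - b, k + b) (by simp)).2 hw'
    simp only at h1 h2 h3 h4
    have e1 : w - Complex.I * b * ħ = -(-w + Complex.I * b * ħ) := by ring
    have e2 : w + Complex.I * b * ħ = -(-w + Complex.I * (-b) * ħ) := by ring
    have e3 : w - Complex.I * k * ħ + Complex.I * b * ħ = -(-w + Complex.I * (k - b) * ħ) := by ring
    have e4 : w - Complex.I * k * ħ - Complex.I * b * ħ = -(-w + Complex.I * (k + b) * ħ) := by ring
    simp only [ratio_cons, ratio_nil, Polynomial.eval_one, mul_one, one_mul]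
    rw [e4, e3, e1, e2]
    generalize -w + Complex.I * b * ħ = a₁ at *
    generalize -w + Complex.I * (-b) * ħ = a₂ at *
    generalize -w + Complex.I * (k - b) * ħ = a₃ at *
    generalize -w + Complex.I * (k + b) * ħ = a₄ at *
    field_simp

end FreeBoson

namespace FreeBoson

variable {N : ℕ} {ħ : ℝ} {k : ℂ} {ι κ : Type*}

/-! ### Regular families of matrix elements -/

/-- The family `T`, indexed by the matrix elements, continues from `R < |Im (u - v)|` to entire
functions of `(u, v)`. -/
def Regular (T : (Symbols N ħ → ℂ) → Symbols N ħ → ℂ → ℂ → ℂ) : Prop :=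
  ∃ R : ℝ, ∀ Ψ ∈ Fock N ħ, ∀ ζ, IsTest ζ → ∃ G : ℂ × ℂ → ℂ, Differentiable ℂ G ∧
    ∀ u v : ℂ, R < |(u - v).im| → T Ψ ζ u v = G (u, v)

variable {T T' : (Symbols N ħ → ℂ) → Symbols N ħ → ℂ → ℂ → ℂ}

theorem Regular.add (h : Regular T) (h' : Regular T') :
    Regular fun Ψ ζ u v => T Ψ ζ u v + T' Ψ ζ u v := by
  obtain ⟨R, hR⟩ := h
  obtain ⟨R', hR'⟩ := h'
  refine ⟨max R R', fun Ψ hΨ ζ hζ => ?_⟩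
  obtain ⟨G, hG, e⟩ := hR Ψ hΨ ζ hζ
  obtain ⟨G', hG', e'⟩ := hR' Ψ hΨ ζ hζ
  refine ⟨fun z => G z + G' z, hG.add hG', fun u v huv => ?_⟩
  dsimp only
  rw [e u v ((le_max_left _ _).trans_lt huv), e' u v ((le_max_right _ _).trans_lt huv)]

theorem regular_zero : Regular fun (_ : Symbols N ħ → ℂ) (_ : Symbols N ħ) _ _ => 0 :=
  ⟨0, fun _ _ _ _ => ⟨fun _ => 0, by fun_prop, fun _ _ _ => rfl⟩⟩

theorem Regular.sum {s : Finset ι} {T : ι → (Symbols N ħ → ℂ) → Symbols N ħ → ℂ → ℂ → ℂ}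
    (h : ∀ i ∈ s, Regular (T i)) : Regular fun Ψ ζ u v => ∑ i ∈ s, T i Ψ ζ u v := by
  classical
  induction s using Finset.induction_on with
  | empty => simpa using regular_zero
  | insert a s ha ih =>
    simp only [Finset.sum_insert ha]
    exact (h a (Finset.mem_insert_self a s)).add
      (ih fun i hi => h i (Finset.mem_insert_of_mem hi))

theorem Regular.congr (h : Regular T) (R : ℝ)
    (e : ∀ Ψ ζ u v, R < |(u - v).im| → T' Ψ ζ u v = T Ψ ζ u v) : Regular T' := by
  obtain ⟨R', hR⟩ := h
  refine ⟨max R R', fun Ψ hΨ ζ hζ => ?_⟩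
  obtain ⟨G, hG, e'⟩ := hR Ψ hΨ ζ hζ
  refine ⟨G, hG, fun u v huv => ?_⟩
  rw [e _ _ u v ((le_max_left _ _).trans_lt huv), e' u v ((le_max_right _ _).trans_lt huv)]

theorem Regular.congr' (h : Regular T) (e : ∀ Ψ ζ u v, T' Ψ ζ u v = T Ψ ζ u v) : Regular T' :=
  h.congr 0 fun Ψ ζ u v _ => e Ψ ζ u v

/-- It suffices to consider the terms whose indices lie in `s` together. -/
theorem Regular.of_support_add [DecidableEq ι] [DecidableEq κ] {I : Finset ι} {J : Finset κ}
    {T : ι → κ → (Symbols N ħ → ℂ) → Symbols N ħ → ℂ → ℂ → ℂ} (s : Finset (ι × κ))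
    (hs : ∀ p ∈ s, p.1 ∈ I ∧ p.2 ∈ J)
    (h : ∀ a ∈ I, ∀ b ∈ J, (a, b) ∉ s → Regular (T a b))
    (h' : Regular fun Ψ ζ u v => (∑ p ∈ s, T p.1 p.2 Ψ ζ u v) + T' Ψ ζ u v) :
    Regular fun Ψ ζ u v => (∑ a ∈ I, ∑ b ∈ J, T a b Ψ ζ u v) + T' Ψ ζ u v := by
  have h1 : Regular fun Ψ ζ u v => ∑ p ∈ (I ×ˢ J) \ s, T p.1 p.2 Ψ ζ u v :=
    Regular.sum fun p hp => by
      rw [Finset.mem_sdiff, Finset.mem_product] at hp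
      exact h p.1 hp.1.1 p.2 hp.1.2 hp.2
  refine (h1.add h').congr' fun Ψ ζ u v => ?_
  rw [← add_assoc, Finset.sum_sdiff fun p hp => Finset.mem_product.2 (hs p hp),
    Finset.sum_product]

theorem Regular.of_support [DecidableEq ι] [DecidableEq κ] {I : Finset ι} {J : Finset κ}
    {T : ι → κ → (Symbols N ħ → ℂ) → Symbols N ħ → ℂ → ℂ → ℂ} (s : Finset (ι × κ))
    (hs : ∀ p ∈ s, p.1 ∈ I ∧ p.2 ∈ J)
    (h : ∀ a ∈ I, ∀ b ∈ J, (a, b) ∉ s → Regular (T a b))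
    (h' : Regular fun Ψ ζ u v => ∑ p ∈ s, T p.1 p.2 Ψ ζ u v) :
    Regular fun Ψ ζ u v => ∑ a ∈ I, ∑ b ∈ J, T a b Ψ ζ u v := by
  simpa using Regular.of_support_add (T' := fun _ _ _ _ => 0) s hs h (by simpa using h')

variable {A A₁ A₂ B B₁ B₂ : ℂ → VertexData N}

theorem regular_term (hA : EntireFamily A) (hB : EntireFamily B) {q : ℂ → ℂ}
    (hq : Differentiable ℂ q) :
    Regular fun (Ψ : Symbols N ħ → ℂ) ζ u v => q (u - v) * vertexOp k (A u + B v) Ψ ζ :=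
  ⟨0, fun _ hΨ _ hζ => ⟨fun z => q (z.1 - z.2) * vertexOp k (A z.1 + B z.2) _ _,
    (hq.comp (by fun_prop)).mul (differentiable_of_mem_separable
      (vertexOp_mem_separable hA hB hΨ hζ)), fun _ _ _ => rfl⟩⟩

/-- Poles with opposite residues cancel. -/
theorem regular_difference (hA₁ : EntireFamily A₁) (hB₁ : EntireFamily B₁) (hA₂ : EntireFamily A₂)
    (hB₂ : EntireFamily B₂) {q : ℂ → ℂ} (hq : Differentiable ℂ q) (s : ℂ)
    (h : ∀ v, A₁ (sh ħ v (-s)) + B₁ v = A₂ (sh ħ v (-s)) + B₂ v) :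
    Regular fun (Ψ : Symbols N ħ → ℂ) ζ u v => q (u - v) / (u - v + Complex.I * s * ħ)
      * (vertexOp k (A₁ u + B₁ v) Ψ ζ - vertexOp k (A₂ u + B₂ v) Ψ ζ) := by
  refine ⟨|(s * ħ).re|, fun Ψ hΨ ζ hζ => ?_⟩
  -- On the line u = v - isħ the two exponents agree by `h`, so the difference of the matrix
  -- elements vanishes there and is divisible by the denominator.
  obtain ⟨G, hG, e⟩ := exists_division (sub_mem (vertexOp_mem_separable (k := k) hA₁ hB₁ hΨ hζ)
    (vertexOp_mem_separable (k := k) hA₂ hB₂ hΨ hζ)) (-s * (Complex.I * ħ)) (fun v => by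
      have := h v
      simp only [sh] at this
      simp only [Pi.sub_apply, this, sub_self])
  refine ⟨fun z => q (z.1 - z.2) * G z, (hq.comp (by fun_prop)).mul hG, fun u v huv => ?_⟩
  have h0 := ratio_den_ne_zero le_rfl huv
  have e1 := e u v
  simp only [Pi.sub_apply] at e1
  dsimp only
  rw [e1, show u - v - -s * (Complex.I * ħ) = u - v + Complex.I * s * ħ by ring]
  field_simp

theorem ratio_single (s d w : ℂ) (h : w + Complex.I * s * ħ ≠ 0) :
    ratio ħ [(s, s + d)] w = 1 + Complex.I * d * ħ / (w + Complex.I * s * ħ) := by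
  rw [ratio_cons, ratio_nil, mul_one, eq_comm, eq_div_iff h, add_mul, div_mul_cancel₀ _ h]
  ring

/-- Each factor is 1 + idħ/(w + isħ), so the polar parts are c₁d₁ and c₂d₂ times matrix elements
that coincide on the polar line. By `hc` what is left is a multiple of the difference of these
elements over the denominator. -/
theorem regular_cancel (hA₁ : EntireFamily A₁) (hB₁ : EntireFamily B₁) (hA₂ : EntireFamily A₂)
    (hB₂ : EntireFamily B₂) {q : ℂ → ℂ} (hq : Differentiable ℂ q) {s d₁ d₂ c₁ c₂ : ℂ}
    (hc : c₁ * d₁ + c₂ * d₂ = 0)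
    (h : ∀ v, A₁ (sh ħ v (-s)) + B₁ v = A₂ (sh ħ v (-s)) + B₂ v) :
    Regular fun (Ψ : Symbols N ħ → ℂ) ζ u v =>
      c₁ * (q (u - v) * ratio ħ [(s, s + d₁)] (u - v) * vertexOp k (A₁ u + B₁ v) Ψ ζ)
      + c₂ * (q (u - v) * ratio ħ [(s, s + d₂)] (u - v) * vertexOp k (A₂ u + B₂ v) Ψ ζ) := by
  have t₁ := regular_term (ħ := ħ) (k := k) hA₁ hB₁ (q := fun w => c₁ * q w) (hq.const_mul _)
  have t₂ := regular_term (ħ := ħ) (k := k) hA₂ hB₂ (q := fun w => c₂ * q w) (hq.const_mul _)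
  have t₃ := regular_difference (ħ := ħ) (k := k) hA₁ hB₁ hA₂ hB₂
    (q := fun w => c₁ * d₁ * (Complex.I * ħ) * q w) (hq.const_mul _) s h
  refine ((t₁.add t₂).add t₃).congr |(s * ħ).re| fun Ψ ζ u v huv => ?_
  have h0 := ratio_den_ne_zero le_rfl huv
  rw [ratio_single _ _ _ h0, ratio_single _ _ _ h0]
  generalize u - v + Complex.I * s * ħ = z at h0 ⊢
  field_simp
  linear_combination (q (u - v) * Complex.I * ħ * vertexOp k (A₂ u + B₂ v) Ψ ζ) * hc

/-- Subtraction of the polar part. -/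
theorem regular_residue (hA₁ : EntireFamily A₁) (hB₁ : EntireFamily B₁) (hA₂ : EntireFamily A₂)
    (hB₂ : EntireFamily B₂) (s d c : ℂ)
    (h : ∀ v, A₁ (sh ħ v (-s)) + B₁ v = A₂ (sh ħ v (-s)) + B₂ v) :
    Regular fun (Ψ : Symbols N ħ → ℂ) ζ u v =>
      c * (1 * ratio ħ [(s, s + d)] (u - v) * vertexOp k (A₁ u + B₁ v) Ψ ζ)
      + -(c * d * (Complex.I * ħ) / (u - v + Complex.I * s * ħ)
        * vertexOp k (A₂ u + B₂ v) Ψ ζ) := by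
  have t₁ := regular_term (ħ := ħ) (k := k) hA₁ hB₁ (q := fun _ => c) (by fun_prop)
  have t₃ := regular_difference (ħ := ħ) (k := k) hA₁ hB₁ hA₂ hB₂
    (q := fun _ => c * d * (Complex.I * ħ)) (by fun_prop) s h
  refine (t₁.add t₃).congr |(s * ħ).re| fun Ψ ζ u v huv => ?_
  rw [ratio_single _ _ _ (ratio_den_ne_zero le_rfl huv)]
  ring

/-- The zero of `f` cancels the pole of `ratio ħ L`. -/
def Clears (ħ : ℝ) (f : ℂ → ℂ) (L : List (ℂ × ℂ)) : Prop :=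
  L = [] ∨ ∃ α β, L = [(α, β)] ∧ ∀ w, f w = w + Complex.I * α * ħ

theorem regular_of_clears (hA : EntireFamily A) (hB : EntireFamily B) {f : ℂ → ℂ}
    (hf : Differentiable ℂ f) {L : List (ℂ × ℂ)} (h : Clears ħ f L) (c : ℂ) :
    Regular fun (Ψ : Symbols N ħ → ℂ) ζ u v =>
      c * (f (u - v) * ratio ħ L (u - v) * vertexOp k (A u + B v) Ψ ζ) := by
  rcases h with rfl | ⟨α, β, rfl, e⟩
  · refine (regular_term (ħ := ħ) (k := k) hA hB (q := fun w => c * f w)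
      (hf.const_mul _)).congr' fun Ψ ζ u v => ?_
    rw [ratio_nil]
    ring
  · refine (regular_term (ħ := ħ) (k := k) hA hB (q := fun w => c * (w + Complex.I * β * ħ))
      (by fun_prop)).congr |(α * ħ).re| fun Ψ ζ u v huv => ?_
    have h0 := ratio_den_ne_zero le_rfl huv
    rw [ratio_cons, ratio_nil, e]
    simp only
    field_simp

variable {X Y : Current N} {I : Finset ι} {J : Finset κ} {x : ι → ℂ} {y : κ → ℂ}
  {F : ι → ℂ → VertexData N} {H : κ → ℂ → VertexData N}

theorem opeRelation_of_regular (hX : IsExpansion X I x F) (hY : IsExpansion Y J y H)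
    {L : ι → κ → List (ℂ × ℂ)} {L' : κ → ι → List (ℂ × ℂ)}
    (h : ∀ a ∈ I, ∀ b ∈ J, HasContr ħ k (F a) (H b) (L a b))
    (h' : ∀ b ∈ J, ∀ a ∈ I, HasContr ħ k (H b) (F a) (L' b a)) {f g : ℂ → ℂ}
    (hex : ∀ a ∈ I, ∀ b ∈ J, RatExchange ħ f g (L a b) (L' b a))
    (S : ℂ → ℂ → (Symbols N ħ → ℂ) → (Symbols N ħ → ℂ))
    (hS : Regular fun Ψ ζ u v => (∑ a ∈ I, ∑ b ∈ J, x a * y b *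
        (f (u - v) * ratio ħ (L a b) (u - v) * vertexOp k (F a u + H b v) Ψ ζ)) - S u v Ψ ζ) :
    OPERelation ħ k f X Y g S := by
  obtain ⟨R, hR⟩ := hS
  exact opeRelation_of hX hY h h' hex R S hR

/-! ### Exchange of the terms -/

theorem ratio_append (L L' : List (ℂ × ℂ)) (w : ℂ) :
    ratio ħ (L ++ L') w = ratio ħ L w * ratio ħ L' w := by
  simp [ratio]

theorem ratio_barList (L : List (ℂ × ℂ)) (w : ℂ) : ratio ħ (barList L) w = ratio ħ L (-w) := by
  induction L with
  | nil => rfl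
  | cons p L ih =>
    rw [barList_cons, ratio_cons, ratio_cons, ih, ← neg_div_neg_eq]
    congr 2 <;> simp only <;> ring

theorem ratExchange_self (L : List (ℂ × ℂ)) (f : ℂ → ℂ) : RatExchange ħ f f L (barList L) :=
  fun w _ _ => by rw [ratio_barList, neg_neg]

theorem ratExchange_nil (f : ℂ → ℂ) : RatExchange ħ f f [] [] := ratExchange_self [] f

theorem ratExchange_left {α β : ℂ} {f g : ℂ → ℂ} (hf : ∀ w, f w = w + Complex.I * α * ħ)
    (hg : ∀ w, g w = w + Complex.I * β * ħ) : RatExchange ħ f g [(α, β)] [] := by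
  intro w hw _
  simp only [denPoly, List.map_cons, List.map_nil, List.prod_cons, List.prod_nil, mul_one,
    Polynomial.eval_add, Polynomial.eval_X, Polynomial.eval_C] at hw
  rw [ratio_cons, ratio_nil, ratio_nil, hf, hg, mul_one, mul_one, mul_div_cancel₀ _ hw]

theorem RatExchange.symm {f g f' g' : ℂ → ℂ} {L L' : List (ℂ × ℂ)} (h : RatExchange ħ f g L L')
    (c : ℂ) (hf : ∀ w, f' w = c * g (-w)) (hg : ∀ w, g' w = c * f (-w)) :
    RatExchange ħ f' g' L' L := by
  intro w h1 h2
  have := h (-w) h2 (by rwa [neg_neg])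
  rw [neg_neg] at this
  rw [hf, hg, mul_assoc, ← this, mul_assoc]

theorem ratExchange_both {α β α' β' : ℂ} {f g : ℂ → ℂ} (hf : ∀ w, f w = w + Complex.I * α * ħ)
    (hg : ∀ w, g w = w - Complex.I * α' * ħ) (h : β' = -β) :
    RatExchange ħ f g [(α, β)] [(α', β')] := by
  intro w hw hw'
  simp only [denPoly, List.map_cons, List.map_nil, List.prod_cons, List.prod_nil, mul_one,
    Polynomial.eval_add, Polynomial.eval_X, Polynomial.eval_C] at hw hw'
  rw [ratio_cons, ratio_nil, ratio_cons, ratio_nil, hf, hg, mul_one, mul_one, mul_div_cancel₀ _ hw,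
    mul_div_assoc', eq_div_iff hw', h]
  ring

/-- The factors in the exchange relation of two currents, in terms of the exponent `B`. -/
def IsExchangePair (ħ : ℝ) (B : ℂ) (f g : ℂ → ℂ) : Prop :=
  (B = 0 ∧ (f = fun _ => 1) ∧ g = fun _ => 1) ∨
    ((f = fun w => w + Complex.I * B * ħ) ∧ g = fun w => w - Complex.I * B * ħ)

theorem IsExchangePair.differentiable {B : ℂ} {f g : ℂ → ℂ} (h : IsExchangePair ħ B f g) :
    Differentiable ℂ f := by
  rcases h with ⟨-, rfl, -⟩ | ⟨rfl, -⟩ <;> fun_prop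

theorem IsExchangePair.eq_of_zero {f g : ℂ → ℂ} (h : IsExchangePair ħ 0 f g) : f = g := by
  rcases h with ⟨-, rfl, rfl⟩ | ⟨rfl, rfl⟩
  · rfl
  · funext w
    ring

theorem IsExchangePair.eq_of_ne {B : ℂ} {f g : ℂ → ℂ} (h : IsExchangePair ħ B f g) (hB : B ≠ 0) :
    (∀ w, f w = w + Complex.I * B * ħ) ∧ ∀ w, g w = w - Complex.I * B * ħ := by
  rcases h with ⟨h, -, -⟩ | ⟨rfl, rfl⟩
  · exact absurd h hB
  · exact ⟨fun _ => rfl, fun _ => rfl⟩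

theorem halfCartan_self (μ : ℕ) : halfCartan μ μ = 1 := if_pos rfl

theorem halfCartan_adjacent {μ ν : ℕ} (h : μ = ν + 1 ∨ ν = μ + 1) : halfCartan μ ν = -1 / 2 := by
  rw [halfCartan, if_neg (by omega), if_pos h]

theorem halfCartan_distant {μ ν : ℕ} (h : μ ≠ ν) (h' : ¬(μ = ν + 1 ∨ ν = μ + 1)) :
    halfCartan μ ν = 0 := by
  rw [halfCartan, if_neg h, if_neg h']

end FreeBoson

/-! ### Exchange of the terms within E E and F F, and the Serre relations -/

namespace FreeBoson

set_option linter.unusedSimpArgs false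

variable {N : ℕ} {ħ : ℝ} {k : ℂ} {f g : ℂ → ℂ}

theorem IsExchangePair.exists_symm {B : ℂ} (h : IsExchangePair ħ B f g) :
    ∃ c : ℂ, (∀ w, f w = c * g (-w)) ∧ ∀ w, g w = c * f (-w) := by
  rcases h with ⟨-, rfl, rfl⟩ | ⟨rfl, rfl⟩
  · exact ⟨1, fun _ => by simp, fun _ => by simp⟩
  · exact ⟨-1, fun _ => by ring, fun _ => by ring⟩

theorem IsExchangePair.ratExchange_right {B α β : ℂ} (h : IsExchangePair ħ B f g)
    (hr : RatExchange ħ f g [(α, β)] []) : RatExchange ħ f g [] [(α, β)] := by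
  obtain ⟨c, h1, h2⟩ := h.exists_symm
  exact hr.symm c h1 h2

/-- For coupled currents either one order carries the full factor and the other none, or, for
identical terms, each order carries half of it. For distant indices nothing is contracted. -/
theorem ratExchange_EE {μ ν : ℕ} (h : IsExchangePair ħ (halfCartan μ ν) f g) (m : ℕ) (ε : Bool)
    (n : ℕ) (δ : Bool) : RatExchange ħ f g (listEE μ m ε ν n δ) (listEE ν n δ μ m ε) := by
  rcases eq_or_ne μ ν with rfl | h1
  · rw [halfCartan_self] at h
    have e := h.eq_of_ne one_ne_zero
    have hl : RatExchange ħ f g [(1, -1)] [] :=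
      ratExchange_left e.1 fun w => by rw [e.2]; ring
    have hr := h.ratExchange_right hl
    have hb : RatExchange ħ f g [(1, 0)] [(1, 0)] := ratExchange_both e.1 e.2 (by simp)
    simp only [listEE, if_true]
    rcases lt_trichotomy m n with h2 | rfl | h2
    · simpa [h2, h2.ne', h2.not_gt] using hr
    · cases ε <;> cases δ <;> simp [hl, hr, hb]
    · simpa [h2, h2.ne', h2.not_gt] using hl
  by_cases h2 : μ = ν + 1 ∨ ν = μ + 1
  · rw [halfCartan_adjacent h2] at h
    have e := h.eq_of_ne (by norm_num)
    have hl : RatExchange ħ f g [(-1 / 2, 1 / 2)] [] :=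
      ratExchange_left e.1 fun w => by rw [e.2]; ring
    have hr := h.ratExchange_right hl
    rcases h2 with rfl | rfl
    · have h3 : ν ≠ ν + 1 + 1 := by omega
      simp only [listEE, h1, h1.symm, if_false, if_true, h3]
      rcases lt_trichotomy m n with h2 | rfl | h2
      · simpa [h2, h2.ne', h2.not_gt, h2.ne] using hr
      · cases ε <;> cases δ <;> simp only [lt_irrefl, true_and, false_or, Bool.false_eq_true,
          reduceCtorEq, if_true, if_false, hl, hr]
      · simpa [h2, h2.ne', h2.not_gt, h2.ne] using hl
    · have h3 : μ ≠ μ + 1 + 1 := by omega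
      simp only [listEE, h1, h1.symm, if_false, if_true, h3]
      rcases lt_trichotomy m n with h2 | rfl | h2
      · simpa [h2, h2.ne', h2.not_gt, h2.ne] using hr
      · cases ε <;> cases δ <;> simp only [lt_irrefl, true_and, false_or, Bool.false_eq_true,
          reduceCtorEq, if_true, if_false, hl, hr]
      · simpa [h2, h2.ne', h2.not_gt, h2.ne] using hl
  · rw [halfCartan_distant h1 h2] at h
    rw [h.eq_of_zero, listEE, listEE, if_neg h1, if_neg h1.symm, if_neg, if_neg, if_neg, if_neg]
    · exact ratExchange_nil g
    all_goals omega

/-- All poles sit at w = -iBħ, whatever the term, and this is the zero of `f`. -/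
theorem clears_EE {μ ν : ℕ} (h : IsExchangePair ħ (halfCartan μ ν) f g) (m : ℕ) (ε : Bool)
    (n : ℕ) (δ : Bool) : Clears ħ f (listEE μ m ε ν n δ) := by
  rcases eq_or_ne μ ν with rfl | h1
  · rw [halfCartan_self] at h
    have e := h.eq_of_ne one_ne_zero
    simp only [listEE, if_true]
    split_ifs
    · exact Or.inr ⟨_, _, rfl, e.1⟩
    · exact Or.inr ⟨_, _, rfl, e.1⟩
    · exact Or.inl rfl
  by_cases h2 : μ = ν + 1 ∨ ν = μ + 1
  · rw [halfCartan_adjacent h2] at h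
    have e := h.eq_of_ne (by norm_num)
    simp only [listEE, if_neg h1]
    split_ifs
    · exact Or.inr ⟨_, _, rfl, e.1⟩
    · exact Or.inl rfl
    · exact Or.inr ⟨_, _, rfl, e.1⟩
    · exact Or.inl rfl
    · exact Or.inl rfl
  · left
    rw [listEE, if_neg h1, if_neg fun h => h2 (Or.inl h), if_neg fun h => h2 (Or.inr h)]

theorem opeRelation_E_E (hħ : ħ ≠ 0) {μ ν : ℕ} (hμ : μ < N) (hν : ν < N)
    (h : IsExchangePair ħ (halfCartan μ ν) f g) :
    OPERelation ħ k f (ECurrent N ħ μ) (ECurrent N ħ ν) g fun _ _ _ _ => 0 := by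
  refine opeRelation_of_regular (isExpansion_E μ) (isExpansion_E ν)
    (fun a ha b hb => hasContr_E_E hħ (mem_indexE.1 ha) (mem_indexE.1 hb) hμ hν a.2 b.2)
    (fun b hb a ha => hasContr_E_E hħ (mem_indexE.1 hb) (mem_indexE.1 ha) hν hμ b.2 a.2)
    (fun a _ b _ => ratExchange_EE h a.1 a.2 b.1 b.2) _ ?_
  simp only [sub_zero]
  exact Regular.sum fun a _ => Regular.sum fun b _ =>
    regular_of_clears (entireFamily_ETerm μ a.1 a.2) (entireFamily_ETerm ν b.1 b.2)
      h.differentiable (clears_EE h a.1 a.2 b.1 b.2) _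

theorem serreRelation_E (hħ : ħ ≠ 0) {μ ν : ℕ} (hμ : μ < N) (hν : ν < N)
    (h : μ = ν + 1 ∨ ν = μ + 1) : SerreRelation ħ k (ECurrent N ħ μ) (ECurrent N ħ ν) := by
  refine serreRelation_of (isExpansion_E μ) (isExpansion_E ν)
    (fun a ha b hb => hasContr_E_E hħ (mem_indexE.1 ha) (mem_indexE.1 hb) hμ hμ a.2 b.2)
    (fun a ha b hb => hasContr_E_E hħ (mem_indexE.1 ha) (mem_indexE.1 hb) hμ hν a.2 b.2)
    (fun b hb a ha => hasContr_E_E hħ (mem_indexE.1 hb) (mem_indexE.1 ha) hν hμ b.2 a.2)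
    -- The value is dictated by the half Cartan matrix: 2a₀ = iħ B_{μμ} and -a₀ = iħ B_{μν}.
    (Complex.I * ħ / 2) (fun a _ b _ => ratExchange_EE ?_ a.1 a.2 b.1 b.2)
    (fun a _ b _ => ratExchange_EE ?_ a.1 a.2 b.1 b.2)
  · rw [halfCartan_self]
    right
    constructor <;> funext w <;> ring
  · rw [halfCartan_adjacent h]
    right
    constructor <;> funext w <;> ring

/-- The contractions of the terms of `F_μ(u)` and `F_ν(v)`. -/
noncomputable def listFF (k : ℂ) (μ ν : ℕ) :
    (ℕ × Bool) ⊕ (ℕ × Bool) → (ℕ × Bool) ⊕ (ℕ × Bool) → List (ℂ × ℂ)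
  | .inl a, .inl b => listF₁F₁ μ a.1 a.2 ν b.1 b.2
  | .inl a, .inr b => listF₁F₂ k μ a.1 a.2 ν b.1 b.2
  | .inr a, .inl b => listF₂F₁ k μ a.1 a.2 ν b.1 b.2
  | .inr a, .inr b => listF₂F₂ μ a.1 a.2 ν b.1 b.2

/-- The exponents of the terms of `F_μ`. -/
noncomputable def FTerm (N : ℕ) (ħ : ℝ) (k : ℂ) (μ : ℕ) :
    (ℕ × Bool) ⊕ (ℕ × Bool) → ℂ → VertexData N :=
  Sum.elim (fun a => FTerm₁ N ħ k μ a.1 a.2) fun a => FTerm₂ N ħ k μ a.1 a.2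

theorem hasContr_F_F (hħ : ħ ≠ 0) {μ ν : ℕ} (hμ : 1 ≤ μ) (hμN : μ < N) (hν : 1 ≤ ν) (hνN : ν < N)
    {a b : (ℕ × Bool) ⊕ (ℕ × Bool)} (ha : a ∈ (indexF₁ μ).disjSum (indexF₂ N μ))
    (hb : b ∈ (indexF₁ ν).disjSum (indexF₂ N ν)) :
    HasContr ħ k (FTerm N ħ k μ a) (FTerm N ħ k ν b) (listFF k μ ν a b) := by
  rcases a with a | a <;> rcases b with b | b <;>
    simp only [Finset.inl_mem_disjSum, Finset.inr_mem_disjSum, mem_indexF₁, mem_indexF₂] at ha hb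
  · exact hasContr_F₁_F₁ hħ ha.1 hb.1 hμN hνN ha.2 hb.2
  · exact hasContr_F₁_F₂ hħ ha.1 hb.1 hμN hν ha.2 hb.2
  · exact hasContr_F₂_F₁ hħ ha.1 hb.1 hμ hνN ha.2 hb.2
  · exact hasContr_F₂_F₂ hħ ha.1 hb.1 hμ hν ha.2 hb.2

/-- The factor of `barList L'` at w is the factor of `L'` at -w, so it is common to both orders and
only `L` has to be exchanged. -/
theorem ratExchange_append {L : List (ℂ × ℂ)} (h : RatExchange ħ f g L []) (L' : List (ℂ × ℂ)) :
    RatExchange ħ f g (L ++ barList L') L' := by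
  intro w hw _
  have hw' : (denPoly ħ L).eval w ≠ 0 := by
    intro h0
    apply hw
    simp only [denPoly, List.map_append, List.prod_append, Polynomial.eval_mul] at h0 ⊢
    rw [h0, zero_mul]
  have := h w hw' (by simp [denPoly])
  rw [ratio_append, ratio_barList, ← mul_assoc, this, ratio_nil, mul_one]

/-- The part of the contractions of the terms of `F₂` and `F₁` that does not depend on the terms. -/
theorem ratExchange_constant {μ ν : ℕ} (h : IsExchangePair ħ (-halfCartan μ ν) f g) :
    RatExchange ħ f g (if μ = ν then [(-1, 1)]
      else if μ = ν + 1 ∨ ν = μ + 1 then [(1 / 2, -1 / 2)] else []) [] := by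
  rcases eq_or_ne μ ν with rfl | h1
  · rw [halfCartan_self] at h
    have e := h.eq_of_ne (by norm_num)
    rw [if_pos rfl]
    exact ratExchange_left e.1 fun w => by rw [e.2]; ring
  rw [if_neg h1]
  by_cases h2 : μ = ν + 1 ∨ ν = μ + 1
  · rw [halfCartan_adjacent h2] at h
    have e := h.eq_of_ne (by norm_num)
    rw [if_pos h2]
    exact ratExchange_left (fun w => by rw [e.1]; ring) fun w => by rw [e.2]; ring
  · rw [halfCartan_distant h1 h2, neg_zero] at h
    rw [if_neg h2, h.eq_of_zero]
    exact ratExchange_nil g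

theorem ratExchange_F₂F₁ {μ ν : ℕ} (h : IsExchangePair ħ (-halfCartan μ ν) f g) (m : ℕ) (ε : Bool)
    (n : ℕ) (δ : Bool) : RatExchange ħ f g (listF₂F₁ k μ m ε ν n δ) (listF₁F₂ k ν n δ μ m ε) :=
  ratExchange_append (ratExchange_constant h) _

theorem ratExchange_F₁F₁ {μ ν : ℕ} (h : IsExchangePair ħ (-halfCartan μ ν) f g) (m : ℕ) (ε : Bool)
    (n : ℕ) (δ : Bool) : RatExchange ħ f g (listF₁F₁ μ m ε ν n δ) (listF₁F₁ ν n δ μ m ε) := by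
  rcases eq_or_ne μ ν with rfl | h1
  · rw [halfCartan_self] at h
    have e := h.eq_of_ne (by norm_num)
    have hl : RatExchange ħ f g [(-1, 1)] [] :=
      ratExchange_left e.1 fun w => by rw [e.2]; ring
    have hr := h.ratExchange_right hl
    have hb : RatExchange ħ f g [(-1, 0)] [(-1, 0)] := ratExchange_both e.1 e.2 (by simp)
    simp only [listF₁F₁, if_true]
    rcases lt_trichotomy m n with h2 | rfl | h2
    · simpa [h2, h2.ne', h2.not_gt] using hr
    · cases ε <;> cases δ <;> simp [hl, hr, hb]
    · simpa [h2, h2.ne', h2.not_gt] using hl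
  by_cases h2 : μ = ν + 1 ∨ ν = μ + 1
  · rw [halfCartan_adjacent h2] at h
    have e := h.eq_of_ne (by norm_num)
    have hl : RatExchange ħ f g [(1 / 2, -1 / 2)] [] :=
      ratExchange_left (fun w => by rw [e.1]; ring) fun w => by rw [e.2]; ring
    have hr := h.ratExchange_right hl
    rcases h2 with rfl | rfl
    · have h3 : ν ≠ ν + 1 + 1 := by omega
      simp only [listF₁F₁, h1, h1.symm, if_false, if_true, h3]
      rcases lt_trichotomy m n with h2 | rfl | h2
      · simpa [h2, h2.ne', h2.not_gt, h2.ne] using hr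
      · cases ε <;> cases δ <;> simp only [lt_irrefl, true_and, false_or, Bool.false_eq_true,
          reduceCtorEq, if_true, if_false, hl, hr]
      · simpa [h2, h2.ne', h2.not_gt, h2.ne] using hl
    · have h3 : μ ≠ μ + 1 + 1 := by omega
      simp only [listF₁F₁, h1, h1.symm, if_false, if_true, h3]
      rcases lt_trichotomy m n with h2 | rfl | h2
      · simpa [h2, h2.ne', h2.not_gt, h2.ne] using hr
      · cases ε <;> cases δ <;> simp only [lt_irrefl, true_and, false_or, Bool.false_eq_true,
          reduceCtorEq, if_true, if_false, hl, hr]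
      · simpa [h2, h2.ne', h2.not_gt, h2.ne] using hl
  · rw [halfCartan_distant h1 h2, neg_zero] at h
    rw [h.eq_of_zero, listF₁F₁, listF₁F₁, if_neg h1, if_neg h1.symm, if_neg, if_neg, if_neg, if_neg]
    · exact ratExchange_nil g
    all_goals omega

theorem ratExchange_F₂F₂ {μ ν : ℕ} (h : IsExchangePair ħ (-halfCartan μ ν) f g) (m : ℕ) (ε : Bool)
    (n : ℕ) (δ : Bool) : RatExchange ħ f g (listF₂F₂ μ m ε ν n δ) (listF₂F₂ ν n δ μ m ε) := by
  rcases eq_or_ne μ ν with rfl | h1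
  · rw [halfCartan_self] at h
    have e := h.eq_of_ne (by norm_num)
    have hl : RatExchange ħ f g [(-1, 1)] [] :=
      ratExchange_left e.1 fun w => by rw [e.2]; ring
    have hr := h.ratExchange_right hl
    have hb : RatExchange ħ f g [(-1, 0)] [(-1, 0)] := ratExchange_both e.1 e.2 (by simp)
    simp only [listF₂F₂, if_true]
    rcases lt_trichotomy m n with h2 | rfl | h2
    · simpa [h2, h2.ne', h2.not_gt, h2.ne] using hl
    · cases ε <;> cases δ <;> simp [hl, hr, hb]
    · simpa [h2, h2.ne', h2.not_gt, h2.ne] using hr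
  by_cases h2 : μ = ν + 1 ∨ ν = μ + 1
  · rw [halfCartan_adjacent h2] at h
    have e := h.eq_of_ne (by norm_num)
    have hl : RatExchange ħ f g [(1 / 2, -1 / 2)] [] :=
      ratExchange_left (fun w => by rw [e.1]; ring) fun w => by rw [e.2]; ring
    have hr := h.ratExchange_right hl
    rcases h2 with rfl | rfl
    · have h3 : ν ≠ ν + 1 + 1 := by omega
      simp only [listF₂F₂, h1, h1.symm, if_false, if_true, h3]
      rcases lt_trichotomy m n with h2 | rfl | h2
      · simpa [h2, h2.ne', h2.not_gt, h2.ne] using hl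
      · cases ε <;> cases δ <;> simp only [lt_irrefl, true_and, false_or, Bool.false_eq_true,
          reduceCtorEq, if_true, if_false, hl, hr]
      · simpa [h2, h2.ne', h2.not_gt, h2.ne] using hr
    · have h3 : μ ≠ μ + 1 + 1 := by omega
      simp only [listF₂F₂, h1, h1.symm, if_false, if_true, h3]
      rcases lt_trichotomy m n with h2 | rfl | h2
      · simpa [h2, h2.ne', h2.not_gt, h2.ne] using hl
      · cases ε <;> cases δ <;> simp only [lt_irrefl, true_and, false_or, Bool.false_eq_true,
          reduceCtorEq, if_true, if_false, hl, hr]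
      · simpa [h2, h2.ne', h2.not_gt, h2.ne] using hr
  · rw [halfCartan_distant h1 h2, neg_zero] at h
    rw [h.eq_of_zero, listF₂F₂, listF₂F₂, if_neg h1, if_neg h1.symm, if_neg, if_neg, if_neg, if_neg]
    · exact ratExchange_nil g
    all_goals omega

theorem ratExchange_FF {μ ν : ℕ} (h : IsExchangePair ħ (-halfCartan μ ν) f g)
    (a b : (ℕ × Bool) ⊕ (ℕ × Bool)) : RatExchange ħ f g (listFF k μ ν a b) (listFF k ν μ b a) := by
  rcases a with a | a <;> rcases b with b | b
  · exact ratExchange_F₁F₁ h _ _ _ _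
  · obtain ⟨c, h1, h2⟩ := h.exists_symm
    rw [halfCartan_comm] at h
    exact (ratExchange_F₂F₁ h _ _ _ _).symm c h1 h2
  · exact ratExchange_F₂F₁ h _ _ _ _
  · exact ratExchange_F₂F₂ h _ _ _ _

theorem serreRelation_F (hħ : ħ ≠ 0) {μ ν : ℕ} (hμ : 1 ≤ μ) (hμN : μ < N) (hν : 1 ≤ ν) (hνN : ν < N)
    (h : μ = ν + 1 ∨ ν = μ + 1) : SerreRelation ħ k (FCurrent N ħ k μ) (FCurrent N ħ k ν) := by
  refine serreRelation_of (isExpansion_F μ) (isExpansion_F ν)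
    (fun a ha b hb => hasContr_F_F hħ hμ hμN hμ hμN ha hb)
    (fun a ha b hb => hasContr_F_F hħ hμ hμN hν hνN ha hb)
    (fun b hb a ha => hasContr_F_F hħ hν hνN hμ hμN hb ha)
    -- Opposite to the value for E, because F exchanges with the factors of -B.
    (-(Complex.I * ħ / 2)) (fun a _ b _ => ratExchange_FF ?_ a b)
    (fun a _ b _ => ratExchange_FF ?_ a b)
  · rw [halfCartan_self]
    right
    constructor <;> funext w <;> ring
  · rw [halfCartan_adjacent h]
    right
    constructor <;> funext w <;> ring

theorem clears_F₁F₁ {μ ν : ℕ} (h : IsExchangePair ħ (-halfCartan μ ν) f g) (m : ℕ) (ε : Bool)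
    (n : ℕ) (δ : Bool) : Clears ħ f (listF₁F₁ μ m ε ν n δ) := by
  rcases eq_or_ne μ ν with rfl | h1
  · rw [halfCartan_self] at h
    have e := h.eq_of_ne (by norm_num)
    simp only [listF₁F₁, if_true]
    split_ifs
    · exact Or.inr ⟨_, _, rfl, e.1⟩
    · exact Or.inr ⟨_, _, rfl, e.1⟩
    · exact Or.inl rfl
  by_cases h2 : μ = ν + 1 ∨ ν = μ + 1
  · rw [halfCartan_adjacent h2] at h
    have e := (h.eq_of_ne (by norm_num)).1
    rw [show -(-1 / 2 : ℂ) = 1 / 2 by norm_num] at e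
    simp only [listF₁F₁, if_neg h1]
    split_ifs
    · exact Or.inr ⟨_, _, rfl, e⟩
    · exact Or.inl rfl
    · exact Or.inr ⟨_, _, rfl, e⟩
    · exact Or.inl rfl
    · exact Or.inl rfl
  · left
    rw [listF₁F₁, if_neg h1, if_neg fun h => h2 (Or.inl h), if_neg fun h => h2 (Or.inr h)]

theorem clears_F₂F₂ {μ ν : ℕ} (h : IsExchangePair ħ (-halfCartan μ ν) f g) (m : ℕ) (ε : Bool)
    (n : ℕ) (δ : Bool) : Clears ħ f (listF₂F₂ μ m ε ν n δ) := by
  rcases eq_or_ne μ ν with rfl | h1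
  · rw [halfCartan_self] at h
    have e := h.eq_of_ne (by norm_num)
    simp only [listF₂F₂, if_true]
    split_ifs
    · exact Or.inr ⟨_, _, rfl, e.1⟩
    · exact Or.inr ⟨_, _, rfl, e.1⟩
    · exact Or.inl rfl
  by_cases h2 : μ = ν + 1 ∨ ν = μ + 1
  · rw [halfCartan_adjacent h2] at h
    have e := (h.eq_of_ne (by norm_num)).1
    rw [show -(-1 / 2 : ℂ) = 1 / 2 by norm_num] at e
    simp only [listF₂F₂, if_neg h1]
    split_ifs
    · exact Or.inr ⟨_, _, rfl, e⟩
    · exact Or.inl rfl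
    · exact Or.inr ⟨_, _, rfl, e⟩
    · exact Or.inl rfl
    · exact Or.inl rfl
  · left
    rw [listF₂F₂, if_neg h1, if_neg fun h => h2 (Or.inl h), if_neg fun h => h2 (Or.inr h)]

end FreeBoson

namespace FreeBoson

variable {N : ℕ} {ħ : ℝ} {k : ℂ}

/-! ### Coincidence of the exponents at the poles -/

theorem ETerm_succ {μ m : ℕ} (hm : 1 ≤ m) (ε : Bool) (u : ℂ) : ETerm N ħ μ (m + 1) ε u
    = bc N ħ (m + 1) μ (sh ħ u (-m / 2)) + (bS N ħ ε (m + 1) (μ + 1) (sh ħ u (-m / 2))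
        - bc N ħ (m + 1) (μ + 1) (sh ħ u (if ε then -(m + 1) / 2 else -(m - 1) / 2)))
      + (bP N ħ m (μ + 1) (sh ħ u (-(m - 1) / 2)) - bP N ħ m μ (sh ħ u (-m / 2)))
      + ∑ n ∈ Finset.Icc 1 (m - 1),
        (bP N ħ n (μ + 1) (sh ħ u (-(n - 1) / 2)) - bP N ħ n μ (sh ħ u (-n / 2))) := by
  obtain ⟨l, rfl⟩ : ∃ l, m = l + 1 := ⟨m - 1, by omega⟩
  rw [ETerm, add_tsub_cancel_right, Finset.sum_Icc_succ_top (Nat.le_add_left 1 l),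
    add_tsub_cancel_right]
  have e1 : ((l + 1 + 1 : ℕ) : ℂ) - 1 = (l + 1 : ℕ) := by push_cast; ring
  have e2 : ((l + 1 + 1 : ℕ) : ℂ) - 2 = (l + 1 : ℕ) - 1 := by push_cast; ring
  have e3 : ((l + 1 + 1 : ℕ) : ℂ) = (l + 1 : ℕ) + 1 := by push_cast; ring
  rw [e1, e2, e3]
  abel

theorem FTerm₁_eq_add {μ m : ℕ} (hm : m < μ) (ε : Bool) (u : ℂ) : FTerm₁ N ħ k μ m ε u
    = bc N ħ m (μ + 1) (sh ħ u (m / 2))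
      + (- bS N ħ ε m μ (sh ħ u (m / 2))
        - bc N ħ m μ (sh ħ u (if ε then (m + 1) / 2 else (m - 1) / 2)))
      + (bM N ħ (m + 1) (μ + 1) (sh ħ u (m / 2)) - bM N ħ (m + 1) μ (sh ħ u ((m + 1) / 2)))
      + (∑ n ∈ Finset.Icc (m + 1 + 1) μ,
        (bM N ħ n (μ + 1) (sh ħ u ((n - 1) / 2)) - bM N ħ n μ (sh ħ u (n / 2))))
      + ((lamM N ħ μ (sh ħ u (-(k - N) / 4 - μ / 2))
          - lamM N ħ (μ + 1) (sh ħ u (-(k - N) / 4 - μ / 2)))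
        + ∑ s ∈ Finset.Icc (μ + 1) N,
          (bM N ħ μ s (sh ħ u (s / 2)) - bM N ħ (μ + 1) s (sh ħ u ((s - 1) / 2)))) := by
  rw [FTerm₁, ← Finset.add_sum_Ioc_eq_sum_Icc (show m + 1 ≤ μ from hm),
    ← Finset.Icc_add_one_left_eq_Ioc]
  have e1 : ((m + 1 : ℕ) : ℂ) - 1 = m := by push_cast; ring
  have e2 : ((m + 1 : ℕ) : ℂ) = m + 1 := by push_cast; ring
  rw [e1, e2]
  abel

theorem FTerm₁_succ (μ m : ℕ) (ε : Bool) (u : ℂ) : FTerm₁ N ħ k μ (m + 1) ε u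
    = bc N ħ (m + 1) (μ + 1) (sh ħ u ((m + 1) / 2))
      + (- bS N ħ ε (m + 1) μ (sh ħ u ((m + 1) / 2))
        - bc N ħ (m + 1) μ (sh ħ u (if ε then (m + 2) / 2 else m / 2)))
      + (∑ n ∈ Finset.Icc (m + 1 + 1) μ,
        (bM N ħ n (μ + 1) (sh ħ u ((n - 1) / 2)) - bM N ħ n μ (sh ħ u (n / 2))))
      + ((lamM N ħ μ (sh ħ u (-(k - N) / 4 - μ / 2))
          - lamM N ħ (μ + 1) (sh ħ u (-(k - N) / 4 - μ / 2)))
        + ∑ s ∈ Finset.Icc (μ + 1) N,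
          (bM N ħ μ s (sh ħ u (s / 2)) - bM N ħ (μ + 1) s (sh ħ u ((s - 1) / 2)))) := by
  have e1 : ((m + 1 : ℕ) : ℂ) - 1 = m := by push_cast; ring
  have e3 : ((m + 1 : ℕ) : ℂ) + 1 = m + 2 := by push_cast; ring
  have e2 : ((m + 1 : ℕ) : ℂ) = m + 1 := by push_cast; ring
  rw [FTerm₁, e1, e3, e2]
  abel

theorem FTerm₂_eq_add {μ m : ℕ} (hm : m ≤ N) (ε : Bool) (u : ℂ) : FTerm₂ N ħ k μ m ε u
    = bc N ħ μ m (sh ħ u (-k - (m - 1) / 2))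
      + (bS N ħ ε (μ + 1) m (sh ħ u (-k - (m - 1) / 2))
        - bc N ħ (μ + 1) m (sh ħ u (if ε then -k - m / 2 else -k - (m - 2) / 2)))
      + (bP N ħ μ m (sh ħ u (-k - m / 2)) - bP N ħ (μ + 1) m (sh ħ u (-k - (m - 1) / 2)))
      + ((∑ n ∈ Finset.Icc (m + 1) N, (bP N ħ μ n (sh ħ u (-(2 * k + n) / 2))
          - bP N ħ (μ + 1) n (sh ħ u (-(2 * k + n - 1) / 2))))
        + (lamP N ħ μ (sh ħ u (-(3 * k + N) / 4 - μ / 2))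
          - lamP N ħ (μ + 1) (sh ħ u (-(3 * k + N) / 4 - μ / 2)))) := by
  rw [FTerm₂, ← Finset.add_sum_Ioc_eq_sum_Icc hm, ← Finset.Icc_add_one_left_eq_Ioc]
  have e1 : -(2 * k + m - 1) / 2 = -k - ((m : ℂ) - 1) / 2 := by ring
  have e2 : -(2 * k + m) / 2 = -k - (m : ℂ) / 2 := by ring
  have e3 : -(2 * k + m - 2) / 2 = -k - ((m : ℂ) - 2) / 2 := by ring
  rw [e1, e2, e3]
  abel

theorem FTerm₂_succ (μ m : ℕ) (ε : Bool) (u : ℂ) : FTerm₂ N ħ k μ (m + 1) ε u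
    = bc N ħ μ (m + 1) (sh ħ u (-k - m / 2))
      + (bS N ħ ε (μ + 1) (m + 1) (sh ħ u (-k - m / 2))
        - bc N ħ (μ + 1) (m + 1) (sh ħ u (if ε then -k - (m + 1) / 2 else -k - (m - 1) / 2)))
      + ((∑ n ∈ Finset.Icc (m + 1) N, (bP N ħ μ n (sh ħ u (-(2 * k + n) / 2))
          - bP N ħ (μ + 1) n (sh ħ u (-(2 * k + n - 1) / 2))))
        + (lamP N ħ μ (sh ħ u (-(3 * k + N) / 4 - μ / 2))
          - lamP N ħ (μ + 1) (sh ħ u (-(3 * k + N) / 4 - μ / 2)))) := by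
  have e1 : -(2 * k + (m + 1 : ℕ) - 1) / 2 = -k - (m : ℂ) / 2 := by push_cast; ring
  have e2 : -(2 * k + (m + 1 : ℕ)) / 2 = -k - ((m : ℂ) + 1) / 2 := by push_cast; ring
  have e3 : -(2 * k + (m + 1 : ℕ) - 2) / 2 = -k - ((m : ℂ) - 1) / 2 := by push_cast; ring
  rw [FTerm₂, e1, e2, e3]
  abel

/-- At u = v + imħ passing from m to m + 1 trades one tail factor of E and one of F₁ against the
fields at the ends. Thus neighbouring terms, taken with opposite signs, have the same total exponent
on their common pole. -/
theorem E_F₁_coincide_self {μ m : ℕ} (h1 : 1 ≤ m) (hm : m < μ) (v : ℂ) :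
    ETerm N ħ μ m true (sh ħ v (- -m)) + FTerm₁ N ħ k μ m true v
      = ETerm N ħ μ (m + 1) false (sh ħ v (- -m)) + FTerm₁ N ħ k μ (m + 1) false v := by
  have e1 : (- -(m : ℂ) + -m / 2) = m / 2 := by ring
  have e2 : (- -(m : ℂ) + -(m - 1) / 2) = (m + 1) / 2 := by ring
  rw [ETerm_succ h1, FTerm₁_succ, FTerm₁_eq_add hm, ETerm]
  simp only [bS, if_true, Bool.false_eq_true, if_false, sh_sh, e1, e2]
  abel

/-- At this point the field b^±_{m,μ+1} of E cancels against that of F₁, and a change of the sign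
merely interchanges the two β_{m,μ+1}. -/
theorem E_F₁_coincide_succ (μ m : ℕ) (v : ℂ) :
    ETerm N ħ μ m true (sh ħ v (-(1 / 2 - m))) + FTerm₁ N ħ k (μ + 1) m true v
      = ETerm N ħ μ m false (sh ħ v (-(1 / 2 - m))) + FTerm₁ N ħ k (μ + 1) m false v := by
  have e1 : (-(1 / 2 - (m : ℂ)) + -(m - 1) / 2) = m / 2 := by ring
  have e2 : (-(1 / 2 - (m : ℂ)) + -m / 2) = (m - 1) / 2 := by ring
  have e3 : (-(1 / 2 - (m : ℂ)) + -(m - 2) / 2) = (m + 1) / 2 := by ring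
  simp only [ETerm, FTerm₁, bS, if_true, Bool.false_eq_true, if_false, sh_sh, e1, e2, e3]
  abel

/-- The same exchange of ends and tail factors at the pole, now between row ν of E and column μ of
F₂; it holds for both signs `d` of the end that is carried along. -/
theorem E_F₂_coincide {μ ν : ℕ} (hν : 1 ≤ ν) (hμN : μ < N) (d : Bool) (v : ℂ) :
    ETerm N ħ μ ν true (sh ħ v (-(k + (μ - ν) / 2))) + FTerm₂ N ħ k ν (μ + 1) d v
      = ETerm N ħ μ (ν + 1) d (sh ħ v (-(k + (μ - ν) / 2))) + FTerm₂ N ħ k ν μ true v := by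
  have e1 : -(k + (μ - ν) / 2) + -(ν - 1) / 2 = -k - ((μ : ℂ) - 1) / 2 := by ring
  have e2 : -(k + (μ - ν) / 2) + -ν / 2 = -k - (μ : ℂ) / 2 := by ring
  have e3 : -(k + (μ - ν) / 2) + -(ν + 1) / 2 = -k - ((μ : ℂ) + 1) / 2 := by ring
  rw [ETerm_succ hν, FTerm₂_succ, FTerm₂_eq_add hμN.le, ETerm]
  cases d <;> simp only [bS, if_true, Bool.false_eq_true, if_false, sh_sh, e1, e2, e3] <;> abel

theorem E_F₂_coincide' {μ ν : ℕ} (hν : 1 ≤ ν) (v : ℂ) :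
    ETerm N ħ μ (ν + 1) true (sh ħ v (-(k + (μ - ν) / 2))) + FTerm₂ N ħ k ν (μ + 1) false v
      = ETerm N ħ μ (ν + 1) false (sh ħ v (-(k + (μ - ν) / 2)))
        + FTerm₂ N ħ k ν (μ + 1) true v := by
  have e1 : -(k + (μ - ν) / 2) + -(ν - 1) / 2 = -k - ((μ : ℂ) - 1) / 2 := by ring
  have e2 : -(k + (μ - ν) / 2) + -ν / 2 = -k - (μ : ℂ) / 2 := by ring
  have e3 : -(k + (μ - ν) / 2) + -(ν + 1) / 2 = -k - ((μ : ℂ) + 1) / 2 := by ring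
  simp only [ETerm_succ hν, FTerm₂_succ, bS, if_true, Bool.false_eq_true, if_false, sh_sh, e1, e2,
    e3]
  abel

/-- At the pole the ends of F₂ in column ν and of F₁ in row μ turn into tail factors when both
indices are raised by one. -/
theorem F₂_F₁_coincide {μ ν : ℕ} (h : μ < ν) (hν : ν < N) (v : ℂ) :
    FTerm₂ N ħ k μ ν true (sh ħ v (- -((ν + μ) / 2 + k))) + FTerm₁ N ħ k ν μ true v
      = FTerm₂ N ħ k μ (ν + 1) false (sh ħ v (- -((ν + μ) / 2 + k)))
        + FTerm₁ N ħ k ν (μ + 1) false v := by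
  have e1 : - -((ν + μ) / 2 + k) + (-k - ((ν : ℂ) - 1) / 2) = (μ + 1) / 2 := by ring
  have e2 : - -((ν + μ) / 2 + k) + (-k - (ν : ℂ) / 2) = μ / 2 := by ring
  rw [FTerm₂_succ, FTerm₂_eq_add hν.le, FTerm₁_succ, FTerm₁_eq_add h]
  simp only [bS, if_true, Bool.false_eq_true, if_false, sh_sh, e1, e2]
  abel

theorem F₂_F₁_coincide_same {μ ν : ℕ} (hν : ν < N) (v : ℂ) :
    FTerm₂ N ħ k μ ν true (sh ħ v (- -((ν + μ) / 2 + k))) + FTerm₁ N ħ k ν (μ + 1) true v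
      = FTerm₂ N ħ k μ ν false (sh ħ v (- -((ν + μ) / 2 + k)))
        + FTerm₁ N ħ k ν (μ + 1) false v := by
  have e1 : - -((ν + μ) / 2 + k) + (-k - ((ν : ℂ) - 1) / 2) = (μ + 1) / 2 := by ring
  have e2 : - -((ν + μ) / 2 + k) + (-k - (ν : ℂ) / 2) = μ / 2 := by ring
  have e3 : - -((ν + μ) / 2 + k) + (-k - ((ν : ℂ) - 2) / 2) = (μ + 2) / 2 := by ring
  simp only [FTerm₂_eq_add hν.le, FTerm₁_succ, bS, if_true, Bool.false_eq_true, if_false, sh_sh, e1,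
    e2, e3]
  abel

theorem F₂_F₁_coincide_mixed {μ ν : ℕ} (h : μ < ν) (hν : ν < N) (v : ℂ) :
    FTerm₂ N ħ k μ ν false (sh ħ v (- -((ν + μ) / 2 + k))) + FTerm₁ N ħ k ν μ true v
      = FTerm₂ N ħ k μ (ν + 1) false (sh ħ v (- -((ν + μ) / 2 + k)))
        + FTerm₁ N ħ k ν (μ + 1) true v := by
  have e1 : - -((ν + μ) / 2 + k) + (-k - ((ν : ℂ) - 1) / 2) = (μ + 1) / 2 := by ring
  have e2 : - -((ν + μ) / 2 + k) + (-k - (ν : ℂ) / 2) = μ / 2 := by ring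
  have e3 : - -((ν + μ) / 2 + k) + (-k - ((ν : ℂ) - 2) / 2) = (μ + 2) / 2 := by ring
  rw [FTerm₂_succ, FTerm₂_eq_add hν.le, FTerm₁_succ, FTerm₁_eq_add h]
  simp only [bS, if_true, Bool.false_eq_true, if_false, sh_sh, e1, e2, e3]
  abel

end FreeBoson

namespace FreeBoson

variable {N : ℕ} {ħ : ℝ} {k : ℂ} {f g : ℂ → ℂ}

/-! ### Operator products of `F` and `F` -/

theorem entireFamily_FTerm (μ : ℕ) (a : (ℕ × Bool) ⊕ (ℕ × Bool)) :
    EntireFamily (FTerm N ħ k μ a) := by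
  rcases a with a | a
  · exact entireFamily_FTerm₁ μ a.1 a.2
  · exact entireFamily_FTerm₂ μ a.1 a.2

/-- The coefficients of the terms of `F_μ`. -/
noncomputable def coefFF (ħ : ℝ) : (ℕ × Bool) ⊕ (ℕ × Bool) → ℂ := Sum.elim (coefF ħ) (coefF ħ)

/-- The contribution of a pair of terms of `F_μ(u)` and `F_ν(v)` to the matrix elements of the
product. -/
noncomputable def summandFF (k : ℂ) (f : ℂ → ℂ) (μ ν : ℕ) (a b : (ℕ × Bool) ⊕ (ℕ × Bool))
    (Ψ : Symbols N ħ → ℂ) (ζ : Symbols N ħ) (u v : ℂ) : ℂ :=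
  coefFF ħ a * coefFF ħ b * (f (u - v) * ratio ħ (listFF k μ ν a b) (u - v)
    * vertexOp k (FTerm N ħ k μ a u + FTerm N ħ k ν b v) Ψ ζ)

theorem regular_summandFF_of_clears (hf : Differentiable ℂ f) {μ ν : ℕ}
    {a b : (ℕ × Bool) ⊕ (ℕ × Bool)} (h : Clears ħ f (listFF k μ ν a b)) :
    Regular (summandFF (N := N) (ħ := ħ) k f μ ν a b) :=
  regular_of_clears (entireFamily_FTerm μ a) (entireFamily_FTerm ν b) hf h _

theorem clears_F₂F₁ {μ ν : ℕ} (h : IsExchangePair ħ (-halfCartan μ ν) f g) {m n : ℕ} {ε δ : Bool}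
    (hL : listF₁F₂ k ν n δ μ m ε = []) : Clears ħ f (listF₂F₁ k μ m ε ν n δ) := by
  rw [listF₂F₁, hL, barList_nil, List.append_nil]
  rcases eq_or_ne μ ν with rfl | h1
  · rw [halfCartan_self] at h
    rw [if_pos rfl]
    exact Or.inr ⟨_, _, rfl, (h.eq_of_ne (by norm_num)).1⟩
  rw [if_neg h1]
  by_cases h2 : μ = ν + 1 ∨ ν = μ + 1
  · rw [halfCartan_adjacent h2] at h
    have e := (h.eq_of_ne (by norm_num)).1
    rw [show -(-1 / 2 : ℂ) = 1 / 2 by norm_num] at e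
    rw [if_pos h2]
    exact Or.inr ⟨_, _, rfl, e⟩
  · rw [if_neg h2]
    exact Or.inl rfl

/-- Away from the poles that depend on the terms, the factor of `F₂` and `F₁` is `g`. -/
theorem exists_factor_F₂F₁ {μ ν : ℕ} (h : IsExchangePair ħ (-halfCartan μ ν) f g) :
    ∃ R : ℝ, ∀ (m n : ℕ) (ε δ : Bool) (w : ℂ), R < |w.im| →
      f w * ratio ħ (listF₂F₁ k μ m ε ν n δ) w
        = g w * ratio ħ (barList (listF₁F₂ k ν n δ μ m ε)) w := by
  obtain ⟨R, -, hR⟩ := exists_bounded ħ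
    (if μ = ν then [(-1, 1)] else if μ = ν + 1 ∨ ν = μ + 1 then [(1 / 2, -1 / 2)] else [])
  refine ⟨R, fun m n ε δ w hw => ?_⟩
  rw [listF₂F₁, ratio_append, ← mul_assoc, ratExchange_constant h w (denPoly_eval_ne_zero hR hw)
    (by simp [denPoly]), ratio_nil, mul_one]

/-- The part of the factor that is common to all terms turns `f` into `g`, and the remaining
reversed lists fall under `regular_cancel`. Reversal changes the sign of the pole and of the
residues. -/
theorem regular_summandFF_pair {μ ν : ℕ} (h : IsExchangePair ħ (-halfCartan μ ν) f g)
    {a₁ b₁ a₂ b₂ : ℕ × Bool} {s d₁ d₂ : ℂ}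
    (hL₁ : listF₁F₂ k ν b₁.1 b₁.2 μ a₁.1 a₁.2 = [(s, s + d₁)])
    (hL₂ : listF₁F₂ k ν b₂.1 b₂.2 μ a₂.1 a₂.2 = [(s, s + d₂)])
    (hc : coefF ħ a₁ * coefF ħ b₁ * d₁ + coefF ħ a₂ * coefF ħ b₂ * d₂ = 0)
    (hD : ∀ v, FTerm₂ N ħ k μ a₁.1 a₁.2 (sh ħ v (- -s)) + FTerm₁ N ħ k ν b₁.1 b₁.2 v
      = FTerm₂ N ħ k μ a₂.1 a₂.2 (sh ħ v (- -s)) + FTerm₁ N ħ k ν b₂.1 b₂.2 v) :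
    Regular fun Ψ ζ u v => summandFF (N := N) (ħ := ħ) k f μ ν (.inr a₁) (.inl b₁) Ψ ζ u v
      + summandFF k f μ ν (.inr a₂) (.inl b₂) Ψ ζ u v := by
  have hg : Differentiable ℂ g := by
    rcases h with ⟨-, -, rfl⟩ | ⟨-, rfl⟩ <;> fun_prop
  obtain ⟨R, hR⟩ := exists_factor_F₂F₁ (k := k) h
  refine (regular_cancel (k := k) (entireFamily_FTerm₂ μ a₁.1 a₁.2) (entireFamily_FTerm₁ ν b₁.1 b₁.2)
    (entireFamily_FTerm₂ μ a₂.1 a₂.2) (entireFamily_FTerm₁ ν b₂.1 b₂.2) hg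
    (s := -s) (d₁ := -d₁) (d₂ := -d₂) (c₁ := coefF ħ a₁ * coefF ħ b₁)
    (c₂ := coefF ħ a₂ * coefF ħ b₂) (by linear_combination -hc) hD).congr R fun Ψ ζ u v huv => ?_
  simp only [summandFF, listFF, hR _ _ _ _ _ huv, hL₁, hL₂, barList_cons, barList_nil, neg_add]
  rfl

/-- For μ ≤ ν the only poles that `f` does not remove come from F₂ F₁ with μ < ν. Six index pairs
carry them, and they cancel two by two; for ν = μ + 1 four of the six do not occur in the index
sets. -/
theorem regular_FF_of_le {μ ν : ℕ} (hμν : μ ≤ ν) (hμ : 1 ≤ μ) (hνN : ν < N)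
    (h : IsExchangePair ħ (-halfCartan μ ν) f g) :
    Regular fun Ψ ζ u v => ∑ a ∈ (indexF₁ μ).disjSum (indexF₂ N μ),
      ∑ b ∈ (indexF₁ ν).disjSum (indexF₂ N ν),
        summandFF (N := N) (ħ := ħ) k f μ ν a b Ψ ζ u v := by
  have hf := h.differentiable
  have other : ∀ a b, (∀ a' b', a = .inr a' → b = .inl b' →
      listF₁F₂ k ν b'.1 b'.2 μ a'.1 a'.2 = []) →
      Regular (summandFF (N := N) (ħ := ħ) k f μ ν a b) := by
    rintro (a | a) (b | b) hab <;> refine regular_summandFF_of_clears hf ?_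
    · exact clears_F₁F₁ h _ _ _ _
    · exact Or.inl (if_pos hμν)
    · exact clears_F₂F₁ h (hab a b rfl rfl)
    · exact clears_F₂F₂ h _ _ _ _
  have hN : ν + 1 ≤ N := hνN
  have hc : ∀ c : ℂ, c * -1 + c * 1 = 0 := fun c => by ring
  have hc' : ∀ c : ℂ, c * 1 + c * -1 = 0 := fun c => by ring
  rcases hμν.eq_or_lt with rfl | hlt
  · exact Regular.sum fun a _ => Regular.sum fun b _ => other a b fun _ _ _ _ => if_pos le_rfl
  have hle : ¬ν ≤ μ := by omega
  have hne : μ ≠ μ + 1 := by omega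
  have hne' : ν ≠ ν + 1 := by omega
  have p₁ := regular_summandFF_pair (N := N) (k := k) h (a₁ := (ν, true)) (b₁ := (μ, true))
    (a₂ := (ν + 1, false)) (b₂ := (μ + 1, false)) (s := (ν + μ) / 2 + k) (d₁ := -1) (d₂ := 1)
    (by simp [listF₁F₂, hle, sub_eq_add_neg]) (by simp [listF₁F₂, hle])
    (by simp [coefF]) (F₂_F₁_coincide hlt hνN)
  rcases (show μ + 1 ≤ ν from hlt).eq_or_lt with rfl | hlt'
  · refine Regular.of_support {(.inr (μ + 1, true), .inl (μ, true)),
      (.inr (μ + 1 + 1, false), .inl (μ + 1, false))} ?_ ?_ ?_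
    · simp [mem_indexF₁, mem_indexF₂]
      omega
    · intro a ha b hb hab
      refine other a b ?_
      rintro ⟨m, ε⟩ ⟨n, δ⟩ rfl rfl
      simp [mem_indexF₁, mem_indexF₂] at ha hb hab
      simp only [listF₁F₂]
      rw [if_neg, if_neg, if_neg, if_neg, if_neg]
      all_goals first | omega | (cases ε <;> cases δ <;> simp at ha hb hab ⊢ <;> omega)
    · refine p₁.congr' fun Ψ ζ u v => ?_
      rw [Finset.sum_pair (by simp)]
  · have p₂ := regular_summandFF_pair (N := N) (k := k) h (a₁ := (ν, true)) (b₁ := (μ + 1, true))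
      (a₂ := (ν, false)) (b₂ := (μ + 1, false)) (s := (ν + μ) / 2 + k) (d₁ := 1) (d₂ := -1)
      (by simp [listF₁F₂, hle]) (by simp [listF₁F₂, hle, sub_eq_add_neg])
      (by simp [coefF]) (F₂_F₁_coincide_same hνN)
    have p₃ := regular_summandFF_pair (N := N) (k := k) h (a₁ := (ν, false)) (b₁ := (μ, true))
      (a₂ := (ν + 1, false)) (b₂ := (μ + 1, true)) (s := (ν + μ) / 2 + k) (d₁ := -1) (d₂ := 1)
      (by simp [listF₁F₂, hle, sub_eq_add_neg]) (by simp [listF₁F₂, hle])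
      (by simp [coefF]) (F₂_F₁_coincide_mixed hlt hνN)
    refine Regular.of_support {(.inr (ν, true), .inl (μ, true)),
      (.inr (ν + 1, false), .inl (μ + 1, false)), (.inr (ν, true), .inl (μ + 1, true)),
      (.inr (ν, false), .inl (μ + 1, false)), (.inr (ν, false), .inl (μ, true)),
      (.inr (ν + 1, false), .inl (μ + 1, true))} ?_ ?_ ?_
    · simp [mem_indexF₁, mem_indexF₂]
      omega
    · intro a ha b hb hab
      refine other a b ?_
      rintro ⟨m, ε⟩ ⟨n, δ⟩ rfl rfl
      simp [mem_indexF₁, mem_indexF₂] at ha hb hab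
      simp only [listF₁F₂]
      rw [if_neg, if_neg, if_neg, if_neg, if_neg]
      all_goals first | omega | (cases ε <;> cases δ <;> simp at ha hb hab ⊢ <;> omega)
    · refine ((p₁.add p₂).add p₃).congr' fun Ψ ζ u v => ?_
      rw [Finset.sum_insert, Finset.sum_insert, Finset.sum_insert, Finset.sum_insert,
        Finset.sum_pair]
      · ring
      all_goals simp

theorem OPERelation.symm {X Y : Current N} (h : OPERelation ħ k f X Y g fun _ _ _ _ => 0) (c : ℂ)
    {f' g' : ℂ → ℂ} (hf : ∀ w, f' w = c * g (-w)) (hg : ∀ w, g' w = c * f (-w)) :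
    OPERelation ħ k f' Y X g' fun _ _ _ _ => 0 := by
  obtain ⟨R, h1, h2, h3⟩ := h
  refine ⟨R, h2, h1, fun Ψ hΨ ζ hζ => ?_⟩
  obtain ⟨G, hG, e1, e2⟩ := h3 Ψ hΨ ζ hζ
  refine ⟨fun z => c * G (z.2, z.1), (hG.comp (by fun_prop)).const_mul c, fun u v huv => ?_,
    fun u v huv => ?_⟩
  · have := e2 v u huv
    simp only [sub_zero] at this ⊢
    rw [← this, hf, neg_sub, mul_assoc]
  · have := e1 v u huv
    simp only [sub_zero] at this ⊢
    rw [← this, hg, neg_sub, mul_assoc]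

theorem opeRelation_F_F (hħ : ħ ≠ 0) {μ ν : ℕ} (hμ : 1 ≤ μ) (hμN : μ < N) (hν : 1 ≤ ν)
    (hνN : ν < N) (h : IsExchangePair ħ (-halfCartan μ ν) f g) :
    OPERelation ħ k f (FCurrent N ħ k μ) (FCurrent N ħ k ν) g fun _ _ _ _ => 0 := by
  wlog hle : μ ≤ ν generalizing μ ν f g
  · obtain ⟨c, h1, h2⟩ := h.exists_symm
    refine (this hν hνN hμ hμN (f := f) (g := g) ?_ (by omega)).symm c h1 h2
    rwa [halfCartan_comm]
  refine opeRelation_of_regular (isExpansion_F μ) (isExpansion_F ν)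
    (fun a ha b hb => hasContr_F_F hħ hμ hμN hν hνN ha hb)
    (fun b hb a ha => hasContr_F_F hħ hν hνN hμ hμN hb ha)
    (fun a _ b _ => ratExchange_FF h a b) _ ?_
  simp only [sub_zero]
  exact regular_FF_of_le hle hμ hνN h

end FreeBoson

namespace FreeBoson

variable {N : ℕ} {ħ : ℝ} {k : ℂ}

/-! ### Operator products of `E` and `F` -/

/-- The contributions of a term of `E_μ(u)` and a term of the first sum in `F_ν(v)` to the matrix
elements of the product. -/
noncomputable def summandEF₁ (k : ℂ) (μ ν : ℕ) (a b : ℕ × Bool) (Ψ : Symbols N ħ → ℂ)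
    (ζ : Symbols N ħ) (u v : ℂ) : ℂ :=
  coefE ħ a * coefF ħ b * (1 * ratio ħ (listEF₁ μ a.1 a.2 ν b.1 b.2) (u - v)
    * vertexOp k (ETerm N ħ μ a.1 a.2 u + FTerm₁ N ħ k ν b.1 b.2 v) Ψ ζ)

/-- The contributions of a term of `E_μ(u)` and a term of the second sum in `F_ν(v)` to the matrix
elements of the product. -/
noncomputable def summandEF₂ (k : ℂ) (μ ν : ℕ) (a b : ℕ × Bool) (Ψ : Symbols N ħ → ℂ)
    (ζ : Symbols N ħ) (u v : ℂ) : ℂ :=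
  coefE ħ a * coefF ħ b * (1 * ratio ħ (listEF₂ k μ a.1 a.2 ν b.1 b.2) (u - v)
    * vertexOp k (ETerm N ħ μ a.1 a.2 u + FTerm₂ N ħ k ν b.1 b.2 v) Ψ ζ)

theorem regular_summandEF₁_of_eq_nil {μ ν : ℕ} {a b : ℕ × Bool}
    (h : listEF₁ μ a.1 a.2 ν b.1 b.2 = []) : Regular (summandEF₁ (N := N) (ħ := ħ) k μ ν a b) :=
  regular_of_clears (f := fun _ => 1) (entireFamily_ETerm _ _ _) (entireFamily_FTerm₁ _ _ _)
    (by fun_prop) (Or.inl h) _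

theorem regular_summandEF₂_of_eq_nil {μ ν : ℕ} {a b : ℕ × Bool}
    (h : listEF₂ k μ a.1 a.2 ν b.1 b.2 = []) : Regular (summandEF₂ (N := N) (ħ := ħ) k μ ν a b) :=
  regular_of_clears (f := fun _ => 1) (entireFamily_ETerm _ _ _) (entireFamily_FTerm₂ _ _ _)
    (by fun_prop) (Or.inl h) _

theorem regular_summandEF₁_pair {μ ν : ℕ} {a₁ b₁ a₂ b₂ : ℕ × Bool} {s d₁ d₂ : ℂ}
    (hL₁ : listEF₁ μ a₁.1 a₁.2 ν b₁.1 b₁.2 = [(s, s + d₁)])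
    (hL₂ : listEF₁ μ a₂.1 a₂.2 ν b₂.1 b₂.2 = [(s, s + d₂)])
    (hc : coefE ħ a₁ * coefF ħ b₁ * d₁ + coefE ħ a₂ * coefF ħ b₂ * d₂ = 0)
    (hD : ∀ v, ETerm N ħ μ a₁.1 a₁.2 (sh ħ v (-s)) + FTerm₁ N ħ k ν b₁.1 b₁.2 v
      = ETerm N ħ μ a₂.1 a₂.2 (sh ħ v (-s)) + FTerm₁ N ħ k ν b₂.1 b₂.2 v) :
    Regular fun Ψ ζ u v => summandEF₁ (N := N) (ħ := ħ) k μ ν a₁ b₁ Ψ ζ u v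
      + summandEF₁ k μ ν a₂ b₂ Ψ ζ u v := by
  refine (regular_cancel (k := k) (q := fun _ => 1) (entireFamily_ETerm μ a₁.1 a₁.2)
    (entireFamily_FTerm₁ ν b₁.1 b₁.2) (entireFamily_ETerm μ a₂.1 a₂.2)
    (entireFamily_FTerm₁ ν b₂.1 b₂.2) (by fun_prop) hc hD).congr' fun Ψ ζ u v => ?_
  simp only [summandEF₁, hL₁, hL₂]

theorem regular_summandEF₂_pair {μ ν : ℕ} {a₁ b₁ a₂ b₂ : ℕ × Bool} {s d₁ d₂ : ℂ}
    (hL₁ : listEF₂ k μ a₁.1 a₁.2 ν b₁.1 b₁.2 = [(s, s + d₁)])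
    (hL₂ : listEF₂ k μ a₂.1 a₂.2 ν b₂.1 b₂.2 = [(s, s + d₂)])
    (hc : coefE ħ a₁ * coefF ħ b₁ * d₁ + coefE ħ a₂ * coefF ħ b₂ * d₂ = 0)
    (hD : ∀ v, ETerm N ħ μ a₁.1 a₁.2 (sh ħ v (-s)) + FTerm₂ N ħ k ν b₁.1 b₁.2 v
      = ETerm N ħ μ a₂.1 a₂.2 (sh ħ v (-s)) + FTerm₂ N ħ k ν b₂.1 b₂.2 v) :
    Regular fun Ψ ζ u v => summandEF₂ (N := N) (ħ := ħ) k μ ν a₁ b₁ Ψ ζ u v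
      + summandEF₂ k μ ν a₂ b₂ Ψ ζ u v := by
  refine (regular_cancel (k := k) (q := fun _ => 1) (entireFamily_ETerm μ a₁.1 a₁.2)
    (entireFamily_FTerm₂ ν b₁.1 b₁.2) (entireFamily_ETerm μ a₂.1 a₂.2)
    (entireFamily_FTerm₂ ν b₂.1 b₂.2) (by fun_prop) hc hD).congr' fun Ψ ζ u v => ?_
  simp only [summandEF₂, hL₁, hL₂]

/-- The grouping follows the cancellation of poles: (m, true) goes with (m + 1, false), and (1,
false) stays alone. -/
theorem sum_indexF₁ {μ : ℕ} (hμ : 1 ≤ μ) (F : ℕ × Bool → ℂ) : ∑ a ∈ indexF₁ μ, F a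
    = F (1, false) + ∑ m ∈ Finset.Icc 1 (μ - 1), (F (m, true) + F (m + 1, false)) := by
  obtain ⟨l, rfl⟩ : ∃ l, μ = l + 1 := ⟨μ - 1, by omega⟩
  have shift : ∀ l : ℕ, ∑ m ∈ Finset.Icc 1 l, F (m, false) + F (l + 1, false)
      = F (1, false) + ∑ m ∈ Finset.Icc 1 l, F (m + 1, false) := fun l => by
    induction l with
    | zero => simp
    | succ l ih =>
      rw [Finset.sum_Icc_succ_top (Nat.le_add_left 1 l), ih,
        Finset.sum_Icc_succ_top (Nat.le_add_left 1 l), add_assoc]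
  have e : ∑ m ∈ Finset.Icc 1 l, (if m < l + 1 then F (m, true) else 0)
      = ∑ m ∈ Finset.Icc 1 l, F (m, true) := Finset.sum_congr rfl fun m hm => by
    rw [Finset.mem_Icc] at hm
    rw [if_pos (by omega)]
  rw [indexF₁, Finset.sum_filter, Finset.sum_product, add_tsub_cancel_right]
  simp only [Fintype.sum_bool, Bool.false_eq_true, false_imp_iff, true_imp_iff, if_true]
  rw [Finset.sum_Icc_succ_top (Nat.le_add_left 1 l), if_neg (lt_irrefl _), zero_add,
    Finset.sum_add_distrib, e, add_assoc, shift, Finset.sum_add_distrib]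
  ring

/-- Only equal indices are contracted. The poles at w = imħ with m ≥ 1 cancel between neighbouring
terms; the pole at w = 0 belongs to (1, false) alone and has the exponent of H^-(v). -/
theorem regular_EF₁_self (hħ : ħ ≠ 0) {μ : ℕ} (hμ : 1 ≤ μ) :
    Regular fun Ψ ζ u v => (∑ a ∈ indexE μ, ∑ b ∈ indexF₁ μ,
      summandEF₁ (N := N) (ħ := ħ) k μ μ a b Ψ ζ u v)
      + 1 / (Complex.I * ħ) * (1 / (u - v) * vertexOp k (HData N ħ k false μ v) Ψ ζ) := by
  have hħ' : (ħ : ℂ) ≠ 0 := by exact_mod_cast hħ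
  refine Regular.of_support_add ((indexF₁ μ).image fun a => (a, a)) ?_ ?_ ?_
  · intro p hp
    obtain ⟨a, ha, rfl⟩ := Finset.mem_image.1 hp
    exact ⟨mem_indexE.2 (mem_indexF₁.1 ha).1, ha⟩
  · rintro ⟨m, ε⟩ _ ⟨n, δ⟩ hb hab
    refine regular_summandEF₁_of_eq_nil ?_
    simp only [listEF₁, if_true]
    rw [if_neg, if_neg] <;> rintro ⟨rfl, rfl, rfl⟩ <;>
      exact hab (Finset.mem_image.2 ⟨_, hb, rfl⟩)
  · have p₁ := regular_residue (N := N) (ħ := ħ) (k := k) (entireFamily_ETerm μ 1 false)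
      (entireFamily_FTerm₁ μ 1 false) (entireFamily_zero (V := ℂ)) ((isExpansion_H false μ).entire () (by simp)) 0 (-1)
      (coefE ħ (1, false) * coefF ħ (1, false)) (fun v => by
        rw [zero_add]
        simpa [sh, HData] using (HMinusData_eq (N := N) (ħ := ħ) (k := k) μ hμ v).symm)
    have p₂ : Regular fun Ψ ζ u v => ∑ m ∈ Finset.Icc 1 (μ - 1),
        (summandEF₁ (N := N) (ħ := ħ) k μ μ (m, true) (m, true) Ψ ζ u v
          + summandEF₁ k μ μ (m + 1, false) (m + 1, false) Ψ ζ u v) :=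
      Regular.sum fun m hm => by
        rw [Finset.mem_Icc] at hm
        exact regular_summandEF₁_pair (s := -m) (d₁ := 1) (d₂ := -1)
          (by simp [listEF₁]; ring) (by simp [listEF₁]; ring) (by simp [coefE, coefF])
          (E_F₁_coincide_self hm.1 (by omega))
    refine (p₁.add p₂).congr' fun Ψ ζ u v => ?_
    rw [Finset.sum_image (by simp), sum_indexF₁ hμ]
    simp only [summandEF₁, listEF₁, coefE, coefF, if_true, Bool.false_eq_true, if_false,
      reduceCtorEq, and_true, and_false, Nat.cast_one, sub_self, zero_add, mul_zero, zero_mul, add_zero]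
    field_simp
    linear_combination ħ * vertexOp k (HData N ħ k false μ v) Ψ ζ / (u - v) * Complex.I_sq

/-- A single pair of terms is contracted, with its pole at w = -ikħ, and its exponent there is that
of H^+(u). -/
theorem regular_EF₂_self (hħ : ħ ≠ 0) {μ : ℕ} (hμ : 1 ≤ μ) (hμN : μ < N) :
    Regular fun Ψ ζ u v => (∑ a ∈ indexE μ, ∑ b ∈ indexF₂ N μ,
      summandEF₂ (N := N) (ħ := ħ) k μ μ a b Ψ ζ u v)
      + -(1 / (Complex.I * ħ) * (1 / (u - v + Complex.I * k * ħ)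
        * vertexOp k (HData N ħ k true μ u) Ψ ζ)) := by
  have hħ' : (ħ : ℂ) ≠ 0 := by exact_mod_cast hħ
  refine Regular.of_support_add {((μ, true), (μ + 1, true))} ?_ ?_ ?_
  · simp [mem_indexE, mem_indexF₂]
    omega
  · rintro ⟨m, ε⟩ _ ⟨n, δ⟩ hb hab
    refine regular_summandEF₂_of_eq_nil ?_
    simp only [listEF₂, if_true]
    rw [if_neg]
    rintro ⟨rfl, rfl, rfl, rfl⟩
    simp at hab
  · have p₁ := regular_residue (N := N) (ħ := ħ) (k := k) (entireFamily_ETerm μ μ true)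
      (entireFamily_FTerm₂ μ (μ + 1) true) ((isExpansion_H true μ).entire () (by simp))
      (entireFamily_zero (V := ℂ)) k 1
      (coefE ħ (μ, true) * coefF ħ (μ + 1, true)) (fun v => by
        rw [add_zero]
        have := HPlusData_eq (N := N) (ħ := ħ) (k := k) μ hμ (sh ħ v (-k))
        rw [sh_sh, neg_add_cancel] at this
        simpa [sh, HData] using this.symm)
    refine p₁.congr' fun Ψ ζ u v => ?_
    rw [Finset.sum_singleton]
    simp only [summandEF₂, listEF₂, coefE, coefF, if_true, and_self, add_zero]
    congr 2
    generalize u - v + Complex.I * k * ħ = z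
    have e : 1 / ((ħ : ℂ)) * 1 * (1 / ħ * -1) * 1 * (Complex.I * ħ) = 1 / (Complex.I * ħ) := by
      field_simp
      rw [Complex.I_sq]
      ring
    rw [e]
    ring

/-- Poles occur for ν = μ + 1 only, between equal indices, and the two signs of each m cancel. -/
theorem regular_EF₁_of_ne {μ ν : ℕ} (h : μ ≠ ν) :
    Regular fun Ψ ζ u v => ∑ a ∈ indexE μ, ∑ b ∈ indexF₁ ν,
      summandEF₁ (N := N) (ħ := ħ) k μ ν a b Ψ ζ u v := by
  by_cases h' : ν = μ + 1
  · subst h'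
    refine Regular.of_support ((indexE μ).image fun a => (a, a)) ?_ ?_ ?_
    · intro p hp
      obtain ⟨a, ha, rfl⟩ := Finset.mem_image.1 hp
      refine ⟨ha, mem_indexF₁.2 ?_⟩
      have := Finset.mem_Icc.1 (mem_indexE.1 ha)
      exact ⟨Finset.mem_Icc.2 ⟨this.1, by dsimp only; omega⟩, fun _ => by dsimp only; omega⟩
    · rintro ⟨m, ε⟩ ha ⟨n, δ⟩ _ hab
      refine regular_summandEF₁_of_eq_nil ?_
      simp only [listEF₁, if_true, if_neg h]
      rw [if_neg, if_neg] <;> rintro ⟨rfl, rfl, rfl⟩ <;>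
        exact hab (Finset.mem_image.2 ⟨_, ha, rfl⟩)
    · have p : Regular fun Ψ ζ u v => ∑ m ∈ Finset.Icc 1 μ,
          (summandEF₁ (N := N) (ħ := ħ) k μ (μ + 1) (m, true) (m, true) Ψ ζ u v
            + summandEF₁ k μ (μ + 1) (m, false) (m, false) Ψ ζ u v) :=
        Regular.sum fun m _ => regular_summandEF₁_pair (s := 1 / 2 - m) (d₁ := -1) (d₂ := 1)
          (by simp [listEF₁]; ring) (by simp [listEF₁]; ring) (by simp [coefE, coefF])
          (E_F₁_coincide_succ μ m)
      refine p.congr' fun Ψ ζ u v => ?_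
      rw [Finset.sum_image (by simp), indexE, Finset.sum_product]
      simp only [Fintype.sum_bool]
  · exact Regular.sum fun a _ => Regular.sum fun b _ => regular_summandEF₁_of_eq_nil (by
      rw [listEF₁, if_neg h, if_neg h'])

/-- For μ < ν the rows of E do not reach row ν and nothing is contracted. For μ > ν six pairs share
the pole w = -i(k + (μ - ν)/2)ħ and cancel two by two. -/
theorem regular_EF₂_of_ne {μ ν : ℕ} (h : μ ≠ ν) (hμN : μ < N) (hν : 1 ≤ ν) :
    Regular fun Ψ ζ u v => ∑ a ∈ indexE μ, ∑ b ∈ indexF₂ N ν,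
      summandEF₂ (N := N) (ħ := ħ) k μ ν a b Ψ ζ u v := by
  rcases h.lt_or_gt with hlt | hlt
  · refine Regular.sum fun a ha => Regular.sum fun b _ => regular_summandEF₂_of_eq_nil ?_
    have := Finset.mem_Icc.1 (mem_indexE.1 ha)
    rw [listEF₂, if_neg h, if_neg, if_neg, if_neg, if_neg] <;> omega
  have hne : ν ≠ ν + 1 := by omega
  have hne' : μ ≠ μ + 1 := by omega
  have p₁ : ∀ d : Bool, Regular fun Ψ ζ u v =>
      summandEF₂ (N := N) (ħ := ħ) k μ ν (ν, true) (μ + 1, d) Ψ ζ u v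
        + summandEF₂ k μ ν (ν + 1, d) (μ, true) Ψ ζ u v := fun d =>
    regular_summandEF₂_pair (s := k + (μ - ν) / 2) (d₁ := 1) (d₂ := -1)
      (by simp [listEF₂, h]) (by simp [listEF₂, h, sub_eq_add_neg])
      (by cases d <;> simp [coefE, coefF]) (E_F₂_coincide hν hμN d)
  have p₂ : Regular fun Ψ ζ u v =>
      summandEF₂ (N := N) (ħ := ħ) k μ ν (ν + 1, true) (μ + 1, false) Ψ ζ u v
        + summandEF₂ k μ ν (ν + 1, false) (μ + 1, true) Ψ ζ u v :=
    regular_summandEF₂_pair (s := k + (μ - ν) / 2) (d₁ := -1) (d₂ := 1)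
      (by simp [listEF₂, h, sub_eq_add_neg]) (by simp [listEF₂, h])
      (by simp [coefE, coefF]) (E_F₂_coincide' hν)
  refine Regular.of_support {((ν, true), (μ + 1, true)), ((ν + 1, true), (μ, true)),
    ((ν, true), (μ + 1, false)), ((ν + 1, false), (μ, true)),
    ((ν + 1, true), (μ + 1, false)), ((ν + 1, false), (μ + 1, true))} ?_ ?_ ?_
  · simp [mem_indexE, mem_indexF₂]
    omega
  · rintro ⟨m, ε⟩ _ ⟨n, δ⟩ _ hab
    refine regular_summandEF₂_of_eq_nil ?_
    simp only [Finset.mem_insert, Finset.mem_singleton, Prod.mk.injEq, not_or] at hab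
    simp only [listEF₂, if_neg h]
    rw [if_neg, if_neg, if_neg, if_neg] <;> cases ε <;> cases δ <;> simp at hab ⊢ <;> omega
  · refine (((p₁ true).add (p₁ false)).add p₂).congr' fun Ψ ζ u v => ?_
    rw [Finset.sum_insert, Finset.sum_insert, Finset.sum_insert, Finset.sum_insert,
      Finset.sum_pair]
    · ring
    all_goals simp

/-- The contractions of the terms of `E_μ(u)` and `F_ν(v)`. -/
noncomputable def listEF (k : ℂ) (μ ν : ℕ) (a : ℕ × Bool) : (ℕ × Bool) ⊕ (ℕ × Bool) → List (ℂ × ℂ) :=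
  Sum.elim (fun b => listEF₁ μ a.1 a.2 ν b.1 b.2) fun b => listEF₂ k μ a.1 a.2 ν b.1 b.2

/-- The reversed lists have opposite exponents, hence the same rational function in both orders, and
no prefactor is needed. Only the polar parts of the diagonal case remain to be subtracted. -/
theorem opeRelation_E_F (hħ : ħ ≠ 0) {μ ν : ℕ} (hμ : 1 ≤ μ) (hμN : μ < N) (hν : 1 ≤ ν)
    (hνN : ν < N) : OPERelation ħ k (fun _ => 1) (ECurrent N ħ μ) (FCurrent N ħ k ν) (fun _ => 1)
      (fun u v Ψ ζ => (if μ = ν then 1 else 0) / (Complex.I * ħ)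
        * (1 / (u - v + Complex.I * k * ħ) * op k (HCurrent N ħ k true μ u) Ψ ζ
          - 1 / (u - v) * op k (HCurrent N ħ k false μ v) Ψ ζ)) := by
  refine opeRelation_of_regular (L := listEF k μ ν) (L' := fun b a => barList (listEF k μ ν a b))
    (isExpansion_E μ) (isExpansion_F ν) ?_ ?_ (fun a _ b _ => ratExchange_self _ _) _ ?_
  · rintro a ha (b | b) hb <;> rw [mem_indexE] at ha <;>
      simp only [Finset.inl_mem_disjSum, Finset.inr_mem_disjSum, mem_indexF₁, mem_indexF₂] at hb
    · exact hasContr_E_F₁ hħ ha hb.1 hμN hνN a.2 hb.2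
    · exact hasContr_E_F₂ hħ ha hb.1 hμN hν a.2 hb.2
  · rintro (b | b) hb a ha <;> rw [mem_indexE] at ha <;>
      simp only [Finset.inl_mem_disjSum, Finset.inr_mem_disjSum, mem_indexF₁, mem_indexF₂] at hb
    · exact hasContr_F₁_E hħ hb.1 ha hνN hμN hb.2 a.2
    · exact hasContr_F₂_E hħ hb.1 ha hμN hν hb.2 a.2
  have split : ∀ (Ψ : Symbols N ħ → ℂ) ζ u v, (∑ a ∈ indexE μ,
      ∑ b ∈ (indexF₁ ν).disjSum (indexF₂ N ν), coefE ħ a * Sum.elim (coefF ħ) (coefF ħ) b *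
        (1 * ratio ħ (listEF k μ ν a b) (u - v) * vertexOp k (ETerm N ħ μ a.1 a.2 u
          + Sum.elim (fun b => FTerm₁ N ħ k ν b.1 b.2) (fun b => FTerm₂ N ħ k ν b.1 b.2) b v) Ψ ζ))
      = (∑ a ∈ indexE μ, ∑ b ∈ indexF₁ ν, summandEF₁ k μ ν a b Ψ ζ u v)
        + ∑ a ∈ indexE μ, ∑ b ∈ indexF₂ N ν, summandEF₂ k μ ν a b Ψ ζ u v := fun Ψ ζ u v => by
    simp only [Finset.sum_disjSum, Finset.sum_add_distrib]
    rfl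
  simp only [split]
  rcases eq_or_ne μ ν with rfl | h
  · refine ((regular_EF₁_self (N := N) (k := k) hħ hμ).add
      (regular_EF₂_self (N := N) (k := k) hħ hμ hμN)).congr' fun Ψ ζ u v => ?_
    simp only [HCurrent, op_vx, HData, if_true, Bool.false_eq_true, if_false]
    ring
  · refine ((regular_EF₁_of_ne (k := k) h).add (regular_EF₂_of_ne (k := k) h hμN hν)).congr' fun Ψ ζ u v => ?_
    rw [if_neg h, zero_div, zero_mul, sub_zero]

end FreeBoson

/-! ### Vanishing contractions between currents of equal sign -/

namespace FreeBoson

section GLCurrents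

variable {N : ℕ} {ħ : ℝ} {k : ℂ}

theorem vertexOp_zero (Ψ : Symbols N ħ → ℂ) (ζ : Symbols N ħ) : vertexOp k 0 Ψ ζ = Ψ ζ := by
  simp [vertexOp, commWith_zero]

/-- The exponents of the `gl_N` currents. -/
noncomputable def kData (N : ℕ) (ħ : ℝ) (k : ℂ) (ε : Bool) (μ : ℕ) (u : ℂ) : VertexData N :=
  if ε then kPlus N ħ k μ u else kMinus N ħ k μ u

/-- k^+ contains annihilation modes only and k^- creation modes only, so currents of the same sign
and their inverses are not contracted and their products need no condition on the arguments. -/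
theorem contr_kData_neg (ε : Bool) (μ ν : ℕ) (u v : ℂ) (t : HalfLine) :
    contr N ħ k (kData N ħ k ε μ u) (-kData N ħ k ε ν v) t = 0 := by
  cases ε
  · exact contr_of_fst_eq_zero (kMinus_fst μ u) _ t
  · exact contr_of_snd_eq_zero _ (by simp [kData, kPlus_snd]) t

theorem contr_neg_kData (ε : Bool) (μ ν : ℕ) (u v : ℂ) (t : HalfLine) :
    contr N ħ k (-kData N ħ k ε μ u) (kData N ħ k ε ν v) t = 0 := by
  cases ε
  · exact contr_of_fst_eq_zero (by simp [kData, kMinus_fst]) _ t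
  · exact contr_of_snd_eq_zero _ (kPlus_snd ν v) t

theorem contr_HData (ε : Bool) (μ ν : ℕ) (u v : ℂ) (t : HalfLine) :
    contr N ħ k (HData N ħ k ε μ u) (HData N ħ k ε ν v) t = 0 := by
  cases ε
  · exact contr_of_fst_eq_zero (HMinusData_fst μ u) _ t
  · exact contr_of_snd_eq_zero _ (HPlusData_snd ν v) t

theorem op_HCurrent (ε : Bool) (μ : ℕ) (u : ℂ) :
    op (ħ := ħ) k (HCurrent N ħ k ε μ u) = vertexOp k (HData N ħ k ε μ u) :=
  funext₂ fun Ψ ζ => op_vx _ Ψ ζ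

theorem op_kCurrent (ε : Bool) (μ : ℕ) (u : ℂ) :
    op (ħ := ħ) k (kCurrent N ħ k ε μ u) = vertexOp k (kData N ħ k ε μ u) :=
  funext₂ fun Ψ ζ => op_vx _ Ψ ζ

theorem op_kCurrentInv (ε : Bool) (μ : ℕ) (u : ℂ) :
    op (ħ := ħ) k (kCurrentInv N ħ k ε μ u) = vertexOp k (-kData N ħ k ε μ u) :=
  funext₂ fun Ψ ζ => op_vx _ Ψ ζ

end GLCurrents

end FreeBoson

/-! ### Assembly of the relations -/

open FreeBoson

theorem corollary1 (N : ℕ) (hN : 2 ≤ N) (ħ : ℝ) (hħ : ħ ≠ 0) (k : ℂ) :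
    -- the currents come from the `gl_N` currents through the decomposition
    (∀ μ ∈ Finset.Ico 1 N, ∀ Ψ ∈ Fock N ħ, ∀ ζ, IsTest ζ → ∀ u : ℂ,
      (∀ ε : Bool,
        op k (HCurrent N ħ k ε μ u) Ψ ζ
          = op k (kCurrent N ħ k ε (μ + 1) (sh ħ u (- μ / 2)))
              (op k (kCurrentInv N ħ k ε μ (sh ħ u (- μ / 2))) Ψ) ζ) ∧
      op k (ECurrent N ħ μ u) Ψ ζ = 1 / ħ * op k (XPlus N ħ μ (sh ħ u (- μ / 2))) Ψ ζ ∧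
      op k (FCurrent N ħ k μ u) Ψ ζ = 1 / ħ * op k (XMinus N ħ k μ (sh ħ u (- μ / 2))) Ψ ζ) ∧
    (∀ μ ∈ Finset.Icc 1 N, ∀ Ψ ∈ Fock N ħ, ∀ ζ, IsTest ζ → ∀ (ε : Bool) (u : ℂ),
      op k (kCurrent N ħ k ε μ u) (op k (kCurrentInv N ħ k ε μ u) Ψ) ζ = Ψ ζ ∧
      op k (kCurrentInv N ħ k ε μ u) (op k (kCurrent N ħ k ε μ u) Ψ) ζ = Ψ ζ) ∧
    -- they are well defined on the Fock space
    (∀ μ ∈ Finset.Ico 1 N,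
      (∀ ε : Bool, WellDefinedOnFock ħ k (HCurrent N ħ k ε μ)) ∧
      WellDefinedOnFock ħ k (ECurrent N ħ μ) ∧
      WellDefinedOnFock ħ k (FCurrent N ħ k μ)) ∧
    -- and satisfy the relations
    ∀ μ ∈ Finset.Ico 1 N, ∀ ν ∈ Finset.Ico 1 N,
      (∀ ε : Bool, ∀ Ψ ∈ Fock N ħ, ∀ ζ, IsTest ζ → ∀ u v : ℂ,
        op k (HCurrent N ħ k ε μ u) (op k (HCurrent N ħ k ε ν v) Ψ) ζ
          = op k (HCurrent N ħ k ε ν v) (op k (HCurrent N ħ k ε μ u) Ψ) ζ) ∧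
      ExchangeRelation ħ k (fun _ => 1) (HCurrent N ħ k true μ) (HCurrent N ħ k false ν)
        (fun w => (w + Complex.I * k * ħ + Complex.I * halfCartan μ ν * ħ)
            / (w + Complex.I * k * ħ - Complex.I * halfCartan μ ν * ħ)
          * ((w - Complex.I * halfCartan μ ν * ħ) / (w + Complex.I * halfCartan μ ν * ħ))) ∧
      ExchangeRelation ħ k (fun _ => 1) (HCurrent N ħ k false μ) (HCurrent N ħ k true ν)
        (fun w => (w - Complex.I * k * ħ + Complex.I * halfCartan μ ν * ħ)
            / (w - Complex.I * k * ħ - Complex.I * halfCartan μ ν * ħ)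
          * ((w - Complex.I * halfCartan μ ν * ħ) / (w + Complex.I * halfCartan μ ν * ħ))) ∧
      (∀ ε : Bool, ExchangeRelation ħ k (fun w => w + Complex.I * halfCartan μ ν * ħ)
        (HCurrent N ħ k ε μ) (ECurrent N ħ ν) (fun w => w - Complex.I * halfCartan μ ν * ħ)) ∧
      ExchangeRelation ħ k (fun w => w - Complex.I * halfCartan μ ν * ħ)
        (HCurrent N ħ k false μ) (FCurrent N ħ k ν)
        (fun w => w + Complex.I * halfCartan μ ν * ħ) ∧
      ExchangeRelation ħ k (fun w => w - Complex.I * halfCartan μ ν * ħ + Complex.I * k * ħ)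
        (HCurrent N ħ k true μ) (FCurrent N ħ k ν)
        (fun w => w + Complex.I * halfCartan μ ν * ħ + Complex.I * k * ħ) ∧
      (halfCartan μ ν = 0 →
        OPERelation ħ k (fun _ => 1) (ECurrent N ħ μ) (ECurrent N ħ ν) (fun _ => 1)
          (fun _ _ _ _ => 0) ∧
        OPERelation ħ k (fun _ => 1) (FCurrent N ħ k μ) (FCurrent N ħ k ν) (fun _ => 1)
          (fun _ _ _ _ => 0)) ∧
      (halfCartan μ ν ≠ 0 →
        OPERelation ħ k (fun w => w + Complex.I * halfCartan μ ν * ħ)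
          (ECurrent N ħ μ) (ECurrent N ħ ν) (fun w => w - Complex.I * halfCartan μ ν * ħ)
          (fun _ _ _ _ => 0) ∧
        OPERelation ħ k (fun w => w - Complex.I * halfCartan μ ν * ħ)
          (FCurrent N ħ k μ) (FCurrent N ħ k ν) (fun w => w + Complex.I * halfCartan μ ν * ħ)
          (fun _ _ _ _ => 0)) ∧
      OPERelation ħ k (fun _ => 1) (ECurrent N ħ μ) (FCurrent N ħ k ν) (fun _ => 1)
        (fun u v Ψ ζ => (if μ = ν then 1 else 0) / (Complex.I * ħ)
          * (1 / (u - v + Complex.I * k * ħ) * op k (HCurrent N ħ k true μ u) Ψ ζ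
            - 1 / (u - v) * op k (HCurrent N ħ k false μ v) Ψ ζ)) ∧
      (μ = ν + 1 ∨ ν = μ + 1 →
        SerreRelation ħ k (ECurrent N ħ μ) (ECurrent N ħ ν) ∧
        SerreRelation ħ k (FCurrent N ħ k μ) (FCurrent N ħ k ν)) := by
  refine ⟨fun μ hμ Ψ _ ζ hζ u => ⟨fun ε => ?_, ?_, ?_⟩, fun μ _ Ψ _ ζ hζ ε u => ⟨?_, ?_⟩,
    fun μ _ => ⟨fun ε => (isExpansion_H ε μ).wellDefined, (isExpansion_E μ).wellDefined,
      (isExpansion_F μ).wellDefined⟩, fun μ hμ ν hν => ?_⟩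
  · rw [Finset.mem_Ico] at hμ
    rw [op_HCurrent, op_kCurrent, op_kCurrentInv,
      vertexOp_vertexOp_of_contr_eq_zero (contr_kData_neg ε _ _ _ _) hζ, kCurrent_sub ε μ hμ.1 hμ.2]
    rfl
  · rw [ECurrent_eq_XPlus, op_smul]
  · rw [FCurrent_eq_XMinus, op_smul]
  · rw [op_kCurrent, op_kCurrentInv,
      vertexOp_vertexOp_of_contr_eq_zero (contr_kData_neg ε _ _ _ _) hζ, add_neg_cancel,
      vertexOp_zero]
  · rw [op_kCurrent, op_kCurrentInv,
      vertexOp_vertexOp_of_contr_eq_zero (contr_neg_kData ε _ _ _ _) hζ, neg_add_cancel,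
      vertexOp_zero]
  obtain ⟨hμ, hμN⟩ := Finset.mem_Ico.1 hμ
  obtain ⟨hν, hνN⟩ := Finset.mem_Ico.1 hν
  refine ⟨fun ε Ψ _ ζ hζ u v => ?_, exchangeRelation_HPlus_HMinus hħ hμ hμN hν hνN,
    exchangeRelation_HMinus_HPlus hħ hμ hμN hν hνN,
    fun ε => exchangeRelation_H_E hħ hμ hμN hν hνN ε, exchangeRelation_HMinus_F hħ hμ hμN hν hνN,
    exchangeRelation_HPlus_F hħ hμ hμN hν hνN,
    fun h => ⟨opeRelation_E_E hħ hμN hνN (.inl ⟨h, rfl, rfl⟩),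
      opeRelation_F_F hħ hμ hμN hν hνN (.inl ⟨neg_eq_zero.2 h, rfl, rfl⟩)⟩,
    fun _ => ⟨opeRelation_E_E hħ hμN hνN (.inr ⟨rfl, rfl⟩),
      opeRelation_F_F hħ hμ hμN hν hνN (.inr ⟨funext fun w => by ring, funext fun w => by ring⟩)⟩,
    opeRelation_E_F hħ hμ hμN hν hνN,
    fun h => ⟨serreRelation_E hħ hμN hνN h, serreRelation_F hħ hμ hμN hν hνN h⟩⟩
  rw [op_HCurrent, op_HCurrent, vertexOp_vertexOp_of_contr_eq_zero (contr_HData ε _ _ _ _) hζ,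
    vertexOp_vertexOp_of_contr_eq_zero (contr_HData ε _ _ _ _) hζ, add_comm]
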